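/- **Setting.** One space dimension, $p>1$, $0\le\bar\alpha<p$, $0\le\alpha<\frac{2p}{p+1}$, $\mu,\bar\mu,\mu_0\in\mathbb R$. Let $\kappa=(p-1)^{-1/(p-1)}$, $f(z)=\big(p-1+\tfrac{(p-1)^2}{4p}z^2\big)^{-1/(p-1)}$, $\varphi(y,s)=f(y/\sqrt s)+\frac{\kappa}{2ps}$, $\mathcal L=\partial_y^2-\frac12y\,\partial_y+1$, $V=p\varphi^{p-1}-\frac p{p-1}$, $$B(q)=|\varphi+q|^{p-1}(\varphi+q)-\varphi^p-p\varphi^{p-1}q,\qquad R=\partial_y^2\varphi-\tfrac12y\,\partial_y\varphi-\tfrac{\varphi}{p-1}+\varphi^p-\partial_s\varphi,$$ $$N=\mu|\partial_y\varphi+\partial_yq|^\alpha e^{-\beta s}+\bar\mu|\varphi+q|^{\bar\alpha}e^{-\bar\beta s}+\mu_0e^{-\frac p{p-1}s},\qquad \beta=\tfrac{2p-\alpha(p+1)}{2(p-1)},\quad \bar\beta=\tfrac{p-\bar\alpha}{p-1},$$ and consider the (mild) solutions $q$, continuous in $(s,y)$, of $$\partial_sq=(\mathcal L+V)q+B(q)+R+N.\tag{1}$$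 Let $K(s,\sigma)$ be the fundamental solution of $\mathcal L+V$. Given $q$ on $[\tau,\tau+\rho]$, set $$\alpha(s)=K(s,\tau)q(\tau),\quad \beta(s)=\int_\tau^sK(s,\sigma)B(q(\sigma))\,d\sigma,\quad \gamma(s)=\int_\tau^sK(s,\sigma)R(\sigma)\,d\sigma,\quad \delta(s)=\int_\tau^sK(s,\sigma)N(\sigma)\,d\sigma$$ (the numbers $\alpha,\beta$ above and the functions $\alpha(s),\beta(s)$ are unrelated). Let $h_m$ be the Hermite polynomial eigenfunction of $\mathcal L$ for the eigenvalue $1-\frac m2$, with leading coefficient $1$, let $w(y)=e^{-y^2/4}/\sqrt{4\pi}$ and $k_m=h_m/\|h_m\|^2_{L^2_w}$. Let $\chi_0\in C^\infty([0,\infty))$ be supported in $[0,2]$ and equal to $1$ on $[0,1]$, let $K_0>0$ and $\chi(y,s)=\chi_0(|y|/(K_0\sqrt s))$. For a function $r$ at time $s$ put $r_b=\chi r$, $r_e=(1-\chi)r$, $r_m=\int r_bk_mw\,dy$ and $r_-=r_b-\sum_{m\le2}r_mh_m$. For $A>0$, $V_A(s)$ is the set of $r\in L^\infty(\mathbb R)$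 with $|r_m|\le As^{-2}$ ($m=0,1$), $|r_2|\le A^2(\log s)s^{-2}$, $|r_-(y)|\le A(1+|y|^3)s^{-2}$ for all $y$, and $\|r_e\|_{L^\infty}\le A^2s^{-1/2}$. **Lemma.** For all $K_0$ large enough and every $\chi_0$ as above there are constants $A_5>0$ and $C>0$, and for every $\rho>0$ a constant $C_\rho>0$, such that for all $A\ge A_5$, $\rho>0$ and $C_1>0$ there is $T_5>0$, which can be taken smaller than any prescribed positive number, such that for all $0<T\le T_5$ and all $\tau\ge-\log T$ the following holds. If, on $[\tau,\tau+\rho]$, $q$ is a solution of (1) with $q(s)\in V_A(s)$, $q(s)$ Lipschitz and $\|\nabla q(s)\|_{L^\infty}\le C_1A^2/\sqrt s$, then for all $s\in[\tau,\tau+\rho]$ and $y\in\mathbb R$: (i) (linear term) $$|\alpha_2(s)|\le\frac{\tau^2}{s^2}|q_2(\tau)|+C_\rho A(s-\tau)s^{-3},$$ $$\Big\|\frac{\alpha_-(s)}{1+|y|^3}\Big\|_{L^\infty}\le C_\rho e^{-\frac{s-\tau}2}\Big\|\frac{q_-(\tau)}{1+|y|^3}\Big\|_{L^\infty}+C_\rho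 e^{-(s-\tau)^2}\frac{\|q_e(\tau)\|_{L^\infty}}{s^{3/2}},$$ and, with a constant that does not depend on $\rho$, $$\Big\|\frac{\alpha_-(s)}{1+|y|^3}\Big\|_{L^\infty}\le Ce^{-\frac{s-\tau}2}\Big\|\frac{q_-(\tau)}{1+|y|^3}\Big\|_{L^\infty}+Ce^{-(s-\tau)^2}\frac{\|q_e(\tau)\|_{L^\infty}}{s^{3/2}}+\frac{s-\tau}{s^2},$$ $$\|\alpha_e(s)\|_{L^\infty}\le Ce^{-\frac{s-\tau}p}\|q_e(\tau)\|_{L^\infty}+Ce^{s-\tau}s^{3/2}\Big\|\frac{q_-(\tau)}{1+|y|^3}\Big\|_{L^\infty};$$ (ii) (nonlinear term) $|\beta_2(s)|\le(s-\tau)s^{-3}$, $\ |\beta_-(y,s)|\le(s-\tau)(1+|y|^3)s^{-2}$, $\ \|\beta_e(s)\|_{L^\infty}\le(s-\tau)s^{-1/2}$; (iii) (corrective term) $|\gamma_2(s)|\le C_\rho(s-\tau)s^{-3}$, $\ |\gamma_-(y,s)|\le C(s-\tau)(1+|y|^3)s^{-2}$, $\ \|\gamma_e(s)\|_{L^\infty}\le(s-\tau)s^{-1/2}$;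 (iv) (new term) $|\delta_2(s)|\le C(s-\tau)s^{-3}$, $\ |\delta_-(y,s)|\le C(s-\tau)(1+|y|^3)s^{-3}$, $\ \|\delta_e(s)\|_{L^\infty}\le C(s-\tau)s^{-3}$. Here $C$ and $A_5$ depend only on $p,\alpha,\bar\alpha,\mu,\bar\mu,\mu_0,K_0,\chi_0$, and $C_\rho$ moreover only on $\rho$. -/

import Mathlib

open MeasureTheory Set
open scoped ENNReal ContDiff

namespace GradBlowup

noncomputable section

/-! ### The profile and the terms of the equation for `q` (one space dimension) -/

/-- `κ = (p-1)^{-1/(p-1)}`. -/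
def kappa (p : ℝ) : ℝ := (p - 1) ^ (-(1 / (p - 1)))

/-- `f(z) = (p - 1 + (p-1)²/(4p) z²)^{-1/(p-1)}`. -/
def profile (p z : ℝ) : ℝ := (p - 1 + (p - 1) ^ 2 / (4 * p) * z ^ 2) ^ (-(1 / (p - 1)))

/-- `φ(y,s) = f(y/√s) + κ/(2ps)`. -/
def phi (p s y : ℝ) : ℝ := profile p (y / √s) + kappa p / (2 * p * s)

/-- The potential `V(y,s) = p φ^{p-1} - p/(p-1)`. -/
def potV (p s y : ℝ) : ℝ := p * phi p s y ^ (p - 1) - p / (p - 1)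

/-- The nonlinear term `B(g) = |φ+g|^{p-1}(φ+g) - φ^p - p φ^{p-1} g` at time `s`. -/
def termB (p s : ℝ) (g : ℝ → ℝ) (y : ℝ) : ℝ :=
  |phi p s y + g y| ^ (p - 1) * (phi p s y + g y) - phi p s y ^ p
    - p * phi p s y ^ (p - 1) * g y

/-- The corrective term `R = ∂_y²φ - (y/2)∂_yφ - φ/(p-1) + φ^p - ∂_sφ`. -/
def termR (p s y : ℝ) : ℝ :=
  deriv (deriv (phi p s)) y - 1 / 2 * y * deriv (phi p s) y - phi p s y / (p - 1)
    + phi p s y ^ p - deriv (fun t => phi p t y) s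

/-- The exponent `β = (2p - a(p+1)) / (2(p-1))`, where `a` is the power of the gradient. -/
def expBeta (p a : ℝ) : ℝ := (2 * p - a * (p + 1)) / (2 * (p - 1))

/-- The exponent `β̄ = (p - ā)/(p-1)`, where `ā` is the power of the lower order term. -/
def expBetaBar (p abar : ℝ) : ℝ := (p - abar) / (p - 1)

/-- The new term
`N = μ|∂_yφ + ∂_y g|^a e^{-βs} + μ̄|φ + g|^ā e^{-β̄s} + μ₀ e^{-ps/(p-1)}` at time `s`. -/
def termN (p a abar mu mubar mu0 s : ℝ) (g : ℝ → ℝ) (y : ℝ) : ℝ :=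
  mu * |deriv (phi p s) y + deriv g y| ^ a * Real.exp (-(expBeta p a * s))
    + mubar * |phi p s y + g y| ^ abar * Real.exp (-(expBetaBar p abar * s))
    + mu0 * Real.exp (-(p / (p - 1) * s))

/-! ### The semigroup of `𝓛 = ∂_y² - (y/2)∂_y + 1` and the fundamental solution of `𝓛 + V` -/

/-- The kernel `e^{θ𝓛}(y,x)`, for `θ > 0`. -/
def mehler (θ y x : ℝ) : ℝ :=
  Real.exp θ / √(4 * Real.pi * (1 - Real.exp (-θ)))
    * Real.exp (-((y * Real.exp (-θ / 2) - x) ^ 2 / (4 * (1 - Real.exp (-θ)))))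

/-- The semigroup `e^{θ𝓛}`, for `θ ≥ 0` (the identity at `θ = 0`). -/
def semigroupL (θ : ℝ) (g : ℝ → ℝ) (y : ℝ) : ℝ :=
  if 0 < θ then ∫ x, mehler θ y x * g x else g y

/-- The terms of the iterated Duhamel (Dyson) expansion of the evolution of `𝓛 + V`
from time `σ` to time `s`: `K₀(s,σ) = e^{(s-σ)𝓛}` and
`K_{n+1}(s,σ) g = ∫_σ^s e^{(s-t)𝓛} (V(t) K_n(t,σ) g) dt`. -/
def dysonTerm (p : ℝ) : ℕ → ℝ → ℝ → (ℝ → ℝ) → ℝ → ℝ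
  | 0, s, σ, g, y => semigroupL (s - σ) g y
  | n + 1, s, σ, g, y =>
      ∫ t in σ..s, semigroupL (s - t) (fun x => potV p t x * dysonTerm p n t σ g x) y

/-- `K(s,σ) g`, where `K` is the fundamental solution of `∂_s - (𝓛 + V)`, for `s ≥ σ > 0`.
As `V` is bounded, the expansion converges absolutely on bounded functions `g`, and its sum is
the unique bounded solution of `∂_s k = (𝓛 + V) k` with `k(σ) = g`. -/
def fundK (p s σ : ℝ) (g : ℝ → ℝ) (y : ℝ) : ℝ := ∑' n, dysonTerm p n s σ g y

/-- `q` is a (mild) solution of `∂_s q = (𝓛 + V) q + B(q) + R + N` on `[τ, τ + ρ]`. -/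
def IsSolution (p a abar mu mubar mu0 τ ρ : ℝ) (q : ℝ → ℝ → ℝ) : Prop :=
  ContinuousOn (Function.uncurry q) (Icc τ (τ + ρ) ×ˢ univ) ∧
  ∀ s ∈ Icc τ (τ + ρ), ∀ y : ℝ,
    q s y = semigroupL (s - τ) (q τ) y
      + ∫ σ in τ..s, semigroupL (s - σ)
          (fun x => potV p σ x * q σ x + termB p σ (q σ) x + termR p σ x
            + termN p a abar mu mubar mu0 σ (q σ) x) y

/-! ### The four parts of `q` in Duhamel's formula started at time `τ` -/

/-- Linear part `K(s,τ) q(τ)`. -/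
def linPart (p τ : ℝ) (q : ℝ → ℝ → ℝ) (s y : ℝ) : ℝ := fundK p s τ (q τ) y

/-- Nonlinear part `∫_τ^s K(s,σ) B(q(σ)) dσ`. -/
def nonlinPart (p τ : ℝ) (q : ℝ → ℝ → ℝ) (s y : ℝ) : ℝ :=
  ∫ σ in τ..s, fundK p s σ (termB p σ (q σ)) y

/-- Corrective part `∫_τ^s K(s,σ) R(σ) dσ`. -/
def corrPart (p τ s y : ℝ) : ℝ := ∫ σ in τ..s, fundK p s σ (termR p σ) y

/-- New part `∫_τ^s K(s,σ) N(σ) dσ`. -/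
def newPart (p a abar mu mubar mu0 τ : ℝ) (q : ℝ → ℝ → ℝ) (s y : ℝ) : ℝ :=
  ∫ σ in τ..s, fundK p s σ (termN p a abar mu mubar mu0 σ (q σ)) y

/-! ### The decomposition into components -/

/-- The weight `ρ(y) = e^{-y²/4}/√(4π)`. -/
def gaussWeight (y : ℝ) : ℝ := Real.exp (-(y ^ 2 / 4)) / √(4 * Real.pi)

/-- The eigenfunction `h_m` of `𝓛` for the eigenvalue `1 - m/2`. -/
def herm (m : ℕ) (y : ℝ) : ℝ :=
  ∑ n ∈ Finset.range (m / 2 + 1),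
    (m.factorial : ℝ) / ((n.factorial : ℝ) * ((m - 2 * n).factorial : ℝ))
      * (-1) ^ n * y ^ (m - 2 * n)

/-- `k_m = h_m / ‖h_m‖²`, the norm being that of `L²` with the weight `ρ`. -/
def dualHerm (m : ℕ) (y : ℝ) : ℝ := herm m y / ∫ x, herm m x ^ 2 * gaussWeight x

/-- `χ₀` is a smooth function on `[0,∞)`, supported in `[0,2]` and equal to `1` on `[0,1]`. -/
def IsCutoff (χ₀ : ℝ → ℝ) : Prop :=
  ContDiffOn ℝ ∞ χ₀ (Ici 0) ∧ (∀ x, 2 < x → χ₀ x = 0) ∧ ∀ x ∈ Icc (0 : ℝ) 1, χ₀ x = 1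

/-- `χ(y,s) = χ₀(|y| / (K₀ √s))`. -/
def cutoff (χ₀ : ℝ → ℝ) (K₀ s y : ℝ) : ℝ := χ₀ (|y| / (K₀ * √s))

/-- The inner part `g_b = χ g`. -/
def innerPart (χ₀ : ℝ → ℝ) (K₀ s : ℝ) (g : ℝ → ℝ) (y : ℝ) : ℝ := cutoff χ₀ K₀ s y * g y

/-- The outer part `g_e = (1 - χ) g`. -/
def outerPart (χ₀ : ℝ → ℝ) (K₀ s : ℝ) (g : ℝ → ℝ) (y : ℝ) : ℝ :=
  (1 - cutoff χ₀ K₀ s y) * g y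

/-- The mode `g_m`: the coordinate of the inner part on `h_m`. -/
def mode (χ₀ : ℝ → ℝ) (K₀ s : ℝ) (m : ℕ) (g : ℝ → ℝ) : ℝ :=
  ∫ y, innerPart χ₀ K₀ s g y * dualHerm m y * gaussWeight y

/-- The negative part `g_-`: the projection of the inner part on the closed span of the `h_m`,
`m ≥ 3`, that is `g_b - ∑_{m ≤ 2} g_m h_m`. -/
def negativePart (χ₀ : ℝ → ℝ) (K₀ s : ℝ) (g : ℝ → ℝ) (y : ℝ) : ℝ :=
  innerPart χ₀ K₀ s g y - ∑ m ∈ Finset.range 3, mode χ₀ K₀ s m g * herm m y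

/-- The norm of `L^∞(ℝ)`, with values in `[0,∞]`. -/
def linf (g : ℝ → ℝ) : ℝ≥0∞ := eLpNorm g ⊤ volume

/-- `‖g / (1 + |y|³)‖_{L^∞}`, with values in `[0,∞]`. -/
def linfW (g : ℝ → ℝ) : ℝ≥0∞ := linf fun y => g y / (1 + |y| ^ 3)

/-- Membership of `r` in the shrinking set `V_A(s)`. -/
def InVA (χ₀ : ℝ → ℝ) (K₀ A s : ℝ) (r : ℝ → ℝ) : Prop :=
  MemLp r ⊤ volume ∧
  (∀ m < 2, |mode χ₀ K₀ s m r| ≤ A / s ^ 2) ∧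
  |mode χ₀ K₀ s 2 r| ≤ A ^ 2 * Real.log s / s ^ 2 ∧
  (∀ y, |negativePart χ₀ K₀ s r y| ≤ A * (1 + |y| ^ 3) / s ^ 2) ∧
  linf (outerPart χ₀ K₀ s r) ≤ ENNReal.ofReal (A ^ 2 / √s)

/-- `g ∈ W^{1,∞}(ℝ)` up to boundedness (it is Lipschitz), and `‖∇g‖_{L^∞} ≤ M`. -/
def GradBound (M : ℝ) (g : ℝ → ℝ) : Prop :=
  (∃ L, LipschitzWith L g) ∧ linf (deriv g) ≤ ENNReal.ofReal M

end

end GradBlowup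

open GradBlowup

namespace GradBlowup

/-! ### The Gaussian form of the semigroup -/

/-! The potential `V` is bounded but not small, so `K(s,σ)` is not a perturbation of the free
semigroup uniformly in `y`. What saves the estimates is that `V` depends on `y` through `y/√s`,
hence varies slowly. Four of its properties are used: `V = -h₂/(4s)` up to `(1+|y|)⁴/s²`, the
one-sided bound `V ≤ C/s`, the Lipschitz constant `C/√s`, and `V ≤ -(1+1/p)` once `|y| ≥ K√s`. The
free semigroup is `e^θ` times a Gaussian expectation along an Ornstein-Uhlenbeck flow, so it
preserves every weight `(1+|y|)^k` and acts on Hermite polynomials by explicit exponentials.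

Second mode (`exists_abs_mode_two_fundK_sub_le`). The free semigroup conserves it up to the cutoff.
Since `h₂² = h₄ + 8h₂ + 8h₀`, the first Dyson term of `h₂` has second mode close to
`-(8/(4τ))(s-τ)`. The factor `1 - 2(s-τ)/τ` lies below `τ²/s²`, and all else is `O(A τ⁻³)`.

Negative part with a constant depending on `ρ`. Outside the support of the cutoff `q_-` is minus a
polynomial of degree two, so its norm controls `q_m` with a loss `√τ^(3-m)`
(`abs_mode_le_of_negativePart`). The negative part of `K h_m` gains exactly that power
(`exists_abs_negativePart_fundK_herm_le`), so low modes leave no extra term.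

Constants independent of `ρ`. `K(s,τ)g` is close to the free evolution of `g` times the exponential
of `V` integrated along the drift path `σ ↦ e^{-(s-σ)/2}y` ending at `y`, with error `O(τ^{-1/2})`
(`abs_fundK_sub_potPath_le`). By the upper bound on `V` this exponential is at most `2`. For `s - τ
≥ 3`, the decay of `e^{θ𝓛}` on functions orthogonal to `h₀, h₁, h₂`
(`exists_abs_semigroupL_le_of_orthogonal`) controls the negative part. For the outer part, either
the path starts well inside and the Gaussian tail is negligible, or it stays where `V ≤ -(1+1/p)`,
which beats the growth `e^{s-τ}` and leaves `e^{-(s-τ)/p}`. Every error whose constant depends on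
`ρ` or `A` carries a negative power of `τ` and is absorbed by taking `τ` large.

Sources. `B` is superlinear in `q`, and quadratic where `φ` is bounded below, so on `V_A` it is an
arbitrarily small multiple of the size needed (`eventually_abs_termB_le`). `N` is exponentially
small. `R` is a constant of size `s⁻²` up to `s⁻³(1+|y|)⁴`, because `f` solves the profile equation
and the shift `κ/(2ps)` cancels the next order; a constant has almost no second mode and almost no
negative part. -/

/-- The standard Gaussian measure on the line. -/
noncomputable abbrev stdGauss : Measure ℝ := ProbabilityTheory.gaussianReal 0 1

/-- The moments `E (1 + 2|Z|)^k` of a standard Gaussian variable. -/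
noncomputable def gaussMom (k : ℕ) : ℝ := ∫ z, (1 + 2 * |z|) ^ k ∂stdGauss

lemma integrable_one_add_two_mul_abs_pow (k : ℕ) :
    Integrable (fun z : ℝ => (1 + 2 * |z|) ^ k) stdGauss := by
  have h : MemLp (fun z : ℝ => 1 + 2 * |z|) k stdGauss := by
    have h1 : MemLp (fun z : ℝ => z) k stdGauss :=
      ProbabilityTheory.memLp_id_gaussianReal' _ (by simp)
    exact (memLp_const (1 : ℝ)).add (h1.norm.const_mul (2 : ℝ))
  have h2 := h.integrable_norm_pow'
  refine h2.congr (Filter.Eventually.of_forall fun z => ?_)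
  simp only [Real.norm_eq_abs]
  rw [abs_of_nonneg (by positivity)]

lemma one_le_gaussMom (k : ℕ) : 1 ≤ gaussMom k := by
  have h : ∫ _z : ℝ, (1 : ℝ) ∂stdGauss ≤ gaussMom k := by
    refine integral_mono (integrable_const _) (integrable_one_add_two_mul_abs_pow k) fun z => ?_
    exact one_le_pow₀ (by linarith [abs_nonneg z])
  simpa using h

lemma gaussMom_pos (k : ℕ) : 0 < gaussMom k := lt_of_lt_of_le one_pos (one_le_gaussMom k)

lemma sqrt_two_mul_one_sub_exp_le (θ : ℝ) : √(2 * (1 - Real.exp (-θ))) ≤ 2 := by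
  rw [Real.sqrt_le_left (by norm_num)]
  nlinarith [Real.exp_pos (-θ)]

lemma exp_neg_half_le_one {θ : ℝ} (hθ : 0 ≤ θ) : Real.exp (-θ / 2) ≤ 1 :=
  Real.exp_le_one_iff.2 (by linarith)

/-- The value at time `θ`, started from `y`, of the Ornstein-Uhlenbeck flow driven by `z`. -/
noncomputable def ouFlow (θ y z : ℝ) : ℝ :=
  Real.exp (-θ / 2) * y + √(2 * (1 - Real.exp (-θ))) * z

lemma measurable_ouFlow (θ y : ℝ) : Measurable (ouFlow θ y) := by
  unfold ouFlow; fun_prop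

/-- The product form makes the weights stable: its powers split into the weight at `y` and a
Gaussian moment, uniformly in time. -/
lemma one_add_abs_ouFlow_le {θ : ℝ} (hθ : 0 ≤ θ) (y z : ℝ) :
    1 + |ouFlow θ y z| ≤ (1 + |y|) * (1 + 2 * |z|) := by
  have h1 := exp_neg_half_le_one hθ
  have h2 := sqrt_two_mul_one_sub_exp_le θ
  have h3 : |ouFlow θ y z| ≤ |y| + 2 * |z| := by
    refine (abs_add_le _ _).trans ?_
    rw [abs_mul, abs_mul, abs_of_pos (Real.exp_pos _), abs_of_nonneg (Real.sqrt_nonneg _)]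
    gcongr
    nlinarith [abs_nonneg y]
  nlinarith [abs_nonneg y, abs_nonneg z, mul_nonneg (abs_nonneg y) (abs_nonneg z)]

lemma one_add_abs_ouFlow_pow_le {θ : ℝ} (hθ : 0 ≤ θ) (k : ℕ) (y z : ℝ) :
    (1 + |ouFlow θ y z|) ^ k ≤ (1 + |y|) ^ k * (1 + 2 * |z|) ^ k := by
  rw [← mul_pow]
  exact pow_le_pow_left₀ (by positivity) (one_add_abs_ouFlow_le hθ y z) k

lemma mehler_eq_gaussianPDFReal {θ : ℝ} (hθ : 0 < θ) (y x : ℝ) :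
    mehler θ y x = Real.exp θ * ProbabilityTheory.gaussianPDFReal (Real.exp (-θ / 2) * y)
      (2 * (1 - Real.exp (-θ))).toNNReal x := by
  have h : 0 < 1 - Real.exp (-θ) := by
    have := Real.exp_lt_one_iff.2 (show -θ < 0 by linarith)
    linarith
  unfold mehler ProbabilityTheory.gaussianPDFReal
  rw [Real.coe_toNNReal _ (by linarith)]
  rw [show 2 * Real.pi * (2 * (1 - Real.exp (-θ))) = 4 * Real.pi * (1 - Real.exp (-θ)) by ring,
    show 2 * (2 * (1 - Real.exp (-θ))) = 4 * (1 - Real.exp (-θ)) by ring,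
    show (y * Real.exp (-θ / 2) - x) ^ 2 = (x - Real.exp (-θ / 2) * y) ^ 2 by ring, neg_div]
  ring_nf

lemma map_ouFlow_stdGauss (θ y : ℝ) :
    stdGauss.map (ouFlow θ y) = ProbabilityTheory.gaussianReal (Real.exp (-θ / 2) * y)
      (2 * (1 - Real.exp (-θ))).toNNReal := by
  have h1 : ouFlow θ y = (fun x => Real.exp (-θ / 2) * y + x) ∘
      (fun z => √(2 * (1 - Real.exp (-θ))) * z) := rfl
  rw [h1, ← Measure.map_map (by fun_prop) (by fun_prop),
    ProbabilityTheory.gaussianReal_map_const_mul, ProbabilityTheory.gaussianReal_map_const_add]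
  congr 1
  · simp
  · ext
    by_cases h : 0 ≤ 2 * (1 - Real.exp (-θ))
    · simp [-Real.sqrt_mul, -Nat.ofNat_nonneg, Real.sq_sqrt h, Real.coe_toNNReal _ h]
    -- For a negative variance both the real square root and `Real.toNNReal` take the value `0`, so
    -- both measures are the same Dirac mass and no sign condition on `θ` is needed.
    · push Not at h
      simp [Real.sqrt_eq_zero_of_nonpos h.le, Real.toNNReal_of_nonpos h.le]

lemma semigroupL_eq {θ : ℝ} (hθ : 0 ≤ θ) {g : ℝ → ℝ} (hg : Measurable g) (y : ℝ) :
    semigroupL θ g y = Real.exp θ * ∫ z, g (ouFlow θ y z) ∂stdGauss := by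
  rcases hθ.eq_or_lt with rfl | hθ
  -- At time zero the noise coefficient vanishes and the flow stays at `y`, in agreement with the
  -- value fixed by definition.
  · simp [semigroupL, ouFlow]
  · have h : (2 * (1 - Real.exp (-θ))).toNNReal ≠ 0 := by
      have := Real.exp_lt_one_iff.2 (show -θ < 0 by linarith)
      simp only [ne_eq, Real.toNNReal_eq_zero, not_le]
      linarith
    rw [semigroupL, if_pos hθ, ← integral_map (φ := ouFlow θ y)
      (measurable_ouFlow θ y).aemeasurable hg.aestronglyMeasurable, map_ouFlow_stdGauss,
      ProbabilityTheory.integral_gaussianReal_eq_integral_smul h, ← integral_const_mul]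
    refine integral_congr_ae (Filter.Eventually.of_forall fun x => ?_)
    simp only [mehler_eq_gaussianPDFReal hθ, smul_eq_mul, mul_assoc]

/-! ### Measurable functions of polynomial growth -/

/-- Measurable functions of polynomial growth. -/
def PolyBdd (f : ℝ → ℝ) : Prop :=
  Measurable f ∧ ∃ M : ℝ, ∃ k : ℕ, ∀ y, |f y| ≤ M * (1 + |y|) ^ k

lemma PolyBdd.of_bound {f : ℝ → ℝ} (hf : Measurable f) {M : ℝ} {k : ℕ}
    (h : ∀ y, |f y| ≤ M * (1 + |y|) ^ k) : PolyBdd f := ⟨hf, M, k, h⟩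

/-- An envelope forces its own constant to be nonnegative, so the estimates below never assume a
sign for `M`. -/
lemma nonneg_of_abs_le_mul_pow {x M y : ℝ} {k : ℕ} (h : |x| ≤ M * (1 + |y|) ^ k) : 0 ≤ M := by
  by_contra hM
  push Not at hM
  have : M * (1 + |y|) ^ k < 0 := mul_neg_of_neg_of_pos hM (by positivity)
  linarith [abs_nonneg x]

lemma one_le_one_add_abs (y : ℝ) : 1 ≤ 1 + |y| := by linarith [abs_nonneg y]

lemma one_add_abs_pow_mono (y : ℝ) {k l : ℕ} (h : k ≤ l) : (1 + |y|) ^ k ≤ (1 + |y|) ^ l :=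
  pow_le_pow_right₀ (one_le_one_add_abs y) h

lemma one_le_one_add_abs_pow (y : ℝ) (k : ℕ) : 1 ≤ (1 + |y|) ^ k :=
  one_le_pow₀ (one_le_one_add_abs y)

lemma PolyBdd.const (c : ℝ) : PolyBdd fun _ => c :=
  ⟨measurable_const, |c|, 0, fun y => by simp⟩

lemma PolyBdd.id : PolyBdd fun y => y :=
  ⟨measurable_id, 1, 1, fun y => by simp⟩

lemma PolyBdd.add {f g : ℝ → ℝ} (hf : PolyBdd f) (hg : PolyBdd g) :
    PolyBdd fun y => f y + g y := by
  obtain ⟨mf, M, k, hM⟩ := hf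
  obtain ⟨mg, N, l, hN⟩ := hg
  refine ⟨mf.add mg, M + N, k + l, fun y => (abs_add_le _ _).trans ?_⟩
  have hM0 := nonneg_of_abs_le_mul_pow (hM y)
  have hN0 := nonneg_of_abs_le_mul_pow (hN y)
  have h1 := mul_le_mul_of_nonneg_left (one_add_abs_pow_mono y (Nat.le_add_right k l)) hM0
  have h2 := mul_le_mul_of_nonneg_left (one_add_abs_pow_mono y (Nat.le_add_left l k)) hN0
  linarith [hM y, hN y]

lemma PolyBdd.mul {f g : ℝ → ℝ} (hf : PolyBdd f) (hg : PolyBdd g) :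
    PolyBdd fun y => f y * g y := by
  obtain ⟨mf, M, k, hM⟩ := hf
  obtain ⟨mg, N, l, hN⟩ := hg
  refine ⟨mf.mul mg, M * N, k + l, fun y => ?_⟩
  rw [abs_mul, pow_add]
  have hM0 := nonneg_of_abs_le_mul_pow (hM y)
  calc |f y| * |g y| ≤ (M * (1 + |y|) ^ k) * (N * (1 + |y|) ^ l) :=
        mul_le_mul (hM y) (hN y) (abs_nonneg _) (by positivity)
    _ = _ := by ring

lemma PolyBdd.const_mul {f : ℝ → ℝ} (hf : PolyBdd f) (c : ℝ) : PolyBdd fun y => c * f y :=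
  (PolyBdd.const c).mul hf

lemma PolyBdd.neg {f : ℝ → ℝ} (hf : PolyBdd f) : PolyBdd fun y => -f y := by
  simpa using hf.const_mul (-1)

lemma PolyBdd.sub {f g : ℝ → ℝ} (hf : PolyBdd f) (hg : PolyBdd g) :
    PolyBdd fun y => f y - g y := by
  simpa [sub_eq_add_neg] using hf.add hg.neg

lemma PolyBdd.pow {f : ℝ → ℝ} (hf : PolyBdd f) (n : ℕ) : PolyBdd fun y => f y ^ n := by
  induction n with
  | zero => simpa using PolyBdd.const 1
  | succ n ih => simpa [pow_succ] using ih.mul hf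

lemma PolyBdd.sum {ι : Type*} (s : Finset ι) {f : ι → ℝ → ℝ} (hf : ∀ i ∈ s, PolyBdd (f i)) :
    PolyBdd fun y => ∑ i ∈ s, f i y := by
  classical
  induction s using Finset.induction_on with
  | empty => simpa using PolyBdd.const 0
  | insert a s ha ih =>
    simp only [Finset.sum_insert ha]
    exact (hf a (Finset.mem_insert_self a s)).add
      (ih fun i hi => hf i (Finset.mem_insert_of_mem hi))

lemma PolyBdd.comp_affine {f : ℝ → ℝ} (hf : PolyBdd f) (a b : ℝ) :
    PolyBdd fun y => f (a + b * y) := by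
  obtain ⟨mf, M, k, hM⟩ := hf
  refine ⟨mf.comp (by fun_prop), M * (1 + |a| + |b|) ^ k, k, fun y => (hM _).trans ?_⟩
  have hM0 := nonneg_of_abs_le_mul_pow (hM y)
  rw [mul_assoc, ← mul_pow]
  gcongr
  have := abs_add_le a (b * y)
  rw [abs_mul] at this
  nlinarith [abs_nonneg a, abs_nonneg b, abs_nonneg y, mul_nonneg (abs_nonneg a) (abs_nonneg y)]

lemma PolyBdd.integrable_stdGauss {f : ℝ → ℝ} (hf : PolyBdd f) : Integrable f stdGauss := by
  obtain ⟨mf, M, k, hM⟩ := hf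
  refine ((integrable_one_add_two_mul_abs_pow k).const_mul M).mono' mf.aestronglyMeasurable
    (Filter.Eventually.of_forall fun z => (hM z).trans ?_)
  have hM0 := nonneg_of_abs_le_mul_pow (hM z)
  gcongr
  linarith [abs_nonneg z]

lemma PolyBdd.integrable_ouFlow {f : ℝ → ℝ} (hf : PolyBdd f) (θ y : ℝ) :
    Integrable (fun z => f (ouFlow θ y z)) stdGauss :=
  (hf.comp_affine _ _).integrable_stdGauss

lemma abs_integral_ouFlow_le {θ : ℝ} (hθ : 0 ≤ θ) {g : ℝ → ℝ} {M : ℝ} {k : ℕ}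
    (hg : ∀ y, |g y| ≤ M * (1 + |y|) ^ k) (y : ℝ) :
    |∫ z, g (ouFlow θ y z) ∂stdGauss| ≤ gaussMom k * M * (1 + |y|) ^ k := by
  have hM0 := nonneg_of_abs_le_mul_pow (hg y)
  rw [← Real.norm_eq_abs]
  refine (norm_integral_le_of_norm_le
    (((integrable_one_add_two_mul_abs_pow k).const_mul (M * (1 + |y|) ^ k)))
    (Filter.Eventually.of_forall fun z => (hg _).trans ?_)).trans ?_
  · rw [mul_assoc]
    gcongr
    exact one_add_abs_ouFlow_pow_le hθ k y z
  · rw [integral_const_mul, gaussMom]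
    exact le_of_eq (by ring)

lemma abs_semigroupL_le {θ : ℝ} (hθ : 0 ≤ θ) {g : ℝ → ℝ} (mg : Measurable g) {M : ℝ} {k : ℕ}
    (hg : ∀ y, |g y| ≤ M * (1 + |y|) ^ k) (y : ℝ) :
    |semigroupL θ g y| ≤ Real.exp θ * gaussMom k * M * (1 + |y|) ^ k := by
  rw [semigroupL_eq hθ mg, abs_mul, abs_of_pos (Real.exp_pos _)]
  have := mul_le_mul_of_nonneg_left (abs_integral_ouFlow_le hθ hg y) (Real.exp_pos θ).le
  linarith

lemma semigroupL_add {θ : ℝ} (hθ : 0 ≤ θ) {f g : ℝ → ℝ} (hf : PolyBdd f) (hg : PolyBdd g) (y : ℝ) :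
    semigroupL θ (fun x => f x + g x) y = semigroupL θ f y + semigroupL θ g y := by
  rw [semigroupL_eq hθ hf.1, semigroupL_eq hθ hg.1, semigroupL_eq hθ (hf.add hg).1,
    ← mul_add, ← integral_add (hf.integrable_ouFlow _ _) (hg.integrable_ouFlow _ _)]

lemma semigroupL_const_mul (θ c : ℝ) (f : ℝ → ℝ) (y : ℝ) :
    semigroupL θ (fun x => c * f x) y = c * semigroupL θ f y := by
  unfold semigroupL
  split_ifs
  · rw [← integral_const_mul]
    congr 1
    ext x
    ring
  · rfl

lemma semigroupL_sub {θ : ℝ} (hθ : 0 ≤ θ) {f g : ℝ → ℝ} (hf : PolyBdd f) (hg : PolyBdd g) (y : ℝ) :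
    semigroupL θ (fun x => f x - g x) y = semigroupL θ f y - semigroupL θ g y := by
  rw [semigroupL_eq hθ hf.1, semigroupL_eq hθ hg.1, semigroupL_eq hθ (hf.sub hg).1,
    ← mul_sub, ← integral_sub (hf.integrable_ouFlow _ _) (hg.integrable_ouFlow _ _)]

/-! ### Measurability in parameters and the semigroup property -/

lemma measurable_semigroupL_param {α : Type*} [MeasurableSpace α] {θ Y : α → ℝ} {G : α → ℝ → ℝ}
    (hθ : Measurable θ) (hY : Measurable Y) (hG : Measurable (Function.uncurry G)) :
    Measurable fun a => semigroupL (θ a) (G a) (Y a) := by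
  unfold semigroupL
  refine Measurable.ite (measurableSet_lt measurable_const hθ) ?_
    (hG.comp (measurable_id.prodMk hY))
  have h : Measurable (Function.uncurry fun (a : α) (x : ℝ) => mehler (θ a) (Y a) x * G a x) := by
    refine Measurable.mul ?_ hG
    unfold mehler
    fun_prop
  exact (h.stronglyMeasurable.integral_prod_right).measurable

lemma measurable_semigroupL (θ : ℝ) {g : ℝ → ℝ} (hg : Measurable g) :
    Measurable (semigroupL θ g) :=
  measurable_semigroupL_param (α := ℝ) (θ := fun _ => θ) (Y := fun y => y) (G := fun _ => g)
    measurable_const measurable_id (hg.comp measurable_snd)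

lemma PolyBdd.semigroupL {g : ℝ → ℝ} (hg : PolyBdd g) {θ : ℝ} (hθ : 0 ≤ θ) :
    PolyBdd (semigroupL θ g) := by
  obtain ⟨mg, M, k, h⟩ := hg
  exact ⟨measurable_semigroupL θ mg, _, k, abs_semigroupL_le hθ mg h⟩

/-- Two runs of the flow with independent noises compose to one run: with `r = e^{-θ₂/2}` the
variances add up as `r²·2(1-e^{-θ₁}) + 2(1-e^{-θ₂}) = 2(1-e^{-(θ₁+θ₂)})`, so the property is the
convolution rule for Gaussian laws. -/
lemma semigroupL_semigroupL {θ₁ θ₂ : ℝ} (h₁ : 0 ≤ θ₁) (h₂ : 0 ≤ θ₂) {g : ℝ → ℝ} (hg : PolyBdd g)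
    (y : ℝ) : semigroupL θ₁ (semigroupL θ₂ g) y = semigroupL (θ₁ + θ₂) g y := by
  have e1 : 0 ≤ 1 - Real.exp (-θ₁) := by
    have := Real.exp_le_one_iff.2 (show -θ₁ ≤ 0 by linarith)
    linarith
  have e2 : 0 ≤ 1 - Real.exp (-θ₂) := by
    have := Real.exp_le_one_iff.2 (show -θ₂ ≤ 0 by linarith)
    linarith
  have e3 : 0 ≤ 1 - Real.exp (-(θ₁ + θ₂)) := by
    have := Real.exp_le_one_iff.2 (show -(θ₁ + θ₂) ≤ 0 by linarith)
    linarith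
  rw [semigroupL_eq h₁ (hg.semigroupL h₂).1, semigroupL_eq (add_nonneg h₁ h₂) hg.1, Real.exp_add,
    mul_assoc]
  congr 1
  simp_rw [semigroupL_eq h₂ hg.1]
  rw [integral_const_mul]
  congr 1
  set r := Real.exp (-θ₂ / 2) with hr
  set b := √(2 * (1 - Real.exp (-θ₂))) with hb
  have hA : Measurable fun z => r * ouFlow θ₁ y z := (measurable_ouFlow θ₁ y).const_mul r
  have hB : Measurable fun z : ℝ => b * z := by fun_prop
  have h1 : stdGauss.map (fun z => r * ouFlow θ₁ y z) = ProbabilityTheory.gaussianReal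
      (r * (Real.exp (-θ₁ / 2) * y))
      (.mk (r ^ 2) (sq_nonneg r) * (2 * (1 - Real.exp (-θ₁))).toNNReal) := by
    rw [show (fun z => r * ouFlow θ₁ y z) = (fun x => r * x) ∘ ouFlow θ₁ y from rfl,
      ← Measure.map_map (by fun_prop) (measurable_ouFlow _ _), map_ouFlow_stdGauss,
      ProbabilityTheory.gaussianReal_map_const_mul]
  have h2 : stdGauss.map (fun z => b * z) = ProbabilityTheory.gaussianReal (b * 0)
      (.mk (b ^ 2) (sq_nonneg b) * 1) := by
    rw [ProbabilityTheory.gaussianReal_map_const_mul]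
  have h3 : (stdGauss.map (fun z => r * ouFlow θ₁ y z)).conv (stdGauss.map (fun z => b * z)) =
      stdGauss.map (ouFlow (θ₁ + θ₂) y) := by
    rw [h1, h2, ProbabilityTheory.gaussianReal_conv_gaussianReal, map_ouFlow_stdGauss]
    congr 1
    · rw [hr, ← mul_assoc, ← Real.exp_add]
      ring_nf
    · ext
      simp only [NNReal.coe_add, NNReal.coe_mul, NNReal.coe_mk, mul_one]
      rw [Real.coe_toNNReal _ (by linarith), Real.coe_toNNReal _ (by linarith), hb,
        Real.sq_sqrt (by linarith), hr, ← Real.exp_nat_mul, neg_add, Real.exp_add]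
      rw [show ((2 : ℕ) : ℝ) * (-θ₂ / 2) = -θ₂ by push_cast; ring]
      ring
  have hint : Integrable g (stdGauss.map (ouFlow (θ₁ + θ₂) y)) := by
    rw [integrable_map_measure hg.1.aestronglyMeasurable (measurable_ouFlow _ _).aemeasurable]
    exact hg.integrable_ouFlow _ _
  have h4 := integral_map (μ := stdGauss) (measurable_ouFlow (θ₁ + θ₂) y).aemeasurable
    hg.1.aestronglyMeasurable
  rw [← h4, ← h3, integral_conv (by rw [h3]; exact hint), integral_map hA.aemeasurable]
  · refine integral_congr_ae (Filter.Eventually.of_forall fun z => ?_)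
    simp only
    rw [integral_map hB.aemeasurable]
    · rfl
    · exact (hg.1.comp (by fun_prop)).aestronglyMeasurable
  · have hm : Measurable (Function.uncurry fun x w : ℝ => g (x + w)) :=
      hg.1.comp (measurable_fst.add measurable_snd)
    exact (hm.stronglyMeasurable.integral_prod_right).aestronglyMeasurable

/-! ### Gaussian moments -/

lemma integrable_pow_stdGauss (n : ℕ) : Integrable (fun z : ℝ => z ^ n) stdGauss :=
  (PolyBdd.id.pow n).integrable_stdGauss

lemma integral_neg_stdGauss (f : ℝ → ℝ) : ∫ z, f (-z) ∂stdGauss = ∫ z, f z ∂stdGauss := by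
  have h : stdGauss.map (fun z => -z) = stdGauss := by
    rw [ProbabilityTheory.gaussianReal_map_neg, neg_zero]
  conv_rhs => rw [← h]
  exact (integral_map_equiv (MeasurableEquiv.neg ℝ) f).symm

lemma integral_odd_pow_stdGauss (n : ℕ) : ∫ z, z ^ (2 * n + 1) ∂stdGauss = 0 := by
  have h := integral_neg_stdGauss fun z => z ^ (2 * n + 1)
  have h2 : ∀ z : ℝ, (-z) ^ (2 * n + 1) = -z ^ (2 * n + 1) := fun z => by
    rw [Odd.neg_pow ⟨n, rfl⟩]
  simp only [h2, integral_neg] at h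
  linarith

lemma integral_id_stdGauss : ∫ z, z ∂stdGauss = 0 := by
  simpa using integral_odd_pow_stdGauss 0

lemma integral_sq_stdGauss : ∫ z, z ^ 2 ∂stdGauss = 1 := by
  have h := ProbabilityTheory.variance_fun_id_gaussianReal (μ := 0) (v := 1)
  rw [ProbabilityTheory.variance_eq_integral (by fun_prop)] at h
  simpa using h

/-- The sum of two independent standard Gaussian variables has the law of `√2 Z`. -/
lemma integral_add_stdGauss (n : ℕ) :
    ∫ x, ∫ y, (x + y) ^ (2 * n) ∂stdGauss ∂stdGauss = 2 ^ n * ∫ z, z ^ (2 * n) ∂stdGauss := by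
  have h3 : stdGauss.conv stdGauss = stdGauss.map fun z => √2 * z := by
    rw [ProbabilityTheory.gaussianReal_conv_gaussianReal,
      ProbabilityTheory.gaussianReal_map_const_mul]
    congr 1
    · simp
    · ext; norm_num
  have hm : Measurable fun z : ℝ => √2 * z := by fun_prop
  have hp : Measurable fun z : ℝ => z ^ (2 * n) := by fun_prop
  have hmap := integral_map (μ := stdGauss) hm.aemeasurable (f := fun z : ℝ => z ^ (2 * n))
    hp.aestronglyMeasurable
  rw [← h3, integral_conv] at hmap
  · rw [hmap, ← integral_const_mul]
    refine integral_congr_ae (Filter.Eventually.of_forall fun z => ?_)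
    simp only [mul_pow, pow_mul, Real.sq_sqrt (show (0 : ℝ) ≤ 2 by norm_num)]
  · rw [h3, integrable_map_measure hp.aestronglyMeasurable hm.aemeasurable]
    simpa [Function.comp_def] using
      (((PolyBdd.id.const_mul (√2)).pow (2 * n)).integrable_stdGauss)

/-- Integration of an explicit polynomial of degree at most `6`. -/
lemma integral_poly_stdGauss_moments (a b c d e f g : ℝ) :
    ∫ z, (a + b * z + c * z ^ 2 + d * z ^ 3 + e * z ^ 4 + f * z ^ 5 + g * z ^ 6) ∂stdGauss
      = a + c + e * ∫ z, z ^ 4 ∂stdGauss + g * ∫ z, z ^ 6 ∂stdGauss := by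
  have h := integral_finsetSum (μ := stdGauss) (Finset.range 7)
    (f := fun i z => (![a, b, c, d, e, f, g] : Fin 7 → ℝ) (Fin.ofNat 7 i) * z ^ i)
    fun i _ => (integrable_pow_stdGauss i).const_mul _
  have o3 := integral_odd_pow_stdGauss 1
  have o5 := integral_odd_pow_stdGauss 2
  norm_num at o3 o5
  simp only [Finset.sum_range_succ, Finset.sum_range_zero, integral_const_mul, zero_add, pow_zero,
    pow_one, integral_id_stdGauss, integral_sq_stdGauss, o3, o5] at h
  simp [Fin.ofNat] at h
  exact h.trans (by ring)

/-- The law of the sum of two independent copies gives `2m + 6 = 4m` for the fourth moment `m`. -/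
lemma integral_quartic_stdGauss : ∫ z, z ^ 4 ∂stdGauss = 3 := by
  have h := integral_add_stdGauss 2
  have h1 : ∀ x : ℝ, ∫ y, (x + y) ^ (2 * 2) ∂stdGauss =
      (∫ y, y ^ 4 ∂stdGauss) + 0 * x + 6 * x ^ 2 + 0 * x ^ 3 + 1 * x ^ 4 + 0 * x ^ 5
        + 0 * x ^ 6 := by
    intro x
    have e : ∀ y : ℝ, (x + y) ^ (2 * 2) =
      x ^ 4 + 4 * x ^ 3 * y + 6 * x ^ 2 * y ^ 2 + 4 * x * y ^ 3 + 1 * y ^ 4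
        + 0 * y ^ 5 + 0 * y ^ 6 := fun y => by ring
    simp_rw [e, integral_poly_stdGauss_moments]
    ring
  simp_rw [h1, integral_poly_stdGauss_moments] at h
  norm_num at h
  linarith

/-- Same device as for the fourth moment: `2m + 90 = 8m`. -/
lemma integral_sextic_stdGauss : ∫ z, z ^ 6 ∂stdGauss = 15 := by
  have h := integral_add_stdGauss 3
  have h1 : ∀ x : ℝ, ∫ y, (x + y) ^ (2 * 3) ∂stdGauss =
      (∫ y, y ^ 6 ∂stdGauss) + 0 * x + 45 * x ^ 2 + 0 * x ^ 3 + 15 * x ^ 4 + 0 * x ^ 5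
        + 1 * x ^ 6 := by
    intro x
    have e : ∀ y : ℝ, (x + y) ^ (2 * 3) =
      x ^ 6 + 6 * x ^ 5 * y + 15 * x ^ 4 * y ^ 2 + 20 * x ^ 3 * y ^ 3
        + 15 * x ^ 2 * y ^ 4 + 6 * x * y ^ 5 + 1 * y ^ 6 := fun y => by ring
    simp_rw [e, integral_poly_stdGauss_moments, integral_quartic_stdGauss]
    ring
  simp_rw [h1, integral_poly_stdGauss_moments, integral_quartic_stdGauss] at h
  norm_num at h
  linarith

lemma integral_poly_stdGauss (a b c d e f g : ℝ) :
    ∫ z, (a + b * z + c * z ^ 2 + d * z ^ 3 + e * z ^ 4 + f * z ^ 5 + g * z ^ 6) ∂stdGauss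
      = a + c + 3 * e + 15 * g := by
  rw [integral_poly_stdGauss_moments, integral_quartic_stdGauss, integral_sextic_stdGauss]
  ring

/-! ### The action on Hermite polynomials -/

lemma herm_zero (y : ℝ) : herm 0 y = 1 := by simp [herm]

lemma herm_one (y : ℝ) : herm 1 y = y := by simp [herm]

lemma herm_two (y : ℝ) : herm 2 y = y ^ 2 - 2 := by
  simp [herm, Finset.sum_range_succ, Nat.factorial]; ring

/-- The square `(√(2(1-e^{-θ})))² = 2 (1 - (e^{-θ/2})²)`. -/
lemma sq_ouCoeff {θ : ℝ} (hθ : 0 ≤ θ) :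
    √(2 * (1 - Real.exp (-θ))) ^ 2 = 2 * (1 - Real.exp (-θ / 2) ^ 2) := by
  have := Real.exp_le_one_iff.2 (show -θ ≤ 0 by linarith)
  rw [Real.sq_sqrt (by linarith), ← Real.exp_nat_mul]
  congr 3
  push_cast
  ring_nf

lemma semigroupL_const {θ : ℝ} (hθ : 0 ≤ θ) (c y : ℝ) :
    semigroupL θ (fun _ => c) y = Real.exp θ * c := by
  rw [semigroupL_eq hθ measurable_const]; simp

lemma semigroupL_id {θ : ℝ} (hθ : 0 ≤ θ) (y : ℝ) :
    semigroupL θ (fun x => x) y = Real.exp (θ / 2) * y := by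
  rw [semigroupL_eq hθ (g := fun x => x) measurable_id]
  have h := integral_poly_stdGauss (Real.exp (-θ / 2) * y) (√(2 * (1 - Real.exp (-θ)))) 0 0 0 0 0
  have e : ∀ z, ouFlow θ y z = Real.exp (-θ / 2) * y + √(2 * (1 - Real.exp (-θ))) * z
      + 0 * z ^ 2 + 0 * z ^ 3 + 0 * z ^ 4 + 0 * z ^ 5 + 0 * z ^ 6 := fun z => by
    simp [ouFlow]
  simp_rw [e, h]
  rw [show Real.exp θ = Real.exp (θ / 2) * Real.exp (θ / 2) by rw [← Real.exp_add]; ring_nf,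
    show -θ / 2 = -(θ / 2) by ring, Real.exp_neg]
  have := Real.exp_pos (θ / 2)
  field_simp
  ring

lemma semigroupL_herm_two {θ : ℝ} (hθ : 0 ≤ θ) (y : ℝ) :
    semigroupL θ (fun x => x ^ 2 - 2) y = y ^ 2 - 2 := by
  rw [semigroupL_eq hθ (by fun_prop)]
  have hb := sq_ouCoeff hθ
  have h1 : Real.exp θ * Real.exp (-θ / 2) ^ 2 = 1 := by
    rw [← Real.exp_nat_mul, ← Real.exp_add, Real.exp_eq_one_iff]; push_cast; ring
  set r := Real.exp (-θ / 2)
  set b := √(2 * (1 - Real.exp (-θ)))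
  have h := integral_poly_stdGauss ((r * y) ^ 2 - 2) (2 * r * y * b) (b ^ 2) 0 0 0 0
  have e : ∀ z, (ouFlow θ y z) ^ 2 - 2 = ((r * y) ^ 2 - 2) + (2 * r * y * b) * z
      + (b ^ 2) * z ^ 2 + 0 * z ^ 3 + 0 * z ^ 4 + 0 * z ^ 5 + 0 * z ^ 6 := fun z => by
    simp only [ouFlow]; ring
  simp_rw [e, h, hb]
  linear_combination (y ^ 2 - 2) * h1

/-- The square is `h₄ + 8h₂ + 8h₀`, with eigenvalues `-1, 0, 1`. The coefficient `8` of `h₂` is what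
produces the rate `-2/τ` of the second mode. -/
lemma semigroupL_herm_two_sq {θ : ℝ} (hθ : 0 ≤ θ) (y : ℝ) :
    semigroupL θ (fun x => (x ^ 2 - 2) ^ 2) y =
      Real.exp (-θ) * (y ^ 4 - 12 * y ^ 2 + 12) + 8 * (y ^ 2 - 2) + 8 * Real.exp θ := by
  rw [semigroupL_eq hθ (by fun_prop)]
  have hb := sq_ouCoeff hθ
  have h1 : Real.exp θ * Real.exp (-θ / 2) ^ 2 = 1 := by
    rw [← Real.exp_nat_mul, ← Real.exp_add, Real.exp_eq_one_iff]; push_cast; ring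
  have h2 : Real.exp (-θ) = Real.exp (-θ / 2) ^ 2 := by
    rw [← Real.exp_nat_mul]; congr 1; push_cast; ring
  rw [h2]
  set r := Real.exp (-θ / 2)
  set b := √(2 * (1 - Real.exp (-θ)))
  set m := r * y with hm
  have h := integral_poly_stdGauss ((m ^ 2 - 2) ^ 2) (4 * m * b * (m ^ 2 - 2))
    (4 * m ^ 2 * b ^ 2 + 2 * (m ^ 2 - 2) * b ^ 2) (4 * m * b ^ 3) (b ^ 4) 0 0
  have e : ∀ z, ((ouFlow θ y z) ^ 2 - 2) ^ 2 = ((m ^ 2 - 2) ^ 2) + (4 * m * b * (m ^ 2 - 2)) * z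
      + (4 * m ^ 2 * b ^ 2 + 2 * (m ^ 2 - 2) * b ^ 2) * z ^ 2 + (4 * m * b ^ 3) * z ^ 3
      + (b ^ 4) * z ^ 4 + 0 * z ^ 5 + 0 * z ^ 6 := fun z => by
    simp only [ouFlow, hm]; ring
  simp_rw [e, h]
  rw [show b ^ 4 = (b ^ 2) ^ 2 by ring, hb, hm]
  linear_combination (r ^ 2 * (y ^ 4 - 12 * y ^ 2 + 12) + 8 * (y ^ 2 - 2)) * h1

/-! ### The weighted space -/

/-- The Gaussian measure with density `gaussWeight`. -/
noncomputable abbrev wGauss : Measure ℝ := ProbabilityTheory.gaussianReal 0 2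

lemma gaussWeight_eq (y : ℝ) : gaussWeight y = ProbabilityTheory.gaussianPDFReal 0 2 y := by
  unfold gaussWeight ProbabilityTheory.gaussianPDFReal
  simp only [sub_zero, NNReal.coe_ofNat]
  rw [show 2 * Real.pi * 2 = 4 * Real.pi by ring, div_eq_inv_mul, neg_div]
  norm_num

lemma gaussWeight_nonneg (y : ℝ) : 0 ≤ gaussWeight y := by
  unfold gaussWeight; positivity

lemma integral_mul_gaussWeight (f : ℝ → ℝ) : ∫ y, f y * gaussWeight y = ∫ y, f y ∂wGauss := by
  rw [ProbabilityTheory.integral_gaussianReal_eq_integral_smul (by norm_num)]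
  refine integral_congr_ae (Filter.Eventually.of_forall fun y => ?_)
  simp only [gaussWeight_eq, smul_eq_mul, mul_comm]

lemma map_sqrt_two_stdGauss : stdGauss.map (fun z => √2 * z) = wGauss := by
  rw [ProbabilityTheory.gaussianReal_map_const_mul]
  congr 1
  · simp
  · ext; norm_num

lemma integral_wGauss {f : ℝ → ℝ} (hf : Measurable f) :
    ∫ y, f y ∂wGauss = ∫ z, f (√2 * z) ∂stdGauss := by
  rw [← map_sqrt_two_stdGauss, integral_map (by fun_prop) hf.aestronglyMeasurable]

lemma PolyBdd.integrable_wGauss {f : ℝ → ℝ} (hf : PolyBdd f) : Integrable f wGauss := by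
  rw [← map_sqrt_two_stdGauss,
    integrable_map_measure hf.1.aestronglyMeasurable (by fun_prop)]
  simpa [Function.comp_def] using (hf.comp_affine 0 (√2)).integrable_stdGauss

lemma PolyBdd.one_add_abs_pow (k : ℕ) : PolyBdd fun y => (1 + |y|) ^ k :=
  PolyBdd.of_bound (by fun_prop) (M := 1) (k := k) fun y => by
    rw [abs_of_nonneg (by positivity), one_mul]

/-- The moments of the weight. -/
noncomputable def wMom (k : ℕ) : ℝ := ∫ y, (1 + |y|) ^ k ∂wGauss

lemma one_le_wMom (k : ℕ) : 1 ≤ wMom k := by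
  have h : ∫ _y : ℝ, (1 : ℝ) ∂wGauss ≤ wMom k := by
    refine integral_mono (integrable_const _) (PolyBdd.one_add_abs_pow k).integrable_wGauss
      fun z => one_le_one_add_abs_pow z k
  simpa using h

lemma wMom_pos (k : ℕ) : 0 < wMom k := lt_of_lt_of_le one_pos (one_le_wMom k)

lemma abs_integral_wGauss_le {f : ℝ → ℝ} {M : ℝ} {k : ℕ} (h : ∀ y, |f y| ≤ M * (1 + |y|) ^ k) :
    |∫ y, f y ∂wGauss| ≤ M * wMom k := by
  rw [← Real.norm_eq_abs, wMom, ← integral_const_mul]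
  exact norm_integral_le_of_norm_le ((PolyBdd.one_add_abs_pow k).integrable_wGauss.const_mul M)
    (Filter.Eventually.of_forall h)

lemma integral_poly_wGauss (a b c d e f g : ℝ) :
    ∫ y, (a + b * y + c * y ^ 2 + d * y ^ 3 + e * y ^ 4 + f * y ^ 5 + g * y ^ 6) ∂wGauss
      = a + 2 * c + 12 * e + 120 * g := by
  rw [integral_wGauss (by fun_prop)]
  have h2 : √2 ^ 2 = (2 : ℝ) := Real.sq_sqrt (by norm_num)
  have h := integral_poly_stdGauss a (b * √2) (c * √2 ^ 2) (d * √2 ^ 3) (e * √2 ^ 4) (f * √2 ^ 5)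
    (g * √2 ^ 6)
  have e : ∀ z : ℝ, (a + b * (√2 * z) + c * (√2 * z) ^ 2 + d * (√2 * z) ^ 3 + e * (√2 * z) ^ 4
      + f * (√2 * z) ^ 5 + g * (√2 * z) ^ 6) = a + (b * √2) * z + (c * √2 ^ 2) * z ^ 2
      + (d * √2 ^ 3) * z ^ 3 + (e * √2 ^ 4) * z ^ 4 + (f * √2 ^ 5) * z ^ 5
      + (g * √2 ^ 6) * z ^ 6 := fun z => by ring
  simp_rw [e, h]
  rw [show √2 ^ 4 = (√2 ^ 2) ^ 2 by ring, show √2 ^ 6 = (√2 ^ 2) ^ 3 by ring, h2]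
  ring

/-- The squared norms of the first three Hermite polynomials. -/
noncomputable def hermNormSq (m : ℕ) : ℝ := ∫ x, herm m x ^ 2 * gaussWeight x

lemma hermNormSq_zero : hermNormSq 0 = 1 := by
  rw [hermNormSq, integral_mul_gaussWeight]
  simp [herm_zero]

lemma hermNormSq_one : hermNormSq 1 = 2 := by
  rw [hermNormSq, integral_mul_gaussWeight]
  have := integral_poly_wGauss 0 0 1 0 0 0 0
  simpa [herm_one] using this

lemma hermNormSq_two : hermNormSq 2 = 8 := by
  rw [hermNormSq, integral_mul_gaussWeight]
  have := integral_poly_wGauss 4 0 (-4) 0 1 0 0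
  have e : ∀ y : ℝ, herm 2 y ^ 2 = 4 + 0 * y + (-4) * y ^ 2 + 0 * y ^ 3 + 1 * y ^ 4 + 0 * y ^ 5
    + 0 * y ^ 6 := fun y => by rw [herm_two]; ring
  simp_rw [e, this]; norm_num

lemma dualHerm_eq (m : ℕ) (y : ℝ) : dualHerm m y = herm m y / hermNormSq m := rfl

lemma dualHerm_zero (y : ℝ) : dualHerm 0 y = 1 := by
  rw [dualHerm_eq, hermNormSq_zero, herm_zero, div_one]

lemma dualHerm_one (y : ℝ) : dualHerm 1 y = y / 2 := by
  rw [dualHerm_eq, hermNormSq_one, herm_one]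

lemma dualHerm_two (y : ℝ) : dualHerm 2 y = (y ^ 2 - 2) / 8 := by
  rw [dualHerm_eq, hermNormSq_two, herm_two]

lemma abs_herm_le {m : ℕ} (hm : m < 3) (y : ℝ) : |herm m y| ≤ 2 * (1 + |y|) ^ m := by
  have h0 := abs_nonneg y
  interval_cases m
  · simp [herm_zero]
  · rw [herm_one, pow_one]; linarith
  · rw [herm_two, abs_le]
    constructor <;> nlinarith [sq_abs y]

lemma abs_dualHerm_le {m : ℕ} (hm : m < 3) (y : ℝ) : |dualHerm m y| ≤ (1 + |y|) ^ m := by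
  have h0 := abs_nonneg y
  interval_cases m
  · simp [dualHerm_zero]
  · rw [dualHerm_one, pow_one, abs_div]; norm_num; linarith
  · rw [dualHerm_two, abs_le]
    constructor <;> nlinarith [sq_abs y]

lemma measurable_herm (m : ℕ) : Measurable (herm m) := by
  unfold herm; fun_prop

lemma continuous_herm (m : ℕ) : Continuous (herm m) := by
  unfold herm; fun_prop

lemma polyBdd_herm {m : ℕ} (hm : m < 3) : PolyBdd (herm m) :=
  PolyBdd.of_bound (measurable_herm m) (abs_herm_le hm)

lemma polyBdd_dualHerm {m : ℕ} (hm : m < 3) : PolyBdd (dualHerm m) :=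
  PolyBdd.of_bound ((measurable_herm m).div_const _) (k := m) (M := 1)
    fun y => by simpa using abs_dualHerm_le hm y

lemma integral_herm_mul_dualHerm {i j : ℕ} (hi : i < 3) (hj : j < 3) :
    ∫ y, herm i y * dualHerm j y ∂wGauss = if i = j then 1 else 0 := by
  interval_cases i <;> interval_cases j <;>
    simp only [herm_zero, herm_one, herm_two, dualHerm_zero, dualHerm_one, dualHerm_two]
  · simp
  · have := integral_poly_wGauss 0 (1 / 2) 0 0 0 0 0
    have e : ∀ y : ℝ, 1 * (y / 2) = 0 + 1 / 2 * y + 0 * y ^ 2 + 0 * y ^ 3 + 0 * y ^ 4 + 0 * y ^ 5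
      + 0 * y ^ 6 := fun y => by ring
    simp_rw [e, this]; norm_num
  · have := integral_poly_wGauss (-1 / 4) 0 (1 / 8) 0 0 0 0
    have e : ∀ y : ℝ, 1 * ((y ^ 2 - 2) / 8) = -1 / 4 + 0 * y + 1 / 8 * y ^ 2 + 0 * y ^ 3
      + 0 * y ^ 4 + 0 * y ^ 5 + 0 * y ^ 6 := fun y => by ring
    simp_rw [e, this]; norm_num
  · have := integral_poly_wGauss 0 1 0 0 0 0 0
    have e : ∀ y : ℝ, y * 1 = 0 + 1 * y + 0 * y ^ 2 + 0 * y ^ 3 + 0 * y ^ 4 + 0 * y ^ 5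
      + 0 * y ^ 6 := fun y => by ring
    simp_rw [e, this]; norm_num
  · have := integral_poly_wGauss 0 0 (1 / 2) 0 0 0 0
    have e : ∀ y : ℝ, y * (y / 2) = 0 + 0 * y + 1 / 2 * y ^ 2 + 0 * y ^ 3 + 0 * y ^ 4 + 0 * y ^ 5
      + 0 * y ^ 6 := fun y => by ring
    simp_rw [e, this]; norm_num
  · have := integral_poly_wGauss 0 (-1 / 4) 0 (1 / 8) 0 0 0
    have e : ∀ y : ℝ, y * ((y ^ 2 - 2) / 8) = 0 + -1 / 4 * y + 0 * y ^ 2 + 1 / 8 * y ^ 3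
      + 0 * y ^ 4 + 0 * y ^ 5 + 0 * y ^ 6 := fun y => by ring
    simp_rw [e, this]; norm_num
  · have := integral_poly_wGauss (-2) 0 1 0 0 0 0
    have e : ∀ y : ℝ, (y ^ 2 - 2) * 1 = -2 + 0 * y + 1 * y ^ 2 + 0 * y ^ 3
      + 0 * y ^ 4 + 0 * y ^ 5 + 0 * y ^ 6 := fun y => by ring
    simp_rw [e, this]; norm_num
  · have := integral_poly_wGauss 0 (-1) 0 (1 / 2) 0 0 0
    have e : ∀ y : ℝ, (y ^ 2 - 2) * (y / 2) = 0 + (-1) * y + 0 * y ^ 2 + 1 / 2 * y ^ 3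
      + 0 * y ^ 4 + 0 * y ^ 5 + 0 * y ^ 6 := fun y => by ring
    simp_rw [e, this]; norm_num
  · have := integral_poly_wGauss (1 / 2) 0 (-1 / 2) 0 (1 / 8) 0 0
    have e : ∀ y : ℝ, (y ^ 2 - 2) * ((y ^ 2 - 2) / 8) = 1 / 2 + 0 * y + -1 / 2 * y ^ 2 + 0 * y ^ 3
      + 1 / 8 * y ^ 4 + 0 * y ^ 5 + 0 * y ^ 6 := fun y => by ring
    simp_rw [e, this]; norm_num

lemma integral_herm_four_mul_dualHerm_two :
    ∫ y, (y ^ 4 - 12 * y ^ 2 + 12) * dualHerm 2 y ∂wGauss = 0 := by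
  have := integral_poly_wGauss (-3) 0 (9 / 2) 0 (-7 / 4) 0 (1 / 8)
  have e : ∀ y : ℝ, (y ^ 4 - 12 * y ^ 2 + 12) * dualHerm 2 y = -3 + 0 * y + 9 / 2 * y ^ 2
    + 0 * y ^ 3 + -7 / 4 * y ^ 4 + 0 * y ^ 5 + 1 / 8 * y ^ 6 := fun y => by
      rw [dualHerm_two]; ring
  simp_rw [e, this]; norm_num

/-! ### Self-adjointness -/

/-- Detailed balance: with `r = e^{-θ/2}` the total exponent is `-(x² + y² - 2rxy)/(4(1-r²))`,
symmetric in `x` and `y`. Self-adjointness of the semigroup follows by Fubini. -/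
lemma gaussWeight_mul_mehler {θ : ℝ} (hθ : 0 < θ) (y x : ℝ) :
    gaussWeight y * mehler θ y x = gaussWeight x * mehler θ x y := by
  have h : 0 < 1 - Real.exp (-θ) := by
    have := Real.exp_lt_one_iff.2 (show -θ < 0 by linarith)
    linarith
  have h1 : Real.exp (-θ) = Real.exp (-θ / 2) ^ 2 := by
    rw [← Real.exp_nat_mul]; congr 1; push_cast; ring
  unfold gaussWeight mehler
  have e : Real.exp (-(y ^ 2 / 4)) *
        Real.exp (-((y * Real.exp (-θ / 2) - x) ^ 2 / (4 * (1 - Real.exp (-θ))))) =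
      Real.exp (-(x ^ 2 / 4)) *
        Real.exp (-((x * Real.exp (-θ / 2) - y) ^ 2 / (4 * (1 - Real.exp (-θ))))) := by
    rw [← Real.exp_add, ← Real.exp_add]
    congr 1
    rw [h1] at h ⊢
    generalize Real.exp (-θ / 2) = r at h ⊢
    have hne : 1 - r ^ 2 ≠ 0 := h.ne'
    field_simp
    ring
  calc _ = (Real.exp θ / √(4 * Real.pi * (1 - Real.exp (-θ))) / √(4 * Real.pi)) *
        (Real.exp (-(y ^ 2 / 4)) *
        Real.exp (-((y * Real.exp (-θ / 2) - x) ^ 2 / (4 * (1 - Real.exp (-θ)))))) := by ring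
    _ = _ := by rw [e]; ring

lemma mehler_nonneg (θ y x : ℝ) : 0 ≤ mehler θ y x := by unfold mehler; positivity

lemma PolyBdd.integrable_mehler_mul {f : ℝ → ℝ} (hf : PolyBdd f) {θ : ℝ} (hθ : 0 < θ) (y : ℝ) :
    Integrable fun x => mehler θ y x * f x := by
  have h : (2 * (1 - Real.exp (-θ))).toNNReal ≠ 0 := by
    have := Real.exp_lt_one_iff.2 (show -θ < 0 by linarith)
    simp only [ne_eq, Real.toNNReal_eq_zero, not_le]
    linarith
  have h1 : Integrable f (stdGauss.map (ouFlow θ y)) := by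
    rw [integrable_map_measure hf.1.aestronglyMeasurable (measurable_ouFlow _ _).aemeasurable]
    exact hf.integrable_ouFlow _ _
  rw [map_ouFlow_stdGauss, ProbabilityTheory.gaussianReal_of_var_ne_zero _ h,
    integrable_withDensity_iff_integrable_smul' (ProbabilityTheory.measurable_gaussianPDF _ _)
      (Filter.Eventually.of_forall fun x => ProbabilityTheory.gaussianPDF_lt_top)] at h1
  refine (h1.const_mul (Real.exp θ)).congr (Filter.Eventually.of_forall fun x => ?_)
  simp only [mehler_eq_gaussianPDFReal hθ, ProbabilityTheory.toReal_gaussianPDF, smul_eq_mul,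
    mul_assoc]

lemma PolyBdd.abs {f : ℝ → ℝ} (hf : PolyBdd f) : PolyBdd fun y => |f y| := by
  obtain ⟨mf, M, k, h⟩ := hf
  exact ⟨measurable_abs.comp mf, M, k, fun y => by simpa using h y⟩

lemma PolyBdd.integrable_mul_gaussWeight {f : ℝ → ℝ} (hf : PolyBdd f) :
    Integrable fun y => f y * gaussWeight y := by
  have h1 := hf.integrable_wGauss
  unfold wGauss at h1
  rw [ProbabilityTheory.gaussianReal_of_var_ne_zero _ (by norm_num),
    integrable_withDensity_iff_integrable_smul' (ProbabilityTheory.measurable_gaussianPDF _ _)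
      (Filter.Eventually.of_forall fun x => ProbabilityTheory.gaussianPDF_lt_top)] at h1
  refine h1.congr (Filter.Eventually.of_forall fun x => ?_)
  simp only [gaussWeight_eq, ProbabilityTheory.toReal_gaussianPDF, smul_eq_mul, mul_comm]

lemma measurable_gaussWeight : Measurable gaussWeight := by
  unfold gaussWeight; fun_prop

lemma integral_semigroupL_mul {θ : ℝ} (hθ : 0 ≤ θ) {f g : ℝ → ℝ} (hf : PolyBdd f)
    (hg : PolyBdd g) :
    ∫ y, semigroupL θ f y * g y ∂wGauss = ∫ y, f y * semigroupL θ g y ∂wGauss := by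
  rcases hθ.eq_or_lt with rfl | hθ'
  · simp [semigroupL]
  rw [← integral_mul_gaussWeight, ← integral_mul_gaussWeight]
  have hS : ∀ h : ℝ → ℝ, ∀ y, semigroupL θ h y = ∫ x, mehler θ y x * h x := fun h y => by
    rw [semigroupL, if_pos hθ']
  have hm : Measurable (Function.uncurry fun y x : ℝ => mehler θ y x * f x * g y * gaussWeight y) := by
    have m1 : Measurable fun q : ℝ × ℝ => mehler θ q.1 q.2 := by unfold mehler; fun_prop
    exact ((m1.mul (hf.1.comp measurable_snd)).mul (hg.1.comp measurable_fst)).mul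
      (measurable_gaussWeight.comp measurable_fst)
  have hint : Integrable (Function.uncurry fun y x : ℝ => mehler θ y x * f x * g y * gaussWeight y)
      (volume.prod volume) := by
    rw [integrable_prod_iff hm.aestronglyMeasurable]
    constructor
    · refine Filter.Eventually.of_forall fun y => ?_
      exact ((hf.integrable_mehler_mul hθ' y).mul_const (g y)).mul_const (gaussWeight y)
    · have h2 := ((hf.abs.semigroupL hθ).mul hg.abs).integrable_mul_gaussWeight
      refine h2.congr (Filter.Eventually.of_forall fun y => ?_)
      simp only [Function.uncurry_apply_pair, hS, norm_mul, Real.norm_eq_abs,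
        abs_of_nonneg (mehler_nonneg _ _ _), abs_of_nonneg (gaussWeight_nonneg _)]
      rw [integral_mul_const, integral_mul_const]
  have h := integral_integral_swap hint
  calc ∫ y, semigroupL θ f y * g y * gaussWeight y
      = ∫ y, ∫ x, mehler θ y x * f x * g y * gaussWeight y := by
        simp only [hS, integral_mul_const]
    _ = ∫ x, ∫ y, mehler θ y x * f x * g y * gaussWeight y := h
    _ = ∫ y, f y * semigroupL θ g y * gaussWeight y := by
        refine integral_congr_ae (Filter.Eventually.of_forall fun x => ?_)
        simp only [hS]
        rw [mul_right_comm, ← integral_const_mul]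
        refine integral_congr_ae (Filter.Eventually.of_forall fun y => ?_)
        simp only
        linear_combination (f x * g y) * gaussWeight_mul_mehler hθ' y x

/-! ### Tails, localization, short times -/

/-- The mean of the kernel lies within `l/2` of the origin and the noise coefficient is at most `2`,
so reaching the support of `g` requires `|z| ≥ l/4`. Markov's inequality with the fourth moment
gives `4⁴·3 = 768`. -/
lemma abs_semigroupL_tail_le {θ : ℝ} (hθ : 0 ≤ θ) {g : ℝ → ℝ} (mg : Measurable g) {M l : ℝ}
    (hl : 0 < l) (hg : ∀ x, |g x| ≤ M) (hsupp : ∀ x, |x| < l → g x = 0) {y : ℝ}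
    (hy : Real.exp (-θ / 2) * |y| ≤ l / 2) :
    |semigroupL θ g y| ≤ Real.exp θ * (768 * M / l ^ 4) := by
  have hM : 0 ≤ M := (abs_nonneg _).trans (hg 0)
  rw [semigroupL_eq hθ mg, abs_mul, abs_of_pos (Real.exp_pos _), ← Real.norm_eq_abs]
  gcongr
  have hi := (integrable_pow_stdGauss 4).const_mul (256 * M / l ^ 4)
  refine (norm_integral_le_of_norm_le hi (Filter.Eventually.of_forall fun z => ?_)).trans ?_
  · rw [Real.norm_eq_abs]
    by_cases hz : |ouFlow θ y z| < l
    · rw [hsupp _ hz, abs_zero]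
      positivity
    · push Not at hz
      refine (hg _).trans ?_
      have h1 : |ouFlow θ y z| ≤ l / 2 + 2 * |z| := by
        refine (abs_add_le _ _).trans ?_
        rw [abs_mul, abs_mul, abs_of_pos (Real.exp_pos _), abs_of_nonneg (Real.sqrt_nonneg _)]
        gcongr
        exact sqrt_two_mul_one_sub_exp_le θ
      have h2 : l ≤ 4 * |z| := by linarith
      have h3 : l ^ 4 ≤ 256 * z ^ 4 := by
        have := pow_le_pow_left₀ hl.le h2 4
        rw [mul_pow, Even.pow_abs (by decide)] at this
        linarith
      calc M = M * l ^ 4 / l ^ 4 := by field_simp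
        _ ≤ M * (256 * z ^ 4) / l ^ 4 := by gcongr
        _ = _ := by ring
  · rw [integral_const_mul, integral_quartic_stdGauss]
    exact le_of_eq (by ring)

/-- Comparison of the semigroup applied to `D` and to `c f`, when `D` is close to `ℓ f` with `ℓ`
close to the constant `c` near the mean of the kernel. -/
lemma abs_semigroupL_sub_le {θ : ℝ} (hθ : 0 ≤ θ) {D f : ℝ → ℝ} (hD : PolyBdd D) (hf : PolyBdd f)
    {c e Λ y : ℝ} (hΛ : 0 ≤ Λ) (he : 0 ≤ e) {k : ℕ}
    (h : ∀ x, |D x - c * f x| ≤ (e + Λ * |x - Real.exp (-θ / 2) * y|) * (1 + |x|) ^ k) :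
    |semigroupL θ D y - c * semigroupL θ f y| ≤
      Real.exp θ * gaussMom (k + 1) * (e + Λ) * (1 + |y|) ^ k := by
  rw [← semigroupL_const_mul, ← semigroupL_sub hθ hD (hf.const_mul c),
    semigroupL_eq hθ (hD.sub (hf.const_mul c)).1, abs_mul, abs_of_pos (Real.exp_pos _), mul_assoc,
    mul_assoc]
  gcongr
  rw [← Real.norm_eq_abs]
  have hi := (integrable_one_add_two_mul_abs_pow (k + 1)).const_mul ((e + Λ) * (1 + |y|) ^ k)
  refine (norm_integral_le_of_norm_le hi (Filter.Eventually.of_forall fun z => ?_)).trans ?_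
  · rw [Real.norm_eq_abs]
    refine (h _).trans ?_
    have h1 : |ouFlow θ y z - Real.exp (-θ / 2) * y| ≤ 2 * |z| := by
      rw [ouFlow, add_sub_cancel_left, abs_mul, abs_of_nonneg (Real.sqrt_nonneg _)]
      gcongr
      exact sqrt_two_mul_one_sub_exp_le θ
    calc _ ≤ (e + Λ * (2 * |z|)) * ((1 + |y|) ^ k * (1 + 2 * |z|) ^ k) := by
          gcongr
          exact one_add_abs_ouFlow_pow_le hθ k y z
      _ ≤ ((e + Λ) * (1 + 2 * |z|)) * ((1 + |y|) ^ k * (1 + 2 * |z|) ^ k) := by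
          gcongr
          nlinarith [abs_nonneg z, mul_nonneg he (abs_nonneg z)]
      _ = _ := by ring
  · rw [integral_const_mul, gaussMom]
    exact le_of_eq (by ring)

/-- Two successive uses of the mean value inequality; the sharp factor `1/2` is not needed. -/
lemma abs_sub_sub_deriv_le {G G' G'' : ℝ → ℝ} (h1 : ∀ x, HasDerivAt G (G' x) x)
    (h2 : ∀ x, HasDerivAt G' (G'' x) x) {m h B : ℝ}
    (hB : ∀ x ∈ uIcc m (m + h), |G'' x| ≤ B) : |G (m + h) - G m - G' m * h| ≤ B * h ^ 2 := by
  have hm : m ∈ uIcc m (m + h) := left_mem_uIcc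
  have hB0 : 0 ≤ B := (abs_nonneg _).trans (hB m hm)
  have hlen : ∀ x ∈ uIcc m (m + h), |x - m| ≤ |h| := fun x hx => by
    have := abs_sub_left_of_mem_uIcc hx
    simpa using this
  have d1 : ∀ x ∈ uIcc m (m + h), |G' x - G' m| ≤ B * |h| := fun x hx => by
    have := (convex_uIcc m (m + h)).norm_image_sub_le_of_norm_hasDerivWithin_le
      (fun z hz => (h2 z).hasDerivWithinAt) hB hm hx
    simp only [Real.norm_eq_abs] at this
    exact this.trans (mul_le_mul_of_nonneg_left (hlen x hx) hB0)
  have d2 := (convex_uIcc m (m + h)).norm_image_sub_le_of_norm_hasDerivWithin_le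
      (f := fun x => G x - G' m * x) (f' := fun x => G' x - G' m)
      (fun z hz => by
        simpa using ((h1 z).fun_sub ((hasDerivAt_id z).const_mul (G' m))).hasDerivWithinAt) d1 hm
      (right_mem_uIcc)
  simp only [Real.norm_eq_abs, add_sub_cancel_left] at d2
  calc _ = |G (m + h) - G' m * (m + h) - (G m - G' m * m)| := by ring_nf
    _ ≤ B * |h| * |h| := d2
    _ = B * h ^ 2 := by rw [mul_assoc, abs_mul_abs_self, sq]

/-- The variance of the flow is at most `2θ` and the drift moves `y` by at most `θ|y|/2`, so a
function with two controlled derivatives changes by `O(θ)`. The drift costs the additional power of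
the weight. -/
lemma abs_semigroupL_sub_self_le {θ ρ : ℝ} (hθ : 0 ≤ θ) (hρ : θ ≤ ρ) {G G' G'' : ℝ → ℝ}
    (h1 : ∀ x, HasDerivAt G (G' x) x) (h2 : ∀ x, HasDerivAt G' (G'' x) x) {M : ℝ} {k : ℕ}
    (b0 : ∀ x, |G x| ≤ M * (1 + |x|) ^ k) (b1 : ∀ x, |G' x| ≤ M * (1 + |x|) ^ k)
    (b2 : ∀ x, |G'' x| ≤ M * (1 + |x|) ^ k) (y : ℝ) :
    |semigroupL θ G y - G y| ≤ θ * (6 * Real.exp ρ * gaussMom (k + 2) * M) * (1 + |y|) ^ (k + 1) := by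
  have hM := nonneg_of_abs_le_mul_pow (b0 0)
  have hGc : Continuous G := continuous_iff_continuousAt.2 fun x => (h1 x).continuousAt
  have hG : PolyBdd G := PolyBdd.of_bound hGc.measurable b0
  set r := Real.exp (-θ / 2) with hr
  set b := √(2 * (1 - Real.exp (-θ))) with hb
  have hb2 : b ^ 2 ≤ 2 * θ := by
    have := Real.add_one_le_exp (-θ)
    have := Real.exp_le_one_iff.2 (show -θ ≤ 0 by linarith)
    rw [hb, Real.sq_sqrt (by linarith)]
    linarith
  have hr1 : r ≤ 1 := exp_neg_half_le_one hθ
  have hr2 : 1 - r ≤ θ / 2 := by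
    have := Real.add_one_le_exp (-θ / 2)
    linarith
  have hr0 : 0 < r := Real.exp_pos _
  have hry : |r * y| ≤ |y| := by
    rw [abs_mul, abs_of_pos hr0]; nlinarith [abs_nonneg y]
  have hmom : gaussMom k ≤ gaussMom (k + 2) :=
    integral_mono (integrable_one_add_two_mul_abs_pow k) (integrable_one_add_two_mul_abs_pow _)
      fun z => pow_le_pow_right₀ (by linarith [abs_nonneg z]) (by omega)
  have hw := one_add_abs_pow_mono y (Nat.le_succ k)
  -- the second order part
  have p1 : |∫ z, (G (ouFlow θ y z) - G (r * y)) ∂stdGauss| ≤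
      2 * θ * M * gaussMom (k + 2) * (1 + |y|) ^ k := by
    -- The first-order term has zero mean, so it may be subtracted; without this cancellation the
    -- bound would only be of order `√θ`.
    have e : ∫ z, (G (ouFlow θ y z) - G (r * y)) ∂stdGauss =
        ∫ z, (G (ouFlow θ y z) - G (r * y) - G' (r * y) * (b * z)) ∂stdGauss := by
      have i1 : Integrable (fun z => G (ouFlow θ y z) - G (r * y)) stdGauss :=
        (hG.integrable_ouFlow θ y).sub (integrable_const _)
      have i2 : Integrable (fun z => G' (r * y) * (b * z)) stdGauss :=
        ((PolyBdd.id.const_mul b).const_mul _).integrable_stdGauss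
      rw [integral_sub i1 i2, integral_const_mul, integral_const_mul, integral_id_stdGauss]
      ring
    rw [e, ← Real.norm_eq_abs]
    have hi := (integrable_one_add_two_mul_abs_pow (k + 2)).const_mul (2 * θ * M * (1 + |y|) ^ k)
    refine (norm_integral_le_of_norm_le hi (Filter.Eventually.of_forall fun z => ?_)).trans ?_
    · rw [Real.norm_eq_abs]
      have := abs_sub_sub_deriv_le h1 h2 (m := r * y) (h := b * z)
        (B := M * ((1 + |y|) ^ k * (1 + 2 * |z|) ^ k)) (fun x hx => (b2 x).trans ?_)
      · refine this.trans ?_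
        have hz : z ^ 2 ≤ (1 + 2 * |z|) ^ 2 := by nlinarith [abs_nonneg z, sq_abs z]
        calc _ = M * ((1 + |y|) ^ k * (1 + 2 * |z|) ^ k) * (b ^ 2 * z ^ 2) := by ring
          _ ≤ M * ((1 + |y|) ^ k * (1 + 2 * |z|) ^ k) * (2 * θ * (1 + 2 * |z|) ^ 2) := by gcongr
          _ = _ := by ring
      · rw [← mul_pow]
        gcongr
        have h3 : |x - r * y| ≤ |b * z| := by
          have := abs_sub_left_of_mem_uIcc hx
          simpa using this
        have h4 : |b * z| ≤ 2 * |z| := by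
          rw [abs_mul, abs_of_nonneg (Real.sqrt_nonneg _)]
          gcongr
          exact sqrt_two_mul_one_sub_exp_le θ
        have h5 : |x| ≤ |x - r * y| + |r * y| := by
          have := abs_add_le (x - r * y) (r * y); rwa [sub_add_cancel] at this
        nlinarith [mul_nonneg (abs_nonneg y) (abs_nonneg z)]
    · rw [integral_const_mul, gaussMom]
      exact le_of_eq (by ring)
  have p2 : |G (r * y) - G y| ≤ θ * M * (1 + |y|) ^ (k + 1) := by
    have := (convex_uIcc y (r * y)).norm_image_sub_le_of_norm_hasDerivWithin_le
      (C := M * (1 + |y|) ^ k) (fun z hz => (h1 z).hasDerivWithinAt) (fun x hx => by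
        refine (b1 x).trans ?_
        have hx' : |x| ≤ |y| := by
          rcases le_total 0 y with h0 | h0
          · rw [uIcc_of_ge (by nlinarith)] at hx
            rw [abs_of_nonneg h0, abs_of_nonneg ((by positivity : 0 ≤ r * y).trans hx.1)]
            exact hx.2
          · rw [uIcc_of_le (by nlinarith)] at hx
            rw [abs_of_nonpos h0, abs_of_nonpos (hx.2.trans (by nlinarith))]
            linarith [hx.1]
        gcongr)
      left_mem_uIcc right_mem_uIcc
    simp only [Real.norm_eq_abs] at this
    refine this.trans ?_
    have h3 : |r * y - y| ≤ θ * (1 + |y|) := by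
      rw [show r * y - y = -((1 - r) * y) by ring, abs_neg, abs_mul,
        abs_of_nonneg (by linarith)]
      nlinarith [abs_nonneg y, mul_nonneg hθ (abs_nonneg y)]
    calc _ ≤ M * (1 + |y|) ^ k * (θ * (1 + |y|)) := by gcongr
      _ = _ := by ring
  have he1 : Real.exp θ - 1 ≤ θ * Real.exp θ := by
    have h := Real.add_one_le_exp (-θ)
    have h' : Real.exp (-θ) * Real.exp θ = 1 := by rw [← Real.exp_add]; simp
    nlinarith [Real.exp_pos θ]
  have he2 : 1 ≤ Real.exp θ := Real.one_le_exp hθ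
  have he3 : Real.exp θ ≤ Real.exp ρ := Real.exp_le_exp.2 hρ
  have p3 : |∫ z, G (ouFlow θ y z) ∂stdGauss| ≤ gaussMom (k + 2) * M * (1 + |y|) ^ k := by
    refine (abs_integral_ouFlow_le hθ b0 y).trans ?_
    gcongr
  have e : semigroupL θ G y - G y = (Real.exp θ - 1) * (∫ z, G (ouFlow θ y z) ∂stdGauss)
      + (∫ z, (G (ouFlow θ y z) - G (r * y)) ∂stdGauss) + (G (r * y) - G y) := by
    rw [semigroupL_eq hθ hG.1, integral_sub (hG.integrable_ouFlow θ y) (integrable_const _)]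
    simp
    ring
  have hg1 := one_le_gaussMom (k + 2)
  rw [e]
  calc _ ≤ |(Real.exp θ - 1) * (∫ z, G (ouFlow θ y z) ∂stdGauss)|
        + |∫ z, (G (ouFlow θ y z) - G (r * y)) ∂stdGauss| + |G (r * y) - G y| := abs_add_three _ _ _
    _ ≤ (θ * Real.exp ρ) * (gaussMom (k + 2) * M * (1 + |y|) ^ (k + 1))
        + 2 * θ * M * gaussMom (k + 2) * (1 + |y|) ^ (k + 1) + θ * M * (1 + |y|) ^ (k + 1) := by
        rw [abs_mul, abs_of_nonneg (by linarith : 0 ≤ Real.exp θ - 1)]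
        refine add_le_add (add_le_add ?_ (p1.trans ?_)) p2
        · refine mul_le_mul (he1.trans (by gcongr)) (p3.trans ?_) (abs_nonneg _) (by positivity)
          have := gaussMom_pos (k + 2)
          gcongr
        · have := gaussMom_pos (k + 2)
          gcongr
    _ ≤ _ := by
        have hE : 1 ≤ Real.exp ρ := he2.trans he3
        have hX : 0 ≤ θ * M * (1 + |y|) ^ (k + 1) := by positivity
        set X := θ * M * (1 + |y|) ^ (k + 1)
        set g := gaussMom (k + 2)
        have k1 : g ≤ Real.exp ρ * g := by nlinarith
        have k2 : 1 ≤ Real.exp ρ * g := by nlinarith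
        have : X * (Real.exp ρ * g + 2 * g + 1) ≤ X * (6 * (Real.exp ρ * g)) := by
          apply mul_le_mul_of_nonneg_left _ hX
          linarith
        calc _ = X * (Real.exp ρ * g + 2 * g + 1) := by ring
          _ ≤ _ := this
          _ = _ := by ring

/-! ### Decay of the semigroup on functions without components on `h_0, h_1, h_2` -/

/-- Multiplying the density of variance `2` by `e^{x²/8}` gives, up to a constant, the Gaussian
density of variance `4`. -/
lemma integrable_exp_sq_wGauss (k : ℕ) :
    Integrable (fun x : ℝ => (1 + |x|) ^ k * Real.exp (x ^ 2 / 8)) wGauss := by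
  unfold wGauss
  rw [ProbabilityTheory.gaussianReal_of_var_ne_zero _ (by norm_num),
    integrable_withDensity_iff_integrable_smul' (ProbabilityTheory.measurable_gaussianPDF _ _)
      (Filter.Eventually.of_forall fun x => ProbabilityTheory.gaussianPDF_lt_top)]
  have h1 : Integrable (fun x : ℝ => (1 + |x|) ^ k) (stdGauss.map fun z => 2 * z) := by
    rw [integrable_map_measure (by fun_prop) (by fun_prop)]
    simpa [Function.comp_def] using
      ((PolyBdd.one_add_abs_pow k).comp_affine 0 2).integrable_stdGauss
  rw [ProbabilityTheory.gaussianReal_map_const_mul,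
    ProbabilityTheory.gaussianReal_of_var_ne_zero _ (by norm_num [← NNReal.coe_ne_zero]),
    integrable_withDensity_iff_integrable_smul' (ProbabilityTheory.measurable_gaussianPDF _ _)
      (Filter.Eventually.of_forall fun x => ProbabilityTheory.gaussianPDF_lt_top)] at h1
  refine (h1.const_mul (√(2 * Real.pi * 4) / √(4 * Real.pi))).congr
    (Filter.Eventually.of_forall fun x => ?_)
  simp only [ProbabilityTheory.toReal_gaussianPDF, smul_eq_mul, ProbabilityTheory.gaussianPDFReal,
    mul_zero, sub_zero, NNReal.coe_mk, mul_one, NNReal.coe_ofNat]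
  have e : Real.exp (-x ^ 2 / (2 * 2)) * Real.exp (x ^ 2 / 8) = Real.exp (-x ^ 2 / (2 * 2 ^ 2)) := by
    rw [← Real.exp_add]; congr 1; ring
  rw [← e]
  have hpi := Real.pi_pos
  rw [show 2 * Real.pi * 2 ^ 2 = 2 * Real.pi * 4 by ring, show 2 * Real.pi * 2 = 4 * Real.pi by ring]
  have : √(2 * Real.pi * 4) ≠ 0 := (Real.sqrt_pos.2 (by positivity)).ne'
  field_simp

/-- Second order expansion of the Mehler kernel (relative to the weight) in the contraction
factor `r`. -/
lemma abs_mehler_expansion_le {r x y : ℝ} (hr0 : 0 < r) (hr : r ≤ 3 / 8) (hy : r * |y| ≤ 1) :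
    |√(1 / (1 - r ^ 2)) * Real.exp (1 / (1 - r ^ 2) * (r * x * y / 2 - r ^ 2 * (x ^ 2 + y ^ 2) / 4))
      - (1 + r * y / 2 * x + r ^ 2 / 8 * (y ^ 2 - 2) * (x ^ 2 - 2))| ≤
      40 * Real.exp 6 * r ^ 3 * (1 + |y|) ^ 3 * ((1 + |x|) ^ 6 * Real.exp (x ^ 2 / 8)) := by
  obtain ⟨c, hc⟩ : ∃ c, c = 1 / (1 - r ^ 2) := ⟨_, rfl⟩
  obtain ⟨a, ha⟩ : ∃ a, a = r * x * y / 2 := ⟨_, rfl⟩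
  obtain ⟨b, hb⟩ : ∃ b, b = r ^ 2 * (x ^ 2 + y ^ 2) / 4 := ⟨_, rfl⟩
  obtain ⟨X, hX⟩ : ∃ X, X = 1 + |x| := ⟨_, rfl⟩
  obtain ⟨Y, hY⟩ : ∃ Y, Y = 1 + |y| := ⟨_, rfl⟩
  have hX1 : 1 ≤ X := hX ▸ one_le_one_add_abs x
  have hY1 : 1 ≤ Y := hY ▸ one_le_one_add_abs y
  have hxX : |x| ≤ X := by linarith
  have hyY : |y| ≤ Y := by linarith
  have hx2 : x ^ 2 ≤ X ^ 2 := sq_le_sq.2 (by rwa [abs_of_nonneg (by linarith : 0 ≤ X)])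
  have hy2 : y ^ 2 ≤ Y ^ 2 := sq_le_sq.2 (by rwa [abs_of_nonneg (by linarith : 0 ≤ Y)])
  have hr2 : r ^ 2 ≤ 9 / 64 := by nlinarith
  have hD : 0 < 1 - r ^ 2 := by linarith
  have hcmul : c * (1 - r ^ 2) = 1 := by rw [hc]; field_simp
  have hc1 : 1 ≤ c := by rw [hc, le_div_iff₀ hD]; linarith [sq_nonneg r]
  have hc2 : c ≤ 6 / 5 := by rw [hc, div_le_iff₀ hD]; linarith
  have hs1 : 1 ≤ √c := Real.one_le_sqrt.2 hc1
  have hs2 : √c ≤ 6 / 5 := by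
    rw [Real.sqrt_le_left (by norm_num)]; linarith
  have hsq : √c ^ 2 = c := Real.sq_sqrt (by linarith)
  have hr3 : 0 < r ^ 3 := by positivity
  -- size of `a` and `b`
  have ha1 : |a| ≤ r * X * Y / 2 := by
    rw [ha, abs_div, abs_mul, abs_mul, abs_of_pos hr0, abs_of_pos (by norm_num : (0 : ℝ) < 2)]
    gcongr
  have hb0 : 0 ≤ b := by rw [hb]; positivity
  have hry2 : r ^ 2 * y ^ 2 ≤ 1 := by
    have : (r * |y|) ^ 2 ≤ 1 := pow_le_one₀ (by positivity) hy
    rwa [mul_pow, sq_abs] at this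
  have hry3 : r ^ 2 * y ^ 2 ≤ r * Y := by
    have h1 : r ^ 2 * y ^ 2 = r * |y| * (r * |y|) := by rw [← sq_abs y]; ring
    rw [h1]
    have : r * |y| ≤ r * Y := by gcongr
    exact (mul_le_of_le_one_left (by positivity) hy).trans this
  have hXX : X ≤ X ^ 2 := le_self_pow₀ hX1 (by norm_num)
  have hb1 : b ≤ r * X ^ 2 * Y / 2 := by
    have h1 : r ^ 2 * x ^ 2 ≤ r * X ^ 2 * Y := by
      have h0 : r * x ^ 2 ≤ 1 * (X ^ 2 * Y) := by
        refine mul_le_mul (by linarith) (hx2.trans ?_) (sq_nonneg x) zero_le_one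
        exact le_mul_of_one_le_right (sq_nonneg X) hY1
      calc r ^ 2 * x ^ 2 = r * (r * x ^ 2) := by ring
        _ ≤ r * (1 * (X ^ 2 * Y)) := by gcongr
        _ = _ := by ring
    have h2 : r * Y ≤ r * X ^ 2 * Y := by
      have : r * Y * 1 ≤ r * Y * X ^ 2 :=
        mul_le_mul_of_nonneg_left (one_le_pow₀ hX1) (by positivity)
      linarith
    have h3 := hry3.trans h2
    rw [hb, mul_add]
    linarith
  have hb2 : b ≤ r ^ 2 * X ^ 2 * Y ^ 2 / 2 := by
    have h1 : x ^ 2 ≤ X ^ 2 * Y ^ 2 :=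
      hx2.trans (le_mul_of_one_le_right (sq_nonneg X) (one_le_pow₀ hY1))
    have h2 : y ^ 2 ≤ X ^ 2 * Y ^ 2 :=
      hy2.trans (le_mul_of_one_le_left (sq_nonneg Y) (one_le_pow₀ hX1))
    rw [hb]
    have : r ^ 2 * (x ^ 2 + y ^ 2) ≤ r ^ 2 * (2 * (X ^ 2 * Y ^ 2)) := by gcongr; linarith
    linarith
  have hab : |a - b| ≤ r * X ^ 2 * Y := by
    refine (abs_sub _ _).trans ?_
    rw [abs_of_nonneg hb0]
    have : r * X * Y ≤ r * X ^ 2 * Y := by gcongr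
    linarith
  set Q := c * (a - b) with hQ
  have hQ1 : |Q| ≤ 6 / 5 * (r * X ^ 2 * Y) := by
    rw [hQ, abs_mul, abs_of_pos (by linarith : 0 < c)]
    gcongr
  -- This second bound on the exponent has no growth in `y`, thanks to `r|y| ≤ 1`, and its
  -- exponential remains integrable against the Gaussian weight.
  have hQ2 : |Q| ≤ 6 + x ^ 2 / 8 := by
    have h1 : |a - b| ≤ |x| / 2 + (9 / 64 * x ^ 2 + 1) / 4 := by
      refine (abs_sub _ _).trans ?_
      rw [abs_of_nonneg hb0]
      refine add_le_add ?_ ?_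
      · rw [ha, abs_div, abs_mul, abs_mul, abs_of_pos hr0, abs_of_pos (by norm_num : (0 : ℝ) < 2)]
        have : r * |x| * |y| ≤ |x| := by
          rw [mul_right_comm]
          exact mul_le_of_le_one_left (abs_nonneg x) hy
        linarith
      · rw [hb, mul_add]
        have : r ^ 2 * x ^ 2 ≤ 9 / 64 * x ^ 2 := by gcongr
        linarith
    rw [hQ, abs_mul, abs_of_pos (by linarith : 0 < c)]
    have h2 : c * |a - b| ≤ 6 / 5 * (|x| / 2 + (9 / 64 * x ^ 2 + 1) / 4) := by gcongr
    have h3 : 16 * |x| ≤ x ^ 2 + 64 := by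
      have := sq_nonneg (|x| - 8)
      rw [← sq_abs x]
      linarith
    linarith [sq_nonneg x]
  have hexp : Real.exp |Q| ≤ Real.exp 6 * Real.exp (x ^ 2 / 8) := by
    rw [← Real.exp_add]; exact Real.exp_le_exp.2 hQ2
  have hexp1 : 1 ≤ Real.exp |Q| := Real.one_le_exp (abs_nonneg _)
  have p1 : |Real.exp Q - (1 + Q + Q ^ 2 / 2)| ≤ |Q| ^ 3 * Real.exp |Q| := by
    have h := Complex.norm_exp_sub_sum_le_norm_mul_exp (Q : ℂ) 3
    have e : (Complex.exp (Q : ℂ) - ∑ m ∈ Finset.range 3, (Q : ℂ) ^ m / (m.factorial : ℂ)) =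
        ((Real.exp Q - (1 + Q + Q ^ 2 / 2) : ℝ) : ℂ) := by
      simp [Finset.sum_range_succ, Nat.factorial]
    rw [e, Complex.norm_real, Complex.norm_real] at h
    simpa using h
  have q1 : |√c * (Real.exp Q - (1 + Q + Q ^ 2 / 2))| ≤ 3 * r ^ 3 * X ^ 6 * Y ^ 3 * Real.exp |Q| := by
    rw [abs_mul, abs_of_pos (by linarith : 0 < √c)]
    calc √c * |Real.exp Q - (1 + Q + Q ^ 2 / 2)| ≤ 6 / 5 * ((6 / 5 * (r * X ^ 2 * Y)) ^ 3 * Real.exp |Q|) := by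
          gcongr
          refine p1.trans ?_
          gcongr
      _ = (6 / 5) ^ 4 * (r ^ 3 * X ^ 6 * Y ^ 3 * Real.exp |Q|) := by ring
      _ ≤ 3 * (r ^ 3 * X ^ 6 * Y ^ 3 * Real.exp |Q|) := by gcongr; norm_num
      _ = _ := by ring
  set Z := r ^ 3 * X ^ 6 * Y ^ 3 with hZ
  have hZ0 : 0 < Z := by positivity
  have hZmono : ∀ i j : ℕ, i ≤ 6 → j ≤ 3 → r ^ 3 * X ^ i * Y ^ j ≤ Z := fun i j hi hj => by
    rw [hZ]; gcongr
  have hc3 : c - 1 = c * r ^ 2 := by linarith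
  have hs3 : √c - 1 ≤ r ^ 2 := by
    have h1 : (√c - 1) * (√c + 1) = c * r ^ 2 := by linear_combination hsq + hc3
    have h2 : (√c - 1) * 2 ≤ (√c - 1) * (√c + 1) :=
      mul_le_mul_of_nonneg_left (by linarith) (by linarith)
    have h3 : c * r ^ 2 ≤ 6 / 5 * r ^ 2 := by gcongr
    linarith [sq_nonneg r]
  -- the three remaining terms
  have q2 : |√c - 1 - r ^ 2 / 2| ≤ Z := by
    have hz := hZmono 0 0 (by norm_num) (by norm_num)
    simp only [pow_zero, mul_one] at hz
    refine le_trans ?_ hz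
    have hlow : 1 + r ^ 2 / 2 ≤ √c := by
      apply Real.le_sqrt_of_sq_le
      have : (1 + r ^ 2 / 2) ^ 2 * (1 - r ^ 2) ≤ c * (1 - r ^ 2) := by
        rw [hcmul]
        linarith [pow_pos hr0 4, pow_pos hr0 6,
          show (1 + r ^ 2 / 2) ^ 2 * (1 - r ^ 2) = 1 - 3 / 4 * r ^ 4 - 1 / 4 * r ^ 6 by ring]
      exact le_of_mul_le_mul_right this hD
    rw [abs_of_nonneg (by linarith)]
    have hup : √c ≤ 1 + r ^ 2 / 2 + r ^ 4 := by
      rw [Real.sqrt_le_left (by positivity)]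
      have : c * (1 - r ^ 2) ≤ (1 + r ^ 2 / 2 + r ^ 4) ^ 2 * (1 - r ^ 2) := by
        rw [hcmul]
        have e : (1 + r ^ 2 / 2 + r ^ 4) ^ 2 * (1 - r ^ 2) - 1 =
          r ^ 4 * (5 / 4 - 5 / 4 * r ^ 2 - r ^ 6) := by ring
        have h6 : r ^ 6 ≤ 1 / 4 := by
          have : r ^ 6 = (r ^ 2) ^ 3 := by ring
          rw [this]
          calc (r ^ 2) ^ 3 ≤ (9 / 64) ^ 3 := by gcongr
            _ ≤ _ := by norm_num
        have : 0 ≤ r ^ 4 * (5 / 4 - 5 / 4 * r ^ 2 - r ^ 6) :=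
          mul_nonneg (by positivity) (by linarith)
        linarith
      exact le_of_mul_le_mul_right this hD
    have : r ^ 4 ≤ r ^ 3 := pow_le_pow_of_le_one hr0.le (by linarith) (by norm_num)
    linarith
  have q3 : |√c * Q - (a - b)| ≤ 3 * Z := by
    have e : √c * Q - (a - b) = (√c * c - 1) * (a - b) := by rw [hQ]; ring
    have h1 : |√c * c - 1| ≤ 3 * r ^ 2 := by
      have h0 : 1 ≤ √c * c := one_le_mul_of_one_le_of_one_le hs1 hc1
      rw [abs_of_nonneg (by linarith)]
      have h2 : (√c - 1) * c ≤ r ^ 2 * (6 / 5) := by gcongr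
      have h3 : c * r ^ 2 ≤ 6 / 5 * r ^ 2 := by gcongr
      linarith [sq_nonneg r]
    rw [e, abs_mul]
    calc _ ≤ 3 * r ^ 2 * (r * X ^ 2 * Y) := by gcongr
      _ = 3 * (r ^ 3 * X ^ 2 * Y ^ 1) := by ring
      _ ≤ _ := by gcongr; exact hZmono 2 1 (by norm_num) (by norm_num)
  have q4 : |√c * (Q ^ 2 / 2) - a ^ 2 / 2| ≤ 5 * Z := by
    have e : √c * (Q ^ 2 / 2) - a ^ 2 / 2 = 1 / 2 * ((√c * c ^ 2 - 1) * (a - b) ^ 2)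
        + (b * b / 2 - a * b) := by rw [hQ]; ring
    have h1 : |√c * c ^ 2 - 1| ≤ 5 * r ^ 2 := by
      have h0 : 1 ≤ √c * c ^ 2 := one_le_mul_of_one_le_of_one_le hs1 (one_le_pow₀ hc1)
      rw [abs_of_nonneg (by linarith)]
      have : √c * c ^ 2 - 1 = (√c - 1) * c ^ 2 + (c + 1) * (c - 1) := by ring
      rw [this, hc3]
      have h2 : c ^ 2 ≤ 36 / 25 :=
        (pow_le_pow_left₀ (by linarith) hc2 2).trans (by norm_num)
      have h3 : (√c - 1) * c ^ 2 ≤ r ^ 2 * (36 / 25) := by gcongr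
      have h4 : (c + 1) * (c * r ^ 2) ≤ (6 / 5 + 1) * (6 / 5 * r ^ 2) := by gcongr
      linarith [sq_nonneg r]
    have h2 : |1 / 2 * ((√c * c ^ 2 - 1) * (a - b) ^ 2)| ≤ 5 / 2 * Z := by
      rw [abs_mul, abs_mul, abs_pow, abs_of_pos (by norm_num : (0 : ℝ) < 1 / 2)]
      calc _ ≤ 1 / 2 * (5 * r ^ 2 * (r * X ^ 2 * Y) ^ 2) := by gcongr
        _ = 5 / 2 * (r * (r ^ 3 * X ^ 4 * Y ^ 2)) := by ring
        _ ≤ 5 / 2 * (1 * Z) := by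
            gcongr
            · linarith
            · exact hZmono 4 2 (by norm_num) (by norm_num)
        _ = _ := by ring
    have h3 : |b * b / 2| ≤ 1 / 8 * Z := by
      rw [abs_of_nonneg (by positivity)]
      calc b * b / 2 ≤ (r * X ^ 2 * Y / 2) * (r ^ 2 * X ^ 2 * Y ^ 2 / 2) / 2 := by gcongr
        _ = 1 / 8 * (r ^ 3 * X ^ 4 * Y ^ 3) := by ring
        _ ≤ _ := by gcongr; exact hZmono 4 3 (by norm_num) (by norm_num)
    have h4 : |a * b| ≤ 1 / 4 * Z := by
      rw [abs_mul, abs_of_nonneg hb0]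
      calc |a| * b ≤ (r * X * Y / 2) * (r ^ 2 * X ^ 2 * Y ^ 2 / 2) := by gcongr
        _ = 1 / 4 * (r ^ 3 * X ^ 3 * Y ^ 3) := by ring
        _ ≤ _ := by gcongr; exact hZmono 3 3 (by norm_num) (by norm_num)
    rw [e]
    calc _ ≤ |1 / 2 * ((√c * c ^ 2 - 1) * (a - b) ^ 2)| + (|b * b / 2| + |a * b|) :=
          (abs_add_le _ _).trans (by gcongr; exact abs_sub _ _)
      _ ≤ _ := by linarith
  -- The terms of order `r²` are `r²/2` from the prefactor, `-r²(x²+y²)/4` from `-b` and `r²x²y²/8`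
  -- from `a²/2`; their sum is `r²/8 (x²-2)(y²-2)`, so four remainders of order `r³` are left.
  have key : √c * Real.exp Q - (1 + r * y / 2 * x + r ^ 2 / 8 * (y ^ 2 - 2) * (x ^ 2 - 2)) =
      √c * (Real.exp Q - (1 + Q + Q ^ 2 / 2)) + (√c - 1 - r ^ 2 / 2) + (√c * Q - (a - b))
        + (√c * (Q ^ 2 / 2) - a ^ 2 / 2) := by
    rw [ha, hb]; ring
  rw [← hc, ← ha, ← hb, key, ← hX, ← hY]
  have hsum : |√c * (Real.exp Q - (1 + Q + Q ^ 2 / 2)) + (√c - 1 - r ^ 2 / 2)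
      + (√c * Q - (a - b)) + (√c * (Q ^ 2 / 2) - a ^ 2 / 2)| ≤
      3 * r ^ 3 * X ^ 6 * Y ^ 3 * Real.exp |Q| + Z + 3 * Z + 5 * Z :=
    (abs_add_le _ _).trans (add_le_add ((abs_add_three _ _ _).trans
      (add_le_add (add_le_add q1 q2) q3)) q4)
  refine hsum.trans ?_
  have e1 : 3 * r ^ 3 * X ^ 6 * Y ^ 3 * Real.exp |Q| = 3 * (Z * Real.exp |Q|) := by rw [hZ]; ring
  have e2 : Z ≤ Z * Real.exp |Q| := le_mul_of_one_le_right hZ0.le hexp1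
  have e3 : Z * Real.exp |Q| ≤ Z * (Real.exp 6 * Real.exp (x ^ 2 / 8)) := by gcongr
  have e4 : 0 ≤ Z * (Real.exp 6 * Real.exp (x ^ 2 / 8)) := by positivity
  calc _ ≤ 40 * (Z * (Real.exp 6 * Real.exp (x ^ 2 / 8))) := by linarith
    _ = _ := by rw [hZ]; ring

/-- Orthogonality to `h₀, h₁, h₂` allows the second-order expansion of the kernel in `r = e^{-t/2}`
to be subtracted for free, and the remainder is of order `r³`. The condition `t ≥ 2` makes `r ≤ 1/e
< 3/8`, the range of the expansion. -/
lemma exists_abs_semigroupL_le_of_orthogonal : ∃ C > 0, ∀ (g : ℝ → ℝ), Measurable g →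
    ∀ N : ℝ, (∀ y, |g y| ≤ N * (1 + |y|) ^ 3) → (∀ m < 3, ∫ y, g y * herm m y ∂wGauss = 0) →
    ∀ t ≥ 2, ∀ y, |semigroupL t g y| ≤ C * Real.exp (-t / 2) * N * (1 + |y|) ^ 3 := by
  set I := ∫ x, (1 + |x|) ^ 9 * Real.exp (x ^ 2 / 8) ∂wGauss with hI
  have hI0 : 0 ≤ I := integral_nonneg fun x => by positivity
  refine ⟨8 * gaussMom 3 + 40 * Real.exp 6 * I, ?_, ?_⟩
  · have := gaussMom_pos 3
    positivity
  intro g mg N hg horth t ht y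
  have hg3 := gaussMom_pos 3
  have hN := nonneg_of_abs_le_mul_pow (hg 0)
  have ht0 : 0 < t := by linarith
  obtain ⟨r, hr⟩ : ∃ r, r = Real.exp (-t / 2) := ⟨_, rfl⟩
  have hr0 : 0 < r := hr ▸ Real.exp_pos _
  have hr1 : r ≤ 3 / 8 := by
    have h1 : r ≤ Real.exp (-1) := hr ▸ Real.exp_le_exp.2 (by linarith)
    have := Real.exp_neg_one_lt_d9
    linarith
  -- The growth `e^t` of the constants times the order `r³` of the remainder is `e^{-t/2}`, the rate
  -- attached to `h₃`.
  have her : Real.exp t * r ^ 3 = r := by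
    rw [hr, ← Real.exp_nat_mul, ← Real.exp_add]; congr 1; push_cast; ring
  have het : Real.exp (-t) = r ^ 2 := by
    rw [hr, ← Real.exp_nat_mul]; congr 1; push_cast; ring
  rw [← hr]
  have hgP : PolyBdd g := PolyBdd.of_bound mg hg
  by_cases hy : r * |y| ≤ 1
  · have hD : 0 < 1 - r ^ 2 := by nlinarith
    have hk : ∀ x, mehler t y x = Real.exp t * (√(1 / (1 - r ^ 2)) *
        Real.exp (1 / (1 - r ^ 2) * (r * x * y / 2 - r ^ 2 * (x ^ 2 + y ^ 2) / 4))) *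
        gaussWeight x := fun x => by
      unfold mehler gaussWeight
      rw [het, ← hr]
      have e : Real.exp (-((y * r - x) ^ 2 / (4 * (1 - r ^ 2)))) =
          Real.exp (1 / (1 - r ^ 2) * (r * x * y / 2 - r ^ 2 * (x ^ 2 + y ^ 2) / 4)) *
            Real.exp (-(x ^ 2 / 4)) := by
        rw [← Real.exp_add]
        congr 1
        have := hD.ne'
        field_simp
        ring
      rw [e, Real.sqrt_mul (by positivity), Real.sqrt_div (by norm_num), Real.sqrt_one]
      ring
    set T : ℝ → ℝ := fun x => 1 + r * y / 2 * x + r ^ 2 / 8 * (y ^ 2 - 2) * (x ^ 2 - 2) with hT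
    have hTint : ∫ x, g x * T x ∂wGauss = 0 := by
      have h0 := horth 0 (by norm_num)
      have h1 := horth 1 (by norm_num)
      have h2 := horth 2 (by norm_num)
      have i0 := (hgP.mul (polyBdd_herm (m := 0) (by norm_num))).integrable_wGauss
      have i1 := (hgP.mul (polyBdd_herm (m := 1) (by norm_num))).integrable_wGauss
      have i2 := (hgP.mul (polyBdd_herm (m := 2) (by norm_num))).integrable_wGauss
      have e : ∀ x, g x * T x = g x * herm 0 x + r * y / 2 * (g x * herm 1 x)
          + r ^ 2 / 8 * (y ^ 2 - 2) * (g x * herm 2 x) := fun x => by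
        rw [hT, herm_zero, herm_one, herm_two]; ring
      simp_rw [e]
      rw [integral_add (by exact i0.add (i1.const_mul _)) (i2.const_mul _),
        integral_add i0 (i1.const_mul _),
        integral_const_mul, integral_const_mul, h0, h1, h2]
      ring
    set E : ℝ → ℝ := fun x => √(1 / (1 - r ^ 2)) *
        Real.exp (1 / (1 - r ^ 2) * (r * x * y / 2 - r ^ 2 * (x ^ 2 + y ^ 2) / 4)) with hE
    have hbound : ∀ x, ‖(E x - T x) * g x‖ ≤ 40 * Real.exp 6 * r ^ 3 * (1 + |y|) ^ 3 * N *
        ((1 + |x|) ^ 9 * Real.exp (x ^ 2 / 8)) := fun x => by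
      rw [norm_mul, Real.norm_eq_abs, Real.norm_eq_abs]
      calc _ ≤ (40 * Real.exp 6 * r ^ 3 * (1 + |y|) ^ 3 * ((1 + |x|) ^ 6 * Real.exp (x ^ 2 / 8)))
            * (N * (1 + |x|) ^ 3) :=
            mul_le_mul (abs_mehler_expansion_le hr0 hr1 hy) (hg x) (abs_nonneg _) (by positivity)
        _ = _ := by ring
    have hi := (integrable_exp_sq_wGauss 9).const_mul (40 * Real.exp 6 * r ^ 3 * (1 + |y|) ^ 3 * N)
    have hdiff : Integrable (fun x => (E x - T x) * g x) wGauss := by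
      refine hi.mono' ?_ (Filter.Eventually.of_forall hbound)
      have : Measurable fun x => (E x - T x) * g x := by
        simp only [hE, hT]; fun_prop
      exact this.aestronglyMeasurable
    have hTg : Integrable (fun x => g x * T x) wGauss := by
      have : PolyBdd T := ((PolyBdd.const 1).add (PolyBdd.id.const_mul (r * y / 2))).add
        (((PolyBdd.id.pow 2).sub (PolyBdd.const 2)).const_mul (r ^ 2 / 8 * (y ^ 2 - 2)))
      exact (hgP.mul this).integrable_wGauss
    have e : semigroupL t g y = Real.exp t * ∫ x, (E x - T x) * g x ∂wGauss := by
      rw [semigroupL, if_pos ht0]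
      have h1 : ∫ x, E x * g x ∂wGauss = ∫ x, (E x - T x) * g x ∂wGauss := by
        have := integral_add hdiff hTg
        rw [hTint, add_zero] at this
        rw [← this]
        congr 1
        ext x
        ring
      rw [← h1, ← integral_mul_gaussWeight, ← integral_const_mul]
      congr 1
      ext x
      rw [hk x, hE]
      ring
    rw [e, abs_mul, abs_of_pos (Real.exp_pos _)]
    have h2 : |∫ x, (E x - T x) * g x ∂wGauss| ≤
        40 * Real.exp 6 * r ^ 3 * (1 + |y|) ^ 3 * N * I := by
      rw [← Real.norm_eq_abs, hI, ← integral_const_mul]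
      exact norm_integral_le_of_norm_le hi (Filter.Eventually.of_forall hbound)
    calc _ ≤ Real.exp t * (40 * Real.exp 6 * r ^ 3 * (1 + |y|) ^ 3 * N * I) := by gcongr
      _ = 40 * Real.exp 6 * I * (Real.exp t * r ^ 3) * N * (1 + |y|) ^ 3 := by ring
      _ ≤ _ := by
          rw [her]
          gcongr
          linarith
  -- Beyond `|y| = 1/r` no cancellation is needed: `1 + |flow|` is at most `2r|y|(1+2|z|)`, and the
  -- cube already contains `r³`.
  · push Not at hy
    rw [semigroupL_eq ht0.le mg, abs_mul, abs_of_pos (Real.exp_pos _)]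
    have h1 : |∫ z, g (ouFlow t y z) ∂stdGauss| ≤ N * (2 * (r * |y|)) ^ 3 * gaussMom 3 := by
      rw [← Real.norm_eq_abs, gaussMom, ← integral_const_mul]
      refine norm_integral_le_of_norm_le ((integrable_one_add_two_mul_abs_pow 3).const_mul _)
        (Filter.Eventually.of_forall fun z => (hg _).trans ?_)
      rw [mul_assoc, ← mul_pow]
      have h3 : |ouFlow t y z| ≤ r * |y| + 2 * |z| := by
        refine (abs_add_le _ _).trans ?_
        rw [abs_mul, abs_mul, abs_of_pos (Real.exp_pos _), abs_of_nonneg (Real.sqrt_nonneg _), ← hr]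
        gcongr
        exact sqrt_two_mul_one_sub_exp_le t
      gcongr
      nlinarith [abs_nonneg z]
    calc _ ≤ Real.exp t * (N * (2 * (r * |y|)) ^ 3 * gaussMom 3) := by gcongr
      _ = 8 * gaussMom 3 * (Real.exp t * r ^ 3) * N * |y| ^ 3 := by ring
      _ ≤ _ := by
          rw [her]
          have h4 : 0 ≤ 40 * Real.exp 6 * I := by positivity
          gcongr <;> linarith

/-! ### Taylor estimates for real powers -/

lemma rpow_le_add_of_mem_Icc {lo hi x : ℝ} (hlo : 0 < lo) (hx : x ∈ Icc lo hi) (b : ℝ) :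
    x ^ b ≤ lo ^ b + hi ^ b := by
  have hx0 : 0 < x := hlo.trans_le hx.1
  have hhi : 0 < hi := hx0.trans_le hx.2
  rcases le_total 0 b with hb | hb
  · have := Real.rpow_le_rpow hx0.le hx.2 hb
    have := Real.rpow_pos_of_pos hlo b
    linarith
  · have := Real.rpow_le_rpow_of_nonpos hlo hx.1 hb
    have := Real.rpow_pos_of_pos hhi b
    linarith

lemma exists_abs_rpow_sub_le (a : ℝ) {lo hi : ℝ} (hlo : 0 < lo) (hhi : 0 < hi) :
    ∃ C > 0, ∀ x ∈ Icc lo hi, ∀ x' ∈ Icc lo hi, |x ^ a - x' ^ a| ≤ C * |x - x'| := by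
  -- The sum of the two endpoint powers bounds the derivative whatever the sign of `a - 1`; the
  -- added `1` keeps the constant positive when `a = 0`.
  refine ⟨|a| * (lo ^ (a - 1) + hi ^ (a - 1)) + 1, by positivity, fun x hx x' hx' => ?_⟩
  have h := (convex_Icc lo hi).norm_image_sub_le_of_norm_hasDerivWithin_le
    (f := fun t : ℝ => t ^ a) (f' := fun t => a * t ^ (a - 1))
    (C := |a| * (lo ^ (a - 1) + hi ^ (a - 1)))
    (fun z hz => (Real.hasDerivAt_rpow_const (Or.inl (hlo.trans_le hz.1).ne')).hasDerivWithinAt)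
    (fun z hz => by
      rw [Real.norm_eq_abs, abs_mul, abs_of_pos (Real.rpow_pos_of_pos (hlo.trans_le hz.1) _)]
      gcongr
      exact rpow_le_add_of_mem_Icc hlo hz _) hx' hx
  refine h.trans ?_
  rw [Real.norm_eq_abs]
  nlinarith [abs_nonneg (x - x')]

lemma exists_abs_rpow_taylor_le (a : ℝ) {lo hi : ℝ} (hlo : 0 < lo) (hhi : 0 < hi) :
    ∃ C > 0, ∀ x ∈ Icc lo hi, ∀ x' ∈ Icc lo hi,
      |x' ^ a - x ^ a - a * x ^ (a - 1) * (x' - x)| ≤ C * (x' - x) ^ 2 := by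
  obtain ⟨C, hC, h⟩ := exists_abs_rpow_sub_le (a - 1) hlo hhi
  refine ⟨|a| * C + 1, by positivity, fun x hx x' hx' => ?_⟩
  have hsub : uIcc x x' ⊆ Icc lo hi := uIcc_subset_Icc hx hx'
  have h1 := (convex_uIcc x x').norm_image_sub_le_of_norm_hasDerivWithin_le
    (f := fun t : ℝ => t ^ a - a * x ^ (a - 1) * t) (f' := fun t => a * t ^ (a - 1) - a * x ^ (a - 1))
    (C := |a| * C * |x' - x|)
    (fun z hz => by
      have := (Real.hasDerivAt_rpow_const (p := a)
        (Or.inl (hlo.trans_le (hsub hz).1).ne')).fun_sub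
        ((hasDerivAt_id z).const_mul (a * x ^ (a - 1)))
      simpa using this.hasDerivWithinAt)
    (fun z hz => by
      rw [Real.norm_eq_abs, ← mul_sub, abs_mul, mul_assoc]
      gcongr
      exact (h z (hsub hz) x hx).trans
        (mul_le_mul_of_nonneg_left (abs_sub_left_of_mem_uIcc hz) hC.le)) left_mem_uIcc right_mem_uIcc
  have e : x' ^ a - x ^ a - a * x ^ (a - 1) * (x' - x) =
    x' ^ a - a * x ^ (a - 1) * x' - (x ^ a - a * x ^ (a - 1) * x) := by ring
  rw [e]
  refine h1.trans ?_
  rw [Real.norm_eq_abs, mul_assoc, abs_mul_abs_self]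
  nlinarith [sq_nonneg (x' - x)]

/-! ### The profile -/

/-- `X(z) = 1 + (p-1)/(4p) z²`. -/
noncomputable def profX (p z : ℝ) : ℝ := 1 + (p - 1) / (4 * p) * z ^ 2

lemma one_le_profX {p : ℝ} (hp : 1 < p) (z : ℝ) : 1 ≤ profX p z := by
  have : 0 ≤ (p - 1) / (4 * p) * z ^ 2 := by
    have : 0 < p - 1 := by linarith
    positivity
  unfold profX; linarith

lemma profX_pos {p : ℝ} (hp : 1 < p) (z : ℝ) : 0 < profX p z :=
  one_pos.trans_le (one_le_profX hp z)

lemma kappa_pos {p : ℝ} (hp : 1 < p) : 0 < kappa p := Real.rpow_pos_of_pos (by linarith) _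

lemma kappa_rpow {p : ℝ} (hp : 1 < p) : kappa p ^ (p - 1) = 1 / (p - 1) := by
  have h : 0 < p - 1 := by linarith
  rw [kappa, ← Real.rpow_mul h.le, show -(1 / (p - 1)) * (p - 1) = -1 by field_simp,
    Real.rpow_neg_one, one_div]

lemma profile_eq {p : ℝ} (hp : 1 < p) (z : ℝ) :
    profile p z = kappa p * profX p z ^ (-(1 / (p - 1))) := by
  have h : 0 < p - 1 := by linarith
  rw [kappa, ← Real.mul_rpow h.le (profX_pos hp z).le, profile, profX]
  congr 1
  field_simp

lemma profile_pos {p : ℝ} (hp : 1 < p) (z : ℝ) : 0 < profile p z := by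
  rw [profile_eq hp]
  exact mul_pos (kappa_pos hp) (Real.rpow_pos_of_pos (profX_pos hp z) _)

lemma profile_le_kappa {p : ℝ} (hp : 1 < p) (z : ℝ) : profile p z ≤ kappa p := by
  rw [profile_eq hp]
  have h : 0 < p - 1 := by linarith
  exact mul_le_of_le_one_right (kappa_pos hp).le
    (Real.rpow_le_one_of_one_le_of_nonpos (one_le_profX hp z) (by
      rw [neg_nonpos]; positivity))

lemma profile_antitone {p : ℝ} (hp : 1 < p) {z z' : ℝ} (h : |z| ≤ |z'|) :
    profile p z' ≤ profile p z := by
  rw [profile_eq hp, profile_eq hp]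
  have h0 : 0 < p - 1 := by linarith
  refine mul_le_mul_of_nonneg_left (Real.rpow_le_rpow_of_nonpos (profX_pos hp z) ?_ (by
      rw [neg_nonpos]; positivity)) (kappa_pos hp).le
  unfold profX
  have := sq_le_sq.2 h
  gcongr

lemma profile_rpow {p : ℝ} (hp : 1 < p) (z : ℝ) :
    profile p z ^ (p - 1) = 1 / (p - 1) * (profX p z)⁻¹ := by
  have h : 0 < p - 1 := by linarith
  rw [profile_eq hp, Real.mul_rpow (kappa_pos hp).le (Real.rpow_nonneg (profX_pos hp z).le _),
    kappa_rpow hp, ← Real.rpow_mul (profX_pos hp z).le,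
    show -(1 / (p - 1)) * (p - 1) = -1 by field_simp, Real.rpow_neg_one]

lemma profile_zero {p : ℝ} : profile p 0 = kappa p := by
  simp [profile, kappa]

lemma hasDerivAt_profX (p z : ℝ) : HasDerivAt (profX p) ((p - 1) / (2 * p) * z) z := by
  unfold profX
  have := (((hasDerivAt_id z).pow 2).const_mul ((p - 1) / (4 * p))).const_add 1
  refine this.congr_deriv ?_
  simp only [id, mul_one, Nat.cast_ofNat]
  ring

/-- The derivative of the profile, as `-(1/(2p)) z f(z)/X(z)`. -/
lemma hasDerivAt_profile {p : ℝ} (hp : 1 < p) (z : ℝ) :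
    HasDerivAt (profile p) (-(1 / (2 * p)) * z * profile p z / profX p z) z := by
  have h : 0 < p - 1 := by linarith
  have h1 : profile p = fun z => kappa p * profX p z ^ (-(1 / (p - 1))) :=
    funext fun z => profile_eq hp z
  rw [h1]
  have hX := profX_pos hp z
  have := ((hasDerivAt_profX p z).rpow_const (p := -(1 / (p - 1)))
    (Or.inl hX.ne')).const_mul (kappa p)
  refine this.congr_deriv ?_
  rw [Real.rpow_sub hX, Real.rpow_one]
  field_simp

lemma continuous_profile {p : ℝ} (hp : 1 < p) : Continuous (profile p) :=
  continuous_iff_continuousAt.2 fun z => (hasDerivAt_profile hp z).continuousAt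

lemma abs_div_profX_le {p : ℝ} (hp : 1 < p) : ∃ C > 0, ∀ z, |z| / profX p z ≤ C := by
  have h : 0 < p - 1 := by linarith
  refine ⟨1 + 4 * p / (p - 1), by positivity, fun z => ?_⟩
  rw [div_le_iff₀ (profX_pos hp z), profX]
  have e : (1 + 4 * p / (p - 1)) * (1 + (p - 1) / (4 * p) * z ^ 2) =
      1 + 4 * p / (p - 1) + (p - 1) / (4 * p) * z ^ 2 + z ^ 2 := by
    field_simp
    ring
  rw [e]
  have h1 : 0 ≤ 4 * p / (p - 1) := by positivity
  have h2 : 0 ≤ (p - 1) / (4 * p) * z ^ 2 := by positivity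
  nlinarith [sq_abs z, sq_nonneg (|z| - 1)]

lemma abs_profile_sub_kappa_le {p : ℝ} (hp : 1 < p) :
    ∃ C > 0, ∀ z, |z| ≤ 1 → |profile p z - kappa p| ≤ C * z ^ 2 := by
  have h : 0 < p - 1 := by linarith
  obtain ⟨C, hC, hb⟩ := exists_abs_rpow_sub_le (-(1 / (p - 1))) (lo := 1)
    (hi := 1 + (p - 1) / (4 * p)) one_pos (by positivity)
  have hk := kappa_pos hp
  refine ⟨kappa p * (C * ((p - 1) / (4 * p))), by positivity, fun z hz => ?_⟩
  have hz2 : z ^ 2 ≤ 1 := by rw [← sq_abs]; exact pow_le_one₀ (abs_nonneg z) hz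
  have h0 : 0 < (p - 1) / (4 * p) := by positivity
  have := hb (profX p z) ⟨one_le_profX hp z, by unfold profX; nlinarith⟩ 1 ⟨le_rfl, by linarith⟩
  rw [Real.one_rpow] at this
  have e : profX p z - 1 = (p - 1) / (4 * p) * z ^ 2 := by unfold profX; ring
  rw [e, abs_of_nonneg (a := (p - 1) / (4 * p) * z ^ 2) (by positivity)] at this
  rw [profile_eq hp, show kappa p * profX p z ^ (-(1 / (p - 1))) - kappa p =
    kappa p * (profX p z ^ (-(1 / (p - 1))) - 1) by ring, abs_mul, abs_of_pos hk]
  calc _ ≤ kappa p * (C * ((p - 1) / (4 * p) * z ^ 2)) := by gcongr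
    _ = _ := by ring

/-! ### The function `φ` and the potential -/

lemma phiShift_pos {p s : ℝ} (hp : 1 < p) (hs : 0 < s) : 0 < kappa p / (2 * p * s) := by
  have := kappa_pos hp
  positivity

lemma phiShift_le {p s : ℝ} (hp : 1 < p) (hs : 0 < s) : kappa p / (2 * p * s) ≤ kappa p / s := by
  have := kappa_pos hp
  gcongr
  nlinarith

lemma phi_pos {p s : ℝ} (hp : 1 < p) (hs : 0 < s) (y : ℝ) : 0 < phi p s y :=
  add_pos (profile_pos hp _) (phiShift_pos hp hs)

lemma phi_le {p s : ℝ} (hp : 1 < p) (hs : 1 ≤ s) (y : ℝ) : phi p s y ≤ 2 * kappa p := by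
  have h1 := profile_le_kappa hp (y / √s)
  have h2 := phiShift_le hp (one_pos.trans_le hs)
  have h3 : kappa p / s ≤ kappa p := div_le_self (kappa_pos hp).le hs
  unfold phi; linarith

/-- Bounds for the potential, for times `s ≥ 1`. -/
structure PotBounds (p C : ℝ) : Prop where
  one_le : 1 ≤ C
  bdd : ∀ s ≥ 1, ∀ y, |potV p s y| ≤ C
  upper : ∀ s ≥ 1, ∀ y, potV p s y ≤ C / s
  quad : ∀ s ≥ 1, ∀ y, |potV p s y| ≤ C * ((1 + |y|) ^ 2 / s)
  lin : ∀ s ≥ 1, ∀ y, |potV p s y| ≤ C * ((1 + |y|) / √s)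
  expansion : ∀ s ≥ 1, ∀ y, |potV p s y + (y ^ 2 - 2) / (4 * s)| ≤ C * ((1 + |y|) ^ 4 / s ^ 2)
  expansion' : ∀ s ≥ 1, ∀ y, |potV p s y + (y ^ 2 - 2) / (4 * s)| ≤ C * ((1 + |y|) / √s) ^ 3
  lipschitz : ∀ s ≥ 1, ∀ y y', |potV p s y - potV p s y'| ≤ C / √s * |y - y'|

lemma exists_potV_bdd {p : ℝ} (hp : 1 < p) : ∃ C > 0, ∀ s ≥ 1, ∀ y, |potV p s y| ≤ C := by
  have h : 0 < p - 1 := by linarith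
  have hk := kappa_pos hp
  refine ⟨p * (2 * kappa p) ^ (p - 1) + p / (p - 1), by positivity, fun s hs y => ?_⟩
  have hφ := phi_pos hp (one_pos.trans_le hs) y
  have h1 := Real.rpow_le_rpow hφ.le (phi_le hp hs y) h.le
  have h2 : 0 ≤ phi p s y ^ (p - 1) := Real.rpow_nonneg hφ.le _
  have h3 : 0 ≤ p / (p - 1) := by positivity
  have h4 : p * phi p s y ^ (p - 1) ≤ p * (2 * kappa p) ^ (p - 1) := by gcongr
  have h5 : 0 ≤ p * phi p s y ^ (p - 1) := by positivity
  unfold potV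
  rw [abs_le]
  constructor <;> linarith

/-- At the value `κ` the potential vanishes exactly, since `pκ^{p-1} = p/(p-1)`, and `φ` exceeds `κ`
by at most the shift `κ/(2ps)`. No such smallness holds from below. -/
lemma exists_potV_upper {p : ℝ} (hp : 1 < p) : ∃ C > 0, ∀ s ≥ 1, ∀ y, potV p s y ≤ C / s := by
  have h : 0 < p - 1 := by linarith
  have hk := kappa_pos hp
  obtain ⟨C, hC, hb⟩ := exists_abs_rpow_sub_le (p - 1) hk (by positivity : 0 < 2 * kappa p)
  refine ⟨p * (C * kappa p), by positivity, fun s hs y => ?_⟩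
  have hs0 := one_pos.trans_le hs
  have hd := phiShift_pos hp hs0
  have hd1 := phiShift_le hp hs0
  have h3 : kappa p / s ≤ kappa p := div_le_self hk.le hs
  have h1 : phi p s y ^ (p - 1) ≤ (kappa p + kappa p / (2 * p * s)) ^ (p - 1) := by
    refine Real.rpow_le_rpow (phi_pos hp hs0 y).le ?_ h.le
    unfold phi
    gcongr
    exact profile_le_kappa hp _
  have h2 := (abs_le.1 (hb (kappa p + kappa p / (2 * p * s)) ⟨by linarith, by linarith⟩
    (kappa p) ⟨le_rfl, by linarith⟩)).2
  rw [add_sub_cancel_left, abs_of_pos hd, kappa_rpow hp] at h2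
  have h4 : C * (kappa p / (2 * p * s)) ≤ C * (kappa p / s) := by gcongr
  unfold potV
  have h5 : p * phi p s y ^ (p - 1) ≤ p * (1 / (p - 1) + C * (kappa p / s)) := by
    gcongr
    linarith
  calc _ ≤ p * (1 / (p - 1) + C * (kappa p / s)) - p / (p - 1) := by linarith
    _ = _ := by ring

/-- For `|y| ≤ √s` the function `φ^{p-1}` is expanded around `f^{p-1} = 1/((p-1)X)`, where `X` is
`profX`: the profile contributes `-z²/4` with `z = y/√s`, the shift contributes `1/(2s)`, and
together they are `-h₂/(4s)`. -/
lemma exists_potV_expansion {p : ℝ} (hp : 1 < p) : ∃ C > 0, ∀ s ≥ 1, ∀ y,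
    |potV p s y + (y ^ 2 - 2) / (4 * s)| ≤ C * ((1 + |y|) ^ 4 / s ^ 2) := by
  have h : 0 < p - 1 := by linarith
  have hk := kappa_pos hp
  have hlo := profile_pos hp 1
  obtain ⟨C0, hC0, hV⟩ := exists_potV_bdd hp
  obtain ⟨C1, hC1, hT2⟩ := exists_abs_rpow_taylor_le (p - 1) hlo (by positivity : 0 < 2 * kappa p)
  obtain ⟨C2, hC2, hT1⟩ := exists_abs_rpow_sub_le (p - 2) hlo (by positivity : 0 < 2 * kappa p)
  obtain ⟨C3, hC3, hf⟩ := abs_profile_sub_kappa_le hp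
  refine ⟨C0 + 1 + (p * C1 * kappa p ^ 2 + p * (p - 1) * C2 * C3 * kappa p + 1), by positivity,
    fun s hs y => ?_⟩
  have hs0 := one_pos.trans_le hs
  have hss : 0 < √s := Real.sqrt_pos.2 hs0
  have hsq : √s ^ 2 = s := Real.sq_sqrt hs0.le
  have hu : 0 ≤ (1 + |y|) ^ 4 / s ^ 2 := by positivity
  have hy0 := abs_nonneg y
  by_cases hy : |y| ≤ √s
  · set z := y / √s with hz
    set d := kappa p / (2 * p * s) with hd
    have hd0 : 0 < d := phiShift_pos hp hs0
    have hd1 : d ≤ kappa p / s := phiShift_le hp hs0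
    have hz1 : |z| ≤ 1 := by
      rw [hz, abs_div, abs_of_pos hss, div_le_one hss]; exact hy
    have hz2 : z ^ 2 = y ^ 2 / s := by rw [hz, div_pow, hsq]
    have hfm : profile p z ∈ Icc (profile p 1) (2 * kappa p) :=
      ⟨profile_antitone hp (by simpa using hz1), by linarith [profile_le_kappa hp z]⟩
    have hφ : phi p s y = profile p z + d := rfl
    have hφm : profile p z + d ∈ Icc (profile p 1) (2 * kappa p) :=
      ⟨by linarith [hfm.1], hφ ▸ phi_le hp hs y⟩
    have hkm : kappa p ∈ Icc (profile p 1) (2 * kappa p) :=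
      ⟨profile_le_kappa hp 1, by linarith⟩
    have a1 := hT2 _ hfm _ hφm
    rw [add_sub_cancel_left, show p - 1 - 1 = p - 2 by ring] at a1
    have a2 := (hT1 _ hfm _ hkm).trans (mul_le_mul_of_nonneg_left (hf z hz1) hC2.le)
    have hX := profX_pos hp z
    have hX1 := one_le_profX hp z
    -- The shift in `φ` is normalized so that its linear effect on the potential is exactly the
    -- constant term of `-h₂/(4s)`.
    have hκd : p * (p - 1) * kappa p ^ (p - 2) * d = 1 / (2 * s) := by
      have e : kappa p ^ (p - 2) * kappa p = 1 / (p - 1) := by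
        rw [← kappa_rpow hp, ← Real.rpow_add_one hk.ne']; congr 1; ring
      rw [hd]
      calc _ = (p - 1) * (kappa p ^ (p - 2) * kappa p) / (2 * s) := by field_simp
        _ = _ := by rw [e]; field_simp
    have hXinv : p / (p - 1) * (profX p z)⁻¹ - p / (p - 1) + z ^ 2 / 4 =
        (p - 1) / (16 * p) * z ^ 4 * (profX p z)⁻¹ := by
      have hX' : profX p z ≠ 0 := hX.ne'
      field_simp
      unfold profX
      field_simp
      ring
    have key : potV p s y + (y ^ 2 - 2) / (4 * s) =
        p * ((profile p z + d) ^ (p - 1) - profile p z ^ (p - 1)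
          - (p - 1) * profile p z ^ (p - 2) * d)
        + p * (p - 1) * d * (profile p z ^ (p - 2) - kappa p ^ (p - 2))
        + (p - 1) / (16 * p) * z ^ 4 * (profX p z)⁻¹ := by
      rw [← hXinv, potV, hφ, profile_rpow hp, hz2]
      have : (y ^ 2 - 2) / (4 * s) = y ^ 2 / s / 4 - 1 / (2 * s) := by field_simp; ring
      rw [this, ← hκd]
      ring
    have b1 : |p * ((profile p z + d) ^ (p - 1) - profile p z ^ (p - 1)
          - (p - 1) * profile p z ^ (p - 2) * d)| ≤ p * C1 * kappa p ^ 2 * ((1 + |y|) ^ 4 / s ^ 2) := by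
      rw [abs_mul, abs_of_pos (by linarith : 0 < p)]
      calc _ ≤ p * (C1 * (kappa p / s) ^ 2) := by
            gcongr
            refine a1.trans ?_
            gcongr
        _ = p * C1 * kappa p ^ 2 * (1 / s ^ 2) := by field_simp
        _ ≤ _ := by
            gcongr
            exact one_le_one_add_abs_pow y 4
    have b2 : |p * (p - 1) * d * (profile p z ^ (p - 2) - kappa p ^ (p - 2))| ≤
        p * (p - 1) * C2 * C3 * kappa p * ((1 + |y|) ^ 4 / s ^ 2) := by
      rw [abs_mul, abs_of_pos (by positivity)]
      calc _ ≤ p * (p - 1) * (kappa p / s) * (C2 * (C3 * z ^ 2)) := by gcongr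
        _ = p * (p - 1) * C2 * C3 * kappa p * (|y| ^ 2 / s ^ 2) := by
            rw [hz2, sq_abs]; field_simp
        _ ≤ p * (p - 1) * C2 * C3 * kappa p * ((1 + |y|) ^ 2 / s ^ 2) := by gcongr; linarith
        _ ≤ _ := by
            have := one_add_abs_pow_mono y (show 2 ≤ 4 by norm_num)
            gcongr
    have b3 : |(p - 1) / (16 * p) * z ^ 4 * (profX p z)⁻¹| ≤ 1 * ((1 + |y|) ^ 4 / s ^ 2) := by
      have e4 : z ^ 4 = |y| ^ 4 / s ^ 2 := by
        rw [show z ^ 4 = (z ^ 2) ^ 2 by ring, hz2, div_pow, ← sq_abs y]; ring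
      rw [abs_of_nonneg (by positivity), e4]
      have hXi : (profX p z)⁻¹ ≤ 1 := inv_le_one_of_one_le₀ hX1
      have hc : (p - 1) / (16 * p) ≤ 1 := by rw [div_le_one (by positivity)]; linarith
      calc _ ≤ 1 * (|y| ^ 4 / s ^ 2) * 1 := by gcongr
        _ ≤ 1 * ((1 + |y|) ^ 4 / s ^ 2) * 1 := by gcongr; linarith
        _ = _ := by ring
    rw [key]
    refine (abs_add_three _ _ _).trans ?_
    have : 0 ≤ (C0 + 1) * ((1 + |y|) ^ 4 / s ^ 2) := by positivity
    linarith
  -- Beyond `√s` the claimed error exceeds a constant multiple of both terms, so no expansion is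
  -- needed.
  · push Not at hy
    have h1 : 1 ≤ (1 + |y|) ^ 2 / s := by
      rw [le_div_iff₀ hs0, one_mul]
      calc s = √s ^ 2 := hsq.symm
        _ ≤ (1 + |y|) ^ 2 := by gcongr; linarith
    have e : (1 + |y|) ^ 4 / s ^ 2 = ((1 + |y|) ^ 2 / s) ^ 2 := by rw [div_pow]; ring
    have h2 : 1 ≤ (1 + |y|) ^ 4 / s ^ 2 := by rw [e]; exact one_le_pow₀ h1
    have h3 : (1 + |y|) ^ 2 / s ≤ (1 + |y|) ^ 4 / s ^ 2 := by rw [e]; exact le_self_pow₀ h1 two_ne_zero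
    have h4 : |(y ^ 2 - 2) / (4 * s)| ≤ (1 + |y|) ^ 2 / s := by
      rw [abs_div, abs_of_pos (by positivity : 0 < 4 * s), div_le_div_iff₀ (by positivity) hs0]
      have : |y ^ 2 - 2| ≤ 4 * (1 + |y|) ^ 2 := by
        rw [abs_le]; constructor <;> nlinarith [sq_abs y]
      nlinarith
    refine (abs_add_le _ _).trans ((add_le_add (hV s hs y) (h4.trans h3)).trans ?_)
    have h5 : 0 ≤ (p * C1 * kappa p ^ 2 + p * (p - 1) * C2 * C3 * kappa p + 1) *
      ((1 + |y|) ^ 4 / s ^ 2) := by positivity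
    nlinarith

/-- The potential is a function of `y/√s` with bounded derivative, so each derivative in `y` gains
`1/√s`. -/
lemma exists_potV_lipschitz {p : ℝ} (hp : 1 < p) : ∃ C > 0, ∀ s ≥ 1, ∀ y y',
    |potV p s y - potV p s y'| ≤ C / √s * |y - y'| := by
  have h : 0 < p - 1 := by linarith
  have hk := kappa_pos hp
  obtain ⟨C, hC, hX⟩ := abs_div_profX_le hp
  refine ⟨(p - 1) * (2 * kappa p) ^ (p - 1) * C, by positivity, fun s hs y y' => ?_⟩
  have hs0 := one_pos.trans_le hs
  have hss : 0 < √s := Real.sqrt_pos.2 hs0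
  have hd : ∀ x, HasDerivAt (potV p s) (p * ((-(1 / (2 * p)) * (x / √s) * profile p (x / √s) /
      profX p (x / √s) * (1 / √s)) * (p - 1) * phi p s x ^ (p - 1 - 1))) x := fun x => by
    have h1 : HasDerivAt (phi p s) (-(1 / (2 * p)) * (x / √s) * profile p (x / √s) /
        profX p (x / √s) * (1 / √s)) x :=
      ((hasDerivAt_profile hp (x / √s)).comp x ((hasDerivAt_id x).div_const (√s))).add_const _
    exact ((h1.rpow_const (Or.inl (phi_pos hp hs0 x).ne')).const_mul p).sub_const _
  have hb := convex_univ.norm_image_sub_le_of_norm_hasDerivWithin_le (f := potV p s)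
    (C := (p - 1) * (2 * kappa p) ^ (p - 1) * C / √s)
    (fun x _ => (hd x).hasDerivWithinAt) (fun x _ => ?_) (mem_univ y') (mem_univ y)
  · simpa [Real.norm_eq_abs] using hb
  · have hφ := phi_pos hp hs0 x
    have hf := profile_pos hp (x / √s)
    have hXp := profX_pos hp (x / √s)
    have e : p * ((-(1 / (2 * p)) * (x / √s) * profile p (x / √s) /
      profX p (x / √s) * (1 / √s)) * (p - 1) * phi p s x ^ (p - 1 - 1)) =
      -((p - 1) / 2 * ((x / √s) / profX p (x / √s)) *
        (profile p (x / √s) * phi p s x ^ (p - 1 - 1)) / √s) := by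
      field_simp
    rw [e, Real.norm_eq_abs, abs_neg, abs_div, abs_mul, abs_mul, abs_of_pos hss,
      abs_of_pos (by positivity : 0 < (p - 1) / 2), abs_div (x / √s), abs_of_pos hXp,
      abs_of_pos (mul_pos hf (Real.rpow_pos_of_pos hφ _))]
    -- The exponent `p - 2` may be negative while `φ` is small far away; the factor `f ≤ φ` coming
    -- from `f'` raises it to `p - 1`.
    have h2 : profile p (x / √s) * phi p s x ^ (p - 1 - 1) ≤ (2 * kappa p) ^ (p - 1) := by
      have h3 : profile p (x / √s) ≤ phi p s x := by
        have := phiShift_pos hp hs0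
        unfold phi; linarith
      calc _ ≤ phi p s x * phi p s x ^ (p - 1 - 1) := by gcongr
        _ = phi p s x ^ (p - 1) := by
            rw [Real.rpow_sub_one hφ.ne']; field_simp
        _ ≤ _ := Real.rpow_le_rpow hφ.le (phi_le hp hs x) h.le
    calc _ ≤ (p - 1) / 2 * C * (2 * kappa p) ^ (p - 1) / √s := by
          have := hX (x / √s)
          gcongr
      _ ≤ (p - 1) * (2 * kappa p) ^ (p - 1) * C / √s := by
          refine div_le_div_of_nonneg_right ?_ hss.le
          have : 0 < (p - 1) * (2 * kappa p) ^ (p - 1) * C := by positivity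
          linarith

/-- A quantity bounded by two powers of `u` is bounded by every intermediate power: use the higher
one for `u ≤ 1` and the lower one for `u ≥ 1`. With `u = (1+|y|)/√s` it trades weights for decay in
`s`. -/
lemma min_one_interp {u x C : ℝ} (hu : 0 ≤ u) (hC : 0 ≤ C) {i j k : ℕ} (hij : i ≤ j) (hjk : j ≤ k)
    (h1 : x ≤ C * u ^ i) (h2 : x ≤ C * u ^ k) : x ≤ C * u ^ j := by
  rcases le_total u 1 with h | h
  · exact h2.trans (mul_le_mul_of_nonneg_left (pow_le_pow_of_le_one hu h hjk) hC)
  · exact h1.trans (mul_le_mul_of_nonneg_left (pow_le_pow_right₀ h hij) hC)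

lemma exists_potBounds {p : ℝ} (hp : 1 < p) : ∃ C, PotBounds p C := by
  obtain ⟨C1, hC1, h1⟩ := exists_potV_bdd hp
  obtain ⟨C2, hC2, h2⟩ := exists_potV_upper hp
  obtain ⟨C3, hC3, h3⟩ := exists_potV_expansion hp
  obtain ⟨C4, hC4, h4⟩ := exists_potV_lipschitz hp
  set C := 2 + C1 + C2 + C3 + C4 with hC
  have hC0 : 0 ≤ C := by positivity
  have hu : ∀ s : ℝ, s ≥ 1 → ∀ y : ℝ, (1 + |y|) ^ 2 / s = ((1 + |y|) / √s) ^ 2 ∧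
      (1 + |y|) ^ 4 / s ^ 2 = ((1 + |y|) / √s) ^ 4 := fun s hs y => by
    have hsq : √s ^ 2 = s := Real.sq_sqrt (by linarith)
    rw [div_pow, div_pow, show √s ^ 4 = (√s ^ 2) ^ 2 by ring, hsq]
    exact ⟨rfl, rfl⟩
  have hb : ∀ s ≥ 1, ∀ y, |potV p s y| ≤ C * ((1 + |y|) / √s) ^ 0 := fun s hs y => by
    have := h1 s hs y
    simp only [pow_zero, mul_one]
    linarith
  have hherm : ∀ s ≥ 1, ∀ y : ℝ, |(y ^ 2 - 2) / (4 * s)| ≤ ((1 + |y|) / √s) ^ 2 := fun s hs y => by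
    have hs0 : 0 < s := by linarith
    rw [← (hu s hs y).1, abs_div, abs_of_pos (by positivity : 0 < 4 * s),
      div_le_div_iff₀ (by positivity) hs0]
    have : |y ^ 2 - 2| ≤ 4 * (1 + |y|) ^ 2 := by
      rw [abs_le]; constructor <;> nlinarith [sq_abs y, abs_nonneg y]
    nlinarith
  have h3' : ∀ s ≥ 1, ∀ y, |potV p s y + (y ^ 2 - 2) / (4 * s)| ≤ C3 * ((1 + |y|) / √s) ^ 4 :=
    fun s hs y => (hu s hs y).2 ▸ h3 s hs y
  have hq : ∀ s ≥ 1, ∀ y, |potV p s y| ≤ (1 + C1 + C3) * ((1 + |y|) / √s) ^ 2 := fun s hs y => by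
    have hs0 : 0 < s := by linarith
    have hun : 0 ≤ (1 + |y|) / √s := by positivity
    rcases le_total ((1 + |y|) / √s) 1 with h | h
    · have e : potV p s y = (potV p s y + (y ^ 2 - 2) / (4 * s)) - (y ^ 2 - 2) / (4 * s) := by ring
      rw [e]
      refine (abs_sub _ _).trans ?_
      have a := h3' s hs y
      have b := hherm s hs y
      have c := pow_le_pow_of_le_one hun h (show 2 ≤ 4 by norm_num)
      have c' := mul_le_mul_of_nonneg_left c hC3.le
      have d : 0 ≤ C1 * ((1 + |y|) / √s) ^ 2 := by positivity
      linarith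
    · have a := h1 s hs y
      have b : 1 ≤ ((1 + |y|) / √s) ^ 2 := one_le_pow₀ h
      nlinarith
  refine ⟨C, ⟨by rw [hC]; linarith, fun s hs y => (h1 s hs y).trans (by linarith),
    fun s hs y => (h2 s hs y).trans ?_, fun s hs y => ?_, fun s hs y => ?_, fun s hs y => ?_,
    fun s hs y => ?_, fun s hs y y' => (h4 s hs y y').trans ?_⟩⟩
  · have hs0 : 0 < s := by linarith
    gcongr
    linarith
  · rw [(hu s hs y).1]
    refine (hq s hs y).trans ?_
    gcongr
    linarith
  · have hun : 0 ≤ (1 + |y|) / √s := by positivity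
    have hq' : |potV p s y| ≤ C * ((1 + |y|) / √s) ^ 2 := (hq s hs y).trans (by gcongr; linarith)
    have := min_one_interp hun hC0 (show 0 ≤ 1 by norm_num) (show 1 ≤ 2 by norm_num) (hb s hs y) hq'
    simpa using this
  · rw [(hu s hs y).2]
    refine (h3' s hs y).trans ?_
    gcongr
    linarith
  · have hun : 0 ≤ (1 + |y|) / √s := by positivity
    refine min_one_interp hun hC0 (show 2 ≤ 3 by norm_num) (show 3 ≤ 4 by norm_num) ?_
      ((h3' s hs y).trans (by gcongr; linarith))
    refine (abs_add_le _ _).trans ((add_le_add (hq s hs y) (hherm s hs y)).trans ?_)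
    have d : 0 ≤ (C2 + C4) * ((1 + |y|) / √s) ^ 2 := by positivity
    rw [hC]
    linarith
  · gcongr
    linarith

/-- At infinity `V` tends to `-p/(p-1) = -(1 + 1/(p-1))`, which leaves room for `-(1+1/p)`. The `1`
compensates the growth `e^{s-τ}` of the semigroup and `1/p` is the remaining decay rate of the outer
part. -/
lemma exists_potV_outer {p : ℝ} (hp : 1 < p) : ∃ K > 0, ∃ s₀ ≥ 1, ∀ s ≥ s₀, ∀ y,
    K * √s ≤ |y| → potV p s y ≤ -(1 + 1 / p) := by
  have h : 0 < p - 1 := by linarith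
  have hp0 : 0 < p := by linarith
  have hk := kappa_pos hp
  -- This is the room available for `pφ^{p-1}`. Below, `η` is the corresponding bound on `φ`, shared
  -- equally between the profile (far region) and the shift (large times).
  obtain ⟨ε, hε⟩ : ∃ ε, ε = 1 / (p - 1) - 1 / p := ⟨_, rfl⟩
  have hε0 : 0 < ε := by
    rw [hε, sub_pos]
    exact one_div_lt_one_div_of_lt h (by linarith)
  obtain ⟨η, hη⟩ : ∃ η, η = (ε / p) ^ (1 / (p - 1)) := ⟨_, rfl⟩
  have hη0 : 0 < η := hη ▸ Real.rpow_pos_of_pos (by positivity) _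
  have hηp : η ^ (p - 1) = ε / p := by
    rw [hη, ← Real.rpow_mul (by positivity), one_div_mul_cancel h.ne', Real.rpow_one]
  obtain ⟨c, hc⟩ : ∃ c, c = (η / 2) ^ (p - 1) := ⟨_, rfl⟩
  have hc0 : 0 < c := hc ▸ Real.rpow_pos_of_pos (by positivity) _
  obtain ⟨a, ha⟩ : ∃ a, a = 1 / (p - 1) / c / ((p - 1) / (4 * p)) := ⟨_, rfl⟩
  have ha0 : 0 < a := by rw [ha]; positivity
  refine ⟨√a, Real.sqrt_pos.2 ha0, 1 + kappa p / (p * η), by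
    have : 0 < kappa p / (p * η) := by positivity
    linarith, fun s hs y hy => ?_⟩
  have hq : 0 < kappa p / (p * η) := by positivity
  have hs1 : 1 ≤ s := by linarith
  have hs0 : 0 < s := by linarith
  have hss : 0 < √s := Real.sqrt_pos.2 hs0
  set z := y / √s with hz
  have hz2 : a ≤ z ^ 2 := by
    have h1 : √a ≤ |z| := by
      rw [hz, abs_div, abs_of_pos hss, le_div_iff₀ hss]; exact hy
    calc a = √a ^ 2 := (Real.sq_sqrt ha0.le).symm
      _ ≤ |z| ^ 2 := by gcongr
      _ = z ^ 2 := sq_abs z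
  have hX : 1 / (p - 1) / c ≤ profX p z := by
    have : (p - 1) / (4 * p) * a ≤ (p - 1) / (4 * p) * z ^ 2 := by gcongr
    have e : (p - 1) / (4 * p) * a = 1 / (p - 1) / c := by rw [ha]; field_simp
    unfold profX
    linarith
  have hf : profile p z ≤ η / 2 := by
    rw [← Real.rpow_le_rpow_iff (profile_pos hp z).le (by positivity) h, profile_rpow hp, ← hc,
      ← div_eq_mul_inv, div_le_iff₀ (profX_pos hp z)]
    rw [div_le_iff₀ hc0] at hX
    linarith
  have hd : kappa p / (2 * p * s) ≤ η / 2 := by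
    rw [div_le_div_iff₀ (by positivity) (by norm_num)]
    have : kappa p / (p * η) ≤ s := by linarith
    rw [div_le_iff₀ (by positivity)] at this
    linarith
  have hφ : phi p s y ^ (p - 1) ≤ ε / p := by
    rw [← hηp]
    exact Real.rpow_le_rpow (phi_pos hp hs0 y).le (by unfold phi; linarith) h.le
  unfold potV
  have h1 : p * phi p s y ^ (p - 1) ≤ p * (ε / p) := by gcongr
  have h2 : p * (ε / p) = ε := by field_simp
  have h3 : p / (p - 1) = 1 + 1 / (p - 1) := by field_simp; ring
  rw [h3]
  linarith

lemma measurable_profile (p : ℝ) : Measurable (profile p) := by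
  unfold profile; fun_prop

lemma continuousAt_potV {p : ℝ} (hp : 1 < p) {q : ℝ × ℝ} (hq : 0 < q.1) :
    ContinuousAt (fun q : ℝ × ℝ => potV p q.1 q.2) q := by
  have h1 : ContinuousAt (fun q : ℝ × ℝ => phi p q.1 q.2) q := by
    unfold phi
    refine ContinuousAt.add ((continuous_profile hp).continuousAt.comp ?_) ?_
    · exact continuousAt_snd.div (Real.continuous_sqrt.continuousAt.comp continuousAt_fst)
        (Real.sqrt_pos.2 hq).ne'
    · exact continuousAt_const.div (continuousAt_const.mul continuousAt_fst) (by positivity)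
  exact ((h1.rpow_const (Or.inl (phi_pos hp hq q.2).ne')).const_mul p).sub continuousAt_const

/-! ### The Dyson expansion: measurability and bounds -/

lemma measurable_intervalIntegral_param {α : Type*} [MeasurableSpace α] {F : α → ℝ → ℝ}
    {a b : α → ℝ} (hF : Measurable (Function.uncurry F)) (ha : Measurable a) (hb : Measurable b) :
    Measurable fun q => ∫ t in a q..b q, F q t := by
  have key : ∀ {a b : α → ℝ}, Measurable a → Measurable b →
      Measurable fun q => ∫ t in Ioc (a q) (b q), F q t := fun {a b} ha hb => by
    have hS : MeasurableSet {w : α × ℝ | a w.1 < w.2 ∧ w.2 ≤ b w.1} :=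
      (measurableSet_lt (ha.comp measurable_fst) measurable_snd).inter
        (measurableSet_le measurable_snd (hb.comp measurable_fst))
    have h := ((hF.indicator hS).stronglyMeasurable.integral_prod_right'
      (ν := (volume : Measure ℝ))).measurable
    convert h using 2 with q
    rw [← integral_indicator measurableSet_Ioc]
    rfl
  simp only [intervalIntegral]
  exact (key ha hb).sub (key hb ha)

lemma measurable_potV_comp (p : ℝ) {α : Type*} [MeasurableSpace α] {f g : α → ℝ}
    (hf : Measurable f) (hg : Measurable g) : Measurable fun a => potV p (f a) (g a) := by
  unfold potV phi profile
  fun_prop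

lemma measurable_dysonTerm (p : ℝ) {G : ℝ → ℝ → ℝ} (hG : Measurable (Function.uncurry G)) (n : ℕ) :
    Measurable fun q : ℝ × ℝ × ℝ => dysonTerm p n q.1 q.2.1 (G q.2.1) q.2.2 := by
  induction n with
  | zero =>
    simp only [dysonTerm]
    refine measurable_semigroupL_param (α := ℝ × ℝ × ℝ) (θ := fun q => q.1 - q.2.1)
      (Y := fun q => q.2.2) (G := fun q => G q.2.1) (by fun_prop) (by fun_prop) ?_
    exact hG.comp (by fun_prop : Measurable fun w : (ℝ × ℝ × ℝ) × ℝ => (w.1.2.1, w.2))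
  | succ n ih =>
    simp only [dysonTerm]
    refine measurable_intervalIntegral_param (α := ℝ × ℝ × ℝ) (F := fun q t =>
      semigroupL (q.1 - t) (fun x => potV p t x * dysonTerm p n t q.2.1 (G q.2.1) x) q.2.2) ?_
      (by fun_prop) (by fun_prop)
    refine measurable_semigroupL_param (α := (ℝ × ℝ × ℝ) × ℝ) (θ := fun w => w.1.1 - w.2)
      (Y := fun w => w.1.2.2)
      (G := fun w x => potV p w.2 x * dysonTerm p n w.2 w.1.2.1 (G w.1.2.1) x)
      (by fun_prop) (by fun_prop) ?_
    refine Measurable.mul ?_ ?_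
    · exact measurable_potV_comp p (by fun_prop) (by fun_prop)
    · exact ih.comp
        (by fun_prop : Measurable fun w : ((ℝ × ℝ × ℝ) × ℝ) × ℝ => (w.1.2, w.1.1.2.1, w.2))

lemma measurable_dysonTerm_right (p : ℝ) {g : ℝ → ℝ} (hg : Measurable g) (n : ℕ) (s σ : ℝ) :
    Measurable (dysonTerm p n s σ g) :=
  (measurable_dysonTerm p (G := fun _ => g) (hg.comp measurable_snd) n).comp
    (by fun_prop : Measurable fun y : ℝ => (s, σ, y))

lemma measurable_dysonTerm_integrand (p : ℝ) {g : ℝ → ℝ} (hg : Measurable g) (n : ℕ) (s σ y : ℝ) :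
    Measurable fun t => semigroupL (s - t) (fun x => potV p t x * dysonTerm p n t σ g x) y := by
  refine measurable_semigroupL_param (α := ℝ) (θ := fun t => s - t) (Y := fun _ => y)
    (G := fun t x => potV p t x * dysonTerm p n t σ g x) (by fun_prop) (by fun_prop) ?_
  exact (measurable_potV_comp p measurable_fst measurable_snd).mul ((measurable_dysonTerm p (G := fun _ => g)
    (hg.comp measurable_snd) n).comp (by fun_prop : Measurable fun w : ℝ × ℝ => (w.1, σ, w.2)))

lemma measurable_potV_mul_dysonTerm (p : ℝ) {g : ℝ → ℝ} (hg : Measurable g) (n : ℕ) (t σ : ℝ) :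
    Measurable fun x => potV p t x * dysonTerm p n t σ g x :=
  (measurable_potV_comp p measurable_const measurable_id).mul
    (measurable_dysonTerm_right p hg n t σ)

lemma abs_dysonTerm_zero_le {p σ s ρ : ℝ} (hs : s ∈ Icc σ (σ + ρ)) {g : ℝ → ℝ} (hg : Measurable g)
    {M : ℝ} {k : ℕ} (h : ∀ y, |g y| ≤ M * (1 + |y|) ^ k) (y : ℝ) :
    |dysonTerm p 0 s σ g y| ≤ Real.exp ρ * gaussMom k * M * (1 + |y|) ^ k := by
  have hM := nonneg_of_abs_le_mul_pow (h y)
  have := gaussMom_pos k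
  refine (abs_semigroupL_le (by linarith [hs.1]) hg h y).trans ?_
  gcongr
  linarith [hs.2]

/-- One step of the Dyson expansion, with a bound for the potential. -/
lemma abs_dysonTerm_succ_le {p σ s ρ v B : ℝ} (hs : s ∈ Icc σ (σ + ρ)) {g : ℝ → ℝ}
    (hg : Measurable g) {j k l : ℕ} (hB : 0 ≤ B)
    (hV : ∀ t ∈ Icc σ s, ∀ x, |potV p t x| ≤ v * (1 + |x|) ^ l)
    (h : ∀ t ∈ Icc σ s, ∀ x, |dysonTerm p j t σ g x| ≤ B * (t - σ) ^ j * (1 + |x|) ^ k) (y : ℝ) :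
    |dysonTerm p (j + 1) s σ g y| ≤
      Real.exp ρ * gaussMom (l + k) * v * B / (j + 1) * (s - σ) ^ (j + 1) * (1 + |y|) ^ (l + k) := by
  have hm := gaussMom_pos (l + k)
  have hv : 0 ≤ v := nonneg_of_abs_le_mul_pow (hV s ⟨hs.1, le_rfl⟩ y)
  rw [dysonTerm, ← Real.norm_eq_abs]
  have hint : ∀ c : ℝ, IntervalIntegrable (fun t => c * (t - σ) ^ j) volume σ s := fun c =>
    (by fun_prop : Continuous fun t => c * (t - σ) ^ j).intervalIntegrable _ _
  refine (intervalIntegral.norm_integral_le_of_norm_le hs.1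
    (Filter.Eventually.of_forall fun t ht => ?_)
    (hint (Real.exp ρ * gaussMom (l + k) * v * B * (1 + |y|) ^ (l + k)))).trans ?_
  · have ht' : t ∈ Icc σ s := ⟨ht.1.le, ht.2⟩
    have ht0 : 0 ≤ t - σ := by linarith [ht.1]
    rw [Real.norm_eq_abs]
    refine (abs_semigroupL_le (M := v * (B * (t - σ) ^ j)) (k := l + k) (by linarith [ht.2])
      (measurable_potV_mul_dysonTerm p hg j t σ) (fun x => ?_) y).trans ?_
    · rw [abs_mul, pow_add]
      calc _ ≤ (v * (1 + |x|) ^ l) * (B * (t - σ) ^ j * (1 + |x|) ^ k) :=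
            mul_le_mul (hV t ht' x) (h t ht' x) (abs_nonneg _) (by positivity)
        _ = _ := by ring
    · have : Real.exp (s - t) ≤ Real.exp ρ := Real.exp_le_exp.2 (by linarith [ht.1, hs.2])
      calc _ ≤ Real.exp ρ * gaussMom (l + k) * (v * (B * (t - σ) ^ j)) * (1 + |y|) ^ (l + k) := by
            gcongr
        _ = _ := by ring
  · rw [intervalIntegral.integral_const_mul]
    have e : ∫ t in σ..s, (t - σ) ^ j = (s - σ) ^ (j + 1) / (j + 1) := by
      rw [intervalIntegral.integral_comp_sub_right (fun t => t ^ j), integral_pow]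
      simp
    rw [e]
    exact le_of_eq (by ring)

/-- The growth constant of the iteration. -/
noncomputable def dysC (Cv ρ : ℝ) (k : ℕ) : ℝ := Real.exp ρ * gaussMom k * Cv

lemma PotBounds.dysC_nonneg {p Cv : ℝ} (hV : PotBounds p Cv) (ρ : ℝ) (k : ℕ) : 0 ≤ dysC Cv ρ k := by
  have := gaussMom_pos k
  have := hV.one_le
  unfold dysC; positivity

/-- Each further step uses only that `V` is bounded and integrates once more in time, which gives
the general term of an exponential series. Smallness obtained for the `j`-th term is thus kept by
the whole remainder of the expansion. -/
lemma abs_dysonTerm_add_le {p Cv σ ρ B : ℝ} (hV : PotBounds p Cv) (hσ : 1 ≤ σ) {g : ℝ → ℝ}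
    (hg : Measurable g) {j k : ℕ} (hB : 0 ≤ B)
    (h : ∀ t ∈ Icc σ (σ + ρ), ∀ x, |dysonTerm p j t σ g x| ≤ B * (t - σ) ^ j * (1 + |x|) ^ k)
    (n : ℕ) : ∀ s ∈ Icc σ (σ + ρ), ∀ y, |dysonTerm p (n + j) s σ g y| ≤
      B * (s - σ) ^ j * ((dysC Cv ρ k * (s - σ)) ^ n / n.factorial) * (1 + |y|) ^ k := by
  have hc := hV.dysC_nonneg ρ k
  induction n with
  | zero => intro s hs y; simpa using h s hs y
  | succ n ih =>
    intro s hs y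
    have hs0 : 0 ≤ s - σ := by linarith [hs.1]
    have := abs_dysonTerm_succ_le (j := n + j) (l := 0) (k := k) (v := Cv)
      (B := B * dysC Cv ρ k ^ n / n.factorial) hs hg (by positivity)
      (fun t ht x => by simpa using hV.bdd t (hσ.trans ht.1) x)
      (fun t ht x => by
        refine (ih t ⟨ht.1, ht.2.trans hs.2⟩ x).trans (le_of_eq ?_)
        rw [mul_pow, pow_add]; ring) y
    rw [show n + 1 + j = n + j + 1 by ring]
    refine this.trans ?_
    rw [zero_add]
    have hn : ((n + j : ℕ) : ℝ) + 1 ≥ (n : ℝ) + 1 := by push_cast; linarith [(Nat.cast_nonneg j : (0:ℝ) ≤ j)]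
    have hn0 : (0 : ℝ) < n + 1 := by positivity
    rw [Nat.factorial_succ]
    push_cast at hn ⊢
    have hm := gaussMom_pos k
    have hCv := hV.one_le
    calc _ ≤ Real.exp ρ * gaussMom k * Cv * (B * dysC Cv ρ k ^ n / n.factorial) / (n + 1)
          * (s - σ) ^ (n + j + 1) * (1 + |y|) ^ k := by gcongr
      _ = _ := by
          rw [mul_pow, show n + j + 1 = j + (n + 1) by ring, pow_add (s - σ) j (n + 1), pow_succ (dysC Cv ρ k)]
          unfold dysC
          field_simp

lemma hasSum_pow_div_factorial (x : ℝ) :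
    HasSum (fun n : ℕ => x ^ n / n.factorial) (Real.exp x) := by
  rw [Real.exp_eq_exp_ℝ]
  exact NormedSpace.expSeries_div_hasSum_exp x

section
variable {p Cv σ ρ B : ℝ} {g : ℝ → ℝ} {j k : ℕ}

lemma summable_dysonTerm (hV : PotBounds p Cv) (hσ : 1 ≤ σ)
    (hg : Measurable g) {M : ℝ} (h : ∀ y, |g y| ≤ M * (1 + |y|) ^ k) {s : ℝ}
    (hs : σ ≤ s) (y : ℝ) : Summable fun n => dysonTerm p n s σ g y := by
  have hM := nonneg_of_abs_le_mul_pow (h y)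
  have hm := gaussMom_pos k
  have hb := abs_dysonTerm_add_le (ρ := s - σ) (j := 0) (k := k) hV hσ hg
    (B := Real.exp (s - σ) * gaussMom k * M) (by positivity)
    (fun t ht x => by simpa using abs_dysonTerm_zero_le ht hg h x)
  refine Summable.of_norm_bounded
    (((hasSum_pow_div_factorial (dysC Cv (s - σ) k * (s - σ))).summable.mul_left
      (Real.exp (s - σ) * gaussMom k * M)).mul_right ((1 + |y|) ^ k)) fun n => ?_
  simpa using hb n s ⟨hs, by linarith⟩ y

/-- The remainder of the Dyson expansion after `j` terms. -/
lemma abs_fundK_sub_sum_le (hV : PotBounds p Cv) (hσ : 1 ≤ σ)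
    (hg : Measurable g) {M : ℝ} {i : ℕ} (hgM : ∀ y, |g y| ≤ M * (1 + |y|) ^ i) (hB : 0 ≤ B)
    (h : ∀ t ∈ Icc σ (σ + ρ), ∀ x, |dysonTerm p j t σ g x| ≤ B * (t - σ) ^ j * (1 + |x|) ^ k)
    {s : ℝ} (hs : s ∈ Icc σ (σ + ρ)) (y : ℝ) :
    |fundK p s σ g y - ∑ n ∈ Finset.range j, dysonTerm p n s σ g y| ≤
      Real.exp (dysC Cv ρ k * ρ) * B * (s - σ) ^ j * (1 + |y|) ^ k := by
  have hs0 : 0 ≤ s - σ := by linarith [hs.1]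
  have hsum := summable_dysonTerm hV hσ hg hgM hs.1 y
  have e : fundK p s σ g y - ∑ n ∈ Finset.range j, dysonTerm p n s σ g y =
      ∑' n, dysonTerm p (n + j) s σ g y := by
    rw [fundK, ← hsum.sum_add_tsum_nat_add j, add_sub_cancel_left]
  rw [e, ← Real.norm_eq_abs]
  refine (tsum_of_norm_bounded (((hasSum_pow_div_factorial (dysC Cv ρ k * (s - σ))).mul_left
    (B * (s - σ) ^ j)).mul_right ((1 + |y|) ^ k))
    fun n => abs_dysonTerm_add_le hV hσ hg hB h n s hs y).trans ?_
  have hc := hV.dysC_nonneg ρ k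
  calc _ = Real.exp (dysC Cv ρ k * (s - σ)) * B * (s - σ) ^ j * (1 + |y|) ^ k := by ring
    _ ≤ _ := by gcongr; linarith [hs.2]

/-- The growth constant of the evolution on an interval of length `ρ`. -/
noncomputable def fundC (Cv ρ : ℝ) (k : ℕ) : ℝ :=
  Real.exp (dysC Cv ρ k * ρ) * (Real.exp ρ * gaussMom k)

lemma fundC_pos (Cv ρ : ℝ) (k : ℕ) : 0 < fundC Cv ρ k := by
  have := gaussMom_pos k
  unfold fundC; positivity

lemma abs_fundK_le (hV : PotBounds p Cv) (hσ : 1 ≤ σ) (hg : Measurable g) {M : ℝ}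
    (hgM : ∀ y, |g y| ≤ M * (1 + |y|) ^ k) {s : ℝ} (hs : s ∈ Icc σ (σ + ρ)) (y : ℝ) :
    |fundK p s σ g y| ≤ fundC Cv ρ k * M * (1 + |y|) ^ k := by
  have hM := nonneg_of_abs_le_mul_pow (hgM y)
  have hm := gaussMom_pos k
  have := abs_fundK_sub_sum_le (j := 0) (B := Real.exp ρ * gaussMom k * M) hV hσ hg hgM
    (by positivity) (fun t ht x => by simpa using abs_dysonTerm_zero_le ht hg hgM x) hs y
  simp only [Finset.range_zero, Finset.sum_empty, sub_zero, pow_zero, mul_one] at this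
  refine this.trans (le_of_eq ?_)
  unfold fundC; ring

lemma measurable_fundK (hV : PotBounds p Cv) (hσ : 1 ≤ σ) (hg : PolyBdd g) {s : ℝ} (hs : σ ≤ s) :
    Measurable (fundK p s σ g) := by
  obtain ⟨mg, M, k, h⟩ := hg
  refine measurable_of_tendsto_metrizable (fun n => ?_) (tendsto_pi_nhds.2 fun y =>
    (summable_dysonTerm hV hσ mg h hs y).hasSum.tendsto_sum_nat)
  exact Finset.measurable_sum _ fun i _ => measurable_dysonTerm_right p mg i s σ

lemma PolyBdd.fundK (hV : PotBounds p Cv) (hσ : 1 ≤ σ) (hg : PolyBdd g) {s : ℝ} (hs : σ ≤ s) :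
    PolyBdd (fundK p s σ g) := by
  have hm := measurable_fundK hV hσ hg hs
  obtain ⟨mg, M, k, h⟩ := hg
  exact ⟨hm, _, k, abs_fundK_le (ρ := s - σ) hV hσ mg h ⟨hs, by linarith⟩⟩

lemma PolyBdd.dysonTerm (hV : PotBounds p Cv) (hσ : 1 ≤ σ) (hg : PolyBdd g) {s : ℝ} (hs : σ ≤ s)
    (n : ℕ) : PolyBdd (dysonTerm p n s σ g) := by
  obtain ⟨mg, M, k, h⟩ := hg
  have hM := nonneg_of_abs_le_mul_pow (h 0)
  have hm := gaussMom_pos k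
  have hb := abs_dysonTerm_add_le (ρ := s - σ) (j := 0) (k := k) hV hσ mg
    (B := Real.exp (s - σ) * gaussMom k * M) (by positivity)
    (fun t ht x => by simpa using abs_dysonTerm_zero_le ht mg h x) n s ⟨hs, by linarith⟩
  exact ⟨measurable_dysonTerm_right p mg n s σ, _, k, hb⟩

lemma PolyBdd.potV_mul (hV : PotBounds p Cv) {s : ℝ} (hs : 1 ≤ s) (hg : PolyBdd g) :
    PolyBdd fun x => potV p s x * g x := by
  refine PolyBdd.mul (PolyBdd.of_bound (M := Cv) (k := 0)
    (measurable_potV_comp p measurable_const measurable_id)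
    fun y => by simpa using hV.bdd s hs y) hg

lemma intervalIntegrable_of_bound {f : ℝ → ℝ} (hf : Measurable f) {a b M : ℝ} (hab : a ≤ b)
    (h : ∀ t ∈ Ioc a b, |f t| ≤ M) : IntervalIntegrable f volume a b := by
  rw [intervalIntegrable_iff_integrableOn_Ioc_of_le hab]
  exact Measure.integrableOn_of_bounded (M := M) (by simp) hf.aestronglyMeasurable
    ((ae_restrict_iff' measurableSet_Ioc).2 (Filter.Eventually.of_forall h))

lemma intervalIntegrable_dysonTerm_integrand (hV : PotBounds p Cv) (hσ : 1 ≤ σ) (hg : PolyBdd g)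
    {s : ℝ} (hs : σ ≤ s) (n : ℕ) (y : ℝ) : IntervalIntegrable
      (fun t => semigroupL (s - t) (fun x => potV p t x * GradBlowup.dysonTerm p n t σ g x) y)
      volume σ s := by
  obtain ⟨mg, M, k, h⟩ := hg
  have hM := nonneg_of_abs_le_mul_pow (h 0)
  have hm := gaussMom_pos k
  have hCv := hV.one_le
  have hc := hV.dysC_nonneg (s - σ) k
  have hb := abs_dysonTerm_add_le (ρ := s - σ) (j := 0) (k := k) hV hσ mg
    (B := Real.exp (s - σ) * gaussMom k * M) (by positivity)
    (fun t ht x => by simpa using abs_dysonTerm_zero_le ht mg h x) n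
  simp only [pow_zero, mul_one, add_zero] at hb
  set A := Real.exp (s - σ) * gaussMom k * M * ((dysC Cv (s - σ) k * (s - σ)) ^ n / n.factorial)
    with hA
  have hs0 : 0 ≤ s - σ := by linarith
  refine intervalIntegrable_of_bound (measurable_dysonTerm_integrand p mg n s σ y) hs
    (M := Real.exp (s - σ) * gaussMom k * (Cv * A) * (1 + |y|) ^ k) fun t ht => ?_
  have hts : 0 ≤ t - σ := by linarith [ht.1]
  refine (abs_semigroupL_le (M := Cv * A) (k := k) (by linarith [ht.2])
    (measurable_potV_mul_dysonTerm p mg n t σ) (fun x => ?_) y).trans ?_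
  · rw [abs_mul]
    calc _ ≤ Cv * (A * (1 + |x|) ^ k) := by
          refine mul_le_mul (hV.bdd t (by linarith [ht.1]) x)
            ((hb t ⟨ht.1.le, by linarith [ht.2]⟩ x).trans ?_) (abs_nonneg _) (by linarith)
          rw [hA]
          gcongr
          exact ht.2
      _ = _ := by ring
  · have : 0 ≤ A := by positivity
    gcongr
    linarith [ht.1]

lemma dysonTerm_add (hV : PotBounds p Cv) (hσ : 1 ≤ σ) {f g : ℝ → ℝ} (hf : PolyBdd f)
    (hg : PolyBdd g) (n : ℕ) : ∀ s, σ ≤ s → ∀ y,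
    dysonTerm p n s σ (fun x => f x + g x) y = dysonTerm p n s σ f y + dysonTerm p n s σ g y := by
  induction n with
  | zero => intro s hs y; exact semigroupL_add (by linarith) hf hg y
  | succ n ih =>
    intro s hs y
    simp only [dysonTerm]
    rw [← intervalIntegral.integral_add
      (intervalIntegrable_dysonTerm_integrand hV hσ hf hs n y)
      (intervalIntegrable_dysonTerm_integrand hV hσ hg hs n y)]
    refine intervalIntegral.integral_congr fun t ht => ?_
    rw [uIcc_of_le hs] at ht
    rw [← semigroupL_add (by linarith [ht.2]) ((hf.dysonTerm hV hσ ht.1 n).potV_mul hV (hσ.trans ht.1))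
      ((hg.dysonTerm hV hσ ht.1 n).potV_mul hV (hσ.trans ht.1))]
    congr 1
    ext x
    rw [ih t ht.1 x]
    ring

lemma dysonTerm_const_mul (p : ℝ) (c : ℝ) (f : ℝ → ℝ) (n : ℕ) : ∀ s σ y,
    dysonTerm p n s σ (fun x => c * f x) y = c * dysonTerm p n s σ f y := by
  induction n with
  | zero => intro s σ y; exact semigroupL_const_mul _ _ _ _
  | succ n ih =>
    intro s σ y
    simp only [dysonTerm]
    rw [← intervalIntegral.integral_const_mul]
    refine intervalIntegral.integral_congr fun t ht => ?_
    rw [← semigroupL_const_mul]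
    congr 1
    ext x
    rw [ih t σ x]
    ring

lemma fundK_add (hV : PotBounds p Cv) (hσ : 1 ≤ σ) {f g : ℝ → ℝ} (hf : PolyBdd f)
    (hg : PolyBdd g) {s : ℝ} (hs : σ ≤ s) (y : ℝ) :
    fundK p s σ (fun x => f x + g x) y = fundK p s σ f y + fundK p s σ g y := by
  simp only [fundK, dysonTerm_add hV hσ hf hg _ s hs y]
  obtain ⟨mf, M, k, hM⟩ := hf
  obtain ⟨mg, N, l, hN⟩ := hg
  exact (summable_dysonTerm hV hσ mf hM hs y).tsum_add (summable_dysonTerm hV hσ mg hN hs y)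

lemma fundK_const_mul (p s σ c : ℝ) (f : ℝ → ℝ) (y : ℝ) :
    fundK p s σ (fun x => c * f x) y = c * fundK p s σ f y := by
  simp only [fundK, dysonTerm_const_mul, tsum_mul_left]

/-- The first term of the Dyson expansion, when the integrand is close to a multiple of `P`. -/
lemma abs_dysonTerm_one_sub_le (hV : PotBounds p Cv) (hσ : 1 ≤ σ) (hg : PolyBdd g)
    {s : ℝ} (hs : s ∈ Icc σ (σ + ρ)) {c : ℝ → ℝ} {P : ℝ → ℝ} (hP : PolyBdd P) {M : ℝ}
    (hc : ContinuousOn c (Icc σ s))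
    (h : ∀ t ∈ Icc σ s, ∀ x, |potV p t x * semigroupL (t - σ) g x - c t * P x| ≤ M * (1 + |x|) ^ k)
    (hPc : ∀ y, ContinuousOn (fun t => semigroupL (s - t) P y) (Icc σ s)) (y : ℝ) :
    |dysonTerm p 1 s σ g y - ∫ t in σ..s, c t * semigroupL (s - t) P y| ≤
      Real.exp ρ * gaussMom k * M * (s - σ) * (1 + |y|) ^ k := by
  have hi := intervalIntegrable_dysonTerm_integrand hV hσ hg hs.1 0 y
  have hi2 : IntervalIntegrable (fun t => c t * semigroupL (s - t) P y) volume σ s :=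
    (ContinuousOn.mul hc (hPc y)).intervalIntegrable_of_Icc hs.1
  have e : dysonTerm p 1 s σ g y - ∫ t in σ..s, c t * semigroupL (s - t) P y =
    ∫ t in σ..s, (semigroupL (s - t) (fun x => potV p t x * dysonTerm p 0 t σ g x) y
      - c t * semigroupL (s - t) P y) := by
    rw [intervalIntegral.integral_sub hi hi2]; rfl
  rw [e, ← Real.norm_eq_abs]
  refine (intervalIntegral.norm_integral_le_of_norm_le_const
    (C := Real.exp ρ * gaussMom k * M * (1 + |y|) ^ k) fun t ht => ?_).trans
    (le_of_eq ?_)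
  · rw [uIoc_of_le hs.1] at ht
    have ht' : t ∈ Icc σ s := ⟨ht.1.le, ht.2⟩
    have h0 := hg.semigroupL (θ := t - σ) (by linarith [ht.1])
    have h1 : PolyBdd fun x => potV p t x * dysonTerm p 0 t σ g x :=
      h0.potV_mul hV (hσ.trans ht'.1)
    rw [← semigroupL_const_mul, ← semigroupL_sub (by linarith [ht.2]) h1 (hP.const_mul _),
      Real.norm_eq_abs]
    refine (abs_semigroupL_le (M := M) (k := k) (by linarith [ht.2]) (h1.sub (hP.const_mul _)).1
      (h t ht') y).trans ?_
    have hM := nonneg_of_abs_le_mul_pow (h t ht' y)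
    have := gaussMom_pos k
    gcongr
    linarith [ht.1, hs.2]
  · rw [abs_of_nonneg (sub_nonneg.2 hs.1)]; ring

end

/-! ### The evolution as a deterministic factor times the free semigroup -/

lemma integral_mul_primitive_pow {φ : ℝ → ℝ} {a b : ℝ} (hab : a ≤ b)
    (hφ : ContinuousOn φ (Icc a b)) (n : ℕ) :
    ∫ t in a..b, φ t * (∫ σ in a..t, φ σ) ^ n = (∫ σ in a..b, φ σ) ^ (n + 1) / (n + 1) := by
  have hint : IntervalIntegrable φ volume a b := hφ.intervalIntegrable_of_Icc hab
  have hcont : ContinuousOn (fun t => ∫ σ in a..t, φ σ) (Icc a b) := by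
    have := intervalIntegral.continuousOn_primitive_interval (f := φ) (μ := volume) (a := a) (b := b)
      (by rw [uIcc_of_le hab]; exact hφ.integrableOn_Icc)
    rwa [uIcc_of_le hab] at this
  have hn : (n : ℝ) + 1 ≠ 0 := by positivity
  have h := intervalIntegral.integral_eq_sub_of_hasDerivAt_of_le hab
    (f := fun t => (∫ σ in a..t, φ σ) ^ (n + 1) / (n + 1))
    (f' := fun t => φ t * (∫ σ in a..t, φ σ) ^ n) ((hcont.pow (n + 1)).div_const _)
    (fun t ht => by
      have hd : HasDerivAt (fun t => ∫ σ in a..t, φ σ) (φ t) t := by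
        refine intervalIntegral.integral_hasDerivAt_right
          (hint.mono_set (by
            rw [uIcc_of_le hab, uIcc_of_le ht.1.le]; exact Icc_subset_Icc_right ht.2.le))
          ((hφ.mono Ioo_subset_Icc_self).stronglyMeasurableAtFilter isOpen_Ioo t ht)
          (hφ.continuousAt (Icc_mem_nhds ht.1 ht.2))
      have := (hd.pow (n + 1)).div_const ((n : ℝ) + 1)
      refine this.congr_deriv ?_
      simp only [Nat.add_sub_cancel]
      push_cast
      field_simp)
    ((ContinuousOn.mul hφ (hcont.pow n)).intervalIntegrable_of_Icc hab)
  rw [h]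
  simp

/-- The integral of the potential along the deterministic backward path ending at `y`. -/
noncomputable def potPath (p τ s y : ℝ) : ℝ :=
  ∫ σ in τ..s, potV p σ (Real.exp (-(s - σ) / 2) * y)

lemma continuousOn_potV_path {p τ s : ℝ} (hp : 1 < p) (hτ : 1 ≤ τ) (y : ℝ) :
    ContinuousOn (fun σ => potV p σ (Real.exp (-(s - σ) / 2) * y)) (Icc τ s) := fun σ hσ => by
  have h : ContinuousAt (fun σ : ℝ => ((σ, Real.exp (-(s - σ) / 2) * y) : ℝ × ℝ)) σ := by fun_prop
  exact (ContinuousAt.comp (f := fun σ : ℝ => ((σ, Real.exp (-(s - σ) / 2) * y) : ℝ × ℝ))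
    (g := fun q : ℝ × ℝ => potV p q.1 q.2) (continuousAt_potV hp (by simp; linarith [hσ.1])) h
    ).continuousWithinAt

section
variable {p Cv τ ρ : ℝ}

lemma abs_potPath_le (hV : PotBounds p Cv) (hτ : 1 ≤ τ) {s : ℝ} (hs : τ ≤ s) (y : ℝ) :
    |potPath p τ s y| ≤ Cv * (s - τ) := by
  have := intervalIntegral.norm_integral_le_of_norm_le_const (a := τ) (b := s) (C := Cv)
    (f := fun σ => potV p σ (Real.exp (-(s - σ) / 2) * y)) fun t ht => by
      rw [uIoc_of_le hs] at ht
      exact hV.bdd t (by linarith [ht.1]) _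
  rwa [abs_of_nonneg (sub_nonneg.2 hs)] at this

/-- Only the upper bound on the potential enters. Hence the exponential of `potPath` is bounded for
large `τ` uniformly in `y`, although `potPath` itself may be very negative. -/
lemma potPath_le (hp : 1 < p) (hV : PotBounds p Cv) (hτ : 1 ≤ τ) {s : ℝ} (hs : τ ≤ s) (y : ℝ) :
    potPath p τ s y ≤ Cv / τ * (s - τ) := by
  have h := intervalIntegral.integral_mono_on hs
    ((continuousOn_potV_path hp hτ y).intervalIntegrable_of_Icc (μ := volume) hs)
    (intervalIntegrable_const (μ := volume) (c := Cv / τ)) fun t ht => (hV.upper t (hτ.trans ht.1) _).trans (by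
      have := hV.one_le
      exact div_le_div_of_nonneg_left (by linarith) (by linarith) ht.1)
  rw [intervalIntegral.integral_const, smul_eq_mul, mul_comm] at h
  exact h

lemma abs_potPath_sub_le (hp : 1 < p) (hV : PotBounds p Cv) (hτ : 1 ≤ τ) {s : ℝ} (hs : τ ≤ s)
    (y y' : ℝ) : |potPath p τ s y - potPath p τ s y'| ≤ Cv * (s - τ) / √τ * |y - y'| := by
  have hi := fun y => (continuousOn_potV_path hp hτ (s := s) y).intervalIntegrable_of_Icc
    (μ := volume) hs
  have hτs : 0 < √τ := Real.sqrt_pos.2 (by linarith)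
  rw [potPath, potPath, ← intervalIntegral.integral_sub (hi y) (hi y'), ← Real.norm_eq_abs]
  refine (intervalIntegral.norm_integral_le_of_norm_le_const (C := Cv / √τ * |y - y'|)
    fun t ht => ?_).trans (le_of_eq ?_)
  · rw [uIoc_of_le hs] at ht
    rw [Real.norm_eq_abs]
    have hCv := hV.one_le
    refine (hV.lipschitz t (by linarith [ht.1]) _ _).trans ?_
    rw [← mul_sub, abs_mul, abs_of_pos (Real.exp_pos _)]
    have h1 : Real.exp (-(s - t) / 2) ≤ 1 := Real.exp_le_one_iff.2 (by linarith [ht.2])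
    have h2 : √τ ≤ √t := Real.sqrt_le_sqrt ht.1.le
    have h3 : Real.exp (-(s - t) / 2) * |y - y'| ≤ |y - y'| := mul_le_of_le_one_left (abs_nonneg _) h1
    have h4 : Cv / √t ≤ Cv / √τ := div_le_div_of_nonneg_left (by linarith) hτs h2
    exact mul_le_mul h4 h3 (by positivity) (by positivity)
  · rw [abs_of_nonneg (sub_nonneg.2 hs)]; ring

/-- This is the regularity in `y` of the integrand of the exponential series along the path. The
product rule produces a factor `n + 1`, which is put into `2^n` so that the series still sums to an
exponential. -/
lemma abs_potV_mul_potPath_pow_sub_le (hp : 1 < p) (hV : PotBounds p Cv) (hτ : 1 ≤ τ) {s : ℝ}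
    (hs : τ ≤ s) (n : ℕ) (y y' : ℝ) :
    |potV p s y * potPath p τ s y ^ n - potV p s y' * potPath p τ s y' ^ n| ≤
      Cv * (2 * (Cv * (s - τ))) ^ n / √τ * |y - y'| := by
  have hCv := hV.one_le
  have hs0 : 0 ≤ s - τ := sub_nonneg.2 hs
  have hτs : 0 < √τ := Real.sqrt_pos.2 (by linarith)
  obtain ⟨a, ha⟩ : ∃ a, a = Cv * (s - τ) := ⟨_, rfl⟩
  have ha0 : 0 ≤ a := by rw [ha]; positivity
  have b1 : |potPath p τ s y| ≤ a := ha ▸ abs_potPath_le hV hτ hs y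
  have b2 : |potPath p τ s y'| ≤ a := ha ▸ abs_potPath_le hV hτ hs y'
  have l1 := abs_potPath_sub_le hp hV hτ hs y y'
  have l2 : |potV p s y - potV p s y'| ≤ Cv / √τ * |y - y'| := by
    refine (hV.lipschitz s (hτ.trans hs) y y').trans ?_
    gcongr
  have e : potV p s y * potPath p τ s y ^ n - potV p s y' * potPath p τ s y' ^ n =
      (potV p s y - potV p s y') * potPath p τ s y ^ n
      + potV p s y' * (potPath p τ s y ^ n - potPath p τ s y' ^ n) := by ring
  have p1 : |(potV p s y - potV p s y') * potPath p τ s y ^ n| ≤ Cv / √τ * |y - y'| * a ^ n := by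
    rw [abs_mul, abs_pow]; gcongr
  have p2 : |potV p s y' * (potPath p τ s y ^ n - potPath p τ s y' ^ n)| ≤
      Cv * (a / √τ * |y - y'| * n * a ^ (n - 1)) := by
    rw [abs_mul]
    gcongr
    · exact hV.bdd s (hτ.trans hs) _
    · refine (abs_pow_sub_pow_le _ _ n).trans ?_
      rw [← ha] at l1
      gcongr
      exact max_le b1 b2
  have e2 : a / √τ * |y - y'| * n * a ^ (n - 1) = n * a ^ n / √τ * |y - y'| := by
    rcases n with _ | n
    · simp
    · rw [Nat.add_sub_cancel, pow_succ]; ring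
  rw [e]
  refine (abs_add_le _ _).trans ((add_le_add p1 p2).trans ?_)
  have hn : (n : ℝ) + 1 ≤ 2 ^ n := by
    exact_mod_cast Nat.lt_two_pow_self
  rw [e2, ← ha, mul_pow]
  calc _ = (n + 1) * (Cv * a ^ n / √τ * |y - y'|) := by ring
    _ ≤ 2 ^ n * (Cv * a ^ n / √τ * |y - y'|) := by gcongr
    _ = _ := by ring

/-- The constant of the comparison with the free semigroup. -/
noncomputable def pathC (Cv ρ : ℝ) (k : ℕ) : ℝ :=
  2 * Cv + Real.exp ρ * gaussMom (k + 1) * (Cv * (1 + Real.exp ρ * gaussMom k))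

/-- By induction, the `n`-th Dyson term is the `n`-th term of the exponential series of `potPath`
times the free evolution. The kernel of `e^{(s-t)𝓛}` is concentrated at bounded distance from
`e^{-(s-t)/2}y`, and over such a distance `V` varies by `O(τ^{-1/2})`, so it may be frozen at that
point. -/
lemma abs_dysonTerm_sub_potPath_le (hp : 1 < p) (hV : PotBounds p Cv) (hτ : 1 ≤ τ) {g : ℝ → ℝ}
    (hg : Measurable g) {M : ℝ} {k : ℕ} (hgM : ∀ y, |g y| ≤ M * (1 + |y|) ^ k) (n : ℕ) :
    ∀ s ∈ Icc τ (τ + ρ), ∀ y,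
      |dysonTerm p n s τ g y - potPath p τ s y ^ n / n.factorial * semigroupL (s - τ) g y| ≤
        M / √τ * ((pathC Cv ρ k * (s - τ)) ^ n / n.factorial) * (1 + |y|) ^ k := by
  have hM := nonneg_of_abs_le_mul_pow (hgM 0)
  have hCv := hV.one_le
  have hτs : 0 < √τ := Real.sqrt_pos.2 (by linarith)
  have hm := gaussMom_pos k
  have hm1 := gaussMom_pos (k + 1)
  have hgP : PolyBdd g := PolyBdd.of_bound hg hgM
  obtain ⟨K, hK⟩ : ∃ K, K = pathC Cv ρ k := ⟨_, rfl⟩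
  have hK2 : 2 * Cv ≤ K := by
    rw [hK, pathC]
    have : 0 < Real.exp ρ * gaussMom (k + 1) * (Cv * (1 + Real.exp ρ * gaussMom k)) := by positivity
    linarith
  have hK3 : Real.exp ρ * gaussMom (k + 1) * (Cv * (1 + Real.exp ρ * gaussMom k)) ≤ K := by
    rw [hK, pathC]; linarith
  have hK0 : 0 ≤ K := by linarith
  rw [← hK]
  induction n with
  | zero =>
    intro s hs y
    simp only [dysonTerm, pow_zero, Nat.factorial_zero, Nat.cast_one, div_one, one_mul, sub_self,
      abs_zero, mul_one]
    positivity
  | succ n ih =>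
    intro s hs y
    have hs0 : 0 ≤ s - τ := sub_nonneg.2 hs.1
    set c : ℝ → ℝ := fun t => potV p t (Real.exp (-(s - t) / 2) * y) *
      potPath p τ t (Real.exp (-(s - t) / 2) * y) ^ n / n.factorial with hc
    -- Backward paths compose: the path through the intermediate point is the path ending at `y`, so
    -- the frozen integrand is the exact derivative of a power of one primitive.
    have hpath : ∀ t, potPath p τ t (Real.exp (-(s - t) / 2) * y) =
        ∫ σ in τ..t, potV p σ (Real.exp (-(s - σ) / 2) * y) := fun t => by
      unfold potPath
      refine intervalIntegral.integral_congr fun σ _ => ?_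
      rw [← mul_assoc, ← Real.exp_add]
      congr 3
      ring
    have hφ := continuousOn_potV_path (s := s) hp hτ y
    have hcint : ∫ t in τ..s, c t * semigroupL (s - τ) g y =
        potPath p τ s y ^ (n + 1) / (n + 1).factorial * semigroupL (s - τ) g y := by
      rw [intervalIntegral.integral_mul_const]
      congr 1
      simp only [hc, hpath, mul_div_assoc]
      simp only [← mul_div_assoc]
      rw [intervalIntegral.integral_div, integral_mul_primitive_pow hs.1 hφ, Nat.factorial_succ,
        potPath]
      generalize (∫ σ in τ..s, potV p σ (Real.exp (-(s - σ) / 2) * y)) = J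
      push_cast
      field_simp
    have hccont : ContinuousOn c (Icc τ s) := by
      simp only [hc, hpath]
      refine (hφ.mul (ContinuousOn.pow ?_ n)).div_const _
      have := intervalIntegral.continuousOn_primitive_interval (μ := volume) (a := τ) (b := s)
        (f := fun σ => potV p σ (Real.exp (-(s - σ) / 2) * y))
        (by rw [uIcc_of_le hs.1]; exact hφ.integrableOn_Icc)
      rwa [uIcc_of_le hs.1] at this
    have hi1 := intervalIntegrable_dysonTerm_integrand hV hτ hgP hs.1 n y
    have hi2 : IntervalIntegrable (fun t => c t * semigroupL (s - τ) g y) volume τ s :=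
      (hccont.mul continuousOn_const).intervalIntegrable_of_Icc hs.1
    rw [← hcint, dysonTerm, ← intervalIntegral.integral_sub hi1 hi2, ← Real.norm_eq_abs]
    refine (intervalIntegral.norm_integral_le_of_norm_le hs.1
      (g := fun t => M / √τ * (K * (K ^ n / n.factorial)) * (1 + |y|) ^ k * (t - τ) ^ n)
      (Filter.Eventually.of_forall fun t ht => ?_)
      ((by fun_prop : Continuous fun t => M / √τ * (K * (K ^ n / n.factorial)) * (1 + |y|) ^ k *
        (t - τ) ^ n).intervalIntegrable _ _)).trans ?_
    · have ht' : t ∈ Icc τ (τ + ρ) := ⟨ht.1.le, ht.2.trans hs.2⟩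
      have ht0 : 0 ≤ t - τ := by linarith [ht.1]
      have hst : 0 ≤ s - t := by linarith [ht.2]
      -- Both quantities are written as `e^{(s-t)𝓛}` of something at time `t`, so that they can be
      -- compared under the same kernel.
      have hu : semigroupL (s - τ) g y = semigroupL (s - t) (semigroupL (t - τ) g) y := by
        rw [semigroupL_semigroupL hst ht0 hgP]; congr 1; ring
      rw [hu, Real.norm_eq_abs]
      set A := M / √τ * ((K * (t - τ)) ^ n / n.factorial) with hA
      have hA0 : 0 ≤ A := by positivity
      have hub : ∀ x, |semigroupL (t - τ) g x| ≤ Real.exp ρ * gaussMom k * M * (1 + |x|) ^ k :=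
        fun x => abs_dysonTerm_zero_le (p := p) ht' hg hgM x
      refine (abs_semigroupL_sub_le hst ((hgP.dysonTerm hV hτ ht.1.le n).potV_mul hV (hτ.trans ht.1.le))
        (hgP.semigroupL ht0) (e := Cv * A) (Λ := Cv * (Real.exp ρ * gaussMom k) * A) (k := k)
        (by positivity) (by positivity) fun x => ?_).trans ?_
      · have e : potV p t x * dysonTerm p n t τ g x - c t * semigroupL (t - τ) g x =
            potV p t x * (dysonTerm p n t τ g x
              - potPath p τ t x ^ n / n.factorial * semigroupL (t - τ) g x)
            + (potV p t x * potPath p τ t x ^ n - potV p t (Real.exp (-(s - t) / 2) * y) *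
              potPath p τ t (Real.exp (-(s - t) / 2) * y) ^ n) / n.factorial *
              semigroupL (t - τ) g x := by
          simp only [hc]; ring
        rw [e]
        refine (abs_add_le _ _).trans ?_
        rw [abs_mul, abs_mul, abs_div, abs_of_pos (show (0 : ℝ) < n.factorial by positivity)]
        have q1 : |potV p t x| * |dysonTerm p n t τ g x
              - potPath p τ t x ^ n / n.factorial * semigroupL (t - τ) g x| ≤
            Cv * (A * (1 + |x|) ^ k) :=
          mul_le_mul (hV.bdd t (hτ.trans ht.1.le) x) (ih t ht' x) (abs_nonneg _) (by linarith)
        have q2 := abs_potV_mul_potPath_pow_sub_le hp hV hτ ht.1.le n x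
          (Real.exp (-(s - t) / 2) * y)
        have q3 : Cv * (2 * (Cv * (t - τ))) ^ n / √τ * |x - Real.exp (-(s - t) / 2) * y| ≤
            Cv * (K * (t - τ)) ^ n / √τ * |x - Real.exp (-(s - t) / 2) * y| := by
          rw [show 2 * (Cv * (t - τ)) = 2 * Cv * (t - τ) by ring]
          gcongr
        have q4 := mul_le_mul (div_le_div_of_nonneg_right (q2.trans q3)
          (show (0 : ℝ) ≤ n.factorial by positivity)) (hub x) (abs_nonneg _) (by positivity)
        refine (add_le_add q1 q4).trans (le_of_eq ?_)
        rw [hA]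
        ring
      · have hE : Real.exp (s - t) ≤ Real.exp ρ := Real.exp_le_exp.2 (by linarith [ht.1, hs.2])
        calc _ ≤ Real.exp ρ * gaussMom (k + 1) * (Cv * A + Cv * (Real.exp ρ * gaussMom k) * A)
              * (1 + |y|) ^ k := by gcongr
          _ = Real.exp ρ * gaussMom (k + 1) * (Cv * (1 + Real.exp ρ * gaussMom k)) * A *
              (1 + |y|) ^ k := by ring
          _ ≤ K * A * (1 + |y|) ^ k := by gcongr
          _ = _ := by rw [hA, mul_pow]; ring
    · rw [intervalIntegral.integral_const_mul]
      have e : ∫ t in τ..s, (t - τ) ^ n = (s - τ) ^ (n + 1) / (n + 1) := by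
        rw [intervalIntegral.integral_comp_sub_right (fun t => t ^ n), integral_pow]
        simp
      rw [e, Nat.factorial_succ, mul_pow, pow_succ K n]
      push_cast
      refine le_of_eq ?_
      field_simp

/-- Comparison of the evolution with the free semigroup multiplied by the exponential of the
potential integrated along the deterministic path. -/
lemma abs_fundK_sub_potPath_le (hp : 1 < p) (hV : PotBounds p Cv) (hτ : 1 ≤ τ) {g : ℝ → ℝ}
    (hg : Measurable g) {M : ℝ} {k : ℕ} (hgM : ∀ y, |g y| ≤ M * (1 + |y|) ^ k) {s : ℝ}
    (hs : s ∈ Icc τ (τ + ρ)) (y : ℝ) :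
    |fundK p s τ g y - Real.exp (potPath p τ s y) * semigroupL (s - τ) g y| ≤
      Real.exp (pathC Cv ρ k * ρ) * (M / √τ) * (1 + |y|) ^ k := by
  have hM := nonneg_of_abs_le_mul_pow (hgM 0)
  have hCv := hV.one_le
  have hs0 : 0 ≤ s - τ := sub_nonneg.2 hs.1
  have h1 := (summable_dysonTerm hV hτ hg hgM hs.1 y).hasSum
  have h2 := (hasSum_pow_div_factorial (potPath p τ s y)).mul_right (semigroupL (s - τ) g y)
  have h3 := h1.sub h2
  have e : fundK p s τ g y - Real.exp (potPath p τ s y) * semigroupL (s - τ) g y =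
      ∑' n : ℕ, (dysonTerm p n s τ g y - potPath p τ s y ^ n / n.factorial *
        semigroupL (s - τ) g y) := h3.tsum_eq.symm
  rw [e, ← Real.norm_eq_abs]
  refine (tsum_of_norm_bounded (((hasSum_pow_div_factorial (pathC Cv ρ k * (s - τ))).mul_left
    (M / √τ)).mul_right ((1 + |y|) ^ k))
    fun n => abs_dysonTerm_sub_potPath_le hp hV hτ hg hgM n s hs y).trans ?_
  have hK : 0 ≤ pathC Cv ρ k := by
    have := gaussMom_pos k
    have := gaussMom_pos (k + 1)
    unfold pathC; positivity
  calc _ = Real.exp (pathC Cv ρ k * (s - τ)) * (M / √τ) * (1 + |y|) ^ k := by ring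
    _ ≤ _ := by gcongr; linarith [hs.2]

end

/-! ### The cutoff and the projections -/

/-- A cutoff bounded by `c` on the half-line. -/
structure CutoffBound (χ₀ : ℝ → ℝ) (c : ℝ) : Prop where
  isCutoff : IsCutoff χ₀
  one_le : 1 ≤ c
  bdd : ∀ z ≥ 0, |χ₀ z| ≤ c

lemma IsCutoff.exists_bound {χ₀ : ℝ → ℝ} (h : IsCutoff χ₀) : ∃ c, CutoffBound χ₀ c := by
  obtain ⟨c, hc⟩ := (isCompact_Icc (a := (0 : ℝ)) (b := 2)).exists_bound_of_continuousOn
    (h.1.continuousOn.mono Icc_subset_Ici_self)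
  refine ⟨max 1 c, h, le_max_left _ _, fun z hz => ?_⟩
  rcases le_or_gt z 2 with h2 | h2
  · exact (hc z ⟨hz, h2⟩).trans (le_max_right _ _)
  · rw [h.2.1 z h2, abs_zero]; positivity

lemma IsCutoff.continuous_comp_abs {χ₀ : ℝ → ℝ} (h : IsCutoff χ₀) : Continuous fun z => χ₀ |z| :=
  h.1.continuousOn.comp_continuous _root_.continuous_abs fun z => abs_nonneg z

section
variable {χ₀ : ℝ → ℝ} {c K₀ s : ℝ}

lemma cutoff_eq_comp_abs (hK : 0 ≤ K₀) (y : ℝ) : cutoff χ₀ K₀ s y = χ₀ |y / (K₀ * √s)| := by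
  rw [cutoff, abs_div, abs_of_nonneg (by positivity : 0 ≤ K₀ * √s)]

lemma IsCutoff.continuous_cutoff (h : IsCutoff χ₀) (hK : 0 ≤ K₀) :
    Continuous (cutoff χ₀ K₀ s) := by
  have : cutoff χ₀ K₀ s = fun y => χ₀ |y / (K₀ * √s)| := funext fun y => cutoff_eq_comp_abs hK y
  rw [this]
  exact h.continuous_comp_abs.comp (continuous_id.div_const _)

lemma CutoffBound.abs_cutoff_le (h : CutoffBound χ₀ c) (hK : 0 ≤ K₀) (y : ℝ) :
    |cutoff χ₀ K₀ s y| ≤ c :=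
  h.bdd _ (by positivity)

lemma CutoffBound.abs_one_sub_cutoff_le (h : CutoffBound χ₀ c) (hK : 0 ≤ K₀) (y : ℝ) :
    |1 - cutoff χ₀ K₀ s y| ≤ 2 * c := by
  have h1 := h.abs_cutoff_le (s := s) hK y
  have h2 := h.one_le
  rw [abs_le] at *
  constructor <;> linarith [h1.1, h1.2]

lemma IsCutoff.cutoff_eq_one (h : IsCutoff χ₀) (hK : 0 < K₀) (hs : 0 < s) {y : ℝ}
    (hy : |y| ≤ K₀ * √s) : cutoff χ₀ K₀ s y = 1 := by
  have : 0 < √s := Real.sqrt_pos.2 hs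
  exact h.2.2 _ ⟨by positivity, (div_le_one (by positivity)).2 hy⟩

lemma IsCutoff.cutoff_eq_zero (h : IsCutoff χ₀) (hK : 0 < K₀) (hs : 0 < s) {y : ℝ}
    (hy : 2 * (K₀ * √s) < |y|) : cutoff χ₀ K₀ s y = 0 := by
  have : 0 < √s := Real.sqrt_pos.2 hs
  exact h.2.1 _ ((lt_div_iff₀ (by positivity)).2 hy)

lemma CutoffBound.polyBdd_cutoff (h : CutoffBound χ₀ c) (hK : 0 ≤ K₀) :
    PolyBdd (cutoff χ₀ K₀ s) :=
  PolyBdd.of_bound (M := c) (k := 0) (h.isCutoff.continuous_cutoff hK).measurable fun y => by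
    rw [pow_zero, mul_one]; exact h.abs_cutoff_le hK y

lemma CutoffBound.polyBdd_innerPart (h : CutoffBound χ₀ c) (hK : 0 ≤ K₀) {g : ℝ → ℝ}
    (hg : PolyBdd g) : PolyBdd (innerPart χ₀ K₀ s g) :=
  (h.polyBdd_cutoff hK).mul hg

lemma CutoffBound.polyBdd_outerPart (h : CutoffBound χ₀ c) (hK : 0 ≤ K₀) {g : ℝ → ℝ}
    (hg : PolyBdd g) : PolyBdd (outerPart χ₀ K₀ s g) :=
  ((PolyBdd.const 1).sub (h.polyBdd_cutoff hK)).mul hg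

lemma innerPart_add_outerPart (g : ℝ → ℝ) (y : ℝ) :
    innerPart χ₀ K₀ s g y + outerPart χ₀ K₀ s g y = g y := by
  unfold innerPart outerPart; ring

lemma mode_eq (m : ℕ) (g : ℝ → ℝ) :
    mode χ₀ K₀ s m g = ∫ y, innerPart χ₀ K₀ s g y * dualHerm m y ∂wGauss := by
  unfold mode
  exact integral_mul_gaussWeight fun y => innerPart χ₀ K₀ s g y * dualHerm m y

lemma CutoffBound.abs_innerPart_le (h : CutoffBound χ₀ c) (hK : 0 < K₀) (hs : 0 < s) {g : ℝ → ℝ}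
    {B : ℝ → ℝ} {y : ℝ} (hB : 0 ≤ B y) (hg : |y| ≤ 2 * (K₀ * √s) → |g y| ≤ B y) :
    |innerPart χ₀ K₀ s g y| ≤ c * B y := by
  have hc := h.one_le
  unfold innerPart
  rcases le_or_gt |y| (2 * (K₀ * √s)) with hy | hy
  · rw [abs_mul]
    exact mul_le_mul (h.abs_cutoff_le hK.le y) (hg hy) (abs_nonneg _) (by linarith)
  · rw [h.isCutoff.cutoff_eq_zero hK hs hy, zero_mul, abs_zero]
    positivity

lemma CutoffBound.abs_mode_le (h : CutoffBound χ₀ c) (hK : 0 < K₀) (hs : 0 < s) {g : ℝ → ℝ}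
    {M : ℝ} {k m : ℕ} (hm : m < 3)
    (hg : ∀ y, |y| ≤ 2 * (K₀ * √s) → |g y| ≤ M * (1 + |y|) ^ k) :
    |mode χ₀ K₀ s m g| ≤ c * wMom (k + m) * M := by
  have hM := nonneg_of_abs_le_mul_pow (hg 0 (by rw [abs_zero]; positivity))
  rw [mode_eq]
  refine (abs_integral_wGauss_le (M := c * M) (k := k + m) fun y => ?_).trans (le_of_eq (by ring))
  rw [abs_mul, pow_add, ← mul_assoc]
  have hc := h.one_le
  refine mul_le_mul ?_ (abs_dualHerm_le hm y) (abs_nonneg _) (by positivity)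
  rw [mul_assoc]
  exact h.abs_innerPart_le hK hs (B := fun y => M * (1 + |y|) ^ k) (by positivity) (hg y)

lemma CutoffBound.mode_add (h : CutoffBound χ₀ c) (hK : 0 ≤ K₀) {f g : ℝ → ℝ} (hf : PolyBdd f)
    (hg : PolyBdd g) {m : ℕ} (hm : m < 3) :
    mode χ₀ K₀ s m (fun y => f y + g y) = mode χ₀ K₀ s m f + mode χ₀ K₀ s m g := by
  rw [mode_eq, mode_eq, mode_eq, ← integral_add
    ((h.polyBdd_innerPart hK hf).mul (polyBdd_dualHerm hm)).integrable_wGauss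
    ((h.polyBdd_innerPart hK hg).mul (polyBdd_dualHerm hm)).integrable_wGauss]
  congr 1
  ext y
  unfold innerPart
  ring

lemma mode_const_mul (a : ℝ) (f : ℝ → ℝ) (m : ℕ) :
    mode χ₀ K₀ s m (fun y => a * f y) = a * mode χ₀ K₀ s m f := by
  unfold mode
  rw [← integral_const_mul]
  congr 1
  ext y
  unfold innerPart
  ring

lemma CutoffBound.negativePart_add (h : CutoffBound χ₀ c) (hK : 0 ≤ K₀) {f g : ℝ → ℝ}
    (hf : PolyBdd f) (hg : PolyBdd g) (y : ℝ) :
    negativePart χ₀ K₀ s (fun y => f y + g y) y =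
      negativePart χ₀ K₀ s f y + negativePart χ₀ K₀ s g y := by
  unfold negativePart
  have : ∑ m ∈ Finset.range 3, mode χ₀ K₀ s m (fun y => f y + g y) * herm m y =
      ∑ m ∈ Finset.range 3, mode χ₀ K₀ s m f * herm m y +
        ∑ m ∈ Finset.range 3, mode χ₀ K₀ s m g * herm m y := by
    rw [← Finset.sum_add_distrib]
    refine Finset.sum_congr rfl fun m hm => ?_
    rw [h.mode_add hK hf hg (Finset.mem_range.1 hm), add_mul]
  rw [this]
  unfold innerPart
  ring

lemma negativePart_const_mul (a : ℝ) (f : ℝ → ℝ) (y : ℝ) :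
    negativePart χ₀ K₀ s (fun y => a * f y) y = a * negativePart χ₀ K₀ s f y := by
  unfold negativePart
  simp_rw [mode_const_mul, mul_assoc, ← Finset.mul_sum]
  unfold innerPart
  ring

lemma one_add_abs_cube_le (y : ℝ) : (1 + |y|) ^ 3 ≤ 4 * (1 + |y| ^ 3) := by
  have h := abs_nonneg y
  nlinarith [mul_nonneg (add_nonneg zero_le_one h) (sq_nonneg (1 - |y|))]

lemma one_add_cube_abs_le (y : ℝ) : 1 + |y| ^ 3 ≤ (1 + |y|) ^ 3 := by
  have h := abs_nonneg y
  have : 0 ≤ 3 * |y| + 3 * |y| ^ 2 := by positivity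
  nlinarith

/-- The norm of the projection on the negative part. -/
noncomputable def negC (c : ℝ) : ℝ := 4 * c * (1 + 2 * wMom 3 + 2 * wMom 4 + 2 * wMom 5)

lemma CutoffBound.negC_pos (h : CutoffBound χ₀ c) : 0 < negC c := by
  have := h.one_le
  have := wMom_pos 3
  have := wMom_pos 4
  have := wMom_pos 5
  unfold negC
  positivity

/-- Only values on the support of the cutoff enter, both in the inner part and in the three
coefficients; the cubic weight dominates `h₀, h₁, h₂`. -/
lemma CutoffBound.abs_negativePart_le (h : CutoffBound χ₀ c) (hK : 0 < K₀) (hs : 0 < s)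
    {g : ℝ → ℝ} {M : ℝ} (hg : ∀ y, |y| ≤ 2 * (K₀ * √s) → |g y| ≤ M * (1 + |y|) ^ 3) (y : ℝ) :
    |negativePart χ₀ K₀ s g y| ≤ negC c * M * (1 + |y| ^ 3) := by
  have hM := nonneg_of_abs_le_mul_pow (hg 0 (by rw [abs_zero]; positivity))
  have hc := h.one_le
  have h0 := h.abs_mode_le (m := 0) hK hs (by norm_num) hg
  have h1 := h.abs_mode_le (m := 1) hK hs (by norm_num) hg
  have h2 := h.abs_mode_le (m := 2) hK hs (by norm_num) hg
  have hb := h.abs_innerPart_le (y := y) hK hs (B := fun y => M * (1 + |y|) ^ 3) (by positivity)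
    (hg y)
  have w3 := wMom_pos 3
  have w4 := wMom_pos 4
  have w5 := wMom_pos 5
  have key : ∀ m < 3, |mode χ₀ K₀ s m g * herm m y| ≤ c * wMom (3 + m) * M * (2 * (1 + |y|) ^ 3) :=
    fun m hm => by
      have w := wMom_pos (3 + m)
      rw [abs_mul]
      refine mul_le_mul (h.abs_mode_le hK hs hm hg) ((abs_herm_le hm y).trans ?_) (abs_nonneg _)
        (by positivity)
      have := one_add_abs_pow_mono y (show m ≤ 3 by omega)
      linarith
  unfold negativePart
  simp only [Finset.sum_range_succ, Finset.sum_range_zero, zero_add]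
  have k0 := key 0 (by norm_num)
  have k1 := key 1 (by norm_num)
  have k2 := key 2 (by norm_num)
  refine (abs_sub _ _).trans ?_
  have t1 := abs_add_le (mode χ₀ K₀ s 0 g * herm 0 y + mode χ₀ K₀ s 1 g * herm 1 y)
    (mode χ₀ K₀ s 2 g * herm 2 y)
  have t2 := abs_add_le (mode χ₀ K₀ s 0 g * herm 0 y) (mode χ₀ K₀ s 1 g * herm 1 y)
  have e : c * (M * (1 + |y|) ^ 3) + (c * wMom 3 * M * (2 * (1 + |y|) ^ 3) +
      c * wMom 4 * M * (2 * (1 + |y|) ^ 3) + c * wMom 5 * M * (2 * (1 + |y|) ^ 3)) =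
      c * (1 + 2 * wMom 3 + 2 * wMom 4 + 2 * wMom 5) * M * (1 + |y|) ^ 3 := by ring
  calc _ ≤ c * (1 + 2 * wMom 3 + 2 * wMom 4 + 2 * wMom 5) * M * (1 + |y|) ^ 3 := by
        rw [← e]
        exact add_le_add hb (t1.trans (add_le_add (t2.trans (add_le_add k0 k1)) k2))
    _ ≤ c * (1 + 2 * wMom 3 + 2 * wMom 4 + 2 * wMom 5) * M * (4 * (1 + |y| ^ 3)) := by
        gcongr; exact one_add_abs_cube_le y
    _ = _ := by unfold negC; ring

/-- Outside of the region where the cutoff is `1`, powers of `1/√s` can be traded for weights. -/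
lemma one_le_weight_div_sqrt (hK : 1 ≤ K₀) (hs : 0 < s) {y : ℝ} (hy : K₀ * √s ≤ |y|) (l : ℕ) :
    1 ≤ (1 + |y|) ^ l / √s ^ l := by
  have h0 : 0 < √s := Real.sqrt_pos.2 hs
  have h1 : √s ≤ 1 + |y| := by nlinarith
  rw [← div_pow]
  exact one_le_pow₀ ((one_le_div h0).2 h1)

lemma CutoffBound.abs_one_sub_cutoff_le_weight (h : CutoffBound χ₀ c) (hK : 1 ≤ K₀) (hs : 0 < s)
    (y : ℝ) (l : ℕ) : |1 - cutoff χ₀ K₀ s y| ≤ 2 * c * ((1 + |y|) ^ l / √s ^ l) := by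
  have hc := h.one_le
  have h0 : 0 < √s := Real.sqrt_pos.2 hs
  rcases le_or_gt |y| (K₀ * √s) with hy | hy
  · rw [h.isCutoff.cutoff_eq_one (by linarith) hs hy, sub_self, abs_zero]
    positivity
  · exact (h.abs_one_sub_cutoff_le (by linarith) y).trans
      (le_mul_of_one_le_right (mul_nonneg zero_le_two (zero_le_one.trans hc)) (one_le_weight_div_sqrt hK hs hy.le l))

/-- The modes are the Hermite coefficients up to powers of `1/√s`. -/
lemma CutoffBound.abs_mode_sub_integral_le (h : CutoffBound χ₀ c) (hK : 1 ≤ K₀) (hs : 0 < s)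
    {g : ℝ → ℝ} (mg : Measurable g) {M : ℝ} {k : ℕ} (hg : ∀ y, |g y| ≤ M * (1 + |y|) ^ k)
    {m : ℕ} (hm : m < 3) (l : ℕ) :
    |mode χ₀ K₀ s m g - ∫ y, g y * dualHerm m y ∂wGauss| ≤
      2 * c * wMom (k + m + l) * M / √s ^ l := by
  have hM := nonneg_of_abs_le_mul_pow (hg 0)
  have hc := h.one_le
  have hgP := PolyBdd.of_bound mg hg
  have h0 : 0 < √s := Real.sqrt_pos.2 hs
  rw [mode_eq, ← integral_sub
    ((h.polyBdd_innerPart (by linarith) hgP).mul (polyBdd_dualHerm hm)).integrable_wGauss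
    (hgP.mul (polyBdd_dualHerm hm)).integrable_wGauss]
  refine (abs_integral_wGauss_le (M := 2 * c * M / √s ^ l) (k := k + m + l) fun y => ?_).trans
    (le_of_eq (by ring))
  have e : innerPart χ₀ K₀ s g y * dualHerm m y - g y * dualHerm m y =
      -((1 - cutoff χ₀ K₀ s y) * g y * dualHerm m y) := by unfold innerPart; ring
  rw [e, abs_neg, abs_mul, abs_mul]
  calc _ ≤ 2 * c * ((1 + |y|) ^ l / √s ^ l) * (M * (1 + |y|) ^ k) * (1 + |y|) ^ m := by
        gcongr
        · exact h.abs_one_sub_cutoff_le_weight hK hs y l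
        · exact hg y
        · exact abs_dualHerm_le hm y
    _ = _ := by rw [pow_add, pow_add]; ring

/-- The constant of the bound on the negative part of a Hermite polynomial. -/
noncomputable def negHermC (c : ℝ) : ℝ :=
  ∑ m ∈ Finset.range 3, 16 * c * (1 + ∑ j ∈ Finset.range 3, 2 * wMom (m + j + (3 - m)))

lemma CutoffBound.negHermC_nonneg (h : CutoffBound χ₀ c) : 0 ≤ negHermC c := by
  have := h.one_le
  refine Finset.sum_nonneg fun m _ => ?_
  have := Finset.sum_nonneg fun j (_ : j ∈ Finset.range 3) =>
    mul_nonneg zero_le_two (wMom_pos (m + j + (3 - m))).le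
  positivity

/-- Without the cutoff this negative part would be zero. The cutoff error lives where `|y| ≥ K₀√s`,
and there raising the weight of `h_m` from degree `m` to `3` gains `√s^(3-m)`. -/
lemma CutoffBound.abs_negativePart_herm_le (h : CutoffBound χ₀ c) (hK : 1 ≤ K₀) (hs : 1 ≤ s)
    {m : ℕ} (hm : m < 3) (y : ℝ) :
    |negativePart χ₀ K₀ s (herm m) y| ≤ negHermC c / √s ^ (3 - m) * (1 + |y| ^ 3) := by
  have hs0 : 0 < s := by linarith
  have hc := h.one_le
  have h0 : 0 < √s := Real.sqrt_pos.2 hs0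
  have hmode : ∀ j < 3, |mode χ₀ K₀ s j (herm m) - if m = j then 1 else 0| ≤
      2 * c * wMom (m + j + (3 - m)) * 2 / √s ^ (3 - m) := fun j hj => by
    have := h.abs_mode_sub_integral_le hK hs0 (measurable_herm m) (abs_herm_le hm) hj (3 - m)
    rwa [integral_herm_mul_dualHerm hm hj] at this
  have e : negativePart χ₀ K₀ s (herm m) y = -((1 - cutoff χ₀ K₀ s y) * herm m y) -
      ∑ j ∈ Finset.range 3, (mode χ₀ K₀ s j (herm m) - if m = j then 1 else 0) * herm j y := by
    unfold negativePart innerPart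
    simp_rw [sub_mul, Finset.sum_sub_distrib, ite_mul, one_mul, zero_mul, Finset.sum_ite_eq,
      Finset.mem_range, if_pos hm]
    ring
  rw [e]
  have b1 : |(1 - cutoff χ₀ K₀ s y) * herm m y| ≤ 4 * c / √s ^ (3 - m) * (1 + |y|) ^ 3 := by
    rw [abs_mul]
    calc _ ≤ 2 * c * ((1 + |y|) ^ (3 - m) / √s ^ (3 - m)) * (2 * (1 + |y|) ^ m) := by
          gcongr
          · exact h.abs_one_sub_cutoff_le_weight hK hs0 y _
          · exact abs_herm_le hm y
      _ = 4 * c / √s ^ (3 - m) * ((1 + |y|) ^ (3 - m) * (1 + |y|) ^ m) := by ring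
      _ = _ := by rw [← pow_add, Nat.sub_add_cancel (by omega)]
  have b2 : |∑ j ∈ Finset.range 3, (mode χ₀ K₀ s j (herm m) - if m = j then 1 else 0) * herm j y| ≤
      ∑ j ∈ Finset.range 3, 2 * c * wMom (m + j + (3 - m)) * 2 / √s ^ (3 - m) *
        (2 * (1 + |y|) ^ 3) := by
    refine (Finset.abs_sum_le_sum_abs _ _).trans (Finset.sum_le_sum fun j hj => ?_)
    have hj := Finset.mem_range.1 hj
    rw [abs_mul]
    have w := wMom_pos (m + j + (3 - m))
    refine mul_le_mul (hmode j hj) ((abs_herm_le hj y).trans ?_) (abs_nonneg _) (by positivity)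
    have := one_add_abs_pow_mono y (show j ≤ 3 by omega)
    linarith
  have b3 : 16 * c * (1 + ∑ j ∈ Finset.range 3, 2 * wMom (m + j + (3 - m))) ≤ negHermC c := by
    refine Finset.single_le_sum (f := fun m =>
      16 * c * (1 + ∑ j ∈ Finset.range 3, 2 * wMom (m + j + (3 - m)))) (fun m _ => ?_)
      (Finset.mem_range.2 hm)
    have := Finset.sum_nonneg fun j (_ : j ∈ Finset.range 3) =>
      mul_nonneg zero_le_two (wMom_pos (m + j + (3 - m))).le
    positivity
  refine (abs_sub _ _).trans ?_
  rw [abs_neg]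
  refine (add_le_add b1 b2).trans ?_
  have e2 : 4 * c / √s ^ (3 - m) * (1 + |y|) ^ 3 + ∑ j ∈ Finset.range 3,
      2 * c * wMom (m + j + (3 - m)) * 2 / √s ^ (3 - m) * (2 * (1 + |y|) ^ 3) =
      4 * c * (1 + ∑ j ∈ Finset.range 3, 2 * wMom (m + j + (3 - m))) / √s ^ (3 - m) *
        (1 + |y|) ^ 3 := by
    simp only [Finset.sum_range_succ, Finset.sum_range_zero]
    ring
  rw [e2]
  have hS := Finset.sum_nonneg fun j (_ : j ∈ Finset.range 3) =>
      mul_nonneg zero_le_two (wMom_pos (m + j + (3 - m))).le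
  calc _ ≤ 4 * c * (1 + ∑ j ∈ Finset.range 3, 2 * wMom (m + j + (3 - m))) / √s ^ (3 - m) *
        (4 * (1 + |y| ^ 3)) := by gcongr; exact one_add_abs_cube_le y
    _ = 16 * c * (1 + ∑ j ∈ Finset.range 3, 2 * wMom (m + j + (3 - m))) / √s ^ (3 - m) *
        (1 + |y| ^ 3) := by ring
    _ ≤ _ := by gcongr

lemma CutoffBound.polyBdd_negativePart (h : CutoffBound χ₀ c) (hK : 0 ≤ K₀) {g : ℝ → ℝ}
    (hg : PolyBdd g) : PolyBdd (negativePart χ₀ K₀ s g) :=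
  (h.polyBdd_innerPart hK hg).sub
    (PolyBdd.sum _ fun _ hm => (polyBdd_herm (Finset.mem_range.1 hm)).const_mul _)

/-- This is the orthogonality required by `exists_abs_semigroupL_le_of_orthogonal`. -/
lemma CutoffBound.integral_negativePart_mul_herm (h : CutoffBound χ₀ c) (hK : 0 ≤ K₀)
    {g : ℝ → ℝ} (hg : PolyBdd g) {m : ℕ} (hm : m < 3) :
    ∫ y, negativePart χ₀ K₀ s g y * herm m y ∂wGauss = 0 := by
  have hd : ∫ y, negativePart χ₀ K₀ s g y * dualHerm m y ∂wGauss = 0 := by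
    unfold negativePart
    simp_rw [sub_mul, Finset.sum_mul, mul_assoc]
    rw [integral_sub ((h.polyBdd_innerPart hK hg).mul (polyBdd_dualHerm hm)).integrable_wGauss
      (PolyBdd.sum _ fun j hj => ((polyBdd_herm (Finset.mem_range.1 hj)).mul
        (polyBdd_dualHerm hm)).const_mul _).integrable_wGauss,
      integral_finsetSum _ fun j hj => (((polyBdd_herm (Finset.mem_range.1 hj)).mul
        (polyBdd_dualHerm hm)).const_mul _).integrable_wGauss, ← mode_eq]
    simp_rw [integral_const_mul]
    rw [Finset.sum_congr rfl fun j hj => by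
      rw [integral_herm_mul_dualHerm (Finset.mem_range.1 hj) hm]]
    simp [hm]
  have e : ∀ y, negativePart χ₀ K₀ s g y * herm m y =
      hermNormSq m * (negativePart χ₀ K₀ s g y * dualHerm m y) := fun y => by
    have : hermNormSq m ≠ 0 := by
      interval_cases m <;> simp [hermNormSq_zero, hermNormSq_one, hermNormSq_two]
    rw [dualHerm_eq]
    field_simp
  simp_rw [e]
  rw [integral_const_mul, hd, mul_zero]

lemma innerPart_eq_negativePart_add (g : ℝ → ℝ) (y : ℝ) : innerPart χ₀ K₀ s g y =
    negativePart χ₀ K₀ s g y + ∑ m ∈ Finset.range 3, mode χ₀ K₀ s m g * herm m y := by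
  unfold negativePart; ring

/-- The negative part controls the first modes. -/
lemma CutoffBound.abs_mode_le_of_negativePart (h : CutoffBound χ₀ c) (hK : 1 ≤ K₀) (hs : 1 ≤ s)
    {g : ℝ → ℝ} {N : ℝ} (hN : ∀ y, |negativePart χ₀ K₀ s g y| ≤ N * (1 + |y| ^ 3)) {m : ℕ}
    (hm : m < 3) : |mode χ₀ K₀ s m g| ≤ 500 * K₀ ^ 3 * N * √s ^ (3 - m) := by
  have hs0 : 0 < s := by linarith
  have hsq : 1 ≤ √s := Real.one_le_sqrt.2 hs
  set L := K₀ * √s with hL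
  have hL1 : 1 ≤ L := one_le_mul_of_one_le_of_one_le hK hsq
  have hN0 : 0 ≤ N := by
    have := hN 0
    simp only [abs_zero, ne_eq, OfNat.ofNat_ne_zero, not_false_eq_true, zero_pow, add_zero,
      mul_one] at this
    exact (abs_nonneg _).trans this
  -- Outside the support of the cutoff the negative part is minus the quadratic polynomial with the
  -- modes as coefficients, and `1 + 6³ = 217`.
  have key : ∀ y, 2 * L < |y| → |y| ≤ 6 * L →
      |mode χ₀ K₀ s 0 g + mode χ₀ K₀ s 1 g * y + mode χ₀ K₀ s 2 g * (y ^ 2 - 2)| ≤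
        217 * N * L ^ 3 := fun y h1 h2 => by
    have h3 := hN y
    have e : negativePart χ₀ K₀ s g y =
        -(mode χ₀ K₀ s 0 g + mode χ₀ K₀ s 1 g * y + mode χ₀ K₀ s 2 g * (y ^ 2 - 2)) := by
      unfold negativePart innerPart
      rw [h.isCutoff.cutoff_eq_zero (by linarith) hs0 h1]
      simp only [Finset.sum_range_succ, Finset.sum_range_zero, herm_zero, herm_one, herm_two]
      ring
    rw [e, abs_neg] at h3
    refine h3.trans ?_
    have h4 : |y| ^ 3 ≤ (6 * L) ^ 3 := by gcongr
    have h5 : 1 ≤ L ^ 3 := one_le_pow₀ hL1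
    have : 1 + |y| ^ 3 ≤ 217 * L ^ 3 := by nlinarith
    calc N * (1 + |y| ^ 3) ≤ N * (217 * L ^ 3) := by gcongr
      _ = _ := by ring
  have hL0 : 0 < L := by linarith
  -- Values at `±3L` and `±6L` determine the three coefficients: even parts at two radii give modes
  -- `2` and `0`, an odd part gives mode `1`, with the scaling `L^(3-m)`.
  have a1 := key (3 * L) (by rw [abs_of_pos (by positivity)]; linarith)
    (by rw [abs_of_pos (by positivity)]; linarith)
  have a2 := key (-(3 * L)) (by rw [abs_neg, abs_of_pos (by positivity)]; linarith)
    (by rw [abs_neg, abs_of_pos (by positivity)]; linarith)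
  have a3 := key (6 * L) (by rw [abs_of_pos (by positivity)]; linarith)
    (by rw [abs_of_pos (by positivity)])
  have a4 := key (-(6 * L)) (by rw [abs_neg, abs_of_pos (by positivity)]; linarith)
    (by rw [abs_neg, abs_of_pos (by positivity)])
  obtain ⟨q0, hq0⟩ : ∃ q0, q0 = mode χ₀ K₀ s 0 g := ⟨_, rfl⟩
  obtain ⟨q1, hq1⟩ : ∃ q1, q1 = mode χ₀ K₀ s 1 g := ⟨_, rfl⟩
  rw [← hq0, ← hq1] at a1 a2 a3 a4
  have fin : ∀ q : ℝ, ∀ j ≤ 3, |q| ≤ 500 * N * L ^ j → |q| ≤ 500 * K₀ ^ 3 * N * √s ^ j :=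
    fun q j hj hq => by
      refine hq.trans ?_
      rw [hL, mul_pow]
      have : K₀ ^ j ≤ K₀ ^ 3 := pow_le_pow_right₀ hK hj
      calc 500 * N * (K₀ ^ j * √s ^ j) ≤ 500 * N * (K₀ ^ 3 * √s ^ j) := by gcongr
        _ = _ := by ring
  obtain ⟨M, hM⟩ : ∃ M, M = 217 * N * L ^ 3 := ⟨_, rfl⟩
  rw [← hM] at a1 a2 a3 a4
  rw [abs_le] at a1 a2 a3 a4
  have b2 : |mode χ₀ K₀ s 2 g| * (27 * L ^ 2) ≤ 2 * M := by
    rw [← abs_of_pos (show 0 < 27 * L ^ 2 by positivity), ← abs_mul, abs_le]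
    constructor <;> nlinarith
  have b1 : |q1| * (3 * L) ≤ M := by
    rw [← abs_of_pos (show 0 < 3 * L by positivity), ← abs_mul, abs_le]
    constructor <;> nlinarith
  have b0 : |q0| ≤ 2 * M := by
    have d1 : |q0 + mode χ₀ K₀ s 2 g * (9 * L ^ 2 - 2)| ≤ M := by
      rw [abs_le]
      constructor <;> nlinarith
    have d2 : |mode χ₀ K₀ s 2 g * (9 * L ^ 2 - 2)| ≤ M := by
      rw [abs_mul, abs_of_pos (by nlinarith : 0 < 9 * L ^ 2 - 2)]
      nlinarith [abs_nonneg (mode χ₀ K₀ s 2 g)]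
    have := abs_sub (q0 + mode χ₀ K₀ s 2 g * (9 * L ^ 2 - 2)) (mode χ₀ K₀ s 2 g * (9 * L ^ 2 - 2))
    rw [add_sub_cancel_right] at this
    linarith
  have hN3 : 0 ≤ N * L ^ 2 := by positivity
  interval_cases m
  · rw [← hq0]
    refine fin _ 3 le_rfl (b0.trans ?_)
    rw [hM]
    nlinarith [mul_nonneg hN3 hL0.le]
  · rw [← hq1]
    refine fin _ 2 (by norm_num) (le_of_mul_le_mul_right (b1.trans ?_) (by positivity : 0 < 3 * L))
    rw [hM]
    nlinarith [mul_nonneg hN3 hL0.le]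
  · refine fin _ 1 (by norm_num) (le_of_mul_le_mul_right (b2.trans ?_)
      (by positivity : 0 < 27 * L ^ 2))
    rw [hM]
    nlinarith [mul_nonneg hN3 hL0.le]

/-! ### Pointwise bounds from the essential supremum -/

/-- The set where a continuous function exceeds its essential supremum is open and null, hence
empty. -/
lemma abs_le_toReal_linf {g : ℝ → ℝ} (hg : Continuous g) (h : linf g ≠ ⊤) (y : ℝ) :
    |g y| ≤ (linf g).toReal := by
  by_contra hcon
  push Not at hcon
  have hopen : IsOpen {y | (linf g).toReal < |g y|} := isOpen_lt continuous_const hg.abs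
  have hz : volume {y | (linf g).toReal < |g y|} = 0 := by
    have hae : ∀ᵐ y, ‖g y‖ₑ ≤ linf g := by
      unfold linf
      rw [eLpNorm_exponent_top]
      exact ae_le_eLpNormEssSup
    refine measure_mono_null (fun y hy => ?_) (ae_iff.1 hae)
    intro hle
    have := ENNReal.toReal_mono h hle
    rw [toReal_enorm, Real.norm_eq_abs] at this
    exact absurd this (not_le.2 hy)
  exact (hopen.measure_pos volume ⟨y, hcon⟩).ne' hz

lemma linf_le_ofReal {g : ℝ → ℝ} {M : ℝ} (h : ∀ y, |g y| ≤ M) : linf g ≤ ENNReal.ofReal M := by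
  unfold linf
  rw [eLpNorm_exponent_top]
  exact eLpNormEssSup_le_of_ae_bound (Filter.Eventually.of_forall h)

lemma linfW_le_ofReal {g : ℝ → ℝ} {M : ℝ} (h : ∀ y, |g y| ≤ M * (1 + |y| ^ 3)) :
    linfW g ≤ ENNReal.ofReal M :=
  linf_le_ofReal fun y => by
    have : 0 < 1 + |y| ^ 3 := by positivity
    rw [abs_div, abs_of_pos this, div_le_iff₀ this]
    exact h y

lemma abs_le_toReal_linfW {g : ℝ → ℝ} (hg : Continuous g) (h : linfW g ≠ ⊤) (y : ℝ) :
    |g y| ≤ (linfW g).toReal * (1 + |y| ^ 3) := by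
  have hpos : ∀ y : ℝ, 0 < 1 + |y| ^ 3 := fun y => by positivity
  have := abs_le_toReal_linf (g := fun y => g y / (1 + |y| ^ 3))
    (hg.div (by fun_prop) fun y => (hpos y).ne') h y
  rwa [abs_div, abs_of_pos (hpos y), div_le_iff₀ (hpos y)] at this

end

/-! ### The second mode of the linear evolution -/

/-- Smoothness at the origin holds because the cutoff equals `1` on `[0,1]`, so the corner of the
absolute value is not seen. -/
lemma IsCutoff.contDiff_comp_abs {χ₀ : ℝ → ℝ} (h : IsCutoff χ₀) :
    ContDiff ℝ ∞ fun z => χ₀ |z| := by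
  rw [contDiff_iff_contDiffAt]
  intro z
  have hpos : ∀ x : ℝ, 0 < x → ContDiffAt ℝ ∞ χ₀ x := fun x hx => h.1.contDiffAt (Ici_mem_nhds hx)
  rcases lt_trichotomy z 0 with hz | hz | hz
  · have : (fun z => χ₀ |z|) =ᶠ[nhds z] fun z => χ₀ (-z) := by
      filter_upwards [Iio_mem_nhds hz] with x hx
      rw [abs_of_neg hx]
    refine ContDiffAt.congr_of_eventuallyEq ?_ this
    exact (hpos (-z) (by linarith)).comp z contDiff_neg.contDiffAt
  · have : (fun z => χ₀ |z|) =ᶠ[nhds z] fun _ => 1 := by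
      subst hz
      filter_upwards [Ioo_mem_nhds (show (-1 : ℝ) < 0 by norm_num) (show (0 : ℝ) < 1 by norm_num)]
        with x hx
      exact h.2.2 _ ⟨abs_nonneg _, (abs_lt.2 hx).le⟩
    exact contDiffAt_const.congr_of_eventuallyEq this
  · have : (fun z => χ₀ |z|) =ᶠ[nhds z] fun z => χ₀ z := by
      filter_upwards [Ioi_mem_nhds hz] with x hx
      rw [abs_of_pos hx]
    exact (hpos z hz).congr_of_eventuallyEq this

/-- The complement of the cutoff, as a function on the line, with its first two derivatives. -/
lemma IsCutoff.exists_complement {χ₀ : ℝ → ℝ} (h : IsCutoff χ₀) : ∃ η' η'' : ℝ → ℝ, ∃ b, 1 ≤ b ∧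
    (∀ z, HasDerivAt (fun z => 1 - χ₀ |z|) (η' z) z) ∧ (∀ z, HasDerivAt η' (η'' z) z) ∧
    (∀ z, |1 - χ₀ (|z|)| ≤ b ∧ |η' z| ≤ b ∧ |η'' z| ≤ b) ∧
    ∀ z, |z| < 1 → 1 - χ₀ |z| = 0 ∧ η' z = 0 ∧ η'' z = 0 := by
  set η : ℝ → ℝ := fun z => 1 - χ₀ |z| with hη
  have hsm : ContDiff ℝ ∞ η := contDiff_const.sub h.contDiff_comp_abs
  have hsm1 : ContDiff ℝ ∞ (deriv η) := ((contDiff_infty_iff_deriv).1 hsm).2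
  have hsm2 : ContDiff ℝ ∞ (deriv (deriv η)) := ((contDiff_infty_iff_deriv).1 hsm1).2
  have hne : (∞ : WithTop ℕ∞) ≠ 0 := by simp
  have hloc : ∀ z : ℝ, |z| < 1 → η =ᶠ[nhds z] fun _ => 0 := fun z hz => by
    filter_upwards [(isOpen_lt _root_.continuous_abs continuous_const).mem_nhds hz] with x hx
    rw [hη]; simp only; rw [h.2.2 _ ⟨abs_nonneg _, le_of_lt hx⟩, sub_self]
  have hloc2 : ∀ z : ℝ, 2 < |z| → η =ᶠ[nhds z] fun _ => 1 := fun z hz => by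
    filter_upwards [(isOpen_lt continuous_const _root_.continuous_abs).mem_nhds hz] with x hx
    rw [hη]; simp only; rw [h.2.1 _ hx, sub_zero]
  have hd1 : ∀ (z a : ℝ), η =ᶠ[nhds z] (fun _ => a) → deriv η =ᶠ[nhds z] fun _ => 0 :=
    fun z a hz => by
      have := hz.deriv
      simpa using this
  have hd2 : ∀ (z a : ℝ), η =ᶠ[nhds z] (fun _ => a) → deriv (deriv η) z = 0 := fun z a hz => by
    rw [(hd1 z a hz).deriv_eq]; simp
  obtain ⟨c, hc⟩ := h.exists_bound
  obtain ⟨b1, hb1⟩ := (isCompact_Icc (a := (-2 : ℝ)) (b := 2)).exists_bound_of_continuousOn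
    hsm1.continuous.continuousOn
  obtain ⟨b2, hb2⟩ := (isCompact_Icc (a := (-2 : ℝ)) (b := 2)).exists_bound_of_continuousOn
    hsm2.continuous.continuousOn
  refine ⟨deriv η, deriv (deriv η), max (1 + c) (max b1 b2), ?_,
    fun z => (hsm.differentiable hne z).hasDerivAt, fun z => (hsm1.differentiable hne z).hasDerivAt,
    fun z => ⟨?_, ?_, ?_⟩, fun z hz => ⟨(hloc z hz).eq_of_nhds, (hd1 z 0 (hloc z hz)).eq_of_nhds,
      hd2 z 0 (hloc z hz)⟩⟩
  · exact le_max_of_le_left (by linarith [hc.one_le])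
  · refine le_max_of_le_left ?_
    have := abs_sub 1 (χ₀ |z|)
    have h2 := hc.bdd |z| (abs_nonneg z)
    rw [abs_one] at this
    linarith
  · rcases le_or_gt |z| 2 with hz | hz
    · exact (hb1 z (abs_le.1 hz)).trans ((le_max_left _ _).trans (le_max_right _ _))
    · rw [(hd1 z 1 (hloc2 z hz)).eq_of_nhds, abs_zero]
      exact le_max_of_le_left (by linarith [hc.one_le])
  · rcases le_or_gt |z| 2 with hz | hz
    · exact (hb2 z (abs_le.1 hz)).trans ((le_max_right _ _).trans (le_max_right _ _))
    · rw [hd2 z 1 (hloc2 z hz), abs_zero]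
      exact le_max_of_le_left (by linarith [hc.one_le])

lemma inv_sqrt_sub_inv_sqrt_le {τ s : ℝ} (hτ : 1 ≤ τ) (hs : τ ≤ s) :
    |1 / √τ - 1 / √s| ≤ s - τ := by
  have h1 : 1 ≤ √τ := Real.one_le_sqrt.2 hτ
  have h2 : √τ ≤ √s := Real.sqrt_le_sqrt hs
  have e : 1 / √τ - 1 / √s = (√s - √τ) / (√τ * √s) := by
    have h3 : √s ≠ 0 := by linarith
    have h4 : √τ ≠ 0 := by linarith
    field_simp
  rw [e, abs_of_nonneg (div_nonneg (by linarith) (by positivity))]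
  refine (div_le_self (by linarith) (one_le_mul_of_one_le_of_one_le h1 (h1.trans h2))).trans ?_
  have e2 : s - τ = (√s - √τ) * (√s + √τ) := by
    have a1 := Real.sq_sqrt (show 0 ≤ s by linarith)
    have a2 := Real.sq_sqrt (show 0 ≤ τ by linarith)
    nlinarith
  rw [e2]
  exact le_mul_of_one_le_right (by linarith) (by linarith)

section
variable {χ₀ : ℝ → ℝ} {c K₀ : ℝ}

lemma semigroupL_dualHerm_two {θ : ℝ} (hθ : 0 ≤ θ) (y : ℝ) :
    semigroupL θ (dualHerm 2) y = dualHerm 2 y := by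
  have e : dualHerm 2 = fun x => 1 / 8 * (x ^ 2 - 2) := by
    ext x; rw [dualHerm_two]; ring
  rw [e, semigroupL_const_mul, semigroupL_herm_two hθ]

/-- The second mode is almost conserved by the free semigroup. -/
lemma CutoffBound.exists_abs_mode_two_semigroupL_sub_le (h : CutoffBound χ₀ c) (hK : 1 ≤ K₀)
    (ρ : ℝ) : ∃ C > 0, ∀ τ ≥ 1, ∀ s ∈ Icc τ (τ + ρ), ∀ g : ℝ → ℝ, Measurable g → ∀ M : ℝ,
      (∀ y, |g y| ≤ M * (1 + |y|) ^ 3) →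
      |mode χ₀ K₀ s 2 (semigroupL (s - τ) g) - mode χ₀ K₀ τ 2 g| ≤ C * (s - τ) * (M / τ ^ 2) := by
  obtain ⟨η', η'', b, hb, hd1, hd2, hbd, hz⟩ := h.isCutoff.exists_complement
  have hg8 := gaussMom_pos 8
  have hw10 := wMom_pos 10
  refine ⟨b * (1 + 18 * Real.exp ρ * gaussMom 8) * wMom 10, by positivity,
    fun τ hτ s hs g mg M hg => ?_⟩
  have hM := nonneg_of_abs_le_mul_pow (hg 0)
  have hgP := PolyBdd.of_bound mg hg
  have hs1 : 1 ≤ s := hτ.trans hs.1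
  have ht : 0 ≤ s - τ := sub_nonneg.2 hs.1
  have hK0 : 0 ≤ K₀ := by linarith
  have hτ2 : √τ ^ 4 = τ ^ 2 := by
    rw [show √τ ^ 4 = (√τ ^ 2) ^ 2 by ring, Real.sq_sqrt (by linarith)]
  have hs2 : √s ^ 4 = s ^ 2 := by
    rw [show √s ^ 4 = (√s ^ 2) ^ 2 by ring, Real.sq_sqrt (by linarith)]
  -- The mode is the Hermite coefficient minus a pairing with `G`. By self-adjointness and `e^{θ𝓛}k₂
  -- = k₂` the Hermite coefficients cancel, and only the change of `G` in time and under the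
  -- semigroup remains.
  set G : ℝ → ℝ → ℝ := fun s y => (1 - cutoff χ₀ K₀ s y) * dualHerm 2 y with hG
  have hGP : ∀ s, PolyBdd (G s) := fun s =>
    ((PolyBdd.const 1).sub (h.polyBdd_cutoff hK0)).mul (polyBdd_dualHerm (by norm_num))
  have hdP := polyBdd_dualHerm (m := 2) (by norm_num)
  have hmode : ∀ (s : ℝ) (f : ℝ → ℝ), PolyBdd f → mode χ₀ K₀ s 2 f =
      ∫ y, f y * dualHerm 2 y ∂wGauss - ∫ y, f y * G s y ∂wGauss := fun s f hf => by
    rw [mode_eq, ← integral_sub (hf.mul hdP).integrable_wGauss (hf.mul (hGP s)).integrable_wGauss]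
    congr 1; ext y; simp only [hG, innerPart]; ring
  -- derivatives of `G s`
  have hGs : ∀ y, |semigroupL (s - τ) (G s) y - G s y| ≤
      (s - τ) * (6 * Real.exp ρ * gaussMom 8 * (3 * b / s ^ 2)) * (1 + |y|) ^ 7 := by
    set L := K₀ * √s with hL
    have hL1 : 1 ≤ L := one_le_mul_of_one_le_of_one_le hK (Real.one_le_sqrt.2 hs1)
    have hL0 : 0 < L := by linarith
    have eG : ∀ y, G s y = (1 - χ₀ |y / L|) * ((y ^ 2 - 2) / 8) := fun y => by
      simp only [hG]; rw [cutoff_eq_comp_abs hK0, dualHerm_two]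
    have eG' : G s = fun y => (1 - χ₀ |y / L|) * ((y ^ 2 - 2) / 8) := funext eG
    have hdiv : ∀ y : ℝ, HasDerivAt (fun y => y / L) (1 / L) y := fun y =>
      (hasDerivAt_id y).div_const L
    have hsq : ∀ y : ℝ, HasDerivAt (fun y : ℝ => (y ^ 2 - 2) / 8) (y / 4) y := fun y => by
      have := ((hasDerivAt_pow 2 y).sub_const 2).div_const 8
      refine this.congr_deriv ?_
      norm_num; ring
    have hid : ∀ y : ℝ, HasDerivAt (fun y : ℝ => y / 4) (1 / 4) y := fun y =>
      (hasDerivAt_id y).div_const 4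
    have D1 : ∀ y, HasDerivAt (G s) (η' (y / L) / L * ((y ^ 2 - 2) / 8) +
        (1 - χ₀ |y / L|) * (y / 4)) y := fun y => by
      rw [eG']
      refine (((hd1 (y / L)).comp y (hdiv y)).mul (hsq y)).congr_deriv ?_
      simp only [Function.comp]; ring
    have D2 : ∀ y, HasDerivAt (fun y => η' (y / L) / L * ((y ^ 2 - 2) / 8) +
        (1 - χ₀ |y / L|) * (y / 4)) (η'' (y / L) / L / L * ((y ^ 2 - 2) / 8) +
        2 * (η' (y / L) / L * (y / 4)) + (1 - χ₀ |y / L|) * (1 / 4)) y := fun y => by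
      refine ((((((hd2 (y / L)).comp y (hdiv y))).div_const L).mul (hsq y)).add
        (((hd1 (y / L)).comp y (hdiv y)).mul (hid y))).congr_deriv ?_
      simp only [Function.comp]; ring
    -- `G` and its derivatives vanish for `|y| < K₀√s`, so four extra powers of the weight buy the
    -- factor `s⁻²`.
    have wt : ∀ y, ∀ x : ℝ, (|y| < L → x = 0) → |x| ≤ 3 * b * (1 + |y|) ^ 2 →
        |x| ≤ 3 * b / s ^ 2 * (1 + |y|) ^ 6 := fun y x h0 h1 => by
      rcases lt_or_ge |y| L with hy | hy
      · rw [h0 hy, abs_zero]; positivity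
      · have := one_le_weight_div_sqrt hK (by linarith) hy 4
        rw [hs2] at this
        calc |x| ≤ 3 * b * (1 + |y|) ^ 2 * 1 := by linarith
          _ ≤ 3 * b * (1 + |y|) ^ 2 * ((1 + |y|) ^ 4 / s ^ 2) := by gcongr
          _ = _ := by ring
    have hzL : ∀ y, |y| < L → |y / L| < 1 := fun y hy => by
      rw [abs_div, abs_of_pos hL0]; exact (div_lt_one hL0).2 hy
    have dl : ∀ x, |x| ≤ b → |x / L| ≤ b := fun x hx => by
      rw [abs_div, abs_of_pos hL0]; exact (div_le_self (abs_nonneg _) hL1).trans hx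
    have q2 : ∀ y : ℝ, |(y ^ 2 - 2) / 8| ≤ (1 + |y|) ^ 2 := fun y => by
      rw [← dualHerm_two]; exact abs_dualHerm_le (by norm_num) y
    have q1 : ∀ y : ℝ, |y / 4| ≤ (1 + |y|) ^ 2 / 2 := fun y => by
      rw [abs_div, abs_of_pos (by norm_num : (0 : ℝ) < 4)]
      nlinarith [abs_nonneg y]
    have q0 : ∀ y : ℝ, |(1 / 4 : ℝ)| ≤ (1 + |y|) ^ 2 := fun y => by
      rw [abs_of_pos (by norm_num)]; nlinarith [abs_nonneg y]
    have ml : ∀ u v w : ℝ, |u| ≤ b → |v| ≤ w → |u * v| ≤ b * w := fun u v w hu hv => by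
      rw [abs_mul]; exact mul_le_mul hu hv (abs_nonneg _) (by linarith)
    refine abs_semigroupL_sub_self_le (k := 6) ht (by linarith [hs.2]) D1 D2 (fun y => ?_)
      (fun y => ?_) fun y => ?_
    · refine wt y _ (fun hy => ?_) ?_
      · rw [eG, (hz _ (hzL y hy)).1, zero_mul]
      · rw [eG]
        refine (ml _ _ _ (hbd _).1 (q2 y)).trans ?_
        have : 0 ≤ b * (1 + |y|) ^ 2 := by positivity
        linarith
    · refine wt y _ (fun hy => ?_) ?_
      · rw [(hz _ (hzL y hy)).1, (hz _ (hzL y hy)).2.1]; ring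
      · have t1 := ml _ _ _ (dl _ (hbd (y / L)).2.1) (q2 y)
        have t2 := ml _ _ _ (hbd (y / L)).1 (q1 y)
        refine (abs_add_le _ _).trans ?_
        have : 0 ≤ b * (1 + |y|) ^ 2 := by positivity
        linarith
    · refine wt y _ (fun hy => ?_) ?_
      · rw [(hz _ (hzL y hy)).1, (hz _ (hzL y hy)).2.1, (hz _ (hzL y hy)).2.2]; ring
      · have t1 := ml _ _ _ (dl _ (dl _ (hbd (y / L)).2.2)) (q2 y)
        have t2 := ml _ _ _ (dl _ (hbd (y / L)).2.1) (q1 y)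
        have t3 := ml _ _ _ (hbd (y / L)).1 (q0 y)
        refine (abs_add_le _ _).trans ?_
        have t4 := abs_add_le (η'' (y / L) / L / L * ((y ^ 2 - 2) / 8))
          (2 * (η' (y / L) / L * (y / 4)))
        rw [abs_mul 2, abs_two] at t4
        linarith
  -- Where `|y| < K₀√τ` both cutoffs equal `1`. Elsewhere the Lipschitz dependence on `y/√s` gives
  -- the factor `s - τ` and the support gives `τ⁻²`.
  have hGd : ∀ y, |G τ y - G s y| ≤ b * (s - τ) / τ ^ 2 * (1 + |y|) ^ 7 := fun y => by
    have hsq0 : 0 < √τ := Real.sqrt_pos.2 (by linarith)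
    have hsq1 : 0 < √s := Real.sqrt_pos.2 (by linarith)
    have hle : √τ ≤ √s := Real.sqrt_le_sqrt hs.1
    simp only [hG]
    rw [← sub_mul, abs_mul]
    rcases lt_or_ge |y| (K₀ * √τ) with hy | hy
    · rw [h.isCutoff.cutoff_eq_one (by linarith) (by linarith) hy.le,
        h.isCutoff.cutoff_eq_one (by linarith) (by linarith) (hy.le.trans (by gcongr))]
      simp only [sub_self, abs_zero, zero_mul]
      positivity
    · have l1 : |(1 - χ₀ |y / (K₀ * √τ)|) - (1 - χ₀ |y / (K₀ * √s)|)| ≤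
          b * |y / (K₀ * √τ) - y / (K₀ * √s)| := by
        have := Convex.norm_image_sub_le_of_norm_hasDerivWithin_le (s := univ)
          (f := fun z => 1 - χ₀ |z|) (f' := η') (C := b)
          (fun z _ => (hd1 z).hasDerivWithinAt) (fun z _ => (hbd z).2.1) convex_univ
          (mem_univ (y / (K₀ * √s))) (mem_univ (y / (K₀ * √τ)))
        exact this
      have l2 : |y / (K₀ * √τ) - y / (K₀ * √s)| ≤ (1 + |y|) * (s - τ) := by
        have e : y / (K₀ * √τ) - y / (K₀ * √s) = y / K₀ * (1 / √τ - 1 / √s) := by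
          field_simp
        rw [e, abs_mul, abs_div, abs_of_nonneg hK0]
        refine mul_le_mul ?_ (inv_sqrt_sub_inv_sqrt_le hτ hs.1) (abs_nonneg _) (by positivity)
        exact (div_le_self (abs_nonneg _) hK).trans (by linarith)
      have l3 := one_le_weight_div_sqrt hK (by linarith) hy 4
      rw [hτ2] at l3
      rw [cutoff_eq_comp_abs hK0, cutoff_eq_comp_abs hK0]
      calc _ ≤ b * ((1 + |y|) * (s - τ)) * (1 + |y|) ^ 2 := by
            gcongr
            · exact l1.trans (by gcongr)
            · exact abs_dualHerm_le (by norm_num) y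
        _ = b * ((1 + |y|) * (s - τ)) * (1 + |y|) ^ 2 * 1 := by ring
        _ ≤ b * ((1 + |y|) * (s - τ)) * (1 + |y|) ^ 2 * ((1 + |y|) ^ 4 / τ ^ 2) := by
            gcongr
        _ = _ := by ring
  rw [hmode s _ (hgP.semigroupL ht), hmode τ g hgP, integral_semigroupL_mul ht hgP hdP,
    integral_semigroupL_mul ht hgP (hGP s)]
  simp_rw [semigroupL_dualHerm_two ht]
  rw [sub_sub_sub_cancel_left, ← integral_sub (hgP.mul (hGP τ)).integrable_wGauss
    (hgP.mul ((hGP s).semigroupL ht)).integrable_wGauss]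
  refine (abs_integral_wGauss_le (M := M * ((s - τ) / τ ^ 2 *
    (b * (1 + 18 * Real.exp ρ * gaussMom 8)))) (k := 10) fun y => ?_).trans (le_of_eq (by ring))
  rw [← mul_sub, abs_mul]
  have e : G τ y - semigroupL (s - τ) (G s) y =
    (G τ y - G s y) - (semigroupL (s - τ) (G s) y - G s y) := by ring
  have f1 : (s - τ) * (6 * Real.exp ρ * gaussMom 8 * (3 * b / s ^ 2)) * (1 + |y|) ^ 7 ≤
      (s - τ) * (6 * Real.exp ρ * gaussMom 8 * (3 * b / τ ^ 2)) * (1 + |y|) ^ 7 := by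
    have := hs.1
    gcongr
  calc _ ≤ M * (1 + |y|) ^ 3 * (b * (s - τ) / τ ^ 2 * (1 + |y|) ^ 7 +
        (s - τ) * (6 * Real.exp ρ * gaussMom 8 * (3 * b / τ ^ 2)) * (1 + |y|) ^ 7) := by
        refine mul_le_mul (hg y) ?_ (abs_nonneg _) (by positivity)
        rw [e]
        exact (abs_sub _ _).trans (add_le_add (hGd y) ((hGs y).trans f1))
    _ = _ := by ring

end

/-! ### Evolution of the second mode under `𝓛 + V`: the rate `-2/τ` -/

section
variable {p Cv ρ : ℝ}

lemma herm_two_eq : herm 2 = fun x => x ^ 2 - 2 := funext herm_two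

lemma polyBdd_herm_four : PolyBdd fun y : ℝ => y ^ 4 - 12 * y ^ 2 + 12 :=
  ((PolyBdd.id.pow 4).sub ((PolyBdd.id.pow 2).const_mul 12)).add (PolyBdd.const 12)

lemma integral_semigroupL_herm_two_sq {τ s : ℝ} (hs : τ ≤ s) (a y : ℝ) :
    ∫ t in τ..s, a * semigroupL (s - t) (fun x => (x ^ 2 - 2) ^ 2) y =
      a * ((1 - Real.exp (-(s - τ))) * (y ^ 4 - 12 * y ^ 2 + 12) + 8 * (s - τ) * (y ^ 2 - 2)
        + 8 * (Real.exp (s - τ) - 1)) := by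
  have h := intervalIntegral.integral_eq_sub_of_hasDerivAt_of_le (a := τ) (b := s) hs
    (f := fun t => a * (Real.exp (-(s - t)) * (y ^ 4 - 12 * y ^ 2 + 12) + 8 * t * (y ^ 2 - 2)
      - 8 * Real.exp (s - t)))
    (f' := fun t => a * (Real.exp (-(s - t)) * (y ^ 4 - 12 * y ^ 2 + 12) + 8 * (y ^ 2 - 2)
      + 8 * Real.exp (s - t))) (by fun_prop)
    (fun t _ => by
      have d1 : HasDerivAt (fun t => s - t) (-1) t := (hasDerivAt_id t).const_sub s
      have d2 := (d1.neg.exp.mul_const (y ^ 4 - 12 * y ^ 2 + 12)).add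
        (((hasDerivAt_id t).const_mul 8).mul_const (y ^ 2 - 2))
      refine ((d2.sub (d1.exp.const_mul 8)).const_mul a).congr_deriv ?_
      simp only [Pi.neg_apply]
      ring)
    ((by fun_prop : Continuous fun t => a * (Real.exp (-(s - t)) * (y ^ 4 - 12 * y ^ 2 + 12)
      + 8 * (y ^ 2 - 2) + 8 * Real.exp (s - t))).intervalIntegrable _ _)
  rw [intervalIntegral.integral_congr (g := fun t => a * (Real.exp (-(s - t)) *
    (y ^ 4 - 12 * y ^ 2 + 12) + 8 * (y ^ 2 - 2) + 8 * Real.exp (s - t))) fun t ht => by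
      rw [uIcc_of_le hs] at ht
      simp only
      rw [semigroupL_herm_two_sq (sub_nonneg.2 ht.2)], h]
  simp only [sub_self, neg_zero, Real.exp_zero]
  ring

/-- The first correction of the evolution of the second Hermite polynomial. -/
lemma abs_dysonTerm_one_herm_two_sub_le (hV : PotBounds p Cv) {τ s : ℝ} (hτ : 1 ≤ τ)
    (hs : s ∈ Icc τ (τ + ρ)) (y : ℝ) :
    |dysonTerm p 1 s τ (herm 2) y - -(1 / (4 * τ)) *
        ((1 - Real.exp (-(s - τ))) * (y ^ 4 - 12 * y ^ 2 + 12) + 8 * (s - τ) * (y ^ 2 - 2)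
          + 8 * (Real.exp (s - τ) - 1))| ≤
      Real.exp ρ * gaussMom 6 * (2 * (Cv + ρ) / τ ^ 2) * (s - τ) * (1 + |y|) ^ 6 := by
  have hCv := hV.one_le
  have hP : PolyBdd fun x : ℝ => (x ^ 2 - 2) ^ 2 :=
    ((PolyBdd.id.pow 2).sub (PolyBdd.const 2)).pow 2
  rw [← integral_semigroupL_herm_two_sq hs.1]
  have hρ : 0 ≤ ρ := by linarith [hs.1, hs.2]
  have habs : ∀ x : ℝ, |x ^ 2 - 2| ≤ 2 * (1 + |x|) ^ 2 := fun x => by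
    rw [← herm_two]; exact abs_herm_le (by norm_num) x
  refine abs_dysonTerm_one_sub_le hV hτ (polyBdd_herm (by norm_num)) hs hP continuousOn_const
    (fun t ht x => ?_) (fun y => ?_) y
  · have ht1 : 1 ≤ t := hτ.trans ht.1
    rw [herm_two_eq, semigroupL_herm_two (sub_nonneg.2 ht.1)]
    have e : potV p t x * (x ^ 2 - 2) - -(1 / (4 * τ)) * (x ^ 2 - 2) ^ 2 =
        (x ^ 2 - 2) * ((potV p t x + (x ^ 2 - 2) / (4 * t)) +
          (x ^ 2 - 2) * ((t - τ) / (4 * (t * τ)))) := by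
      have : τ ≠ 0 := by linarith
      have : t ≠ 0 := by linarith
      field_simp
      ring
    rw [e, abs_mul]
    have h1 : |(t - τ) / (4 * (t * τ))| ≤ ρ / (4 * τ ^ 2) := by
      rw [abs_of_nonneg (div_nonneg (sub_nonneg.2 ht.1) (by positivity))]
      refine div_le_div₀ hρ (by linarith [ht.2, hs.2]) (by positivity) ?_
      nlinarith [ht.1]
    have h2 := hV.expansion t ht1 x
    have h3 : Cv * ((1 + |x|) ^ 4 / t ^ 2) ≤ Cv * ((1 + |x|) ^ 4 / τ ^ 2) := by
      have := ht.1
      gcongr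
    have h4 : |(x ^ 2 - 2) * ((t - τ) / (4 * (t * τ)))| ≤
        2 * (1 + |x|) ^ 4 * (ρ / (4 * τ ^ 2)) := by
      rw [abs_mul]
      refine mul_le_mul ((habs x).trans ?_) h1 (abs_nonneg _) (by positivity)
      have := one_add_abs_pow_mono x (show 2 ≤ 4 by norm_num)
      linarith
    calc _ ≤ 2 * (1 + |x|) ^ 2 * (Cv * ((1 + |x|) ^ 4 / τ ^ 2) +
          2 * (1 + |x|) ^ 4 * (ρ / (4 * τ ^ 2))) := by
          refine mul_le_mul (habs x) ?_ (abs_nonneg _) (by positivity)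
          exact (abs_add_le _ _).trans (add_le_add (h2.trans h3) h4)
      _ = 2 * (Cv + ρ / 2) / τ ^ 2 * (1 + |x|) ^ 6 := by
          field_simp
          ring
      _ ≤ _ := by
          gcongr
          linarith
  · refine ContinuousOn.congr (f := fun t => Real.exp (-(s - t)) * (y ^ 4 - 12 * y ^ 2 + 12)
      + 8 * (y ^ 2 - 2) + 8 * Real.exp (s - t)) (by fun_prop) fun t ht => ?_
    exact semigroupL_herm_two_sq (sub_nonneg.2 ht.2) y

variable {χ₀ : ℝ → ℝ} {c K₀ : ℝ}

/-- To leading order the potential is `-h₂/(4τ)`, and the coefficient of `h₂² = h₄ + 8h₂ + 8h₀` on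
`h₂` is `8`, whence `-(8/(4τ))(s-τ)`. Errors come from the expansion of `V` and from the cutoff. -/
lemma CutoffBound.exists_abs_mode_two_dysonTerm_one_herm_two_le (h : CutoffBound χ₀ c)
    (hK : 1 ≤ K₀) (hV : PotBounds p Cv) (hρ : 0 < ρ) : ∃ C > 0, ∀ τ ≥ 1, ∀ s ∈ Icc τ (τ + ρ),
      |mode χ₀ K₀ s 2 (dysonTerm p 1 s τ (herm 2)) - -(2 / τ * (s - τ))| ≤
        C * (s - τ) * (1 / τ ^ 2) := by
  have hc := h.one_le
  have hCv := hV.one_le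
  have w8 := wMom_pos 8
  have g6 := gaussMom_pos 6
  refine ⟨2 * c * wMom 8 * (50 + 8 * Real.exp ρ) +
    c * wMom 8 * (Real.exp ρ * gaussMom 6 * (2 * (Cv + ρ))), by positivity, fun τ hτ s hs => ?_⟩
  have ht : 0 ≤ s - τ := sub_nonneg.2 hs.1
  have hs1 : 1 ≤ s := hτ.trans hs.1
  set Q : ℝ → ℝ := fun y => (1 - Real.exp (-(s - τ))) * (y ^ 4 - 12 * y ^ 2 + 12) +
    8 * (s - τ) * (y ^ 2 - 2) + 8 * (Real.exp (s - τ) - 1) with hQ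
  have e1 : 1 - Real.exp (-(s - τ)) ≤ s - τ := by
    have := Real.add_one_le_exp (-(s - τ)); linarith
  have e1' : 0 ≤ 1 - Real.exp (-(s - τ)) := by
    have : Real.exp (-(s - τ)) ≤ 1 := Real.exp_le_one_iff.2 (by linarith)
    linarith
  have e2 : Real.exp (s - τ) - 1 ≤ (s - τ) * Real.exp ρ := by
    have a1 := Real.add_one_le_exp (-(s - τ))
    have a2 : Real.exp (s - τ) * Real.exp (-(s - τ)) = 1 := by rw [← Real.exp_add]; simp
    have a3 : Real.exp (s - τ) ≤ Real.exp ρ := Real.exp_le_exp.2 (by linarith [hs.2])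
    have a4 := Real.exp_pos (s - τ)
    nlinarith
  have e2' : 0 ≤ Real.exp (s - τ) - 1 := by
    have : 1 ≤ Real.exp (s - τ) := Real.one_le_exp ht
    linarith
  have h2P : PolyBdd fun y : ℝ => y ^ 2 - 2 := (PolyBdd.id.pow 2).sub (PolyBdd.const 2)
  have hQP : PolyBdd Q := ((polyBdd_herm_four.const_mul _).add (h2P.const_mul _)).add
    (PolyBdd.const _)
  have hQb : ∀ y, |Q y| ≤ (s - τ) * (50 + 8 * Real.exp ρ) * (1 + |y|) ^ 4 := fun y => by
    have b1 : |y ^ 4 - 12 * y ^ 2 + 12| ≤ 12 * (1 + |y|) ^ 4 := by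
      have hy := abs_nonneg y
      rw [← sq_abs y, show y ^ 4 = |y| ^ 4 by rw [← abs_pow, abs_of_nonneg (by positivity)], abs_le]
      constructor <;> nlinarith [pow_nonneg hy 2, pow_nonneg hy 3, pow_nonneg hy 4]
    have b2 : |y ^ 2 - 2| ≤ 2 * (1 + |y|) ^ 4 := by
      rw [← herm_two]
      refine (abs_herm_le (by norm_num) y).trans ?_
      have := one_add_abs_pow_mono y (show 2 ≤ 4 by norm_num)
      linarith
    have b3 := one_le_one_add_abs_pow y 4
    simp only [hQ]
    refine (abs_add_le _ _).trans ?_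
    have t1 := abs_add_le ((1 - Real.exp (-(s - τ))) * (y ^ 4 - 12 * y ^ 2 + 12))
      (8 * (s - τ) * (y ^ 2 - 2))
    rw [abs_mul, abs_mul (8 * (s - τ)), abs_of_nonneg e1',
      abs_of_nonneg (by positivity : 0 ≤ 8 * (s - τ))] at t1
    rw [abs_of_nonneg (by positivity : 0 ≤ 8 * (Real.exp (s - τ) - 1))]
    have c1 : (1 - Real.exp (-(s - τ))) * |y ^ 4 - 12 * y ^ 2 + 12| ≤
      (s - τ) * (12 * (1 + |y|) ^ 4) := mul_le_mul e1 b1 (abs_nonneg _) ht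
    have c2 : 8 * (s - τ) * |y ^ 2 - 2| ≤ 8 * (s - τ) * (2 * (1 + |y|) ^ 4) := by gcongr
    have c3 : 8 * (Real.exp (s - τ) - 1) ≤ 8 * ((s - τ) * Real.exp ρ) * (1 + |y|) ^ 4 := by
      refine (mul_le_mul_of_nonneg_left e2 (by norm_num)).trans ?_
      exact le_mul_of_one_le_right (by positivity) b3
    have c4 : 0 ≤ (s - τ) * (1 + |y|) ^ 4 := by positivity
    nlinarith
  have hd := polyBdd_dualHerm (m := 2) (by norm_num)
  -- Only the `h₂` term of `Q` survives, by orthogonality to `h₄` and `h₀`.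
  have hint : ∫ y, Q y * dualHerm 2 y ∂wGauss = 8 * (s - τ) := by
    have e : ∀ y, Q y * dualHerm 2 y = (1 - Real.exp (-(s - τ))) *
        ((y ^ 4 - 12 * y ^ 2 + 12) * dualHerm 2 y) + 8 * (s - τ) * (herm 2 y * dualHerm 2 y) +
        8 * (Real.exp (s - τ) - 1) * (herm 0 y * dualHerm 2 y) := fun y => by
      simp only [hQ, herm_two, herm_zero]; ring
    simp_rw [e]
    have i1 := ((polyBdd_herm_four.mul hd).const_mul (1 - Real.exp (-(s - τ)))).integrable_wGauss
    have i2 := (((polyBdd_herm (m := 2) (by norm_num)).mul hd).const_mul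
      (8 * (s - τ))).integrable_wGauss
    have i3 := (((polyBdd_herm (m := 0) (by norm_num)).mul hd).const_mul
      (8 * (Real.exp (s - τ) - 1))).integrable_wGauss
    have i12 : Integrable (fun y => (1 - Real.exp (-(s - τ))) *
      ((y ^ 4 - 12 * y ^ 2 + 12) * dualHerm 2 y) + 8 * (s - τ) * (herm 2 y * dualHerm 2 y))
      wGauss := i1.add i2
    rw [integral_add i12 i3, integral_add i1 i2]
    simp_rw [integral_const_mul]
    rw [integral_herm_four_mul_dualHerm_two, integral_herm_mul_dualHerm (by norm_num) (by norm_num),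
      integral_herm_mul_dualHerm (by norm_num) (by norm_num)]
    norm_num
  have hmQ := h.abs_mode_sub_integral_le (s := s) hK (by linarith) hQP.1 hQb (m := 2) (by norm_num) 2
  rw [hint, Real.sq_sqrt (by linarith)] at hmQ
  set E : ℝ → ℝ := fun y => dysonTerm p 1 s τ (herm 2) y - -(1 / (4 * τ)) * Q y with hE
  have hDP := (polyBdd_herm (m := 2) (by norm_num)).dysonTerm hV hτ hs.1 1
  have hEP : PolyBdd E := hDP.sub (hQP.const_mul _)
  have hmE := h.abs_mode_le (K₀ := K₀) (s := s) (m := 2) (by linarith) (by linarith) (by norm_num)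
    (g := E) fun y _ => abs_dysonTerm_one_herm_two_sub_le hV hτ hs y
  have hsplit : mode χ₀ K₀ s 2 (dysonTerm p 1 s τ (herm 2)) =
      mode χ₀ K₀ s 2 E + -(1 / (4 * τ)) * mode χ₀ K₀ s 2 Q := by
    rw [← mode_const_mul, ← h.mode_add (by linarith) hEP (hQP.const_mul _) (by norm_num)]
    congr 1; ext y; simp only [hE]; ring
  have e : mode χ₀ K₀ s 2 (dysonTerm p 1 s τ (herm 2)) - -(2 / τ * (s - τ)) =
      mode χ₀ K₀ s 2 E + -(1 / (4 * τ) * (mode χ₀ K₀ s 2 Q - 8 * (s - τ))) := by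
    rw [hsplit]; field_simp; ring
  rw [e]
  refine (abs_add_le _ _).trans ?_
  rw [abs_neg, abs_mul, abs_of_pos (by positivity : 0 < 1 / (4 * τ))]
  have f1 : 1 / (4 * τ) * |mode χ₀ K₀ s 2 Q - 8 * (s - τ)| ≤
      1 / τ * (2 * c * wMom 8 * ((s - τ) * (50 + 8 * Real.exp ρ)) / τ) := by
    refine mul_le_mul ?_ (hmQ.trans ?_) (abs_nonneg _) (by positivity)
    · exact one_div_le_one_div_of_le (by linarith) (by linarith)
    · have := hs.1
      norm_num
      gcongr
  have f2 : 1 / τ * (2 * c * wMom 8 * ((s - τ) * (50 + 8 * Real.exp ρ)) / τ) =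
      2 * c * wMom 8 * (50 + 8 * Real.exp ρ) * (s - τ) * (1 / τ ^ 2) := by field_simp
  have f3 : c * wMom (6 + 2) * (Real.exp ρ * gaussMom 6 * (2 * (Cv + ρ) / τ ^ 2) * (s - τ)) =
      c * wMom 8 * (Real.exp ρ * gaussMom 6 * (2 * (Cv + ρ))) * (s - τ) * (1 / τ ^ 2) := by
    norm_num; ring
  rw [f3] at hmE
  rw [f2] at f1
  refine (add_le_add hmE f1).trans (le_of_eq ?_)
  ring

/-- The evolution of the second mode. -/
lemma CutoffBound.exists_abs_mode_two_fundK_sub_le (h : CutoffBound χ₀ c) (hK : 1 ≤ K₀)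
    (hV : PotBounds p Cv) (hρ : 0 < ρ) : ∃ C > 0, ∀ τ ≥ 1, ∀ s ∈ Icc τ (τ + ρ),
      ∀ g : ℝ → ℝ, Measurable g → ∀ a M M' : ℝ, (∀ y, |g y| ≤ M * (1 + |y|) ^ 3) →
      (∀ y, |g y - a * herm 2 y| ≤ M' * (1 + |y|) ^ 4) → |a| ≤ M →
      |mode χ₀ K₀ s 2 (fundK p s τ g) - (mode χ₀ K₀ τ 2 g - 2 / τ * (s - τ) * a)| ≤
        C * (s - τ) * (M / τ ^ 2 + M' / τ) := by
  obtain ⟨C0, hC0, H0⟩ := h.exists_abs_mode_two_semigroupL_sub_le hK ρ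
  obtain ⟨C1, hC1, H1⟩ := h.exists_abs_mode_two_dysonTerm_one_herm_two_le hK hV hρ
  have hc := h.one_le
  have hCv := hV.one_le
  have g3 := gaussMom_pos 3
  have g4 := gaussMom_pos 4
  have g5 := gaussMom_pos 5
  have g6 := gaussMom_pos 6
  have g7 := gaussMom_pos 7
  have w8 := wMom_pos 8
  have w9 := wMom_pos 9
  obtain ⟨e, he⟩ : ∃ e, e = Real.exp ρ := ⟨_, rfl⟩
  have he0 : 0 < e := he ▸ Real.exp_pos _
  set T1 := e * gaussMom 6 * Cv * (e * gaussMom 4) with hT1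
  set T2 := e * gaussMom 7 * Cv * (e * gaussMom 5 * Cv * (e * gaussMom 3)) with hT2
  refine ⟨C0 + C1 + c * wMom 8 * T1 + c * wMom 9 * (Real.exp (dysC Cv ρ 7 * ρ) * T2 * ρ),
    by positivity, fun τ hτ s hs g mg a M M' hM hM' ha => ?_⟩
  have hM0 := nonneg_of_abs_le_mul_pow (hM 0)
  have hM0' := nonneg_of_abs_le_mul_pow (hM' 0)
  have hτ0 : 0 < τ := by linarith
  have hs0 : 0 < s := by linarith [hs.1]
  have ht : 0 ≤ s - τ := sub_nonneg.2 hs.1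
  have hgP := PolyBdd.of_bound mg hM
  have hhP := polyBdd_herm (m := 2) (by norm_num)
  set r : ℝ → ℝ := fun y => g y - a * herm 2 y with hr
  have hrP : PolyBdd r := hgP.sub (hhP.const_mul a)
  have hVq : ∀ t ∈ Icc τ (τ + ρ), ∀ x, |potV p t x| ≤ Cv / τ * (1 + |x|) ^ 2 := fun t ht x => by
    refine (hV.quad t (hτ.trans ht.1) x).trans ?_
    have := ht.1
    calc Cv * ((1 + |x|) ^ 2 / t) ≤ Cv * ((1 + |x|) ^ 2 / τ) := by gcongr
      _ = _ := by ring
  -- the remainder in the first term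
  have hD1r : ∀ y, |dysonTerm p 1 s τ r y| ≤ T1 * (M' / τ) * (s - τ) * (1 + |y|) ^ 6 := fun y => by
    have := abs_dysonTerm_succ_le (p := p) (B := e * gaussMom 4 * M') (j := 0) (k := 4) (l := 2)
      (v := Cv / τ) hs hrP.1 (by positivity) (fun t ht => hVq t ⟨ht.1, ht.2.trans hs.2⟩)
      (fun t ht x => by
        rw [pow_zero, mul_one, he]
        exact abs_dysonTerm_zero_le (ρ := ρ) ⟨ht.1, ht.2.trans hs.2⟩ hrP.1 hM' x) y
    refine this.trans (le_of_eq ?_)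
    rw [hT1, he, Nat.cast_zero]
    ring
  have hD1 : ∀ t ∈ Icc τ (τ + ρ), ∀ y, |dysonTerm p 1 t τ g y| ≤
      e * gaussMom 5 * (Cv / τ) * (e * gaussMom 3 * M) * (t - τ) ^ 1 * (1 + |y|) ^ 5 :=
    fun t ht y => by
      have := abs_dysonTerm_succ_le (p := p) (B := e * gaussMom 3 * M) (j := 0) (k := 3) (l := 2)
        (v := Cv / τ) ht mg (by positivity) (fun t' ht' => hVq t' ⟨ht'.1, ht'.2.trans ht.2⟩)
        (fun t' ht' x => by
          rw [pow_zero, mul_one, he]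
          exact abs_dysonTerm_zero_le (ρ := ρ) ⟨ht'.1, ht'.2.trans ht.2⟩ mg hM x) y
      refine this.trans (le_of_eq ?_)
      rw [he]
      norm_num
  have hD2 : ∀ t ∈ Icc τ (τ + ρ), ∀ y, |dysonTerm p 2 t τ g y| ≤
      T2 * (M / τ ^ 2) * (t - τ) ^ 2 * (1 + |y|) ^ 7 := fun t ht y => by
    have := abs_dysonTerm_succ_le (p := p) (B := e * gaussMom 5 * (Cv / τ) * (e * gaussMom 3 * M))
      (j := 1) (k := 5) (l := 2)
      (v := Cv / τ) ht mg (by positivity) (fun t' ht' => hVq t' ⟨ht'.1, ht'.2.trans ht.2⟩)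
      (fun t' ht' x => hD1 t' ⟨ht'.1, ht'.2.trans ht.2⟩ x) y
    refine this.trans ?_
    have e2 : Real.exp ρ * gaussMom (2 + 5) * (Cv / τ) * (e * gaussMom 5 * (Cv / τ) *
        (e * gaussMom 3 * M)) / ((1 : ℕ) + 1) * (t - τ) ^ (1 + 1) * (1 + |y|) ^ (2 + 5) =
        T2 * (M / τ ^ 2) * (t - τ) ^ 2 * (1 + |y|) ^ 7 / 2 := by
      rw [hT2, he]; norm_num; field_simp
    rw [e2]
    have : 0 ≤ T2 * (M / τ ^ 2) * (t - τ) ^ 2 * (1 + |y|) ^ 7 := by positivity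
    linarith
  have htail := abs_fundK_sub_sum_le hV hτ mg hM (by positivity) hD2 hs
  set Tl : ℝ → ℝ := fun y => fundK p s τ g y - ∑ n ∈ Finset.range 2, dysonTerm p n s τ g y with hTl
  have hTlP : PolyBdd Tl := (hgP.fundK hV hτ hs.1).sub
    (PolyBdd.sum _ fun n _ => hgP.dysonTerm hV hτ hs.1 n)
  have hSP : PolyBdd (semigroupL (s - τ) g) := hgP.semigroupL ht
  have hDhP := hhP.dysonTerm hV hτ hs.1 1
  have hDrP := hrP.dysonTerm hV hτ hs.1 1
  -- The free evolution conserves the mode, the first Dyson term of `a h₂` gives the rate, that of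
  -- `g - a h₂` costs `M'/τ`, and the tail from the second term on carries two factors of `V`, hence
  -- `M/τ²`.
  have hsplit : fundK p s τ g = fun y => (semigroupL (s - τ) g y + a * dysonTerm p 1 s τ (herm 2) y)
      + (dysonTerm p 1 s τ r y + Tl y) := by
    ext y
    have e1 : dysonTerm p 1 s τ g y =
        dysonTerm p 1 s τ r y + a * dysonTerm p 1 s τ (herm 2) y := by
      rw [← dysonTerm_const_mul, ← dysonTerm_add hV hτ hrP (hhP.const_mul a) 1 s hs.1]
      congr 1; ext x; simp only [hr]; ring
    simp only [hTl, Finset.sum_range_succ, Finset.sum_range_zero, e1]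
    rw [dysonTerm]
    ring
  rw [hsplit, h.mode_add (by linarith) (hSP.add (hDhP.const_mul a)) (hDrP.add hTlP) (by norm_num),
    h.mode_add (by linarith) hSP (hDhP.const_mul a) (by norm_num),
    h.mode_add (by linarith) hDrP hTlP (by norm_num), mode_const_mul]
  have b0 := H0 τ hτ s hs g mg M hM
  have b1 := H1 τ hτ s hs
  have b2 := h.abs_mode_le (K₀ := K₀) (s := s) (m := 2) (by linarith) hs0 (by norm_num)
    (g := dysonTerm p 1 s τ r) fun y _ => hD1r y
  have b3 := h.abs_mode_le (K₀ := K₀) (s := s) (m := 2) (by linarith) hs0 (by norm_num)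
    (g := Tl) fun y _ => htail y
  have e4 : mode χ₀ K₀ s 2 (semigroupL (s - τ) g) + a * mode χ₀ K₀ s 2 (dysonTerm p 1 s τ (herm 2)) +
      (mode χ₀ K₀ s 2 (dysonTerm p 1 s τ r) + mode χ₀ K₀ s 2 Tl) -
      (mode χ₀ K₀ τ 2 g - 2 / τ * (s - τ) * a) =
      (mode χ₀ K₀ s 2 (semigroupL (s - τ) g) - mode χ₀ K₀ τ 2 g) +
      a * (mode χ₀ K₀ s 2 (dysonTerm p 1 s τ (herm 2)) - -(2 / τ * (s - τ))) +
      mode χ₀ K₀ s 2 (dysonTerm p 1 s τ r) + mode χ₀ K₀ s 2 Tl := by ring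
  rw [e4]
  have b1' : |a * (mode χ₀ K₀ s 2 (dysonTerm p 1 s τ (herm 2)) - -(2 / τ * (s - τ)))| ≤
      M * (C1 * (s - τ) * (1 / τ ^ 2)) := by
    rw [abs_mul]; exact mul_le_mul ha b1 (abs_nonneg _) hM0
  have b3' : c * wMom (7 + 2) * (Real.exp (dysC Cv ρ 7 * ρ) * (T2 * (M / τ ^ 2)) * (s - τ) ^ 2) ≤
      c * wMom 9 * (Real.exp (dysC Cv ρ 7 * ρ) * T2 * ρ) * (s - τ) * (M / τ ^ 2) := by
    norm_num
    have : s - τ ≤ ρ := by linarith [hs.2]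
    calc _ = c * wMom 9 * (Real.exp (dysC Cv ρ 7 * ρ) * (T2 * (M / τ ^ 2)) * ((s - τ) * (s - τ))) := by
          ring
      _ ≤ c * wMom 9 * (Real.exp (dysC Cv ρ 7 * ρ) * (T2 * (M / τ ^ 2)) * (ρ * (s - τ))) := by
          gcongr
      _ = _ := by ring
  have n1 : 0 ≤ M / τ ^ 2 := by positivity
  have n2 : 0 ≤ M' / τ := by positivity
  have t1 := abs_add_three (mode χ₀ K₀ s 2 (semigroupL (s - τ) g) - mode χ₀ K₀ τ 2 g)
    (a * (mode χ₀ K₀ s 2 (dysonTerm p 1 s τ (herm 2)) - -(2 / τ * (s - τ))))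
    (mode χ₀ K₀ s 2 (dysonTerm p 1 s τ r))
  refine (abs_add_le _ _).trans ((add_le_add (t1.trans (add_le_add_three b0 b1' b2))
    (b3.trans b3')).trans ?_)
  obtain ⟨X, hX⟩ : ∃ X, X = Real.exp (dysC Cv ρ 7 * ρ) := ⟨_, rfl⟩
  rw [← hX]
  have hX0 : 0 < X := hX ▸ Real.exp_pos _
  norm_num
  calc _ = (C0 + C1 + c * wMom 9 * (X * T2 * ρ)) * (s - τ) * (M / τ ^ 2)
        + c * wMom 8 * T1 * (s - τ) * (M' / τ) := by ring
    _ ≤ (C0 + C1 + c * wMom 8 * T1 + c * wMom 9 * (X * T2 * ρ)) * (s - τ) * (M / τ ^ 2)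
        + (C0 + C1 + c * wMom 8 * T1 + c * wMom 9 * (X * T2 * ρ)) * (s - τ) * (M' / τ) := by
        have p1 : 0 ≤ c * wMom 8 * T1 := by positivity
        have p2 : 0 ≤ c * wMom 9 * (X * T2 * ρ) := by positivity
        refine add_le_add (mul_le_mul_of_nonneg_right (mul_le_mul_of_nonneg_right ?_ ht) n1)
          (mul_le_mul_of_nonneg_right (mul_le_mul_of_nonneg_right ?_ ht) n2) <;> linarith
    _ = _ := by ring

end

/-! ### Bounds in the shrinking set -/

/-- Pointwise bounds on an element of the shrinking set, with the sizes `N` and `E` of its negative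
and outer parts. -/
structure ShrinkingBounds (χ₀ : ℝ → ℝ) (K₀ A τ N E : ℝ) (q : ℝ → ℝ) : Prop where
  cont : Continuous q
  neg : ∀ y, |negativePart χ₀ K₀ τ q y| ≤ N * (1 + |y| ^ 3)
  outer : ∀ y, |outerPart χ₀ K₀ τ q y| ≤ E
  neg_le : N ≤ A / τ ^ 2
  outer_le : E ≤ A ^ 2 / √τ
  mode_le : ∀ m < 2, |mode χ₀ K₀ τ m q| ≤ A / τ ^ 2
  mode_two_le : |mode χ₀ K₀ τ 2 q| ≤ A ^ 2 * Real.log τ / τ ^ 2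

section
variable {χ₀ : ℝ → ℝ} {c K₀ A τ N E : ℝ} {q : ℝ → ℝ}

lemma InVA.shrinkingBounds (h : CutoffBound χ₀ c) (hK : 0 ≤ K₀) (hA : 0 ≤ A)
    (hq : Continuous q) (hV : InVA χ₀ K₀ A τ q) :
    ShrinkingBounds χ₀ K₀ A τ (linfW (negativePart χ₀ K₀ τ q)).toReal
      (linf (outerPart χ₀ K₀ τ q)).toReal q := by
  obtain ⟨-, h1, h2, h3, h4⟩ := hV
  have hcc := h.isCutoff.continuous_cutoff (s := τ) hK
  have h3' : linfW (negativePart χ₀ K₀ τ q) ≤ ENNReal.ofReal (A / τ ^ 2) :=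
    linfW_le_ofReal fun y => (h3 y).trans (le_of_eq (by ring))
  have cn : Continuous (negativePart χ₀ K₀ τ q) := by
    unfold negativePart innerPart
    exact (hcc.mul hq).sub (continuous_finsetSum _ fun m _ => (continuous_herm m).const_mul _)
  have co : Continuous (outerPart χ₀ K₀ τ q) := (continuous_const.sub hcc).mul hq
  exact ⟨hq, fun y => abs_le_toReal_linfW cn (ne_top_of_le_ne_top ENNReal.ofReal_ne_top h3') y,
    fun y => abs_le_toReal_linf co (ne_top_of_le_ne_top ENNReal.ofReal_ne_top h4) y,
    ENNReal.toReal_le_of_le_ofReal (by positivity) h3',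
    ENNReal.toReal_le_of_le_ofReal (by positivity) h4, h1, h2⟩

lemma ShrinkingBounds.neg_nonneg (h : ShrinkingBounds χ₀ K₀ A τ N E q) : 0 ≤ N := by
  have := h.neg 0
  simp only [abs_zero, ne_eq, OfNat.ofNat_ne_zero, not_false_eq_true, zero_pow, add_zero,
    mul_one] at this
  exact (abs_nonneg _).trans this

lemma ShrinkingBounds.outer_nonneg (h : ShrinkingBounds χ₀ K₀ A τ N E q) : 0 ≤ E :=
  (abs_nonneg _).trans (h.outer 0)

lemma IsCutoff.outerPart_eq_zero (h : IsCutoff χ₀) (hK : 0 < K₀) (hτ : 0 < τ) {y : ℝ}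
    (hy : |y| < K₀ * √τ) : outerPart χ₀ K₀ τ q y = 0 := by
  rw [outerPart, h.cutoff_eq_one hK hτ hy.le, sub_self, zero_mul]

lemma ShrinkingBounds.abs_outerPart_le_weight (h : ShrinkingBounds χ₀ K₀ A τ N E q)
    (hχ : IsCutoff χ₀) (hK : 1 ≤ K₀) (hτ : 0 < τ) (l : ℕ) (y : ℝ) :
    |outerPart χ₀ K₀ τ q y| ≤ E / √τ ^ l * (1 + |y|) ^ l := by
  have hE := h.outer_nonneg
  rcases lt_or_ge |y| (K₀ * √τ) with hy | hy
  · rw [hχ.outerPart_eq_zero (by linarith) hτ hy, abs_zero]; positivity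
  · have := one_le_weight_div_sqrt hK hτ hy l
    calc _ ≤ E * 1 := by rw [mul_one]; exact h.outer y
      _ ≤ E * ((1 + |y|) ^ l / √τ ^ l) := by gcongr
      _ = _ := by ring

lemma eq_sum_mode_add (y : ℝ) : q y = mode χ₀ K₀ τ 0 q * herm 0 y + mode χ₀ K₀ τ 1 q * herm 1 y +
    mode χ₀ K₀ τ 2 q * herm 2 y + negativePart χ₀ K₀ τ q y + outerPart χ₀ K₀ τ q y := by
  have h1 := innerPart_add_outerPart (χ₀ := χ₀) (K₀ := K₀) (s := τ) q y
  have h2 := innerPart_eq_negativePart_add (χ₀ := χ₀) (K₀ := K₀) (s := τ) q y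
  simp only [Finset.sum_range_succ, Finset.sum_range_zero] at h2
  linarith

lemma ShrinkingBounds.abs_neg_le (h : ShrinkingBounds χ₀ K₀ A τ N E q) (y : ℝ) :
    |negativePart χ₀ K₀ τ q y| ≤ N * (1 + |y|) ^ 3 :=
  (h.neg y).trans (mul_le_mul_of_nonneg_left (one_add_cube_abs_le y) h.neg_nonneg)

lemma abs_mul_herm_le {a B : ℝ} (ha : |a| ≤ B) {m k : ℕ} (hm : m < 3) (hk : m ≤ k) (y : ℝ) :
    |a * herm m y| ≤ 2 * B * (1 + |y|) ^ k := by
  rw [abs_mul]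
  have h1 := (abs_nonneg a).trans ha
  calc _ ≤ B * (2 * (1 + |y|) ^ k) := by
        refine mul_le_mul ha ((abs_herm_le hm y).trans ?_) (abs_nonneg _) h1
        have := one_add_abs_pow_mono y hk
        linarith
    _ = _ := by ring

lemma abs_add_five_le (a b c d e : ℝ) : |a + b + c + d + e| ≤ |a| + |b| + |c| + |d| + |e| := by
  have h1 := abs_add_le (a + b + c + d) e
  have h2 := abs_add_le (a + b + c) d
  have h3 := abs_add_three a b c
  linarith

lemma sqrt_pow_four {τ : ℝ} (hτ : 0 ≤ τ) : √τ ^ 4 = τ ^ 2 := by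
  rw [show √τ ^ 4 = (√τ ^ 2) ^ 2 by ring, Real.sq_sqrt hτ]

/-- The outer part fits the common size `τ⁻²` because its support lets `A²τ^{-1/2}` be traded for
`τ⁻²` against the cubic weight; the logarithm comes from the second mode. -/
lemma ShrinkingBounds.abs_le_weight (h : ShrinkingBounds χ₀ K₀ A τ N E q) (hχ : IsCutoff χ₀)
    (hK : 1 ≤ K₀) (hτ : 1 ≤ τ) (hA : 1 ≤ A) (y : ℝ) :
    |q y| ≤ 8 * (A ^ 2 * (1 + Real.log τ)) / τ ^ 2 * (1 + |y|) ^ 3 := by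
  have hτ0 : 0 < τ := by linarith
  have hlog := Real.log_nonneg hτ
  obtain ⟨D, hD⟩ : ∃ D, D = A ^ 2 * (1 + Real.log τ) := ⟨_, rfl⟩
  have hA2 : A ≤ A ^ 2 := by nlinarith
  have hAD2 : A ^ 2 ≤ D := by rw [hD]; nlinarith [sq_nonneg A]
  have hD0 : 0 ≤ D := (sq_nonneg A).trans hAD2
  have hAD : A / τ ^ 2 ≤ D / τ ^ 2 := by gcongr; linarith
  have m0 := abs_mul_herm_le ((h.mode_le 0 (by norm_num)).trans hAD) (m := 0) (k := 3) (by norm_num)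
    (by norm_num) y
  have m1 := abs_mul_herm_le ((h.mode_le 1 (by norm_num)).trans hAD) (m := 1) (k := 3) (by norm_num)
    (by norm_num) y
  have m2' : |mode χ₀ K₀ τ 2 q| ≤ D / τ ^ 2 := h.mode_two_le.trans (by
    rw [hD]; gcongr; linarith)
  have m2 := abs_mul_herm_le m2' (m := 2) (k := 3) (by norm_num) (by norm_num) y
  have m3 : |negativePart χ₀ K₀ τ q y| ≤ D / τ ^ 2 * (1 + |y|) ^ 3 := (h.abs_neg_le y).trans (by
    gcongr; exact h.neg_le.trans hAD)
  have m4 : |outerPart χ₀ K₀ τ q y| ≤ D / τ ^ 2 * (1 + |y|) ^ 3 := by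
    refine (h.abs_outerPart_le_weight hχ hK hτ0 3 y).trans ?_
    have hsq : 0 < √τ := Real.sqrt_pos.2 hτ0
    have e : A ^ 2 / √τ / √τ ^ 3 = A ^ 2 / τ ^ 2 := by
      rw [← sqrt_pow_four hτ0.le]; field_simp
    calc E / √τ ^ 3 * (1 + |y|) ^ 3 ≤ A ^ 2 / √τ / √τ ^ 3 * (1 + |y|) ^ 3 := by
          have := h.outer_le; gcongr
      _ ≤ _ := by rw [e]; gcongr
  rw [eq_sum_mode_add (χ₀ := χ₀) (K₀ := K₀) (τ := τ) (q := q) y, ← hD]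
  refine (abs_add_five_le _ _ _ _ _).trans ?_
  have : 8 * D / τ ^ 2 * (1 + |y|) ^ 3 = 8 * (D / τ ^ 2 * (1 + |y|) ^ 3) := by ring
  rw [this]
  linarith

/-- With the second mode removed and one more power of the weight, the outer part gains `1/√τ`,
which absorbs one factor `A`. The size is then linear in `A` and free of the logarithm, as the bound
on the second mode of the linear term requires. -/
lemma ShrinkingBounds.abs_sub_mode_two_le (h : ShrinkingBounds χ₀ K₀ A τ N E q)
    (hχ : IsCutoff χ₀) (hK : 1 ≤ K₀) (hτ : 1 ≤ τ) (hA : 1 ≤ A) (hAτ : A ≤ √τ) (y : ℝ) :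
    |q y - mode χ₀ K₀ τ 2 q * herm 2 y| ≤ 6 * A / τ ^ 2 * (1 + |y|) ^ 4 := by
  have hτ0 : 0 < τ := by linarith
  have m0 := abs_mul_herm_le (h.mode_le 0 (by norm_num)) (m := 0) (k := 4) (by norm_num)
    (by norm_num) y
  have m1 := abs_mul_herm_le (h.mode_le 1 (by norm_num)) (m := 1) (k := 4) (by norm_num)
    (by norm_num) y
  have m3 : |negativePart χ₀ K₀ τ q y| ≤ A / τ ^ 2 * (1 + |y|) ^ 4 := (h.abs_neg_le y).trans (by
    gcongr
    · exact h.neg_le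
    · linarith [abs_nonneg y]
    · norm_num)
  have m4 : |outerPart χ₀ K₀ τ q y| ≤ A / τ ^ 2 * (1 + |y|) ^ 4 := by
    refine (h.abs_outerPart_le_weight hχ hK hτ0 4 y).trans ?_
    have hsq : 0 < √τ := Real.sqrt_pos.2 hτ0
    have : E ≤ A := h.outer_le.trans (by rw [div_le_iff₀ hsq]; nlinarith)
    rw [sqrt_pow_four hτ0.le]
    gcongr
  have e : q y - mode χ₀ K₀ τ 2 q * herm 2 y = mode χ₀ K₀ τ 0 q * herm 0 y +
      mode χ₀ K₀ τ 1 q * herm 1 y + 0 + negativePart χ₀ K₀ τ q y + outerPart χ₀ K₀ τ q y := by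
    have := eq_sum_mode_add (χ₀ := χ₀) (K₀ := K₀) (τ := τ) (q := q) y
    linarith
  rw [e]
  refine (abs_add_five_le _ _ _ _ _).trans ?_
  have : 6 * A / τ ^ 2 * (1 + |y|) ^ 4 = 6 * (A / τ ^ 2 * (1 + |y|) ^ 4) := by ring
  rw [this, abs_zero]
  linarith

lemma one_add_abs_le_of_le {y : ℝ} (hK : 1 ≤ K₀) (hτ : 1 ≤ τ) (hy : |y| ≤ 2 * (K₀ * √τ)) :
    1 + |y| ≤ 3 * K₀ * √τ := by
  have := one_le_mul_of_one_le_of_one_le hK (Real.one_le_sqrt.2 hτ)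
  linarith

/-- The inner part is controlled by the negative part. -/
lemma ShrinkingBounds.abs_innerPart_le (h : ShrinkingBounds χ₀ K₀ A τ N E q)
    (hχ : CutoffBound χ₀ c) (hK : 1 ≤ K₀) (hτ : 1 ≤ τ) (y : ℝ) :
    |innerPart χ₀ K₀ τ q y| ≤ 14000 * K₀ ^ 5 * (N * √τ ^ 3) := by
  have hN := h.neg_nonneg
  have hK0 : 0 < K₀ := by linarith
  have hτ0 : 0 < τ := by linarith
  rcases le_or_gt |y| (2 * (K₀ * √τ)) with hy | hy
  · have hw := one_add_abs_le_of_le hK hτ hy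
    have hm : ∀ m < 3, |mode χ₀ K₀ τ m q * herm m y| ≤
        1000 * 3 ^ m * K₀ ^ 5 * (N * √τ ^ 3) := fun m hm => by
      rw [abs_mul]
      calc _ ≤ (500 * K₀ ^ 3 * N * √τ ^ (3 - m)) * (2 * (3 * K₀ * √τ) ^ m) := by
            refine mul_le_mul (hχ.abs_mode_le_of_negativePart hK hτ h.neg hm) ?_ (abs_nonneg _)
              (by positivity)
            exact (abs_herm_le hm y).trans (by gcongr)
        _ = 1000 * 3 ^ m * (K₀ ^ 3 * K₀ ^ m) * (N * (√τ ^ (3 - m) * √τ ^ m)) := by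
            rw [mul_pow, mul_pow]; ring
        _ ≤ 1000 * 3 ^ m * (K₀ ^ 3 * K₀ ^ 2) * (N * (√τ ^ (3 - m) * √τ ^ m)) := by
            have : K₀ ^ m ≤ K₀ ^ 2 := pow_le_pow_right₀ hK (by omega)
            gcongr
        _ = _ := by rw [← pow_add √τ, Nat.sub_add_cancel (by omega)]; ring
    have h3 : |negativePart χ₀ K₀ τ q y| ≤ 27 * K₀ ^ 5 * (N * √τ ^ 3) := by
      calc _ ≤ N * (3 * K₀ * √τ) ^ 3 := (h.abs_neg_le y).trans (by gcongr)
        _ = 27 * K₀ ^ 3 * (N * √τ ^ 3) := by ring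
        _ ≤ _ := by
          have : K₀ ^ 3 ≤ K₀ ^ 5 := pow_le_pow_right₀ hK (by norm_num)
          gcongr
    rw [innerPart_eq_negativePart_add]
    simp only [Finset.sum_range_succ, Finset.sum_range_zero]
    have m0 := hm 0 (by norm_num)
    have m1 := hm 1 (by norm_num)
    have m2 := hm 2 (by norm_num)
    have t1 := abs_add_le (negativePart χ₀ K₀ τ q y) (0 + mode χ₀ K₀ τ 0 q * herm 0 y +
      mode χ₀ K₀ τ 1 q * herm 1 y + mode χ₀ K₀ τ 2 q * herm 2 y)
    rw [zero_add] at t1 ⊢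
    have t2 := abs_add_three (mode χ₀ K₀ τ 0 q * herm 0 y) (mode χ₀ K₀ τ 1 q * herm 1 y)
      (mode χ₀ K₀ τ 2 q * herm 2 y)
    have : 0 ≤ K₀ ^ 5 * (N * √τ ^ 3) := by positivity
    linarith
  · rw [innerPart, hχ.isCutoff.cutoff_eq_zero hK0 hτ0 hy, zero_mul, abs_zero]
    positivity

lemma log_le_two_mul_sqrt (hτ : 0 < τ) : Real.log τ ≤ 2 * √τ := by
  have h1 := Real.log_le_sub_one_of_pos (Real.sqrt_pos.2 hτ)
  rw [Real.log_sqrt hτ.le] at h1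
  linarith

/-- Elements of the shrinking set are uniformly small. -/
lemma ShrinkingBounds.abs_le_sqrt (h : ShrinkingBounds χ₀ K₀ A τ N E q)
    (hχ : IsCutoff χ₀) (hK : 1 ≤ K₀) (hτ : 1 ≤ τ) (hA : 1 ≤ A) (y : ℝ) :
    |q y| ≤ 100 * K₀ ^ 3 * A ^ 2 / √τ := by
  have hτ0 : 0 < τ := by linarith
  have hsq : 0 < √τ := Real.sqrt_pos.2 hτ0
  have hA2 : A ≤ A ^ 2 := by nlinarith
  have hK3 : 1 ≤ K₀ ^ 3 := one_le_pow₀ hK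
  have hAs : 0 ≤ A ^ 2 / √τ := by positivity
  have ho : |outerPart χ₀ K₀ τ q y| ≤ K₀ ^ 3 * (A ^ 2 / √τ) :=
    (h.outer y).trans (h.outer_le.trans (le_mul_of_one_le_left hAs hK3))
  rcases le_or_gt |y| (2 * (K₀ * √τ)) with hy | hy
  · have hw := one_add_abs_le_of_le hK hτ hy
    have hlow : ∀ B : ℝ, |B| ≤ A / τ ^ 2 * (1 + |y|) ^ 3 → |B| ≤ 27 * K₀ ^ 3 * (A ^ 2 / √τ) :=
      fun B hB => by
        calc |B| ≤ A ^ 2 / τ ^ 2 * (3 * K₀ * √τ) ^ 3 := hB.trans (by gcongr)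
          _ = 27 * K₀ ^ 3 * (A ^ 2 / √τ) := by
            rw [← sqrt_pow_four hτ0.le]; field_simp; ring
    have m1 : |mode χ₀ K₀ τ 1 q * herm 1 y| ≤ 6 * K₀ ^ 3 * (A ^ 2 / √τ) := by
      calc _ ≤ 2 * (A / τ ^ 2) * (1 + |y|) ^ 1 := abs_mul_herm_le (h.mode_le 1 (by norm_num))
            (k := 1) (by norm_num) (by norm_num) y
        _ ≤ 2 * (A ^ 2 / τ ^ 2) * (3 * K₀ * √τ) ^ 1 := by gcongr
        _ = 6 * K₀ * (A ^ 2 / √τ) * (1 / √τ ^ 2) := by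
            rw [← sqrt_pow_four hτ0.le]; field_simp; ring
        _ ≤ 6 * K₀ ^ 3 * (A ^ 2 / √τ) * 1 := by
            have a1 : K₀ ≤ K₀ ^ 3 := le_self_pow₀ hK (by norm_num)
            have a2 : 1 / √τ ^ 2 ≤ 1 := by
              rw [Real.sq_sqrt hτ0.le]; exact (div_le_one hτ0).2 hτ
            gcongr
        _ = _ := by ring
    have m0' : |mode χ₀ K₀ τ 0 q * herm 0 y| ≤ 2 * K₀ ^ 3 * (A ^ 2 / √τ) := by
      calc _ ≤ 2 * (A / τ ^ 2) * (1 + |y|) ^ 0 := abs_mul_herm_le (h.mode_le 0 (by norm_num))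
            (k := 0) (by norm_num) (by norm_num) y
        _ ≤ 2 * (A ^ 2 / τ ^ 2) * (1 + |y|) ^ 0 := by gcongr
        _ = 2 * (A ^ 2 / √τ) * (1 / √τ ^ 3) := by
            rw [← sqrt_pow_four hτ0.le]; field_simp
        _ ≤ 2 * (K₀ ^ 3 * (A ^ 2 / √τ)) * 1 := by
            have a2 : 1 / √τ ^ 3 ≤ 1 :=
              (div_le_one (by positivity)).2 (one_le_pow₀ (Real.one_le_sqrt.2 hτ))
            gcongr
            exact le_mul_of_one_le_left hAs hK3
        _ = _ := by ring
    have m2 : |mode χ₀ K₀ τ 2 q * herm 2 y| ≤ 36 * K₀ ^ 3 * (A ^ 2 / √τ) := by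
      calc _ ≤ 2 * (A ^ 2 * Real.log τ / τ ^ 2) * (1 + |y|) ^ 2 := abs_mul_herm_le h.mode_two_le
            (k := 2) (by norm_num) (by norm_num) y
        _ ≤ 2 * (A ^ 2 * (2 * √τ) / τ ^ 2) * (3 * K₀ * √τ) ^ 2 := by
            have := log_le_two_mul_sqrt hτ0
            gcongr
        _ = 36 * K₀ ^ 2 * (A ^ 2 / √τ) := by
            rw [← sqrt_pow_four hτ0.le]; field_simp; ring
        _ ≤ _ := by
            have : K₀ ^ 2 ≤ K₀ ^ 3 := pow_le_pow_right₀ hK (by norm_num)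
            gcongr
    have m3 : |negativePart χ₀ K₀ τ q y| ≤ 27 * K₀ ^ 3 * (A ^ 2 / √τ) :=
      hlow _ ((h.abs_neg_le y).trans (by have := h.neg_le; gcongr))
    rw [eq_sum_mode_add (χ₀ := χ₀) (K₀ := K₀) (τ := τ) (q := q) y]
    refine (abs_add_five_le _ _ _ _ _).trans ?_
    have e : 100 * K₀ ^ 3 * A ^ 2 / √τ = 100 * K₀ ^ 3 * (A ^ 2 / √τ) := by ring
    rw [e]
    have : 0 ≤ K₀ ^ 3 * (A ^ 2 / √τ) := by positivity
    linarith
  · have e : q y = outerPart χ₀ K₀ τ q y := by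
      rw [outerPart, hχ.cutoff_eq_zero (by linarith) hτ0 hy]; ring
    rw [e]
    have : 0 ≤ K₀ ^ 3 * (A ^ 2 / √τ) := by positivity
    have e : 100 * K₀ ^ 3 * A ^ 2 / √τ = 100 * K₀ ^ 3 * (A ^ 2 / √τ) := by ring
    linarith

end

/-! ### Powers of logarithms -/

lemma eventually_mul_log_pow_le_rpow (K : ℝ) (n : ℕ) {r : ℝ} (hr : 0 < r) :
    ∀ᶠ τ : ℝ in Filter.atTop, K * (1 + Real.log τ) ^ n ≤ τ ^ r := by
  -- Each of the `n` logarithmic factors costs one power `τ^ε`, and the one left over absorbs the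
  -- constant.
  set ε := r / (n + 1) with hε
  have hn : (0 : ℝ) < n + 1 := by positivity
  have hε0 : 0 < ε := by positivity
  filter_upwards [(tendsto_rpow_atTop hε0).eventually_ge_atTop (|K| * (1 + 1 / ε) ^ n),
    Filter.eventually_ge_atTop 1] with τ h1 h2
  have hl := Real.log_nonneg h2
  have hlog : 1 + Real.log τ ≤ (1 + 1 / ε) * τ ^ ε := by
    have a1 := Real.log_le_rpow_div (by linarith : 0 ≤ τ) hε0
    have a2 : 1 ≤ τ ^ ε := Real.one_le_rpow h2 hε0.le
    have : (1 + 1 / ε) * τ ^ ε = τ ^ ε + τ ^ ε / ε := by ring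
    linarith
  calc K * (1 + Real.log τ) ^ n ≤ |K| * ((1 + 1 / ε) * τ ^ ε) ^ n :=
        mul_le_mul (le_abs_self K) (by gcongr) (by positivity) (abs_nonneg K)
    _ = |K| * (1 + 1 / ε) ^ n * (τ ^ ε) ^ n := by rw [mul_pow]; ring
    _ ≤ τ ^ ε * (τ ^ ε) ^ n := by gcongr
    _ = (τ ^ ε) ^ ((n : ℝ) + 1) := by
        rw [← pow_succ', ← Real.rpow_natCast]; push_cast; rfl
    _ = τ ^ r := by
        rw [← Real.rpow_mul (by linarith), hε]; congr 1; field_simp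

lemma eventually_mul_log_pow_le_sqrt (K : ℝ) (n : ℕ) :
    ∀ᶠ τ : ℝ in Filter.atTop, K * (1 + Real.log τ) ^ n ≤ √τ := by
  filter_upwards [eventually_mul_log_pow_le_rpow K n (r := 1 / 2) (by norm_num)] with τ h
  rwa [Real.sqrt_eq_rpow]

lemma eventually_le_sqrt (K : ℝ) : ∀ᶠ τ : ℝ in Filter.atTop, K ≤ √τ := by
  simpa using eventually_mul_log_pow_le_sqrt K 0

/-! ### Second mode of the linear part -/

/-- The logarithmic size `A²(1 + log τ)` enters only with `τ⁻⁴`, so it is absorbed by one factor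
`τ`; what is left is linear in `A`. -/
lemma CutoffBound.exists_abs_mode_two_linear_le {p Cv ρ : ℝ} {χ₀ : ℝ → ℝ} {c K₀ : ℝ}
    (h : CutoffBound χ₀ c) (hK : 1 ≤ K₀)
    (hV : PotBounds p Cv) (hρ : 0 < ρ) : ∃ C > 0, ∀ A ≥ 1, ∀ᶠ τ in Filter.atTop,
      ∀ s ∈ Icc τ (τ + ρ), ∀ (q : ℝ → ℝ) (N E : ℝ), ShrinkingBounds χ₀ K₀ A τ N E q →
      |mode χ₀ K₀ s 2 (fundK p s τ q)| ≤
        τ ^ 2 / s ^ 2 * |mode χ₀ K₀ τ 2 q| + C * A * (s - τ) / s ^ 3 := by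
  obtain ⟨C, hC, H⟩ := h.exists_abs_mode_two_fundK_sub_le hK hV hρ
  refine ⟨112 * C, by positivity, fun A hA => ?_⟩
  filter_upwards [Filter.eventually_ge_atTop 1, Filter.eventually_ge_atTop (2 * ρ),
    eventually_le_sqrt A, eventually_mul_log_pow_le_sqrt A 1] with τ h1 h2 h3 h4 s hs q N E hq
  have hlog := Real.log_nonneg h1
  have hτ0 : 0 < τ := by linarith
  have hs0 : 0 < s := by linarith [hs.1]
  have ht : 0 ≤ s - τ := sub_nonneg.2 hs.1
  have hsτ : s ≤ 2 * τ := by linarith [hs.2]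
  rw [pow_one] at h4
  have h4' : A * (1 + Real.log τ) ≤ τ := by
    refine h4.trans ((Real.sqrt_le_iff).2 ⟨hτ0.le, by nlinarith⟩)
  have hq2 : |mode χ₀ K₀ τ 2 q| ≤ 8 * (A ^ 2 * (1 + Real.log τ)) / τ ^ 2 :=
    hq.mode_two_le.trans (div_le_div_of_nonneg_right
      (by nlinarith [sq_nonneg A, mul_nonneg (sq_nonneg A) hlog]) (by positivity))
  have key := H τ h1 s hs q hq.cont.measurable (mode χ₀ K₀ τ 2 q) _ _
    (hq.abs_le_weight h.isCutoff hK h1 hA) (hq.abs_sub_mode_two_le h.isCutoff hK h1 hA h3) hq2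
  have herr : C * (s - τ) * (8 * (A ^ 2 * (1 + Real.log τ)) / τ ^ 2 / τ ^ 2 + 6 * A / τ ^ 2 / τ) ≤
      112 * C * A * (s - τ) / s ^ 3 := by
    have e1 : 8 * (A ^ 2 * (1 + Real.log τ)) / τ ^ 2 / τ ^ 2 ≤ 8 * A / τ ^ 3 := by
      have : A ^ 2 * (1 + Real.log τ) ≤ A * τ := by nlinarith
      calc _ ≤ 8 * (A * τ) / τ ^ 2 / τ ^ 2 := by gcongr
        _ = _ := by field_simp
    have e2 : 6 * A / τ ^ 2 / τ = 6 * A / τ ^ 3 := by field_simp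
    have e3 : 1 / τ ^ 3 ≤ 8 / s ^ 3 := by
      rw [div_le_div_iff₀ (by positivity) (by positivity)]
      have : s ^ 3 ≤ (2 * τ) ^ 3 := by gcongr
      linarith [this, mul_pow 2 τ 3]
    calc _ ≤ C * (s - τ) * (8 * A / τ ^ 3 + 6 * A / τ ^ 3) := by rw [e2]; gcongr
      _ = 14 * C * A * (s - τ) * (1 / τ ^ 3) := by ring
      _ ≤ 14 * C * A * (s - τ) * (8 / s ^ 3) := by gcongr
      _ = _ := by ring
  have hx : |(1 - 2 / τ * (s - τ)) * mode χ₀ K₀ τ 2 q| ≤ τ ^ 2 / s ^ 2 * |mode χ₀ K₀ τ 2 q| := by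
    rw [abs_mul]
    refine mul_le_mul_of_nonneg_right ?_ (abs_nonneg _)
    have x1 : 2 / τ * (s - τ) ≤ 1 := by
      rw [div_mul_eq_mul_div, div_le_one hτ0]; linarith [hs.2]
    rw [abs_of_nonneg (by linarith), le_div_iff₀ (by positivity)]
    -- With `x = (s-τ)/τ` this is `(1-2x)(1+x)² = 1 - 3x² - 2x³ ≤ 1`: the factor `τ²/s²` has the
    -- logarithmic derivative `-2/τ` at `s = τ` and lies above its tangent there.
    have e : (1 - 2 / τ * (s - τ)) * s ^ 2 = τ ^ 2 - (3 * (s - τ) ^ 2 + 2 * (s - τ) ^ 3 / τ) := by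
      field_simp; ring
    rw [e]
    have : 0 ≤ 3 * (s - τ) ^ 2 + 2 * (s - τ) ^ 3 / τ := by positivity
    linarith
  have e : mode χ₀ K₀ s 2 (fundK p s τ q) = (1 - 2 / τ * (s - τ)) * mode χ₀ K₀ τ 2 q +
    (mode χ₀ K₀ s 2 (fundK p s τ q) -
      (mode χ₀ K₀ τ 2 q - 2 / τ * (s - τ) * mode χ₀ K₀ τ 2 q)) := by ring
  rw [e]
  exact (abs_add_le _ _).trans (add_le_add hx (key.trans herr))

/-! ### Negative part of the linear evolution -/

lemma semigroupL_herm {θ : ℝ} (hθ : 0 ≤ θ) {m : ℕ} (hm : m < 3) (y : ℝ) :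
    semigroupL θ (herm m) y = Real.exp ((1 - m / 2) * θ) * herm m y := by
  interval_cases m
  · have e : herm 0 = fun _ => (1 : ℝ) := funext herm_zero
    rw [e, semigroupL_const hθ]; norm_num
  · have e : herm 1 = fun x => x := funext herm_one
    rw [e, semigroupL_id hθ]
    congr 2; push_cast; ring
  · rw [herm_two_eq, semigroupL_herm_two hθ]; norm_num

lemma exp_herm_le {θ ρ : ℝ} (hθ : 0 ≤ θ) (hρ : θ ≤ ρ) (m : ℕ) :
    Real.exp ((1 - (m : ℝ) / 2) * θ) ≤ Real.exp ρ := by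
  refine Real.exp_le_exp.2 ?_
  have : (0 : ℝ) ≤ m := Nat.cast_nonneg m
  nlinarith [mul_nonneg this hθ]

section
variable {p Cv ρ : ℝ} {χ₀ : ℝ → ℝ} {c K₀ : ℝ}

lemma abs_potV_le_lin (hV : PotBounds p Cv) {τ t : ℝ} (hτ : 1 ≤ τ) (ht : τ ≤ t) (x : ℝ) :
    |potV p t x| ≤ Cv / √τ * (1 + |x|) ^ 1 := by
  have hCv := hV.one_le
  have hsq : 0 < √τ := Real.sqrt_pos.2 (by linarith)
  refine (hV.lin t (hτ.trans ht) x).trans ?_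
  have h2 : √τ ≤ √t := Real.sqrt_le_sqrt ht
  calc Cv * ((1 + |x|) / √t) ≤ Cv * ((1 + |x|) / √τ) := by gcongr
    _ = _ := by ring

lemma abs_potV_le_quad (hV : PotBounds p Cv) {τ t : ℝ} (hτ : 1 ≤ τ) (ht : τ ≤ t) (x : ℝ) :
    |potV p t x| ≤ Cv / √τ ^ 2 * (1 + |x|) ^ 2 := by
  have hCv := hV.one_le
  rw [Real.sq_sqrt (by linarith)]
  refine (hV.quad t (hτ.trans ht) x).trans ?_
  calc Cv * ((1 + |x|) ^ 2 / t) ≤ Cv * ((1 + |x|) ^ 2 / τ) := by gcongr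
    _ = _ := by ring

/-- The evolution differs from the free semigroup by one factor of the potential. -/
lemma abs_fundK_sub_semigroupL_le (hV : PotBounds p Cv) {τ : ℝ} (hτ : 1 ≤ τ) {g : ℝ → ℝ}
    (mg : Measurable g) {M v : ℝ} {k l : ℕ} (hM : ∀ y, |g y| ≤ M * (1 + |y|) ^ k) (hv : 0 ≤ v)
    (hVl : ∀ t, τ ≤ t → ∀ x, |potV p t x| ≤ v * (1 + |x|) ^ l) {s : ℝ} (hs : s ∈ Icc τ (τ + ρ))
    (y : ℝ) : |fundK p s τ g y - semigroupL (s - τ) g y| ≤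
      Real.exp (dysC Cv ρ (l + k) * ρ) * (Real.exp ρ * gaussMom (l + k) *
        (Real.exp ρ * gaussMom k)) * (v * M) * (s - τ) * (1 + |y|) ^ (l + k) := by
  have hM0 := nonneg_of_abs_le_mul_pow (hM 0)
  have g1 := gaussMom_pos k
  have g2 := gaussMom_pos (l + k)
  have h1 : ∀ t ∈ Icc τ (τ + ρ), ∀ x, |dysonTerm p 1 t τ g x| ≤
      Real.exp ρ * gaussMom (l + k) * v * (Real.exp ρ * gaussMom k * M) * (t - τ) ^ 1 *
        (1 + |x|) ^ (l + k) := fun t ht x => by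
    have := abs_dysonTerm_succ_le (p := p) (B := Real.exp ρ * gaussMom k * M) (j := 0) (k := k)
      (l := l) (v := v) ht mg (by positivity) (fun t' ht' => hVl t' ht'.1)
      (fun t' ht' x => by
        rw [pow_zero, mul_one]
        exact abs_dysonTerm_zero_le (ρ := ρ) ⟨ht'.1, ht'.2.trans ht.2⟩ mg hM x) x
    rwa [Nat.cast_zero, zero_add, zero_add, div_one] at this
  have := abs_fundK_sub_sum_le hV hτ mg hM (by positivity) h1 hs y
  rw [Finset.sum_range_one, dysonTerm] at this
  refine this.trans (le_of_eq ?_)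
  ring

/-- The gain `√τ^(3-m)` offsets exactly the loss in `abs_mode_le_of_negativePart`. For the free
evolution it is the cutoff error; each factor of `V` brings as many powers of `1/√τ` as powers of
the weight, up to total degree three. -/
lemma CutoffBound.exists_abs_negativePart_fundK_herm_le (h : CutoffBound χ₀ c) (hK : 1 ≤ K₀)
    (hV : PotBounds p Cv) (hρ : 0 < ρ) : ∃ C > 0, ∀ τ ≥ 1, ∀ s ∈ Icc τ (τ + ρ), ∀ m < 3, ∀ y,
      |negativePart χ₀ K₀ s (fundK p s τ (herm m)) y| ≤ C / √τ ^ (3 - m) * (1 + |y| ^ 3) := by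
  have hnH := h.negHermC_nonneg
  have hnC := h.negC_pos
  have hCv := hV.one_le
  obtain ⟨e, he⟩ : ∃ e, e = Real.exp ρ := ⟨_, rfl⟩
  have he0 : 0 < e := he ▸ Real.exp_pos _
  obtain ⟨X, hX⟩ : ∃ X, X = Real.exp (dysC Cv ρ 3 * ρ) := ⟨_, rfl⟩
  have hX0 : 0 < X := hX ▸ Real.exp_pos _
  have g0 := gaussMom_pos 0
  have g1 := gaussMom_pos 1
  have g2 := gaussMom_pos 2
  have g3 := gaussMom_pos 3
  set Z1 : ℕ → ℝ := fun m => X * (e * gaussMom 3 * (e * gaussMom m)) * (Cv * 2) * ρ with hZ1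
  have hZ1p : ∀ m, 0 < Z1 m := fun m => by
    have := gaussMom_pos m
    simp only [hZ1]; positivity
  set Z0 : ℝ := X * (e * gaussMom 3 * Cv * (e * gaussMom 2 * Cv * (e * gaussMom 0 * 2))) * ρ ^ 2 +
    e * gaussMom 3 * (e * Cv) * ρ with hZ0
  have hZ0p : 0 < Z0 := by positivity
  -- transfer of the free part
  have hfree : ∀ τ ≥ 1, ∀ s ∈ Icc τ (τ + ρ), ∀ m < 3, ∀ y,
      |negativePart χ₀ K₀ s (semigroupL (s - τ) (herm m)) y| ≤
        e * negHermC c / √τ ^ (3 - m) * (1 + |y| ^ 3) := fun τ hτ s hs m hm y => by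
    have ht : 0 ≤ s - τ := sub_nonneg.2 hs.1
    have hsq : 0 < √τ := Real.sqrt_pos.2 (by linarith)
    have hsq' : √τ ≤ √s := Real.sqrt_le_sqrt hs.1
    have e1 : semigroupL (s - τ) (herm m) = fun y => Real.exp ((1 - m / 2) * (s - τ)) * herm m y :=
      funext fun y => semigroupL_herm ht hm y
    rw [e1, negativePart_const_mul, abs_mul, abs_of_pos (Real.exp_pos _)]
    calc _ ≤ e * (negHermC c / √s ^ (3 - m) * (1 + |y| ^ 3)) := by
          gcongr
          · rw [he]; exact exp_herm_le ht (by linarith [hs.2]) m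
          · exact h.abs_negativePart_herm_le hK (hτ.trans hs.1) hm y
      _ ≤ e * (negHermC c / √τ ^ (3 - m) * (1 + |y| ^ 3)) := by gcongr
      _ = _ := by ring
  refine ⟨e * negHermC c + negC c * (Z1 1 + Z1 2 + Z0) + e * ρ * negHermC c, by
    have := hZ1p 1; have := hZ1p 2; positivity, fun τ hτ s hs m hm y => ?_⟩
  have hz1 := hZ1p 1
  have hz2 := hZ1p 2
  have ht : 0 ≤ s - τ := sub_nonneg.2 hs.1
  have htρ : s - τ ≤ ρ := by linarith [hs.2]
  have hτ0 : 0 < τ := by linarith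
  have hs0 : 0 < s := by linarith [hs.1]
  have hsq : 0 < √τ := Real.sqrt_pos.2 (by linarith)
  have hsq' : √τ ≤ √s := Real.sqrt_le_sqrt hs.1
  have hmP := polyBdd_herm hm
  have hFP : PolyBdd (fundK p s τ (herm m)) := hmP.fundK hV hτ hs.1
  have hSP : PolyBdd (semigroupL (s - τ) (herm m)) := hmP.semigroupL ht
  have hf := hfree τ hτ s hs m hm y
  rcases Nat.eq_zero_or_pos m with h0 | h0
  · subst h0
    have e0 : herm 0 = fun _ => (1 : ℝ) := funext herm_zero
    -- For `m = 0` a single factor of `V` seems to give only `1/τ`. Its leading part is a multiple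
    -- `a` of `h₂`, of size `1/τ`, whose negative part brings the missing `1/√τ`; the rest of `V` is
    -- `O(τ^{-3/2})` with cubic weight.
    obtain ⟨a, ha⟩ : ∃ a, a = ∫ t in τ..s, -(Real.exp (t - τ) / (4 * t)) := ⟨_, rfl⟩
    have hcont : ContinuousOn (fun t : ℝ => -(Real.exp (t - τ) / (4 * t))) (Icc τ s) := by
      refine (ContinuousOn.div (by fun_prop) (by fun_prop) fun t ht => ?_).neg
      have : 0 < t := by linarith [ht.1]
      positivity
    have habs : |a| ≤ e * ρ / √τ ^ 2 := by
      rw [ha]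
      refine (intervalIntegral.norm_integral_le_of_norm_le_const (C := e / √τ ^ 2)
        (f := fun t => -(Real.exp (t - τ) / (4 * t))) fun t ht' => ?_).trans ?_
      · rw [uIoc_of_le hs.1] at ht'
        have ht0 : 0 < t := by linarith [ht'.1]
        rw [Real.norm_eq_abs, abs_neg, abs_of_pos (by positivity), Real.sq_sqrt hτ0.le, he]
        refine div_le_div₀ (Real.exp_pos _).le (Real.exp_le_exp.2 ?_) hτ0 ?_
        · linarith [ht'.2, hs.2]
        · linarith [ht'.1]
      · rw [abs_of_nonneg ht]
        calc _ ≤ e / √τ ^ 2 * ρ := by gcongr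
          _ = _ := by ring
    have hh2P : PolyBdd fun x : ℝ => x ^ 2 - 2 := herm_two_eq ▸ polyBdd_herm (m := 2) (by norm_num)
    have hD1 : ∀ y, |dysonTerm p 1 s τ (herm 0) y - a * herm 2 y| ≤
        e * gaussMom 3 * (e * Cv / √τ ^ 3) * (s - τ) * (1 + |y|) ^ 3 := fun y => by
      have key := abs_dysonTerm_one_sub_le (k := 3) (M := e * Cv / √τ ^ 3) hV hτ hmP hs hh2P hcont
        (fun t ht' x => by
          have ht0 : 0 < t := by linarith [ht'.1]
          have hst : √τ ≤ √t := Real.sqrt_le_sqrt ht'.1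
          rw [semigroupL_herm (sub_nonneg.2 ht'.1) (by norm_num), herm_zero]
          have e1 : potV p t x * (Real.exp ((1 - ((0 : ℕ) : ℝ) / 2) * (t - τ)) * 1) -
              -(Real.exp (t - τ) / (4 * t)) * (x ^ 2 - 2) =
              Real.exp (t - τ) * (potV p t x + (x ^ 2 - 2) / (4 * t)) := by
            norm_num; field_simp
          rw [e1, abs_mul, abs_of_pos (Real.exp_pos _)]
          calc _ ≤ e * (Cv * ((1 + |x|) / √t) ^ 3) := by
                gcongr
                · rw [he]; exact Real.exp_le_exp.2 (by linarith [ht'.2, hs.2])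
                · exact hV.expansion' t (hτ.trans ht'.1) x
            _ ≤ e * (Cv * ((1 + |x|) / √τ) ^ 3) := by gcongr
            _ = _ := by rw [div_pow]; ring)
        (fun y => (continuousOn_const (c := y ^ 2 - 2)).congr fun t ht' =>
          semigroupL_herm_two (sub_nonneg.2 ht'.2) y) y
      have e2 : ∫ t in τ..s, -(Real.exp (t - τ) / (4 * t)) *
          semigroupL (s - t) (fun x => x ^ 2 - 2) y = a * herm 2 y := by
        rw [ha, ← intervalIntegral.integral_mul_const]
        refine intervalIntegral.integral_congr fun t ht' => ?_
        rw [uIcc_of_le hs.1] at ht'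
        rw [semigroupL_herm_two (sub_nonneg.2 ht'.2), herm_two]
      rw [e2, ← he] at key
      exact key
    have hB1 : ∀ t ∈ Icc τ (τ + ρ), ∀ x, |dysonTerm p 1 t τ (herm 0) x| ≤
        e * gaussMom 2 * (Cv / √τ ^ 2) * (e * gaussMom 0 * 2) * (t - τ) ^ 1 * (1 + |x|) ^ 2 :=
      fun t ht' x => by
        have := abs_dysonTerm_succ_le (p := p) (B := e * gaussMom 0 * 2) (j := 0) (k := 0)
          (l := 2) (v := Cv / √τ ^ 2) ht' hmP.1 (by positivity)
          (fun t' ht'' => abs_potV_le_quad hV hτ ht''.1)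
          (fun t' ht'' x => by
            rw [pow_zero, mul_one, he]
            exact abs_dysonTerm_zero_le (ρ := ρ) ⟨ht''.1, ht''.2.trans ht'.2⟩ hmP.1
              (abs_herm_le (by norm_num)) x) x
        rwa [Nat.cast_zero, zero_add, zero_add, div_one, ← he] at this
    -- Bounding one factor of `V` quadratically and the other linearly gives `τ^{-3/2}` without
    -- exceeding the cubic weight.
    have hB2 : ∀ t ∈ Icc τ (τ + ρ), ∀ x, |dysonTerm p 2 t τ (herm 0) x| ≤
        (e * gaussMom 3 * (Cv / √τ) * (e * gaussMom 2 * (Cv / √τ ^ 2) * (e * gaussMom 0 * 2))) *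
          (t - τ) ^ 2 * (1 + |x|) ^ 3 :=
      fun t ht' x => by
        have := abs_dysonTerm_succ_le (p := p)
          (B := e * gaussMom 2 * (Cv / √τ ^ 2) * (e * gaussMom 0 * 2)) (j := 1) (k := 2)
          (l := 1) (v := Cv / √τ) ht' hmP.1 (by positivity)
          (fun t' ht'' => abs_potV_le_lin hV hτ ht''.1)
          (fun t' ht'' x => hB1 t' ⟨ht''.1, ht''.2.trans ht'.2⟩ x) x
        refine this.trans ?_
        rw [Nat.cast_one, ← he]
        have ht'' : 0 ≤ t - τ := sub_nonneg.2 ht'.1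
        refine mul_le_mul_of_nonneg_right (mul_le_mul_of_nonneg_right ?_ (by positivity))
          (by positivity)
        exact div_le_self (by positivity) (by norm_num)
    have htail := abs_fundK_sub_sum_le hV hτ hmP.1 (abs_herm_le (m := 0) (by norm_num))
      (by positivity) hB2 hs
    rw [← hX] at htail
    set v : ℝ → ℝ := fun y => fundK p s τ (herm 0) y - semigroupL (s - τ) (herm 0) y -
      a * herm 2 y with hv
    have h2P := polyBdd_herm (m := 2) (by norm_num)
    have hvP : PolyBdd v := (hFP.sub hSP).sub (h2P.const_mul a)
    have hvb : ∀ y, |v y| ≤ Z0 / √τ ^ 3 * (1 + |y|) ^ 3 := fun y => by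
      have e1 : v y = (fundK p s τ (herm 0) y - ∑ n ∈ Finset.range 2, dysonTerm p n s τ (herm 0) y)
          + (dysonTerm p 1 s τ (herm 0) y - a * herm 2 y) := by
        simp only [hv, Finset.sum_range_succ, Finset.sum_range_zero]
        rw [dysonTerm]; ring
      rw [e1]
      refine (abs_add_le _ _).trans ((add_le_add (htail y) (hD1 y)).trans ?_)
      calc _ ≤ X * (e * gaussMom 3 * (Cv / √τ) * (e * gaussMom 2 * (Cv / √τ ^ 2) *
            (e * gaussMom 0 * 2))) * ρ ^ 2 * (1 + |y|) ^ 3 +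
            e * gaussMom 3 * (e * Cv / √τ ^ 3) * ρ * (1 + |y|) ^ 3 := by gcongr
        _ = _ := by rw [hZ0]; field_simp
    have hneg := h.abs_negativePart_le (K₀ := K₀) (by linarith) hs0 (fun y _ => hvb y) y
    have hsplit : negativePart χ₀ K₀ s (fundK p s τ (herm 0)) y =
        negativePart χ₀ K₀ s (semigroupL (s - τ) (herm 0)) y +
        (a * negativePart χ₀ K₀ s (herm 2) y + negativePart χ₀ K₀ s v y) := by
      rw [← negativePart_const_mul, ← h.negativePart_add (by linarith) (h2P.const_mul a) hvP,
        ← h.negativePart_add (by linarith) hSP ((h2P.const_mul a).add hvP)]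
      congr 1; ext x; simp only [hv]; ring
    have hn2 := h.abs_negativePart_herm_le hK (hτ.trans hs.1) (m := 2) (by norm_num) y
    have hn2' : |a * negativePart χ₀ K₀ s (herm 2) y| ≤
        e * ρ * negHermC c / √τ ^ 3 * (1 + |y| ^ 3) := by
      rw [abs_mul]
      calc _ ≤ e * ρ / √τ ^ 2 * (negHermC c / √τ ^ (3 - 2) * (1 + |y| ^ 3)) := by
            refine mul_le_mul habs (hn2.trans ?_) (abs_nonneg _) (by positivity)
            gcongr
        _ = _ := by norm_num; field_simp
    rw [hsplit]
    refine (abs_add_le _ _).trans ((add_le_add hf ((abs_add_le _ _).trans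
      (add_le_add hn2' hneg))).trans ?_)
    have e5 : e * negHermC c / √τ ^ (3 - 0) * (1 + |y| ^ 3) +
        (e * ρ * negHermC c / √τ ^ 3 * (1 + |y| ^ 3) + negC c * (Z0 / √τ ^ 3) * (1 + |y| ^ 3)) =
        (e * negHermC c + negC c * Z0 + e * ρ * negHermC c) / √τ ^ 3 * (1 + |y| ^ 3) := by
      norm_num; ring
    rw [e5]
    gcongr
    linarith
  · set v : ℝ → ℝ := fun y => fundK p s τ (herm m) y - semigroupL (s - τ) (herm m) y with hv
    have hvP : PolyBdd v := hFP.sub hSP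
    -- For `m = 1, 2` one factor of `V`, bounded with the power `3 - m`, already has the required
    -- size.
    have hVl : ∀ t, τ ≤ t → ∀ x, |potV p t x| ≤ Cv / √τ ^ (3 - m) * (1 + |x|) ^ (3 - m) := by
      interval_cases m
      · exact fun t ht' => abs_potV_le_quad hV hτ ht'
      · intro t ht'
        have := abs_potV_le_lin hV hτ ht'
        simpa using this
    have hvb : ∀ y, |v y| ≤ Z1 m / √τ ^ (3 - m) * (1 + |y|) ^ 3 := fun y => by
      have := abs_fundK_sub_semigroupL_le hV hτ hmP.1 (abs_herm_le hm) (by positivity) hVl hs y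
      have e3 : 3 - m + m = 3 := by omega
      rw [e3, ← hX, ← he] at this
      refine this.trans ?_
      have gm := gaussMom_pos m
      calc _ ≤ X * (e * gaussMom 3 * (e * gaussMom m)) * (Cv / √τ ^ (3 - m) * 2) * ρ *
            (1 + |y|) ^ 3 := by gcongr
        _ = _ := by simp only [hZ1]; ring
    have hneg := h.abs_negativePart_le (K₀ := K₀) (by linarith) hs0 (fun y _ => hvb y) y
    have hsplit : negativePart χ₀ K₀ s (fundK p s τ (herm m)) y =
        negativePart χ₀ K₀ s (semigroupL (s - τ) (herm m)) y + negativePart χ₀ K₀ s v y := by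
      rw [← h.negativePart_add (by linarith) hSP hvP]
      congr 1; ext x; simp only [hv]; ring
    have hZm : Z1 m ≤ Z1 1 + Z1 2 := by
      interval_cases m <;> linarith
    rw [hsplit]
    refine (abs_add_le _ _).trans ((add_le_add hf hneg).trans ?_)
    have e5 : e * negHermC c / √τ ^ (3 - m) * (1 + |y| ^ 3) +
        negC c * (Z1 m / √τ ^ (3 - m)) * (1 + |y| ^ 3) =
        (e * negHermC c + negC c * Z1 m) / √τ ^ (3 - m) * (1 + |y| ^ 3) := by ring
    rw [e5]
    refine mul_le_mul_of_nonneg_right (div_le_div_of_nonneg_right ?_ (by positivity))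
      (by positivity)
    have : negC c * Z1 m ≤ negC c * (Z1 1 + Z1 2 + Z0) :=
      mul_le_mul_of_nonneg_left (by linarith) hnC.le
    have : 0 ≤ e * ρ * negHermC c := by positivity
    linarith

/-- Bound on the negative part of the linear evolution, on bounded time intervals. -/
lemma CutoffBound.exists_abs_negativePart_linear_le (h : CutoffBound χ₀ c) (hK : 1 ≤ K₀)
    (hV : PotBounds p Cv) (hρ : 0 < ρ) : ∃ C > 0, ∀ τ ≥ 1, ∀ s ∈ Icc τ (τ + ρ),
      ∀ (q : ℝ → ℝ) (A N E : ℝ), 1 ≤ A → ShrinkingBounds χ₀ K₀ A τ N E q → ∀ y,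
      |negativePart χ₀ K₀ s (fundK p s τ q) y| ≤ C * (N + E / √τ ^ 3) * (1 + |y| ^ 3) := by
  obtain ⟨C, hC, H⟩ := h.exists_abs_negativePart_fundK_herm_le hK hV hρ
  have hnC := h.negC_pos
  have hF := fundC_pos Cv ρ 3
  have hK0 : 0 < K₀ := by linarith
  refine ⟨1500 * K₀ ^ 3 * C + negC c * fundC Cv ρ 3, by positivity,
    fun τ hτ s hs q A N E hA hq y => ?_⟩
  have hτ0 : 0 < τ := by linarith
  have hs0 : 0 < s := by linarith [hs.1]
  have hsq : 0 < √τ := Real.sqrt_pos.2 hτ0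
  have hN := hq.neg_nonneg
  have hE := hq.outer_nonneg
  have hqP : PolyBdd q := PolyBdd.of_bound hq.cont.measurable
    (hq.abs_le_weight h.isCutoff hK hτ hA)
  set r : ℝ → ℝ := fun y => negativePart χ₀ K₀ τ q y + outerPart χ₀ K₀ τ q y with hr
  have hrP : PolyBdd r := (h.polyBdd_negativePart hK0.le hqP).add (h.polyBdd_outerPart hK0.le hqP)
  have hrb : ∀ y, |r y| ≤ (N + E / √τ ^ 3) * (1 + |y|) ^ 3 := fun y => by
    rw [add_mul]
    exact (abs_add_le _ _).trans (add_le_add (hq.abs_neg_le y)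
      (hq.abs_outerPart_le_weight h.isCutoff hK hτ0 3 y))
  have hP : ∀ m < 3, PolyBdd (herm m) := fun m hm => polyBdd_herm hm
  have hFm : ∀ m < 3, PolyBdd fun x => mode χ₀ K₀ τ m q * fundK p s τ (herm m) x := fun m hm =>
    ((hP m hm).fundK hV hτ hs.1).const_mul _
  have hsplit : fundK p s τ q = fun x => (mode χ₀ K₀ τ 0 q * fundK p s τ (herm 0) x +
      mode χ₀ K₀ τ 1 q * fundK p s τ (herm 1) x) + (mode χ₀ K₀ τ 2 q * fundK p s τ (herm 2) x +
      fundK p s τ r x) := by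
    have p0 := (hP 0 (by norm_num)).const_mul (mode χ₀ K₀ τ 0 q)
    have p1 := (hP 1 (by norm_num)).const_mul (mode χ₀ K₀ τ 1 q)
    have p2 := (hP 2 (by norm_num)).const_mul (mode χ₀ K₀ τ 2 q)
    ext x
    rw [← fundK_const_mul, ← fundK_const_mul, ← fundK_const_mul, ← fundK_add hV hτ p0 p1 hs.1,
      ← fundK_add hV hτ p2 hrP hs.1, ← fundK_add hV hτ (p0.add p1) (p2.add hrP) hs.1]
    congr 1
    ext z
    rw [eq_sum_mode_add (χ₀ := χ₀) (K₀ := K₀) (τ := τ) (q := q) z]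
    simp only [hr]
    ring
  rw [hsplit, h.negativePart_add hK0.le ((hFm 0 (by norm_num)).add (hFm 1 (by norm_num)))
    ((hFm 2 (by norm_num)).add (hrP.fundK hV hτ hs.1)),
    h.negativePart_add hK0.le (hFm 0 (by norm_num)) (hFm 1 (by norm_num)),
    h.negativePart_add hK0.le (hFm 2 (by norm_num)) (hrP.fundK hV hτ hs.1),
    negativePart_const_mul, negativePart_const_mul, negativePart_const_mul]
  -- The powers of `√τ` lost on the mode and gained on its evolution cancel, so low modes cost no
  -- more than the norm of the negative part.
  have hm : ∀ m < 3, |mode χ₀ K₀ τ m q * negativePart χ₀ K₀ s (fundK p s τ (herm m)) y| ≤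
      500 * K₀ ^ 3 * C * N * (1 + |y| ^ 3) := fun m hm => by
    rw [abs_mul]
    calc _ ≤ 500 * K₀ ^ 3 * N * √τ ^ (3 - m) * (C / √τ ^ (3 - m) * (1 + |y| ^ 3)) :=
          mul_le_mul (h.abs_mode_le_of_negativePart hK hτ hq.neg hm) (H τ hτ s hs m hm y)
            (abs_nonneg _) (by positivity)
      _ = _ := by field_simp
  have hrn := h.abs_negativePart_le (K₀ := K₀) hK0 hs0
    (fun x _ => abs_fundK_le hV hτ hrP.1 hrb hs x) y
  have m0 := hm 0 (by norm_num)
  have m1 := hm 1 (by norm_num)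
  have m2 := hm 2 (by norm_num)
  refine (abs_add_le _ _).trans ((add_le_add ((abs_add_le _ _).trans (add_le_add m0 m1))
    ((abs_add_le _ _).trans (add_le_add m2 hrn))).trans ?_)
  have hE' : 0 ≤ E / √τ ^ 3 := by positivity
  have e1 : (1500 * K₀ ^ 3 * C + negC c * fundC Cv ρ 3) * (N + E / √τ ^ 3) * (1 + |y| ^ 3) =
    1500 * K₀ ^ 3 * C * N * (1 + |y| ^ 3) + 1500 * K₀ ^ 3 * C * (E / √τ ^ 3) * (1 + |y| ^ 3) +
    negC c * (fundC Cv ρ 3 * (N + E / √τ ^ 3)) * (1 + |y| ^ 3) := by ring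
  rw [e1]
  have : 0 ≤ 1500 * K₀ ^ 3 * C * (E / √τ ^ 3) * (1 + |y| ^ 3) := by positivity
  linarith

end

/-! ### Negative part at large time differences, through the drift path -/

section
variable {p Cv ρ : ℝ} {χ₀ : ℝ → ℝ} {c K₀ : ℝ}

lemma abs_potPath_le_lin (hV : PotBounds p Cv) {τ s : ℝ} (hτ : 1 ≤ τ) (hs : s ∈ Icc τ (τ + ρ))
    (y : ℝ) : |potPath p τ s y| ≤ Cv * ρ * ((1 + |y|) / √τ) := by
  have hCv := hV.one_le
  have hsq : 0 < √τ := Real.sqrt_pos.2 (by linarith)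
  unfold potPath
  refine (intervalIntegral.norm_integral_le_of_norm_le_const (C := Cv / √τ * (1 + |y|))
    (f := fun σ => potV p σ (Real.exp (-(s - σ) / 2) * y)) fun σ hσ => ?_).trans ?_
  · rw [uIoc_of_le hs.1] at hσ
    refine (abs_potV_le_lin hV hτ hσ.1.le _).trans ?_
    rw [pow_one, abs_mul, abs_of_pos (Real.exp_pos _)]
    have : Real.exp (-(s - σ) / 2) ≤ 1 := Real.exp_le_one_iff.2 (by linarith [hσ.2])
    have h2 : Real.exp (-(s - σ) / 2) * |y| ≤ |y| := mul_le_of_le_one_left (abs_nonneg y) this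
    gcongr
  · rw [abs_of_nonneg (sub_nonneg.2 hs.1)]
    calc _ ≤ Cv / √τ * (1 + |y|) * ρ := by gcongr; linarith [hs.2]
      _ = _ := by ring

lemma abs_exp_sub_one_le_mul (x : ℝ) : |Real.exp x - 1| ≤ |x| * Real.exp |x| := by
  rcases le_total 0 x with hx | hx
  · rw [abs_of_nonneg hx, abs_of_nonneg (sub_nonneg.2 (Real.one_le_exp hx))]
    have h1 := Real.add_one_le_exp (-x)
    have h2 : Real.exp x * Real.exp (-x) = 1 := by rw [← Real.exp_add]; simp
    nlinarith [Real.exp_pos x]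
  · rw [abs_of_nonpos hx, abs_of_nonpos (sub_nonpos.2 (Real.exp_le_one_iff.2 hx))]
    have h1 := Real.add_one_le_exp x
    have h2 : 1 ≤ Real.exp (-x) := Real.one_le_exp (by linarith)
    nlinarith

lemma exp_potPath_le_two (hp : 1 < p) (hV : PotBounds p Cv) {τ s : ℝ} (hτ : 1 ≤ τ)
    (hs : s ∈ Icc τ (τ + ρ)) (hτC : 2 * (Cv * ρ) ≤ τ) (y : ℝ) :
    Real.exp (potPath p τ s y) ≤ 2 := by
  have hCv := hV.one_le
  have h1 : potPath p τ s y ≤ 1 / 2 := by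
    refine (potPath_le hp hV hτ hs.1 y).trans ?_
    rw [div_mul_eq_mul_div, div_le_iff₀ (by linarith)]
    have : Cv * (s - τ) ≤ Cv * ρ := by gcongr; linarith [hs.2]
    linarith
  have h2 : Real.exp (1 / 2 : ℝ) ≤ 2 := by
    have := Real.exp_one_lt_d9
    have e : Real.exp (1 / 2 : ℝ) ^ 2 = Real.exp 1 := by rw [← Real.exp_nat_mul]; norm_num
    nlinarith [Real.exp_pos (1 / 2 : ℝ)]
  exact (Real.exp_le_exp.2 h1).trans h2

lemma sqrt_mul_le (a : ℝ) (ha : 1 ≤ a) {s τ : ℝ} (h : s ≤ a ^ 2 * τ) : √s ≤ a * √τ := by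
  have : √(a ^ 2 * τ) = a * √τ := by
    rw [Real.sqrt_mul (sq_nonneg a), Real.sqrt_sq (by linarith)]
  rw [← this]
  exact Real.sqrt_le_sqrt h

/-- Bound on the negative part of the linear evolution after a unit of time, with a constant
that does not depend on the length of the time interval. -/
lemma CutoffBound.exists_abs_negativePart_linear_le_of_three_le (hp : 1 < p)
    (h : CutoffBound χ₀ c) (hK : 1 ≤ K₀) (hV : PotBounds p Cv) : ∃ C > 0, ∀ ρ > 0, ∀ A ≥ 1,
      ∀ᶠ τ in Filter.atTop, ∀ s ∈ Icc τ (τ + ρ), 3 ≤ s - τ → ∀ (q : ℝ → ℝ) (N E : ℝ),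
      ShrinkingBounds χ₀ K₀ A τ N E q → ∀ y, |negativePart χ₀ K₀ s (fundK p s τ q) y| ≤
        (C * Real.exp (-(s - τ) / 2) * N + (s - τ) / s ^ 2) * (1 + |y| ^ 3) := by
  obtain ⟨C4, hC4, H4⟩ := exists_abs_semigroupL_le_of_orthogonal
  have hnC := h.negC_pos
  have hnH := h.negHermC_nonneg
  have hCv := hV.one_le
  have hK0 : 0 < K₀ := by linarith
  refine ⟨negC c * (2 * C4), by positivity, fun ρ hρ A hA => ?_⟩
  obtain ⟨e, he⟩ : ∃ e, e = Real.exp ρ := ⟨_, rfl⟩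
  have he0 : 0 < e := he ▸ Real.exp_pos _
  obtain ⟨X, hX⟩ : ∃ X, X = Real.exp (pathC Cv ρ 3 * ρ) := ⟨_, rfl⟩
  have hX0 : 0 < X := hX ▸ Real.exp_pos _
  obtain ⟨Y, hY⟩ : ∃ Y, Y = Cv * ρ * Real.exp (Cv * ρ) := ⟨_, rfl⟩
  have hY0 : 0 < Y := by rw [hY]; positivity
  set Z := negC c * (8 * X + 48 * Y * e + 1536 * e) + 24 * e * negHermC c with hZ
  have hZ0 : 0 < Z := by positivity
  filter_upwards [Filter.eventually_ge_atTop 1, Filter.eventually_ge_atTop ρ,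
    Filter.eventually_ge_atTop (10 * ρ), Filter.eventually_ge_atTop (2 * (Cv * ρ)),
    eventually_mul_log_pow_le_sqrt (4 * Z * A ^ 2) 1] with τ h1 h2 h2' h3 h4 s hs ht3 q N E hq y
  have hlog := Real.log_nonneg h1
  have hτ0 : 0 < τ := by linarith
  have hs0 : 0 < s := by linarith [hs.1]
  have ht : 0 ≤ s - τ := sub_nonneg.2 hs.1
  have htρ : s - τ ≤ ρ := by linarith [hs.2]
  have hsτ : s ≤ 2 * τ := by linarith [hs.2]
  have hsq : 0 < √τ := Real.sqrt_pos.2 hτ0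
  have hsq1 : 1 ≤ √τ := Real.one_le_sqrt.2 h1
  have hss : √τ ≤ √s := Real.sqrt_le_sqrt hs.1
  have hN := hq.neg_nonneg
  have hE := hq.outer_nonneg
  obtain ⟨D, hD⟩ : ∃ D, D = A ^ 2 * (1 + Real.log τ) := ⟨_, rfl⟩
  have hAD2 : A ^ 2 ≤ D := by rw [hD]; nlinarith [sq_nonneg A]
  have hAD : A ≤ D := by nlinarith
  have hD0 : 0 ≤ D := (sq_nonneg A).trans hAD2
  have hDτ : 0 ≤ D / τ ^ 2 := by positivity
  have hqb := hq.abs_le_weight h.isCutoff hK h1 hA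
  rw [← hD] at hqb
  have hqP : PolyBdd q := PolyBdd.of_bound hq.cont.measurable hqb
  have hqm : ∀ m < 3, |mode χ₀ K₀ τ m q| ≤ D / τ ^ 2 := fun m hm => by
    have a1 : A / τ ^ 2 ≤ D / τ ^ 2 := by gcongr
    interval_cases m
    · exact (hq.mode_le 0 (by norm_num)).trans a1
    · exact (hq.mode_le 1 (by norm_num)).trans a1
    · refine hq.mode_two_le.trans ?_
      rw [hD]; gcongr; linarith
  have hnP := h.polyBdd_negativePart (s := τ) hK0.le hqP
  have hoP := h.polyBdd_outerPart (s := τ) hK0.le hqP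
  have hhP : ∀ m < 3, PolyBdd (herm m) := fun m hm => polyBdd_herm hm
  -- the polynomial part
  set b : ℕ → ℝ := fun m => mode χ₀ K₀ τ m q * Real.exp ((1 - m / 2) * (s - τ)) with hb
  have hbb : ∀ m < 3, |b m| ≤ e * (D / τ ^ 2) := fun m hm => by
    simp only [hb]
    rw [abs_mul, abs_of_pos (Real.exp_pos _), mul_comm e]
    exact mul_le_mul (hqm m hm) (he ▸ exp_herm_le ht htρ m) (Real.exp_pos _).le hDτ
  set P : ℝ → ℝ := fun y => (b 0 * herm 0 y + b 1 * herm 1 y) + b 2 * herm 2 y with hP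
  have hPP : PolyBdd P := (((hhP 0 (by norm_num)).const_mul _).add
    ((hhP 1 (by norm_num)).const_mul _)).add ((hhP 2 (by norm_num)).const_mul _)
  have hPb : ∀ y, |P y| ≤ 6 * e * (D / τ ^ 2) * (1 + |y|) ^ 2 := fun y => by
    have b0 := abs_mul_herm_le (hbb 0 (by norm_num)) (m := 0) (k := 2) (by norm_num) (by norm_num) y
    have b1 := abs_mul_herm_le (hbb 1 (by norm_num)) (m := 1) (k := 2) (by norm_num) (by norm_num) y
    have b2 := abs_mul_herm_le (hbb 2 (by norm_num)) (m := 2) (k := 2) (by norm_num) (by norm_num) y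
    refine (abs_add_three _ _ _).trans ?_
    linarith
  have hSq : ∀ y, semigroupL (s - τ) q y = P y + semigroupL (s - τ) (negativePart χ₀ K₀ τ q) y +
      semigroupL (s - τ) (outerPart χ₀ K₀ τ q) y := fun y => by
    have p0 := (hhP 0 (by norm_num)).const_mul (mode χ₀ K₀ τ 0 q)
    have p1 := (hhP 1 (by norm_num)).const_mul (mode χ₀ K₀ τ 1 q)
    have p2 := (hhP 2 (by norm_num)).const_mul (mode χ₀ K₀ τ 2 q)
    have eq : q = fun y => ((((mode χ₀ K₀ τ 0 q * herm 0 y + mode χ₀ K₀ τ 1 q * herm 1 y) +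
      mode χ₀ K₀ τ 2 q * herm 2 y) + negativePart χ₀ K₀ τ q y) + outerPart χ₀ K₀ τ q y) :=
      funext fun y => eq_sum_mode_add y
    conv_lhs => rw [eq]
    rw [semigroupL_add ht (((p0.add p1).add p2).add hnP) hoP,
      semigroupL_add ht ((p0.add p1).add p2) hnP, semigroupL_add ht (p0.add p1) p2,
      semigroupL_add ht p0 p1, semigroupL_const_mul, semigroupL_const_mul, semigroupL_const_mul,
      semigroupL_herm ht (by norm_num), semigroupL_herm ht (by norm_num),
      semigroupL_herm ht (by norm_num)]
    simp only [hP, hb]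
    ring
  -- the remainder
  set v : ℝ → ℝ := fun y => fundK p s τ q y - P y with hv
  have hvP : PolyBdd v := (hqP.fundK hV h1 hs.1).sub hPP
  -- With `w` the path factor, the remainder splits into the comparison error, `(w - 1)P`, and `w`
  -- times the free evolutions of the negative and outer parts. Only the evolved negative part is
  -- not smaller than `τ⁻²` by a power of `τ`, up to logarithms.
  have hvb : ∀ y, |y| ≤ 2 * (K₀ * √s) → |v y| ≤ (2 * C4 * Real.exp (-(s - τ) / 2) * N +
      (8 * X + 48 * Y * e + 1536 * e) * (D / τ ^ 2 / √τ)) * (1 + |y|) ^ 3 := fun y hy => by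
    obtain ⟨w, hw⟩ : ∃ w, w = Real.exp (potPath p τ s y) := ⟨_, rfl⟩
    have hw0 : 0 < w := hw ▸ Real.exp_pos _
    have hw2 : w ≤ 2 := hw ▸ exp_potPath_le_two hp hV h1 hs h3 y
    have hw1 : |w - 1| ≤ Y * ((1 + |y|) / √τ) := by
      have a1 : |potPath p τ s y| ≤ Cv * ρ :=
        (abs_potPath_le hV h1 hs.1 y).trans (by gcongr)
      have a2 := abs_potPath_le_lin hV h1 hs y
      rw [hw, hY]
      calc _ ≤ |potPath p τ s y| * Real.exp |potPath p τ s y| := abs_exp_sub_one_le_mul _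
        _ ≤ Cv * ρ * ((1 + |y|) / √τ) * Real.exp (Cv * ρ) := by gcongr
        _ = _ := by ring
    have t1 := abs_fundK_sub_potPath_le hp hV h1 hqP.1 hqb hs y
    rw [← hX, ← hw] at t1
    have t2 : |(w - 1) * P y| ≤ Y * ((1 + |y|) / √τ) * (6 * e * (D / τ ^ 2) * (1 + |y|) ^ 2) := by
      rw [abs_mul]
      exact mul_le_mul hw1 (hPb y) (abs_nonneg _) (by positivity)
    have t3 : |w * semigroupL (s - τ) (negativePart χ₀ K₀ τ q) y| ≤
        2 * (C4 * Real.exp (-(s - τ) / 2) * N * (1 + |y|) ^ 3) := by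
      rw [abs_mul, abs_of_pos hw0]
      exact mul_le_mul hw2 (H4 _ hnP.1 N hq.abs_neg_le
        (fun m hm => h.integral_negativePart_mul_herm hK0.le hqP hm) _ (by linarith) y)
        (abs_nonneg _) (by norm_num)
    have t4 : |w * semigroupL (s - τ) (outerPart χ₀ K₀ τ q) y| ≤
        1536 * e * (D / τ ^ 2 / √τ) * (1 + |y|) ^ 3 := by
      have tail := abs_semigroupL_tail_le ht hoP.1 (M := E) (l := K₀ * √τ) (by positivity) hq.outer
        (fun x hx => h.isCutoff.outerPart_eq_zero hK0 hτ0 hx) (y := y) (by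
          -- After a time `3` the drift brings the support of the cutoff well inside the region
          -- where the outer part vanishes: `0.23 · 2 · 1.05 = 0.483 < 1/2`, as the tail estimate
          -- requires.
          have r1 : Real.exp (-(s - τ) / 2) ≤ 23 / 100 := by
            have : Real.exp (-(s - τ) / 2) ≤ Real.exp (-(3 / 2)) :=
              Real.exp_le_exp.2 (by linarith)
            refine this.trans ?_
            have e1 : Real.exp (-(3 / 2)) ^ 2 * Real.exp 1 ^ 3 = 1 := by
              rw [← Real.exp_nat_mul, ← Real.exp_nat_mul, ← Real.exp_add]; norm_num
            have e2 := Real.exp_one_gt_d9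
            have e3 : (2.7 : ℝ) ^ 3 ≤ Real.exp 1 ^ 3 := by gcongr; linarith
            have e4 := Real.exp_pos (-(3 / 2))
            by_contra hcon
            push Not at hcon
            have e5 : (23 / 100 : ℝ) ^ 2 * 2.7 ^ 3 ≤
              Real.exp (-(3 / 2)) ^ 2 * Real.exp 1 ^ 3 := by gcongr
            rw [e1] at e5
            norm_num at e5
          have r2 : √s ≤ 1.05 * √τ := sqrt_mul_le 1.05 (by norm_num) (by
            norm_num; linarith [hs.2])
          calc _ ≤ 23 / 100 * (2 * (K₀ * (1.05 * √τ))) := by gcongr; exact hy.trans (by gcongr)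
            _ = 0.483 * (K₀ * √τ) := by ring
            _ ≤ K₀ * √τ / 2 := by
              have : 0 < K₀ * √τ := by positivity
              linarith)
      have hE2 : E ≤ D / √τ := hq.outer_le.trans (by gcongr)
      rw [abs_mul, abs_of_pos hw0]
      have hw3 := one_le_one_add_abs_pow y 3
      calc _ ≤ 2 * (e * (768 * (D / √τ) / τ ^ 2)) := by
            refine mul_le_mul hw2 (tail.trans ?_) (abs_nonneg _) (by norm_num)
            have a3 : Real.exp (s - τ) ≤ e := he ▸ Real.exp_le_exp.2 htρ
            have a4 : τ ^ 2 ≤ (K₀ * √τ) ^ 4 := by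
              rw [mul_pow, sqrt_pow_four hτ0.le]
              exact le_mul_of_one_le_left (by positivity) (one_le_pow₀ hK)
            gcongr
        _ = 1536 * e * (D / τ ^ 2 / √τ) := by ring
        _ ≤ _ := le_mul_of_one_le_right (by positivity) hw3
    have ev : v y = (fundK p s τ q y - w * semigroupL (s - τ) q y) + (w - 1) * P y +
        w * semigroupL (s - τ) (negativePart χ₀ K₀ τ q) y +
        w * semigroupL (s - τ) (outerPart χ₀ K₀ τ q) y := by
      rw [hSq]; simp only [hv]; ring
    rw [ev]
    refine (abs_add_le _ _).trans ((add_le_add ((abs_add_three _ _ _).trans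
      (add_le_add_three t1 t2 t3)) t4).trans ?_)
    have e1 : X * (8 * D / τ ^ 2 / √τ) * (1 + |y|) ^ 3 + Y * ((1 + |y|) / √τ) *
        (6 * e * (D / τ ^ 2) * (1 + |y|) ^ 2) +
        2 * (C4 * Real.exp (-(s - τ) / 2) * N * (1 + |y|) ^ 3) +
        1536 * e * (D / τ ^ 2 / √τ) * (1 + |y|) ^ 3 =
        (2 * C4 * Real.exp (-(s - τ) / 2) * N +
        (8 * X + 6 * Y * e + 1536 * e) * (D / τ ^ 2 / √τ)) * (1 + |y|) ^ 3 := by ring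
    rw [e1]
    have : 0 ≤ D / τ ^ 2 / √τ := by positivity
    gcongr
    norm_num
  have hneg := h.abs_negativePart_le hK0 hs0 hvb y
  have hnP3 : |negativePart χ₀ K₀ s P y| ≤ 24 * e * negHermC c * (D / τ ^ 2 / √τ) *
      (1 + |y| ^ 3) := by
    have q0 := (hhP 0 (by norm_num)).const_mul (b 0)
    have q1 := (hhP 1 (by norm_num)).const_mul (b 1)
    have q2 := (hhP 2 (by norm_num)).const_mul (b 2)
    have eP : negativePart χ₀ K₀ s P y = b 0 * negativePart χ₀ K₀ s (herm 0) y +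
        b 1 * negativePart χ₀ K₀ s (herm 1) y + b 2 * negativePart χ₀ K₀ s (herm 2) y := by
      simp only [hP]
      rw [h.negativePart_add hK0.le (q0.add q1) q2, h.negativePart_add hK0.le q0 q1,
        negativePart_const_mul, negativePart_const_mul, negativePart_const_mul]
    have each : ∀ m < 3, |b m * negativePart χ₀ K₀ s (herm m) y| ≤
        e * (D / τ ^ 2) * (negHermC c / √τ * (1 + |y| ^ 3)) := fun m hm => by
      rw [abs_mul]
      refine mul_le_mul (hbb m hm) ((h.abs_negativePart_herm_le hK (h1.trans hs.1) hm y).trans ?_)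
        (abs_nonneg _) (by positivity)
      have : √τ ≤ √s ^ (3 - m) := hss.trans (le_self_pow₀ (hsq1.trans hss) (by omega))
      gcongr
    rw [eP]
    refine (abs_add_three _ _ _).trans ?_
    have e0 := each 0 (by norm_num)
    have e1 := each 1 (by norm_num)
    have e2 := each 2 (by norm_num)
    have e3 : e * (D / τ ^ 2) * (negHermC c / √τ * (1 + |y| ^ 3)) =
      e * negHermC c * (D / τ ^ 2 / √τ) * (1 + |y| ^ 3) := by ring
    have : 0 ≤ e * negHermC c * (D / τ ^ 2 / √τ) * (1 + |y| ^ 3) := by positivity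
    linarith
  have hsplit : negativePart χ₀ K₀ s (fundK p s τ q) y =
      negativePart χ₀ K₀ s P y + negativePart χ₀ K₀ s v y := by
    rw [← h.negativePart_add hK0.le hPP hvP]
    congr 1; ext x; simp only [hv]; ring
  rw [hsplit]
  refine (abs_add_le _ _).trans ((add_le_add hnP3 hneg).trans ?_)
  -- The errors depend on `ρ` and `A` but carry the extra `1/√τ`; for `τ` large they fit under
  -- `1/s²`, hence under `(s-τ)/s²` because `s - τ ≥ 3`.
  have hsmall : Z * (D / τ ^ 2 / √τ) ≤ (s - τ) / s ^ 2 := by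
    have a1 : Z * D ≤ √τ / 4 := by
      rw [pow_one] at h4
      rw [hD]; linarith
    calc Z * (D / τ ^ 2 / √τ) = Z * D / √τ / τ ^ 2 := by ring
      _ ≤ √τ / 4 / √τ / τ ^ 2 := by gcongr
      _ = 1 / (2 * τ) ^ 2 := by field_simp; norm_num
      _ ≤ 1 / s ^ 2 := by gcongr
      _ ≤ (s - τ) / s ^ 2 := by gcongr; linarith
  have e9 : 24 * e * negHermC c * (D / τ ^ 2 / √τ) * (1 + |y| ^ 3) +
      negC c * (2 * C4 * Real.exp (-(s - τ) / 2) * N +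
      (8 * X + 48 * Y * e + 1536 * e) * (D / τ ^ 2 / √τ)) * (1 + |y| ^ 3) =
      (negC c * (2 * C4) * Real.exp (-(s - τ) / 2) * N + Z * (D / τ ^ 2 / √τ)) * (1 + |y| ^ 3) := by
    rw [hZ]; ring
  rw [e9]
  gcongr

end

/-! ### Outer part, and the uniform estimate of the negative part -/

section
variable {p Cv ρ : ℝ} {χ₀ : ℝ → ℝ} {c K₀ : ℝ}

/-- Bound on the outer part of the linear evolution. -/
lemma CutoffBound.exists_abs_outerPart_linear_le (hp : 1 < p)
    (h : CutoffBound χ₀ c) (hK : 1 ≤ K₀) (hV : PotBounds p Cv) {s₀ : ℝ}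
    (hout : ∀ s ≥ s₀, ∀ y, K₀ / 4 * √s ≤ |y| → potV p s y ≤ -(1 + 1 / p)) :
    ∃ C > 0, ∀ ρ > 0, ∀ A ≥ 1,
      ∀ᶠ τ in Filter.atTop, ∀ s ∈ Icc τ (τ + ρ), ∀ (q : ℝ → ℝ) (N E : ℝ),
      ShrinkingBounds χ₀ K₀ A τ N E q → ∀ y, |outerPart χ₀ K₀ s (fundK p s τ q) y| ≤
        C * Real.exp (-(s - τ) / p) * E + C * Real.exp (s - τ) * N * √τ ^ 3 := by
  have hCv := hV.one_le
  have hc := h.one_le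
  have hK0 : 0 < K₀ := by linarith
  have g0 := gaussMom_pos 0
  have hp0 : 0 < p := by linarith
  set Cb := 14000 * K₀ ^ 5 with hCb
  have hCb0 : 0 < Cb := by positivity
  refine ⟨2 * c * (2 + gaussMom 0 + Cb + 2 * gaussMom 0 * Cb), by positivity, fun ρ hρ A hA => ?_⟩
  obtain ⟨X, hX⟩ : ∃ X, X = Real.exp (pathC Cv ρ 0 * ρ) := ⟨_, rfl⟩
  have hX0 : 0 < X := hX ▸ Real.exp_pos _
  filter_upwards [Filter.eventually_ge_atTop 1, Filter.eventually_ge_atTop ρ,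
    Filter.eventually_ge_atTop s₀, Filter.eventually_ge_atTop (2 * (Cv * ρ)),
    eventually_le_sqrt (X * Real.exp (ρ / p)),
    eventually_le_sqrt (1536 * Real.exp ρ * Real.exp (ρ / p))]
    with τ h1 h2 hs₀ h3 h4 h5 s hs q N E hq y
  have hτ0 : 0 < τ := by linarith
  have hs0 : 0 < s := by linarith [hs.1]
  have ht : 0 ≤ s - τ := sub_nonneg.2 hs.1
  have htρ : s - τ ≤ ρ := by linarith [hs.2]
  have hsq : 0 < √τ := Real.sqrt_pos.2 hτ0
  have hsq1 : 1 ≤ √τ := Real.one_le_sqrt.2 h1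
  have hss : √τ ≤ √s := Real.sqrt_le_sqrt hs.1
  have hN := hq.neg_nonneg
  have hE := hq.outer_nonneg
  have hqP : PolyBdd q := PolyBdd.of_bound hq.cont.measurable
    (hq.abs_le_weight h.isCutoff hK h1 hA)
  obtain ⟨B, hB⟩ : ∃ B, B = Cb * (N * √τ ^ 3) := ⟨_, rfl⟩
  have hB0 : 0 ≤ B := by rw [hB]; positivity
  have hib : ∀ y, |innerPart χ₀ K₀ τ q y| ≤ B * (1 + |y|) ^ 0 := fun y => by
    rw [pow_zero, mul_one, hB]; exact hq.abs_innerPart_le h hK h1 y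
  have hqb : ∀ y, |q y| ≤ (B + E) * (1 + |y|) ^ 0 := fun y => by
    rw [← innerPart_add_outerPart (χ₀ := χ₀) (K₀ := K₀) (s := τ) q y, add_mul]
    refine (abs_add_le _ _).trans (add_le_add (hib y) ?_)
    rw [pow_zero, mul_one]; exact hq.outer y
  have hiP := h.polyBdd_innerPart (s := τ) hK0.le hqP
  have hoP := h.polyBdd_outerPart (s := τ) hK0.le hqP
  have he1 : 1 ≤ Real.exp (s - τ) := Real.one_le_exp ht
  have hep : Real.exp (-(ρ / p)) ≤ Real.exp (-(s - τ) / p) :=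
    Real.exp_le_exp.2 (by rw [neg_div]; exact neg_le_neg (div_le_div_of_nonneg_right htρ hp0.le))
  have hep1 : Real.exp (-(s - τ) / p) ≤ 1 :=
    Real.exp_le_one_iff.2 (div_nonpos_of_nonpos_of_nonneg (by linarith) hp0.le)
  have hepp : Real.exp (ρ / p) * Real.exp (-(ρ / p)) = 1 := by rw [← Real.exp_add]; simp
  -- The inner part is bounded in terms of `N` alone by `abs_innerPart_le`, so `q` has size `N√τ³ +
  -- E` without any weight. Only points where the cutoff at time `s` may differ from `1` matter.
  have key : K₀ * √s ≤ |y| → |fundK p s τ q y| ≤ (2 + gaussMom 0 + Cb + 2 * gaussMom 0 * Cb) *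
      (Real.exp (-(s - τ) / p) * E + Real.exp (s - τ) * N * √τ ^ 3) := fun hy => by
    obtain ⟨w, hw⟩ : ∃ w, w = Real.exp (potPath p τ s y) := ⟨_, rfl⟩
    have hw0 : 0 < w := hw ▸ Real.exp_pos _
    have hw2 : w ≤ 2 := hw ▸ exp_potPath_le_two hp hV h1 hs h3 y
    have t1 : |fundK p s τ q y - w * semigroupL (s - τ) q y| ≤
        Real.exp (-(s - τ) / p) * (B + E) := by
      have := abs_fundK_sub_potPath_le hp hV h1 hqP.1 hqb hs y
      rw [← hX, ← hw, pow_zero, mul_one] at this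
      refine this.trans ?_
      -- The comparison constant `X` depends on `ρ`, but for large `τ` the factor `1/√τ` beats even
      -- the smallest value of `e^{-(s-τ)/p}` on the interval, which makes the final constant
      -- independent of `ρ`.
      have e1 : X ≤ √τ * Real.exp (-(ρ / p)) := by
        calc X = X * Real.exp (ρ / p) * Real.exp (-(ρ / p)) := by rw [mul_assoc, hepp, mul_one]
          _ ≤ _ := by gcongr
      calc X * ((B + E) / √τ) ≤ √τ * Real.exp (-(ρ / p)) * ((B + E) / √τ) := by gcongr
        _ = Real.exp (-(ρ / p)) * (B + E) := by field_simp
        _ ≤ _ := by gcongr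
    have t2 : |w * semigroupL (s - τ) (innerPart χ₀ K₀ τ q) y| ≤
        2 * (Real.exp (s - τ) * gaussMom 0 * B) := by
      rw [abs_mul, abs_of_pos hw0]
      have := abs_semigroupL_le ht hiP.1 hib y
      rw [pow_zero, mul_one] at this
      exact mul_le_mul hw2 this (abs_nonneg _) (by norm_num)
    have t3 : |w * semigroupL (s - τ) (outerPart χ₀ K₀ τ q) y| ≤
        (1 + gaussMom 0) * (Real.exp (-(s - τ) / p) * E) := by
      rw [abs_mul, abs_of_pos hw0]
      -- Either the path ending at `y` starts well inside, and the outer part is seen only through a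
      -- Gaussian tail, or it starts beyond `K₀√τ/2`.
      rcases le_or_gt (Real.exp (-(s - τ) / 2) * |y|) (K₀ * √τ / 2) with hyy | hyy
      · have tail := abs_semigroupL_tail_le ht hoP.1 (M := E) (l := K₀ * √τ) (by positivity)
          hq.outer (fun x hx => h.isCutoff.outerPart_eq_zero hK0 hτ0 hx) hyy
        have a3 : Real.exp (s - τ) ≤ Real.exp ρ := Real.exp_le_exp.2 htρ
        have a4 : √τ ≤ (K₀ * √τ) ^ 4 := by
          have : √τ ≤ K₀ * √τ := le_mul_of_one_le_left hsq.le hK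
          exact this.trans (le_self_pow₀ (hsq1.trans this) (by norm_num))
        calc _ ≤ 2 * (Real.exp ρ * (768 * E / √τ)) := by
              refine mul_le_mul hw2 (tail.trans ?_) (abs_nonneg _) (by norm_num)
              gcongr
          _ = 1536 * Real.exp ρ * Real.exp (ρ / p) * (Real.exp (-(ρ / p)) * E) / √τ := by
              linear_combination -(1536 * Real.exp ρ * E / √τ) * hepp
          _ ≤ √τ * (Real.exp (-(ρ / p)) * E) / √τ := by gcongr
          _ = Real.exp (-(ρ / p)) * E := by field_simp
          _ ≤ 1 * (Real.exp (-(s - τ) / p) * E) := by rw [one_mul]; gcongr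
          _ ≤ _ := by gcongr; linarith
      -- The backward path has increasing modulus in `σ`, and `√σ ≤ 2√τ` on the interval; a start
      -- beyond `K₀√τ/2` thus keeps it beyond `(K₀/4)√σ`, where the potential is at most `-(1+1/p)`.
      · have hI : potPath p τ s y ≤ -(1 + 1 / p) * (s - τ) := by
          have hint := intervalIntegral.integral_mono_on hs.1
            ((continuousOn_potV_path hp h1 y).intervalIntegrable_of_Icc (μ := volume) hs.1)
            (intervalIntegrable_const (μ := volume) (c := -(1 + 1 / p))) fun σ hσ =>
              hout σ (hs₀.trans hσ.1) _ (by
                rw [abs_mul, abs_of_pos (Real.exp_pos _)]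
                have a1 : Real.exp (-(s - τ) / 2) ≤ Real.exp (-(s - σ) / 2) :=
                  Real.exp_le_exp.2 (by linarith [hσ.1])
                have a2 : √σ ≤ 2 * √τ := sqrt_mul_le 2 (by norm_num) (by
                  linarith [hσ.2, hs.2])
                calc K₀ / 4 * √σ ≤ K₀ / 4 * (2 * √τ) := by gcongr
                  _ = K₀ * √τ / 2 := by ring
                  _ ≤ Real.exp (-(s - τ) / 2) * |y| := hyy.le
                  _ ≤ _ := by gcongr)
          rw [intervalIntegral.integral_const, smul_eq_mul, mul_comm] at hint
          exact hint
        have := abs_semigroupL_le ht hoP.1 (M := E) (k := 0)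
          (fun x => by rw [pow_zero, mul_one]; exact hq.outer x) y
        rw [pow_zero, mul_one] at this
        have hw3 : w * Real.exp (s - τ) ≤ Real.exp (-(s - τ) / p) := by
          rw [hw, ← Real.exp_add]
          refine Real.exp_le_exp.2 ?_
          have : -(1 + 1 / p) * (s - τ) + (s - τ) = -(s - τ) / p := by ring
          linarith
        calc _ ≤ w * (Real.exp (s - τ) * gaussMom 0 * E) := by gcongr
          _ = w * Real.exp (s - τ) * (gaussMom 0 * E) := by ring
          _ ≤ Real.exp (-(s - τ) / p) * (gaussMom 0 * E) := by gcongr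
          _ = gaussMom 0 * (Real.exp (-(s - τ) / p) * E) := by ring
          _ ≤ _ := by gcongr; linarith
    have ev : fundK p s τ q y = (fundK p s τ q y - w * semigroupL (s - τ) q y) +
        w * semigroupL (s - τ) (innerPart χ₀ K₀ τ q) y +
        w * semigroupL (s - τ) (outerPart χ₀ K₀ τ q) y := by
      have eq : q = fun y => innerPart χ₀ K₀ τ q y + outerPart χ₀ K₀ τ q y :=
        funext fun y => (innerPart_add_outerPart q y).symm
      have : semigroupL (s - τ) q y = semigroupL (s - τ) (innerPart χ₀ K₀ τ q) y +
          semigroupL (s - τ) (outerPart χ₀ K₀ τ q) y := by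
        conv_lhs => rw [eq]
        exact semigroupL_add ht hiP hoP y
      rw [this]; ring
    rw [ev]
    refine (abs_add_three _ _ _).trans ((add_le_add_three t1 t2 t3).trans ?_)
    obtain ⟨u, hu⟩ : ∃ u, u = Real.exp (-(s - τ) / p) := ⟨_, rfl⟩
    obtain ⟨v, hv⟩ : ∃ v, v = Real.exp (s - τ) := ⟨_, rfl⟩
    have hu0 : 0 < u := hu ▸ Real.exp_pos _
    rw [← hu] at hep1
    rw [← hv] at he1
    rw [← hu, ← hv]
    obtain ⟨n, hn⟩ : ∃ n, n = N * √τ ^ 3 := ⟨_, rfl⟩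
    have hn0 : 0 ≤ n := by rw [hn]; positivity
    rw [← hn] at hB
    have k1 : u * B ≤ v * B := by gcongr; linarith
    have k2 : 0 ≤ u * E := by positivity
    have k3 : 0 ≤ v * n := by positivity
    have k4 : v * B = Cb * (v * n) := by rw [hB]; ring
    have k5 : v * N * √τ ^ 3 = v * n := by rw [hn]; ring
    rw [k5]
    have k6 : 0 ≤ (Cb + 2 * gaussMom 0 * Cb) * (u * E) := by positivity
    have k7 : 0 ≤ (2 + gaussMom 0) * (v * n) := by positivity
    calc u * (B + E) + 2 * (v * gaussMom 0 * B) + (1 + gaussMom 0) * (u * E) =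
          u * B + 2 * gaussMom 0 * (v * B) + (2 + gaussMom 0) * (u * E) := by ring
      _ ≤ v * B + 2 * gaussMom 0 * (v * B) + (2 + gaussMom 0) * (u * E) := by gcongr
      _ = (Cb + 2 * gaussMom 0 * Cb) * (v * n) + (2 + gaussMom 0) * (u * E) := by rw [k4]; ring
      _ ≤ _ := by linarith
  rw [outerPart]
  rcases lt_or_ge |y| (K₀ * √s) with hy | hy
  · rw [h.isCutoff.cutoff_eq_one hK0 hs0 hy.le, sub_self, zero_mul, abs_zero]
    positivity
  · rw [abs_mul]
    calc _ ≤ 2 * c * ((2 + gaussMom 0 + Cb + 2 * gaussMom 0 * Cb) *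
          (Real.exp (-(s - τ) / p) * E + Real.exp (s - τ) * N * √τ ^ 3)) :=
          mul_le_mul (h.abs_one_sub_cutoff_le hK0.le y) (key hy) (abs_nonneg _) (by positivity)
      _ = _ := by ring

/-- On an interval of length `ρ` the exponentials and the ratio `τ/s` are bounded below, so they may
be inserted at the price of a constant depending on `ρ`. -/
lemma CutoffBound.exists_abs_negativePart_linear_le_exp (h : CutoffBound χ₀ c) (hK : 1 ≤ K₀)
    (hV : PotBounds p Cv) (hρ : 0 < ρ) : ∃ C > 0, ∀ τ ≥ 1, ∀ s ∈ Icc τ (τ + ρ),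
      ∀ (q : ℝ → ℝ) (A N E : ℝ), 1 ≤ A → ShrinkingBounds χ₀ K₀ A τ N E q → ∀ y,
      |negativePart χ₀ K₀ s (fundK p s τ q) y| ≤ (C * Real.exp (-(s - τ) / 2) * N +
        C * Real.exp (-(s - τ) ^ 2) * E / √s ^ 3) * (1 + |y| ^ 3) := by
  obtain ⟨C, hC, H⟩ := h.exists_abs_negativePart_linear_le hK hV hρ
  have e2 : 1 ≤ Real.exp (ρ ^ 2) := Real.one_le_exp (by positivity)
  have e1 : 1 ≤ Real.exp (ρ / 2) := Real.one_le_exp (by positivity)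
  have e3 : 1 ≤ (1 + ρ) ^ 3 := one_le_pow₀ (by linarith)
  refine ⟨C * (Real.exp (ρ / 2) * Real.exp (ρ ^ 2) * (1 + ρ) ^ 3), by positivity,
    fun τ hτ s hs q A N E hA hq y => (H τ hτ s hs q A N E hA hq y).trans ?_⟩
  have hN := hq.neg_nonneg
  have hE := hq.outer_nonneg
  have ht : 0 ≤ s - τ := sub_nonneg.2 hs.1
  have htρ : s - τ ≤ ρ := by linarith [hs.2]
  have hτ0 : 0 < √τ := Real.sqrt_pos.2 (by linarith)
  have hs0 : 0 < √s := Real.sqrt_pos.2 (by linarith [hs.1])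
  have hsτ : √s ≤ (1 + ρ) * √τ := sqrt_mul_le (1 + ρ) (by linarith) (by
    have h1 : s ≤ τ + ρ := hs.2
    nlinarith [mul_nonneg hρ.le (sub_nonneg.2 hτ), mul_nonneg (sq_nonneg ρ) (by linarith : 0 ≤ τ)])
  have a1 : 1 ≤ Real.exp (ρ / 2) * Real.exp (-(s - τ) / 2) := by
    rw [← Real.exp_add]; exact Real.one_le_exp (by linarith)
  have a2 : 1 ≤ Real.exp (ρ ^ 2) * Real.exp (-(s - τ) ^ 2) := by
    rw [← Real.exp_add]; exact Real.one_le_exp (by nlinarith)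
  have a3 : 1 / √τ ^ 3 ≤ (1 + ρ) ^ 3 / √s ^ 3 := by
    rw [div_le_div_iff₀ (by positivity) (by positivity), one_mul, ← mul_pow]
    gcongr
  have b1 : N ≤ Real.exp (ρ / 2) * Real.exp (ρ ^ 2) * (1 + ρ) ^ 3 *
      (Real.exp (-(s - τ) / 2) * N) := by
    calc N = 1 * 1 * 1 * N := by ring
      _ ≤ (Real.exp (ρ / 2) * Real.exp (-(s - τ) / 2)) * Real.exp (ρ ^ 2) * (1 + ρ) ^ 3 * N := by
          gcongr
      _ = _ := by ring
  have b2 : E / √τ ^ 3 ≤ Real.exp (ρ / 2) * Real.exp (ρ ^ 2) * (1 + ρ) ^ 3 *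
      (Real.exp (-(s - τ) ^ 2) * E / √s ^ 3) := by
    calc E / √τ ^ 3 = 1 * 1 * E * (1 / √τ ^ 3) := by ring
      _ ≤ Real.exp (ρ / 2) * (Real.exp (ρ ^ 2) * Real.exp (-(s - τ) ^ 2)) * E *
          ((1 + ρ) ^ 3 / √s ^ 3) := by gcongr
      _ = _ := by ring
  refine mul_le_mul_of_nonneg_right ?_ (by positivity)
  calc C * (N + E / √τ ^ 3) ≤ C * (Real.exp (ρ / 2) * Real.exp (ρ ^ 2) * (1 + ρ) ^ 3 *
      (Real.exp (-(s - τ) / 2) * N) + Real.exp (ρ / 2) * Real.exp (ρ ^ 2) * (1 + ρ) ^ 3 *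
      (Real.exp (-(s - τ) ^ 2) * E / √s ^ 3)) := by gcongr
    _ = _ := by ring

/-- The time difference is split at `3`: short ones use the previous estimate with `ρ = 3`, whose
constant is absolute, and long ones use the comparison along the path. The Gaussian factor in `s -
τ` is thus needed only on a bounded range. -/
lemma CutoffBound.exists_abs_negativePart_linear_le_uniform (hp : 1 < p)
    (h : CutoffBound χ₀ c) (hK : 1 ≤ K₀) (hV : PotBounds p Cv) : ∃ C > 0, ∀ ρ > 0, ∀ A ≥ 1,
      ∀ᶠ τ in Filter.atTop, ∀ s ∈ Icc τ (τ + ρ), ∀ (q : ℝ → ℝ) (N E : ℝ),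
      ShrinkingBounds χ₀ K₀ A τ N E q → ∀ y, |negativePart χ₀ K₀ s (fundK p s τ q) y| ≤
        (C * Real.exp (-(s - τ) / 2) * N + C * Real.exp (-(s - τ) ^ 2) * E / √s ^ 3 +
          (s - τ) / s ^ 2) * (1 + |y| ^ 3) := by
  obtain ⟨C1, hC1, H1⟩ := h.exists_abs_negativePart_linear_le_exp hK hV (ρ := 3) (by norm_num)
  obtain ⟨C2, hC2, H2⟩ := h.exists_abs_negativePart_linear_le_of_three_le hp hK hV
  refine ⟨C1 + C2, by positivity, fun ρ hρ A hA => ?_⟩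
  filter_upwards [H2 ρ hρ A hA, Filter.eventually_ge_atTop 1] with τ h2 h1 s hs q N E hq y
  have hN := hq.neg_nonneg
  have hE := hq.outer_nonneg
  have ht : 0 ≤ s - τ := sub_nonneg.2 hs.1
  have b1 : 0 ≤ Real.exp (-(s - τ) / 2) * N := by positivity
  have b2 : 0 ≤ Real.exp (-(s - τ) ^ 2) * E / √s ^ 3 := by positivity
  have b3 : 0 ≤ (s - τ) / s ^ 2 := by positivity
  rcases le_total 3 (s - τ) with h3 | h3
  · refine (h2 s hs h3 q N E hq y).trans (mul_le_mul_of_nonneg_right ?_ (by positivity))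
    have b4 := mul_nonneg hC1.le b1
    have b5 := mul_nonneg (add_pos hC1 hC2).le b2
    calc _ ≤ C2 * (Real.exp (-(s - τ) / 2) * N) + (s - τ) / s ^ 2 +
          C1 * (Real.exp (-(s - τ) / 2) * N) +
          (C1 + C2) * (Real.exp (-(s - τ) ^ 2) * E / √s ^ 3) := by linarith
      _ = _ := by ring
  · refine (H1 τ h1 s ⟨hs.1, by linarith⟩ q A N E hA hq y).trans
      (mul_le_mul_of_nonneg_right ?_ (by positivity))
    have b4 := mul_nonneg hC2.le b1
    have b5 := mul_nonneg hC2.le b2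
    calc _ ≤ C1 * (Real.exp (-(s - τ) / 2) * N) + C1 * (Real.exp (-(s - τ) ^ 2) * E / √s ^ 3) +
          C2 * (Real.exp (-(s - τ) / 2) * N) + C2 * (Real.exp (-(s - τ) ^ 2) * E / √s ^ 3) +
          (s - τ) / s ^ 2 := by
            have : C1 * Real.exp (-(s - τ) / 2) * N + C1 * Real.exp (-(s - τ) ^ 2) * E / √s ^ 3 =
              C1 * (Real.exp (-(s - τ) / 2) * N) +
              C1 * (Real.exp (-(s - τ) ^ 2) * E / √s ^ 3) := by ring
            linarith
      _ = _ := by ring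

end

/-! ### Duhamel terms -/

section
variable {p Cv ρ : ℝ} {χ₀ : ℝ → ℝ} {c K₀ : ℝ}

/-- The pointwise bound on the integrand suffices. No measurability in `σ` is required, since a
nonintegrable integrand would have integral zero. -/
lemma abs_duhamel_le (hV : PotBounds p Cv) {τ s : ℝ} (hτ : 1 ≤ τ) (hs : s ∈ Icc τ (τ + ρ))
    {G : ℝ → ℝ → ℝ} {M : ℝ} {k : ℕ} (mG : ∀ σ ∈ Icc τ s, Measurable (G σ))
    (hG : ∀ σ ∈ Icc τ s, ∀ y, |G σ y| ≤ M * (1 + |y|) ^ k) (y : ℝ) :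
    |∫ σ in τ..s, fundK p s σ (G σ) y| ≤ fundC Cv ρ k * M * (s - τ) * (1 + |y|) ^ k := by
  refine (intervalIntegral.norm_integral_le_of_norm_le_const
    (C := fundC Cv ρ k * M * (1 + |y|) ^ k) (f := fun σ => fundK p s σ (G σ) y)
    fun σ hσ => ?_).trans (le_of_eq ?_)
  · rw [uIoc_of_le hs.1] at hσ
    exact abs_fundK_le hV (hτ.trans hσ.1.le) (mG σ ⟨hσ.1.le, hσ.2⟩) (hG σ ⟨hσ.1.le, hσ.2⟩)
      ⟨hσ.2, by linarith [hσ.1, hs.2]⟩ y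
  · rw [abs_of_nonneg (sub_nonneg.2 hs.1)]; ring

lemma CutoffBound.abs_mode_two_duhamel_le (h : CutoffBound χ₀ c) (hK : 0 < K₀)
    (hV : PotBounds p Cv) {τ s : ℝ} (hτ : 1 ≤ τ)
    (hs : s ∈ Icc τ (τ + ρ)) {G : ℝ → ℝ → ℝ} {M : ℝ} {k : ℕ}
    (mG : ∀ σ ∈ Icc τ s, Measurable (G σ))
    (hG : ∀ σ ∈ Icc τ s, ∀ y, |G σ y| ≤ M * (1 + |y|) ^ k) :
    |mode χ₀ K₀ s 2 fun y => ∫ σ in τ..s, fundK p s σ (G σ) y| ≤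
      c * wMom (k + 2) * fundC Cv ρ k * M * (s - τ) :=
  (h.abs_mode_le hK (by linarith [hs.1]) (by norm_num)
    fun y _ => abs_duhamel_le hV hτ hs mG hG y).trans (le_of_eq (by ring))

lemma CutoffBound.abs_negativePart_duhamel_le (h : CutoffBound χ₀ c) (hK : 0 < K₀)
    (hV : PotBounds p Cv) {τ s : ℝ} (hτ : 1 ≤ τ)
    (hs : s ∈ Icc τ (τ + ρ)) {G : ℝ → ℝ → ℝ} {M : ℝ}
    (mG : ∀ σ ∈ Icc τ s, Measurable (G σ))
    (hG : ∀ σ ∈ Icc τ s, ∀ y, |G σ y| ≤ M * (1 + |y|) ^ 3) (y : ℝ) :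
    |negativePart χ₀ K₀ s (fun y => ∫ σ in τ..s, fundK p s σ (G σ) y) y| ≤
      negC c * fundC Cv ρ 3 * M * (s - τ) * (1 + |y| ^ 3) :=
  (h.abs_negativePart_le hK (by linarith [hs.1])
    (fun y _ => abs_duhamel_le hV hτ hs mG hG y) y).trans (le_of_eq (by ring))

lemma CutoffBound.abs_outerPart_duhamel_le (h : CutoffBound χ₀ c) (hK : 0 < K₀)
    (hV : PotBounds p Cv) {τ s : ℝ} (hτ : 1 ≤ τ)
    (hs : s ∈ Icc τ (τ + ρ)) {G : ℝ → ℝ → ℝ} {M : ℝ}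
    (mG : ∀ σ ∈ Icc τ s, Measurable (G σ))
    (hG : ∀ σ ∈ Icc τ s, ∀ y, |G σ y| ≤ M) (y : ℝ) :
    |outerPart χ₀ K₀ s (fun y => ∫ σ in τ..s, fundK p s σ (G σ) y) y| ≤
      2 * c * fundC Cv ρ 0 * M * (s - τ) := by
  have hd := abs_duhamel_le (k := 0) hV hτ hs mG
    (fun σ hσ y => by rw [pow_zero, mul_one]; exact hG σ hσ y) y
  rw [pow_zero, mul_one] at hd
  have hc := h.one_le
  rw [outerPart, abs_mul]
  refine (mul_le_mul (h.abs_one_sub_cutoff_le hK.le y) hd (abs_nonneg _)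
    (by positivity)).trans (le_of_eq (by ring))

end

/-! ### The nonlinear term -/

/-- The nonlinearity as a function of two real variables. -/
noncomputable def nonlinB (p a x : ℝ) : ℝ :=
  |a + x| ^ (p - 1) * (a + x) - a ^ p - p * a ^ (p - 1) * x

/-- By homogeneity the nonlinearity is `a^p` times the second-order Taylor remainder of the `p`-th
power at `1`, evaluated at `x/a`. -/
lemma exists_abs_nonlinB_small_le (p : ℝ) : ∃ C > 0, ∀ a > 0, ∀ x, |x| ≤ a / 2 →
    |nonlinB p a x| ≤ C * (a ^ p * (x / a) ^ 2) := by
  obtain ⟨C, hC, H⟩ := exists_abs_rpow_taylor_le p (lo := 1 / 2) (hi := 3 / 2) (by norm_num)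
    (by norm_num)
  refine ⟨C, hC, fun a ha x hx => ?_⟩
  obtain ⟨u, hu⟩ : ∃ u, u = x / a := ⟨_, rfl⟩
  have hxu : x = a * u := by rw [hu]; field_simp
  have hu2 : |u| ≤ 1 / 2 := by
    rw [hu, abs_div, abs_of_pos ha, div_le_iff₀ ha]; linarith
  obtain ⟨h1, h2⟩ := abs_le.1 hu2
  have hpos : 0 < 1 + u := by linarith
  have e : nonlinB p a x = a ^ p * ((1 + u) ^ p - 1 ^ p - p * 1 ^ (p - 1) * (1 + u - 1)) := by
    have e1 : a + x = a * (1 + u) := by rw [hxu]; ring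
    unfold nonlinB
    rw [e1, abs_of_pos (by positivity), ← Real.rpow_add_one (by positivity), sub_add_cancel,
      Real.mul_rpow ha.le hpos.le, Real.one_rpow, Real.one_rpow, hxu]
    have e2 : a ^ p = a ^ (p - 1) * a := by
      rw [← Real.rpow_add_one ha.ne', sub_add_cancel]
    rw [e2]; ring
  rw [e, abs_mul, abs_of_pos (Real.rpow_pos_of_pos ha p), ← hu]
  have := H 1 ⟨by norm_num, by norm_num⟩ (1 + u) ⟨by linarith, by linarith⟩
  rw [add_sub_cancel_left] at this ⊢
  have h3 := Real.rpow_pos_of_pos ha p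
  calc _ ≤ a ^ p * (C * u ^ 2) := by gcongr
    _ = _ := by ring

/-- The bound is uniform as `a → 0`, which is needed far out where `φ` is small. There the quadratic
estimate degenerates when `p < 2`, whence the exponent `min p 2`, still larger than `1`. -/
lemma exists_abs_nonlinB_le {p : ℝ} (hp : 1 < p) {hi : ℝ} (hhi : 0 < hi) : ∃ C > 0, ∀ a > 0,
    a ≤ hi → ∀ x, |x| ≤ 1 → |nonlinB p a x| ≤ C * |x| ^ (min p 2) := by
  obtain ⟨C, hC, H⟩ := exists_abs_nonlinB_small_le p
  have c1 : 0 < hi ^ (p - 2) := Real.rpow_pos_of_pos hhi _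
  have c2 : (0 : ℝ) < 3 ^ p := Real.rpow_pos_of_pos (by norm_num) _
  have c3 : (0 : ℝ) < 2 ^ p := Real.rpow_pos_of_pos (by norm_num) _
  have c4 : (0 : ℝ) < 2 ^ (p - 1) := Real.rpow_pos_of_pos (by norm_num) _
  refine ⟨C * (1 + hi ^ (p - 2)) + (3 ^ p + 2 ^ p + p * 2 ^ (p - 1)), by positivity,
    fun a ha hahi x hx => ?_⟩
  have hX : 0 ≤ |x| ^ (min p 2) := Real.rpow_nonneg (abs_nonneg x) _
  rcases le_or_gt |x| (a / 2) with hxa | hxa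
  · have key : a ^ p * (x / a) ^ 2 ≤ (1 + hi ^ (p - 2)) * |x| ^ (min p 2) := by
      rcases le_total p 2 with h2 | h2
      · rw [min_eq_left h2]
        have hu : |x / a| ≤ 1 := by
          rw [abs_div, abs_of_pos ha, div_le_one ha]; linarith
        have h3 : (x / a) ^ 2 ≤ |x / a| ^ p := by
          rw [← sq_abs]
          rcases (abs_nonneg (x / a)).eq_or_lt with h0 | h0
          · rw [← h0]; simp [Real.rpow_nonneg]
          · rw [← Real.rpow_two]
            exact Real.rpow_le_rpow_of_exponent_ge h0 hu h2
        have h4 : a ^ p * |x / a| ^ p = |x| ^ p := by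
          rw [← Real.mul_rpow ha.le (abs_nonneg _), abs_div, abs_of_pos ha]
          congr 1; field_simp
        calc a ^ p * (x / a) ^ 2 ≤ a ^ p * |x / a| ^ p := by
              have := Real.rpow_pos_of_pos ha p
              gcongr
          _ = 1 * |x| ^ p := by rw [h4, one_mul]
          _ ≤ _ := by
            have := Real.rpow_nonneg (abs_nonneg x) p
            gcongr
            linarith
      · rw [min_eq_right h2, Real.rpow_two, sq_abs]
        have e : a ^ p * (x / a) ^ 2 = a ^ (p - 2) * x ^ 2 := by
          rw [Real.rpow_sub ha, Real.rpow_two]; field_simp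
        rw [e]
        have : a ^ (p - 2) ≤ hi ^ (p - 2) := Real.rpow_le_rpow ha.le hahi (by linarith)
        gcongr
        linarith
    calc _ ≤ C * (a ^ p * (x / a) ^ 2) := H a ha x hxa
      _ ≤ C * ((1 + hi ^ (p - 2)) * |x| ^ (min p 2)) := by gcongr
      _ = C * (1 + hi ^ (p - 2)) * |x| ^ (min p 2) := by ring
      _ ≤ _ := mul_le_mul_of_nonneg_right
          (by linarith [show 0 < 3 ^ p + 2 ^ p + p * 2 ^ (p - 1) by positivity]) hX
  -- When `x` is not small compared with `a`, each of the three terms is separately at most a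
  -- multiple of `|x|^p`.
  · have hx0 : 0 < |x| := by linarith
    have ha2 : a ≤ 2 * |x| := by linarith
    have b1 : |(|a + x| ^ (p - 1) * (a + x))| ≤ 3 ^ p * |x| ^ p := by
      rw [← Real.mul_rpow (by norm_num) hx0.le, abs_mul,
        abs_of_nonneg (Real.rpow_nonneg (abs_nonneg _) _)]
      rcases (abs_nonneg (a + x)).eq_or_lt with h0 | h0
      · rw [← h0, mul_zero]; positivity
      · rw [← Real.rpow_add_one h0.ne', sub_add_cancel]
        refine Real.rpow_le_rpow h0.le ((abs_add_le _ _).trans ?_) (by linarith)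
        rw [abs_of_pos ha]; linarith
    have b2 : |a ^ p| ≤ 2 ^ p * |x| ^ p := by
      rw [← Real.mul_rpow (by norm_num) hx0.le, abs_of_pos (Real.rpow_pos_of_pos ha p)]
      exact Real.rpow_le_rpow ha.le ha2 (by linarith)
    have b3 : |p * a ^ (p - 1) * x| ≤ p * 2 ^ (p - 1) * |x| ^ p := by
      have e : |x| ^ p = |x| ^ (p - 1) * |x| := by
        rw [← Real.rpow_add_one hx0.ne', sub_add_cancel]
      rw [abs_mul, abs_mul, abs_of_pos (by linarith : 0 < p),
        abs_of_pos (Real.rpow_pos_of_pos ha _), e]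
      have : a ^ (p - 1) ≤ 2 ^ (p - 1) * |x| ^ (p - 1) := by
        rw [← Real.mul_rpow (by norm_num) hx0.le]
        exact Real.rpow_le_rpow ha.le ha2 (by linarith)
      calc p * a ^ (p - 1) * |x| ≤ p * (2 ^ (p - 1) * |x| ^ (p - 1)) * |x| := by gcongr
        _ = _ := by ring
    have b4 : |x| ^ p ≤ |x| ^ (min p 2) :=
      Real.rpow_le_rpow_of_exponent_ge hx0 hx (min_le_left _ _)
    unfold nonlinB
    have t1 := abs_sub (|a + x| ^ (p - 1) * (a + x) - a ^ p) (p * a ^ (p - 1) * x)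
    have t2 := abs_sub (|a + x| ^ (p - 1) * (a + x)) (a ^ p)
    calc _ ≤ (3 ^ p + 2 ^ p + p * 2 ^ (p - 1)) * |x| ^ p := by
          have : (3 ^ p + 2 ^ p + p * 2 ^ (p - 1)) * |x| ^ p =
            3 ^ p * |x| ^ p + 2 ^ p * |x| ^ p + p * 2 ^ (p - 1) * |x| ^ p := by ring
          linarith
      _ ≤ (3 ^ p + 2 ^ p + p * 2 ^ (p - 1)) * |x| ^ (min p 2) := by gcongr
      _ ≤ _ := mul_le_mul_of_nonneg_right
          (by linarith [show 0 < C * (1 + hi ^ (p - 2)) by positivity]) hX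

/-- Smallness of the nonlinear term on the shrinking set. -/
lemma eventually_abs_termB_le {p : ℝ} (hp : 1 < p) {χ₀ : ℝ → ℝ} (hχ : IsCutoff χ₀) {K₀ : ℝ}
    (hK : 1 ≤ K₀) {A δ : ℝ} (hA : 1 ≤ A) (hδ : 0 < δ) :
    ∀ᶠ σ in Filter.atTop, ∀ (q : ℝ → ℝ) (N E : ℝ), ShrinkingBounds χ₀ K₀ A σ N E q → ∀ y,
      |termB p σ q y| ≤ δ / σ ^ 3 * (1 + |y|) ^ 8 ∧ |termB p σ q y| ≤ δ / σ ^ 2 * (1 + |y|) ^ 3 ∧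
      |termB p σ q y| ≤ δ / √σ := by
  have hκ := kappa_pos hp
  obtain ⟨C1, hC1, H1⟩ := exists_abs_nonlinB_le hp (hi := 2 * kappa p) (by positivity)
  obtain ⟨C2, hC2, H2⟩ := exists_abs_nonlinB_small_le p
  obtain ⟨φm, hφm⟩ : ∃ φm, φm = profile p (2 * K₀) := ⟨_, rfl⟩
  have hφ0 : 0 < φm := hφm ▸ profile_pos hp _
  set L := 100 * K₀ ^ 3 * A ^ 2 with hL
  have hL0 : 0 < L := by positivity
  set r := min p 2 - 1 with hr
  have hr0 : 0 < r := by rw [hr, sub_pos]; exact lt_min hp (by norm_num)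
  have hκp : 0 < (2 * kappa p) ^ p := Real.rpow_pos_of_pos (by positivity) p
  set C3 := C2 * ((2 * kappa p) ^ p / φm ^ 2) with hC3
  have hC30 : 0 < C3 := by positivity
  -- The excess exponent `r > 0` over linearity, applied to the uniform size `L/√σ`, provides the
  -- arbitrarily small factor `δ`.
  have hlim : Filter.Tendsto (fun σ : ℝ => C1 * L * (L / √σ) ^ r) Filter.atTop (nhds 0) := by
    have h1 : Filter.Tendsto (fun σ : ℝ => L / √σ) Filter.atTop (nhds 0) :=
      Filter.Tendsto.div_atTop tendsto_const_nhds Real.tendsto_sqrt_atTop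
    have h2 := h1.rpow_const (p := r) (Or.inr hr0.le)
    rw [Real.zero_rpow hr0.ne'] at h2
    simpa using h2.const_mul (C1 * L)
  filter_upwards [hlim.eventually_le_const hδ, Filter.eventually_ge_atTop 1,
    eventually_le_sqrt L, eventually_le_sqrt (2 * L / φm),
    eventually_mul_log_pow_le_sqrt (1728 * C3 * K₀ ^ 3 * A ^ 4 / δ) 2]
    with σ h1 h2 h3 h4 h5 q N E hq y
  have hσ0 : 0 < σ := by linarith
  have hlog := Real.log_nonneg h2
  have hsq : 0 < √σ := Real.sqrt_pos.2 hσ0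
  have hsq1 : 1 ≤ √σ := Real.one_le_sqrt.2 h2
  have hqs := hq.abs_le_sqrt hχ hK h2 hA y
  have hq1 : |q y| ≤ 1 := hqs.trans ((div_le_one hsq).2 h3)
  have hB3 : |termB p σ q y| ≤ δ / √σ := by
    have e : termB p σ q y = nonlinB p (phi p σ y) (q y) := rfl
    rw [e]
    refine (H1 _ (phi_pos hp hσ0 y) (phi_le hp h2 y) _ hq1).trans ?_
    have hm : |q y| ^ (min p 2) ≤ (L / √σ) ^ (min p 2) :=
      Real.rpow_le_rpow (abs_nonneg _) hqs (by linarith [lt_min hp (by norm_num : (1 : ℝ) < 2)])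
    have e2 : (L / √σ) ^ (min p 2) = (L / √σ) ^ r * (L / √σ) := by
      rw [← Real.rpow_add_one (by positivity), hr, sub_add_cancel]
    calc _ ≤ C1 * ((L / √σ) ^ r * (L / √σ)) := by rw [← e2]; gcongr
      _ = C1 * L * (L / √σ) ^ r / √σ := by ring
      _ ≤ _ := by gcongr
  have hw : ∀ l, K₀ * √σ ≤ |y| → |termB p σ q y| ≤ δ / √σ * ((1 + |y|) ^ l / √σ ^ l) :=
    fun l hy => hB3.trans (le_mul_of_one_le_right (by positivity)
      (one_le_weight_div_sqrt hK hσ0 hy l))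
  have hσ4 := sqrt_pow_four hσ0.le
  have hσ6 : √σ ^ 6 = σ ^ 3 := by
    rw [show √σ ^ 6 = (√σ ^ 2) ^ 3 by ring, Real.sq_sqrt hσ0.le]
  have hw1 : 1 ≤ 1 + |y| := by linarith [abs_nonneg y]
  rcases le_or_gt |y| (2 * (K₀ * √σ)) with hy | hy
  · have hφ : φm ≤ phi p σ y := by
      have h6 : profile p (2 * K₀) ≤ profile p (y / √σ) := by
        refine profile_antitone hp ?_
        rw [abs_div, abs_of_pos hsq, abs_of_pos (show 0 < 2 * K₀ by linarith), div_le_iff₀ hsq]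
        linarith
      rw [phi, hφm]
      linarith [phiShift_pos (p := p) hp hσ0]
    have hqφ : |q y| ≤ phi p σ y / 2 := by
      refine hqs.trans ?_
      rw [div_le_iff₀ hsq]
      rw [div_le_iff₀ hφ0] at h4
      have : φm * √σ ≤ phi p σ y * √σ := by gcongr
      linarith
    have hφp := phi_pos hp hσ0 y
    have hBq : |termB p σ q y| ≤ C3 * q y ^ 2 := by
      refine (H2 _ hφp (q y) hqφ).trans ?_
      have h6 : phi p σ y ^ p ≤ (2 * kappa p) ^ p :=
        Real.rpow_le_rpow hφp.le (phi_le hp h2 y) (by linarith)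
      calc C2 * (phi p σ y ^ p * (q y / phi p σ y) ^ 2)
          ≤ C2 * ((2 * kappa p) ^ p * (q y ^ 2 / φm ^ 2)) := by
            rw [div_pow]
            gcongr
        _ = _ := by rw [hC3]; ring
    have hqw : q y ^ 2 ≤ 64 * A ^ 4 * (1 + Real.log σ) ^ 2 / σ ^ 4 * (1 + |y|) ^ 6 := by
      have := hq.abs_le_weight hχ hK h2 hA y
      calc q y ^ 2 = |q y| ^ 2 := (sq_abs _).symm
        _ ≤ (8 * (A ^ 2 * (1 + Real.log σ)) / σ ^ 2 * (1 + |y|) ^ 3) ^ 2 := by gcongr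
        _ = _ := by ring
    have h5' : 1728 * C3 * K₀ ^ 3 * A ^ 4 * (1 + Real.log σ) ^ 2 ≤ δ * √σ := by
      have e : 1728 * C3 * K₀ ^ 3 * A ^ 4 / δ * (1 + Real.log σ) ^ 2 =
        1728 * C3 * K₀ ^ 3 * A ^ 4 * (1 + Real.log σ) ^ 2 / δ := by ring
      rw [e, div_le_iff₀ hδ] at h5
      linarith
    have hBw : |termB p σ q y| ≤
        64 * C3 * A ^ 4 * (1 + Real.log σ) ^ 2 / σ ^ 4 * (1 + |y|) ^ 6 :=
      calc _ ≤ C3 * (64 * A ^ 4 * (1 + Real.log σ) ^ 2 / σ ^ 4 * (1 + |y|) ^ 6) :=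
            hBq.trans (by gcongr)
        _ = _ := by ring
    have hK3 : (1 : ℝ) ≤ K₀ ^ 3 := one_le_pow₀ hK
    have hσσ : √σ ≤ σ := by nlinarith [Real.sq_sqrt hσ0.le]
    refine ⟨hBw.trans ?_, hBw.trans ?_, hB3⟩
    · have h7 : 64 * C3 * A ^ 4 * (1 + Real.log σ) ^ 2 ≤ δ * σ := by
        have h8 : 64 * C3 * A ^ 4 * (1 + Real.log σ) ^ 2 * 1 ≤
            64 * C3 * A ^ 4 * (1 + Real.log σ) ^ 2 * (27 * K₀ ^ 3) :=
          mul_le_mul_of_nonneg_left (by linarith) (by positivity)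
        have h9 : δ * √σ ≤ δ * σ := by gcongr
        linarith
      have h10 : 64 * C3 * A ^ 4 * (1 + Real.log σ) ^ 2 / σ ^ 4 ≤ δ / σ ^ 3 := by
        rw [div_le_div_iff₀ (by positivity) (by positivity)]
        calc _ ≤ δ * σ * σ ^ 3 := by gcongr
          _ = _ := by ring
      exact mul_le_mul h10 (pow_le_pow_right₀ hw1 (by norm_num)) (by positivity) (by positivity)
    -- The square of the cubic weight is too large for the negative part; on this region three of
    -- its six powers are turned into `√σ³`, which leaves `σ^{-5/2}` times logarithms.
    · have hW : (1 + |y|) ^ 3 ≤ 27 * K₀ ^ 3 * √σ ^ 3 :=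
        (pow_le_pow_left₀ (by positivity) (one_add_abs_le_of_le hK h2 hy) 3).trans
          (le_of_eq (by ring))
      calc _ = 64 * C3 * A ^ 4 * (1 + Real.log σ) ^ 2 / σ ^ 4 * ((1 + |y|) ^ 3 * (1 + |y|) ^ 3) := by
            ring
        _ ≤ 64 * C3 * A ^ 4 * (1 + Real.log σ) ^ 2 / σ ^ 4 *
            (27 * K₀ ^ 3 * √σ ^ 3 * (1 + |y|) ^ 3) := by gcongr
        _ = 1728 * C3 * K₀ ^ 3 * A ^ 4 * (1 + Real.log σ) ^ 2 * √σ ^ 3 / σ ^ 4 *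
            (1 + |y|) ^ 3 := by ring
        _ ≤ δ * √σ * √σ ^ 3 / σ ^ 4 * (1 + |y|) ^ 3 := by gcongr
        _ = δ * √σ ^ 4 / σ ^ 4 * (1 + |y|) ^ 3 := by ring
        _ = _ := by rw [hσ4]; field_simp
  · have hy' : K₀ * √σ ≤ |y| := by nlinarith
    refine ⟨(hw 8 hy').trans ?_, (hw 3 hy').trans (le_of_eq ?_), hB3⟩
    · have : σ ^ 3 ≤ √σ ^ 9 := by
        rw [← hσ6]; exact pow_le_pow_right₀ hsq1 (by norm_num)
      calc _ = δ / √σ ^ 9 * (1 + |y|) ^ 8 := by field_simp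
        _ ≤ _ := by gcongr
    · rw [← hσ4]; field_simp

/-! ### Derivatives of the profile and of Lipschitz functions -/

/-- The derivative of the profile. -/
noncomputable def profD (p z : ℝ) : ℝ := -(1 / (2 * p)) * z * profile p z / profX p z

lemma hasDerivAt_phi {p s : ℝ} (hp : 1 < p) (y : ℝ) :
    HasDerivAt (phi p s) (profD p (y / √s) / √s) y := by
  have h := ((hasDerivAt_profile hp (y / √s)).comp y
    ((hasDerivAt_id y).div_const √s)).add_const (kappa p / (2 * p * s))
  refine h.congr_deriv ?_
  rw [profD]; ring

lemma exists_abs_profD_le {p : ℝ} (hp : 1 < p) : ∃ C > 0, ∀ z, |profD p z| ≤ C := by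
  obtain ⟨C, hC, h⟩ := abs_div_profX_le hp
  have hκ := kappa_pos hp
  refine ⟨1 / (2 * p) * kappa p * C, by positivity, fun z => ?_⟩
  have hX := profX_pos hp z
  have e : profD p z = -(1 / (2 * p) * profile p z * (z / profX p z)) := by rw [profD]; ring
  rw [e, abs_neg, abs_mul, abs_mul, abs_div z (profX p z), abs_of_pos hX, abs_of_pos (profile_pos hp z),
    abs_of_pos (by positivity : 0 < 1 / (2 * p))]
  have := h z
  have := profile_le_kappa hp z
  have := profile_pos hp z
  gcongr

/-- A Lipschitz function is absolutely continuous, so it is the integral of its derivative and the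
essential bound on that derivative becomes a Lipschitz constant. -/
lemma GradBound.abs_sub_le {M : ℝ} {g : ℝ → ℝ} (hM : 0 ≤ M) (h : GradBound M g) (a b : ℝ) :
    |g b - g a| ≤ M * |b - a| := by
  obtain ⟨⟨L, hL⟩, hg⟩ := h
  rw [← (hL.lipschitzOnWith (s := uIcc a b)).absolutelyContinuousOnInterval.integral_deriv_eq_sub]
  have hae : ∀ᵐ x, ‖deriv g x‖ ≤ M := by
    have h1 := enorm_ae_le_eLpNormEssSup (deriv g) volume
    rw [linf, eLpNorm_exponent_top] at hg
    filter_upwards [h1] with x hx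
    have h2 := hx.trans hg
    rwa [← ofReal_norm, ENNReal.ofReal_le_ofReal_iff hM] at h2
  refine intervalIntegral.norm_integral_le_of_norm_le_const_ae (f := deriv g) ?_
  filter_upwards [hae] with x hx _ using hx

/-- An essential bound is turned into one at every point. Where the function is not differentiable,
`deriv` is `0`. -/
lemma GradBound.abs_deriv_le {M : ℝ} {g : ℝ → ℝ} (hM : 0 ≤ M) (h : GradBound M g) (y : ℝ) :
    |deriv g y| ≤ M := by
  have hl : LipschitzWith ⟨M, hM⟩ g := LipschitzWith.of_dist_le_mul fun x y => by
    rw [Real.dist_eq, Real.dist_eq]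
    exact h.abs_sub_le hM y x
  exact norm_deriv_le_of_lipschitz hl

lemma measurable_phi_right (p s : ℝ) : Measurable (phi p s) := by
  unfold phi
  exact ((measurable_profile p).comp (measurable_id.div_const _)).add_const _

lemma measurable_termB (p s : ℝ) {g : ℝ → ℝ} (hg : Measurable g) : Measurable (termB p s g) := by
  have := measurable_phi_right p s
  unfold termB
  fun_prop

lemma measurable_termN (p a abar mu mubar mu0 s : ℝ) {g : ℝ → ℝ} (hg : Measurable g) :
    Measurable (termN p a abar mu mubar mu0 s g) := by
  have := measurable_phi_right p s
  have h1 := measurable_deriv (phi p s)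
  have h2 := measurable_deriv g
  unfold termN
  fun_prop

lemma expBeta_pos {p a : ℝ} (hp : 1 < p) (ha : a < 2 * p / (p + 1)) : 0 < expBeta p a := by
  rw [lt_div_iff₀ (by linarith)] at ha
  exact div_pos (by linarith) (by linarith)

lemma expBetaBar_pos {p abar : ℝ} (hp : 1 < p) (h : abar < p) : 0 < expBetaBar p abar :=
  div_pos (by linarith) (by linarith)

/-- The new term is smaller than any multiple of `σ⁻³`. -/
lemma eventually_abs_termN_le {p a abar : ℝ} (hp : 1 < p) (habar0 : 0 ≤ abar) (habar : abar < p)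
    (ha0 : 0 ≤ a) (ha : a < 2 * p / (p + 1)) (mu mubar mu0 : ℝ) {δ : ℝ} (hδ : 0 < δ) :
    ∀ᶠ σ in Filter.atTop, ∀ q : ℝ → ℝ, (∀ y, |q y| ≤ 1) → (∀ y, |deriv q y| ≤ 1) → ∀ y,
      |termN p a abar mu mubar mu0 σ q y| ≤ δ / σ ^ 3 := by
  obtain ⟨C, hC, hD⟩ := exists_abs_profD_le hp
  have hκ := kappa_pos hp
  have hlim : ∀ k b : ℝ, 0 < b → Filter.Tendsto
      (fun σ : ℝ => k * (σ ^ (3 : ℝ) * Real.exp (-b * σ))) Filter.atTop (nhds 0) :=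
    fun k b hb => by simpa using (tendsto_rpow_mul_exp_neg_mul_atTop_nhds_zero 3 b hb).const_mul k
  have h3 := ((hlim (|mu| * (C + 1) ^ a) _ (expBeta_pos hp ha)).add
    (hlim (|mubar| * (2 * kappa p + 1) ^ abar) _ (expBetaBar_pos hp habar))).add
    (hlim |mu0| (p / (p - 1)) (div_pos (by linarith) (by linarith)))
  rw [add_zero, add_zero] at h3
  filter_upwards [h3.eventually_le_const hδ, Filter.eventually_ge_atTop 1] with σ h1 h2 q hq hq' y
  have hσ : 0 < σ := by linarith
  have hs1 : 1 ≤ √σ := Real.one_le_sqrt.2 h2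
  have e3 : σ ^ (3 : ℝ) = σ ^ 3 := by rw [← Real.rpow_natCast]; norm_num
  rw [e3] at h1
  have b1 : |deriv (phi p σ) y + deriv q y| ^ a ≤ (C + 1) ^ a := by
    refine Real.rpow_le_rpow (abs_nonneg _) ((abs_add_le _ _).trans (add_le_add ?_ (hq' y))) ha0
    rw [(hasDerivAt_phi hp y).deriv, abs_div, abs_of_pos (by linarith : 0 < √σ)]
    exact (div_le_self (abs_nonneg _) hs1).trans (hD _)
  have b2 : |phi p σ y + q y| ^ abar ≤ (2 * kappa p + 1) ^ abar := by
    refine Real.rpow_le_rpow (abs_nonneg _) ((abs_add_le _ _).trans (add_le_add ?_ (hq y))) habar0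
    rw [abs_of_pos (phi_pos hp hσ y)]
    exact phi_le hp h2 y
  have hN : |termN p a abar mu mubar mu0 σ q y| ≤
      |mu| * (C + 1) ^ a * Real.exp (-(expBeta p a * σ)) +
      |mubar| * (2 * kappa p + 1) ^ abar * Real.exp (-(expBetaBar p abar * σ)) +
      |mu0| * Real.exp (-(p / (p - 1) * σ)) := by
    unfold termN
    refine (abs_add_le _ _).trans (add_le_add ((abs_add_le _ _).trans (add_le_add ?_ ?_)) ?_)
    · rw [abs_mul, abs_mul, Real.abs_exp, abs_of_nonneg (Real.rpow_nonneg (abs_nonneg _) a)]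
      gcongr
    · rw [abs_mul, abs_mul, Real.abs_exp, abs_of_nonneg (Real.rpow_nonneg (abs_nonneg _) abar)]
      gcongr
    · rw [abs_mul, Real.abs_exp]
  rw [le_div_iff₀ (by positivity)]
  simp only [neg_mul] at h1
  refine (mul_le_mul_of_nonneg_right hN (by positivity)).trans (le_trans (le_of_eq ?_) h1)
  ring

/-! ### The corrective term -/

/-- The second derivative of the profile. -/
noncomputable def profDD (p z : ℝ) : ℝ :=
  -(profile p z / (2 * p)) * (1 / profX p z - z ^ 2 / (2 * profX p z ^ 2))

lemma hasDerivAt_profD {p : ℝ} (hp : 1 < p) (z : ℝ) : HasDerivAt (profD p) (profDD p z) z := by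
  have hX := (profX_pos hp z).ne'
  have hp0 : p ≠ 0 := by linarith
  have h := ((((hasDerivAt_id z).const_mul (-(1 / (2 * p)))).fun_mul
    (hasDerivAt_profile hp z)).fun_div (hasDerivAt_profX p z) hX)
  refine h.congr_deriv ?_
  simp only [id_eq, profDD]
  field_simp
  ring

/-- The coefficient of `1/s` in the expansion of the corrective term. -/
noncomputable def corrCoeff (p z : ℝ) : ℝ :=
  profDD p z + z * profD p z / 2 + kappa p / (2 * p * (p - 1)) * (p / profX p z - 1)

/-- The terms of order one cancel because the profile solves `-(z/2)f' - f/(p-1) + f^p = 0`. The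
coefficient of `1/s` gathers `f''`, the time derivative of the profile and the linear effect of the
shift. -/
lemma termR_eq {p s : ℝ} (hp : 1 < p) (hs : 0 < s) (y : ℝ) : termR p s y =
    corrCoeff p (y / √s) / s + nonlinB p (profile p (y / √s)) (kappa p / (2 * p * s)) +
      kappa p / (2 * p * s ^ 2) := by
  have hsq : 0 < √s := Real.sqrt_pos.2 hs
  have hss := Real.mul_self_sqrt hs.le
  obtain ⟨z, hz⟩ : ∃ z, z = y / √s := ⟨_, rfl⟩
  have hX := profX_pos hp z
  have hf := profile_pos hp z
  have hp1 : p - 1 ≠ 0 := by linarith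
  have hp0 : p ≠ 0 := by linarith
  have e1 : deriv (phi p s) = fun y => profD p (y / √s) / √s :=
    funext fun y => (hasDerivAt_phi hp y).deriv
  have e2 : deriv (deriv (phi p s)) y = profDD p z / s := by
    have h0 := ((hasDerivAt_profD hp (y / √s)).comp y
      ((hasDerivAt_id y).div_const √s)).div_const √s
    have h00 : deriv (fun y => profD p (y / √s) / √s) y =
      profDD p (y / √s) * (1 / √s) / √s := h0.deriv
    rw [e1, h00, ← hz]
    have : s = √s ^ 2 := (Real.sq_sqrt hs.le).symm
    calc profDD p z * (1 / √s) / √s = profDD p z / √s ^ 2 := by field_simp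
      _ = _ := by rw [← this]
  have e3 : deriv (fun t => phi p t y) s =
      -(profD p z * (z / (2 * s))) - kappa p / (2 * p * s ^ 2) := by
    have h1 := (hasDerivAt_const s y).fun_div (Real.hasDerivAt_sqrt hs.ne') hsq.ne'
    have h2 := (hasDerivAt_const s (kappa p)).fun_div ((hasDerivAt_id s).const_mul (2 * p))
      (by simp only [id_eq]; positivity)
    have h3 := ((hasDerivAt_profile hp (y / √s)).comp s h1).add h2
    have h4 : HasDerivAt (fun t => phi p t y) _ s := h3
    rw [h4.deriv, ← hz, profD]
    have hy : y = z * √s := by rw [hz]; field_simp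
    have h5 : √s ^ 2 = s := Real.sq_sqrt hs.le
    simp only [id_eq, hy, h5]
    field_simp
    ring
  have hη := phiShift_pos (p := p) hp hs
  obtain ⟨η, hηd⟩ : ∃ η, η = kappa p / (2 * p * s) := ⟨_, rfl⟩
  have e4 : nonlinB p (profile p z) (kappa p / (2 * p * s)) =
      (profile p z + kappa p / (2 * p * s)) ^ p - profile p z / ((p - 1) * profX p z) -
        p * (1 / (p - 1) * (profX p z)⁻¹) * (kappa p / (2 * p * s)) := by
    have e5 : profile p z ^ p = profile p z / ((p - 1) * profX p z) := by
      rw [show profile p z ^ p = profile p z ^ (p - 1) * profile p z by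
        rw [← Real.rpow_add_one hf.ne', sub_add_cancel], profile_rpow hp]
      field_simp
    unfold nonlinB
    rw [abs_of_pos (by positivity), ← Real.rpow_add_one (by positivity), sub_add_cancel, e5,
      profile_rpow hp]
  have hz2 : y * (profD p z / √s) = z * profD p z := by rw [hz]; ring
  have hXz : profX p z = 1 + (p - 1) / (4 * p) * z ^ 2 := rfl
  unfold termR
  rw [e2, e3, e1, phi, ← hz, e4, corrCoeff]
  simp only [mul_assoc, ← hz, hz2]
  -- This is the profile equation, with `f^p` written as `f/((p-1)X)`.
  have key : -(1 / 2 * (z * profD p z)) - profile p z / (p - 1) +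
      profile p z / ((p - 1) * profX p z) = 0 := by
    rw [profD]
    have : z ^ 2 = (profX p z - 1) * (4 * p) / (p - 1) := by rw [hXz]; field_simp; ring
    field_simp
    rw [this]
    field_simp
    ring
  have key2 : kappa p / (2 * (p * (p - 1))) * (p / profX p z - 1) / s =
      kappa p / (2 * (p * s)) * (p * (1 / (p - 1) * (profX p z)⁻¹)) -
        kappa p / (2 * (p * s)) / (p - 1) := by
    field_simp
  have e6 : (profDD p z + z * profD p z / 2 +
      kappa p / (2 * (p * (p - 1))) * (p / profX p z - 1)) / s = profDD p z / s +
      z * profD p z / 2 / s + kappa p / (2 * (p * (p - 1))) * (p / profX p z - 1) / s := by ring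
  rw [e6, key2]
  have e7 : (profile p z + kappa p / (2 * (p * s))) / (p - 1) =
    profile p z / (p - 1) + kappa p / (2 * (p * s)) / (p - 1) := by ring
  rw [e7]
  have e8 : profD p z * (z / (2 * s)) = z * profD p z / 2 / s := by field_simp
  rw [e8]
  linear_combination key

lemma sq_div_profX_le {p : ℝ} (hp : 1 < p) (z : ℝ) : z ^ 2 / profX p z ≤ 4 * p / (p - 1) := by
  have h : 0 < p - 1 := by linarith
  rw [div_le_iff₀ (profX_pos hp z), profX]
  have e : 4 * p / (p - 1) * (1 + (p - 1) / (4 * p) * z ^ 2) = 4 * p / (p - 1) + z ^ 2 := by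
    field_simp
  rw [e]
  have : 0 < 4 * p / (p - 1) := by positivity
  linarith

lemma exists_abs_corrCoeff_le {p : ℝ} (hp : 1 < p) : ∃ C > 0, ∀ z, |corrCoeff p z| ≤ C := by
  have hκ := kappa_pos hp
  have h : 0 < p - 1 := by linarith
  refine ⟨kappa p / (2 * p) * (1 + 4 * p / (p - 1)) + kappa p / (2 * p) * (4 * p / (p - 1)) +
    kappa p / (2 * p * (p - 1)) * (p + 1), by positivity, fun z => ?_⟩
  have hX := profX_pos hp z
  have hX1 := one_le_profX hp z
  have hf := profile_pos hp z
  have hfκ := profile_le_kappa hp z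
  have hz := sq_div_profX_le hp z
  have hz0 : 0 ≤ z ^ 2 / profX p z := by positivity
  have hi : 1 / profX p z ≤ 1 := by rw [div_le_one hX]; exact hX1
  have hi0 : 0 < 1 / profX p z := by positivity
  unfold corrCoeff
  refine (abs_add_le _ _).trans (add_le_add ((abs_add_le _ _).trans (add_le_add ?_ ?_)) ?_)
  · rw [profDD, abs_mul, abs_neg, abs_of_pos (by positivity : 0 < profile p z / (2 * p))]
    have e : z ^ 2 / (2 * profX p z ^ 2) = 1 / 2 * ((z ^ 2 / profX p z) * (1 / profX p z)) := by
      field_simp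
    have h1 : z ^ 2 / profX p z * (1 / profX p z) ≤ 4 * p / (p - 1) * 1 :=
      mul_le_mul hz hi hi0.le (by positivity)
    have h2 : 0 ≤ z ^ 2 / profX p z * (1 / profX p z) := by positivity
    have h3 : |1 / profX p z - z ^ 2 / (2 * profX p z ^ 2)| ≤ 1 + 4 * p / (p - 1) := by
      rw [e, abs_le]
      constructor <;> linarith
    gcongr
  · have e : z * profD p z / 2 = -(1 / 2 * (profile p z / (2 * p) * (z ^ 2 / profX p z))) := by
      rw [profD]; field_simp
    rw [e, abs_neg, abs_of_nonneg (by positivity)]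
    have h1 : profile p z / (2 * p) * (z ^ 2 / profX p z) ≤
      kappa p / (2 * p) * (4 * p / (p - 1)) := by gcongr
    have h2 : 0 ≤ profile p z / (2 * p) * (z ^ 2 / profX p z) := by positivity
    linarith
  · rw [abs_mul, abs_of_pos (by positivity)]
    have h1 : |p / profX p z - 1| ≤ p + 1 := by
      have e : p / profX p z = p * (1 / profX p z) := by ring
      have h4 : p * (1 / profX p z) ≤ p * 1 := by gcongr
      have h5 : 0 < p * (1 / profX p z) := by positivity
      rw [e, abs_le]
      constructor <;> linarith
    gcongr

/-- The shift `κ/(2ps)` cancels the value of the coefficient at `z = 0`, and its quadratic Taylor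
coefficient vanishes as well. This double cancellation makes `R - R(·,0)` of order `s⁻³` against
`(1+|y|)⁴`. -/
lemma exists_abs_corrCoeff_le_pow_four {p : ℝ} (hp : 1 < p) :
    ∃ C > 0, ∀ z, |z| ≤ 1 → |corrCoeff p z| ≤ C * z ^ 4 := by
  have hκ := kappa_pos hp
  have h : 0 < p - 1 := by linarith
  obtain ⟨d, hd⟩ : ∃ d, d = (p - 1) / (4 * p) := ⟨_, rfl⟩
  have hd0 : 0 < d := by rw [hd]; positivity
  obtain ⟨C1, hC1, H1⟩ := exists_abs_rpow_taylor_le (-(p / (p - 1))) (lo := 1) (hi := 1 + d)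
    one_pos (by positivity)
  refine ⟨kappa p / (2 * p) * (d / 2 + C1 * d ^ 2 + p / (p - 1) * d ^ 2), by positivity,
    fun z hz => ?_⟩
  have hX := profX_pos hp z
  have hX1 := one_le_profX hp z
  have hz2 : z ^ 2 ≤ 1 := by rw [← sq_abs]; exact pow_le_one₀ (abs_nonneg z) hz
  have eX : profX p z - 1 = d * z ^ 2 := by rw [hd]; unfold profX; ring
  have hXd : profX p z ≤ 1 + d := by nlinarith
  have hT := H1 1 ⟨le_rfl, by linarith⟩ (profX p z) ⟨hX1, hXd⟩
  rw [Real.one_rpow, Real.one_rpow, eX, mul_one] at hT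
  have hm : profX p z ^ (-(1 / (p - 1))) ≤ 1 :=
    Real.rpow_le_one_of_one_le_of_nonpos hX1 (by
      rw [neg_nonpos]; positivity)
  have hm0 : 0 < profX p z ^ (-(1 / (p - 1))) := Real.rpow_pos_of_pos hX _
  have em : profX p z ^ (-(p / (p - 1))) = profX p z ^ (-(1 / (p - 1))) / profX p z := by
    rw [← Real.rpow_sub_one hX.ne']
    congr 1
    field_simp
    ring
  -- Everything is expressed through powers of `X = 1 + d z²`. Once the first-order Taylor
  -- polynomial of `X^{-p/(p-1)}` is taken out, each remaining term is visibly of order `z⁴`.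
  have e : corrCoeff p z = kappa p / (2 * p) *
      (-(profX p z ^ (-(1 / (p - 1))) * (d / 2 * z ^ 4 / profX p z ^ 2)) -
        (profX p z ^ (-(p / (p - 1))) - 1 - -(p / (p - 1)) * (d * z ^ 2)) +
        p / (p - 1) * (d * z ^ 2) ^ 2 / profX p z) := by
    have hzz : d * z ^ 2 = profX p z - 1 := eX.symm
    have hz4 : d / 2 * z ^ 4 = z ^ 2 * (profX p z - 1) / 2 := by rw [← hzz]; ring
    rw [em, hz4, hzz, corrCoeff, profDD, profD, profile_eq hp]
    have hp0 : p ≠ 0 := by linarith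
    have hp1 : p - 1 ≠ 0 := h.ne'
    have hX0 := hX.ne'
    generalize profX p z ^ (-(1 / (p - 1))) = F
    field_simp
    ring
  have t1 : |profX p z ^ (-(1 / (p - 1))) * (d / 2 * z ^ 4 / profX p z ^ 2)| ≤ d / 2 * z ^ 4 := by
    have h1 : d / 2 * z ^ 4 / profX p z ^ 2 ≤ d / 2 * z ^ 4 :=
      div_le_self (by positivity) (one_le_pow₀ hX1)
    rw [abs_of_nonneg (by positivity)]
    calc _ ≤ 1 * (d / 2 * z ^ 4) := by gcongr
      _ = _ := one_mul _
  have t3 : |p / (p - 1) * (d * z ^ 2) ^ 2 / profX p z| ≤ p / (p - 1) * d ^ 2 * z ^ 4 := by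
    rw [abs_of_nonneg (by positivity)]
    exact (div_le_self (by positivity) hX1).trans (le_of_eq (by ring))
  rw [e, abs_mul, abs_of_pos (by positivity : 0 < kappa p / (2 * p)), mul_assoc]
  refine mul_le_mul_of_nonneg_left ?_ (by positivity)
  refine (abs_add_le _ _).trans ((add_le_add_left (abs_sub _ _) _).trans ?_)
  rw [abs_neg]
  have : (d / 2 + C1 * d ^ 2 + p / (p - 1) * d ^ 2) * z ^ 4 =
    d / 2 * z ^ 4 + C1 * (d * z ^ 2) ^ 2 + p / (p - 1) * d ^ 2 * z ^ 4 := by ring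
  rw [this]
  linarith

/-- The derivative in `a` is `p` times the second-order Taylor remainder of the power `p - 1`, hence
quadratic in `x`. -/
lemma exists_abs_nonlinB_sub_le {p : ℝ} (hp : 1 < p) {lo hi : ℝ} (hlo : 0 < lo) (hhi : 0 < hi) :
    ∃ C > 0, ∀ a ∈ Icc lo hi, ∀ b ∈ Icc lo hi, ∀ x ∈ Icc 0 hi,
      |nonlinB p a x - nonlinB p b x| ≤ C * x ^ 2 * |a - b| := by
  obtain ⟨C, hC, H⟩ := exists_abs_rpow_taylor_le (p - 1) hlo (hi := 2 * hi) (by positivity)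
  refine ⟨p * C, by positivity, fun a ha b hb x hx => ?_⟩
  have e : ∀ a ∈ Icc lo hi, nonlinB p a x = (a + x) ^ p - a ^ p - p * x * a ^ (p - 1) := by
    intro a ha
    have : 0 < a + x := by linarith [ha.1, hx.1]
    rw [nonlinB, abs_of_pos this, ← Real.rpow_add_one this.ne', sub_add_cancel]
    ring
  rw [e a ha, e b hb]
  refine (convex_Icc lo hi).norm_image_sub_le_of_norm_hasDerivWithin_le
    (f := fun a => (a + x) ^ p - a ^ p - p * x * a ^ (p - 1))
    (f' := fun a => p * ((a + x) ^ (p - 1) - a ^ (p - 1) - (p - 1) * a ^ (p - 1 - 1) * x))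
    (C := p * C * x ^ 2) (fun t ht => ?_) (fun t ht => ?_) hb ha
  · have ht0 : 0 < t := hlo.trans_le ht.1
    have htx : 0 < t + x := by linarith [hx.1]
    have h1 := (Real.hasDerivAt_rpow_const (p := p) (Or.inl htx.ne')).comp t
      ((hasDerivAt_id t).add_const x)
    have h2 := Real.hasDerivAt_rpow_const (p := p) (Or.inl ht0.ne')
    have h3 := (Real.hasDerivAt_rpow_const (p := p - 1) (Or.inl ht0.ne')).const_mul (p * x)
    refine (((h1.sub h2).sub h3).congr_deriv ?_).hasDerivWithinAt
    ring
  · have := H t ⟨ht.1, by linarith [ht.2]⟩ (t + x) ⟨by linarith [ht.1, hx.1], by linarith [ht.2, hx.2]⟩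
    rw [add_sub_cancel_left] at this
    rw [Real.norm_eq_abs, abs_mul, abs_of_pos (by linarith : 0 < p)]
    calc _ ≤ p * (C * x ^ 2) := by gcongr
      _ = _ := by ring

/-- Bounds for the corrective term. -/
structure CorrBounds (p C : ℝ) : Prop where
  pos : 0 < C
  bdd : ∀ s ≥ C, ∀ y, |termR p s y| ≤ C / s
  zero : ∀ s ≥ C, |termR p s 0| ≤ C / s ^ 2
  sub : ∀ s ≥ C, ∀ y, |termR p s y - termR p s 0| ≤ C / s ^ 3 * (1 + |y|) ^ 4
  sub' : ∀ s ≥ C, ∀ y, |termR p s y - termR p s 0| ≤ C / √s ^ 5 * (1 + |y|) ^ 3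

/-- Within `|y| ≤ √s` the difference `R(y) - R(0)` gets `z⁴/s` from the coefficient of `1/s` and
`s⁻²·z²` from the quadratic effect of the shift, both at most `s⁻³(1+|y|)⁴`; at the origin only
order `s⁻²` remains. Beyond `√s` the crude bound `C/s` suffices. -/
lemma exists_corrBounds {p : ℝ} (hp : 1 < p) : ∃ C, CorrBounds p C := by
  have hκ := kappa_pos hp
  obtain ⟨C1, hC1, H1⟩ := exists_abs_corrCoeff_le hp
  obtain ⟨C2, hC2, H2⟩ := exists_abs_corrCoeff_le_pow_four hp
  obtain ⟨C3, hC3, H3⟩ := exists_abs_nonlinB_le hp (hi := kappa p) hκ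
  obtain ⟨C4, hC4, H4⟩ := exists_abs_nonlinB_small_le p
  obtain ⟨C5, hC5, H5⟩ := exists_abs_nonlinB_sub_le hp (profile_pos hp 1) hκ
  obtain ⟨C6, hC6, H6⟩ := abs_profile_sub_kappa_le hp
  obtain ⟨C7, hC7⟩ : ∃ C7, C7 = C1 + C3 * kappa p + kappa p := ⟨_, rfl⟩
  obtain ⟨C8, hC8⟩ : ∃ C8, C8 = C4 * kappa p ^ p + kappa p := ⟨_, rfl⟩
  obtain ⟨C9, hC9⟩ : ∃ C9, C9 = C2 + C5 * kappa p ^ 2 * C6 := ⟨_, rfl⟩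
  have hκp := Real.rpow_pos_of_pos hκ p
  have h7 : 0 < C7 := by rw [hC7]; positivity
  have h8 : 0 < C8 := by rw [hC8]; positivity
  have h9 : 0 < C9 := by rw [hC9]; positivity
  obtain ⟨C, hCd⟩ : ∃ C, C = 1 + kappa p + 2 * C7 + C8 + C9 := ⟨_, rfl⟩
  have hC0 : 0 < C := by rw [hCd]; positivity
  have bdd : ∀ s ≥ C, ∀ y, |termR p s y| ≤ C7 / s := by
    intro s hs y
    have hs1 : 1 ≤ s := by linarith
    have hs0 : 0 < s := by linarith
    have hη := phiShift_pos (p := p) hp hs0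
    have hηs := phiShift_le (p := p) hp hs0
    have hη1 : kappa p / s ≤ 1 := by rw [div_le_one hs0]; linarith
    rw [termR_eq hp hs0]
    have a1 : |corrCoeff p (y / √s) / s| ≤ C1 / s := by
      rw [abs_div, abs_of_pos hs0]
      gcongr
      exact H1 _
    have a2 : |nonlinB p (profile p (y / √s)) (kappa p / (2 * p * s))| ≤ C3 * (kappa p / s) := by
      refine (H3 _ (profile_pos hp _) (profile_le_kappa hp _) _
        (by rw [abs_of_pos hη]; linarith)).trans ?_
      rw [abs_of_pos hη]
      gcongr
      refine le_trans ?_ hηs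
      have := Real.rpow_le_rpow_of_exponent_ge hη (hηs.trans hη1)
        (le_min hp.le (by norm_num : (1 : ℝ) ≤ 2))
      rwa [Real.rpow_one] at this
    have a3 : |kappa p / (2 * p * s ^ 2)| ≤ kappa p / s := by
      rw [abs_of_pos (by positivity)]
      gcongr
      nlinarith
    have t1 := abs_add_le (corrCoeff p (y / √s) / s +
      nonlinB p (profile p (y / √s)) (kappa p / (2 * p * s))) (kappa p / (2 * p * s ^ 2))
    have t2 := abs_add_le (corrCoeff p (y / √s) / s)
      (nonlinB p (profile p (y / √s)) (kappa p / (2 * p * s)))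
    have e : C7 / s = C1 / s + C3 * (kappa p / s) + kappa p / s := by rw [hC7]; ring
    linarith
  have key : ∀ s ≥ C, ∀ y, |y| ≤ √s → |termR p s y - termR p s 0| ≤ C9 / s ^ 3 * (1 + |y|) ^ 4 := by
    intro s hs y hy
    have hs1 : 1 ≤ s := by linarith
    have hs0 : 0 < s := by linarith
    have hsq : 0 < √s := Real.sqrt_pos.2 hs0
    have hss := Real.sq_sqrt hs0.le
    have hη := phiShift_pos (p := p) hp hs0
    have hηs := phiShift_le (p := p) hp hs0
    have hηκ : kappa p / s ≤ kappa p := div_le_self hκ.le hs1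
    have hz : |y / √s| ≤ 1 := by rw [abs_div, abs_of_pos hsq, div_le_one hsq]; exact hy
    have hc0 : corrCoeff p 0 = 0 := by
      have := H2 0 (by simp)
      simpa using this
    have hz2 : (y / √s) ^ 2 = y ^ 2 / s := by rw [div_pow, hss]
    have hz4 : (y / √s) ^ 4 = y ^ 4 / s ^ 2 := by rw [div_pow, sqrt_pow_four hs0.le]
    rw [termR_eq hp hs0, termR_eq hp hs0, zero_div, hc0, profile_zero]
    have a1 : |corrCoeff p (y / √s) / s| ≤ C2 / s ^ 3 * y ^ 4 := by
      have := H2 _ hz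
      rw [abs_div, abs_of_pos hs0, div_le_iff₀ hs0]
      refine this.trans (le_of_eq ?_)
      rw [hz4]
      field_simp
    have a2 : |nonlinB p (profile p (y / √s)) (kappa p / (2 * p * s)) -
        nonlinB p (kappa p) (kappa p / (2 * p * s))| ≤ C5 * kappa p ^ 2 * C6 / s ^ 3 * y ^ 2 := by
      have b1 := H5 (profile p (y / √s)) ⟨profile_antitone hp (by rwa [abs_one]),
        profile_le_kappa hp _⟩ (kappa p) ⟨profile_le_kappa hp _, le_rfl⟩
        (kappa p / (2 * p * s)) ⟨hη.le, hηs.trans hηκ⟩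
      refine b1.trans ?_
      calc _ ≤ C5 * (kappa p / s) ^ 2 * (C6 * (y / √s) ^ 2) := by
            gcongr
            exact H6 _ hz
        _ = _ := by rw [hz2]; field_simp
    have w0 := abs_nonneg y
    have w4 : y ^ 4 ≤ (1 + |y|) ^ 4 := by
      rw [show y ^ 4 = |y| ^ 4 by rw [← abs_pow, abs_of_nonneg (by positivity)]]
      gcongr; linarith
    have w2 : y ^ 2 ≤ (1 + |y|) ^ 4 := by
      rw [← sq_abs]
      calc |y| ^ 2 ≤ (1 + |y|) ^ 2 := by gcongr; linarith
        _ ≤ _ := pow_le_pow_right₀ (by linarith) (by norm_num)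
    have e : corrCoeff p (y / √s) / s + nonlinB p (profile p (y / √s)) (kappa p / (2 * p * s)) +
        kappa p / (2 * p * s ^ 2) - (0 / s + nonlinB p (kappa p) (kappa p / (2 * p * s)) +
        kappa p / (2 * p * s ^ 2)) = corrCoeff p (y / √s) / s +
        (nonlinB p (profile p (y / √s)) (kappa p / (2 * p * s)) -
        nonlinB p (kappa p) (kappa p / (2 * p * s))) := by ring
    rw [e]
    refine (abs_add_le _ _).trans ?_
    calc _ ≤ C2 / s ^ 3 * (1 + |y|) ^ 4 + C5 * kappa p ^ 2 * C6 / s ^ 3 * (1 + |y|) ^ 4 :=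
          add_le_add (a1.trans (by gcongr)) (a2.trans (by gcongr))
      _ = _ := by rw [hC9]; ring
  have key2 : ∀ s ≥ C, ∀ y, |termR p s y - termR p s 0| ≤ 2 * C7 / s := by
    intro s hs y
    have := abs_sub (termR p s y) (termR p s 0)
    have := bdd s hs y
    have := bdd s hs 0
    have e : 2 * C7 / s = C7 / s + C7 / s := by ring
    linarith
  have sub : ∀ s ≥ C, ∀ y, |termR p s y - termR p s 0| ≤ C / s ^ 3 * (1 + |y|) ^ 4 := by
    intro s hs y
    have hs0 : 0 < s := by linarith
    have w0 := abs_nonneg y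
    rcases le_or_gt |y| √s with hy | hy
    · refine (key s hs y hy).trans ?_
      gcongr; linarith
    · refine (key2 s hs y).trans ?_
      have : s ^ 2 ≤ (1 + |y|) ^ 4 := by
        rw [← sqrt_pow_four hs0.le]; gcongr; linarith
      calc 2 * C7 / s ≤ C / s := by gcongr; linarith
        _ = C / s ^ 3 * s ^ 2 := by field_simp
        _ ≤ _ := by gcongr
  refine ⟨C, hC0, fun s hs y => (bdd s hs y).trans ?_, fun s hs => ?_, sub, fun s hs y => ?_⟩
  · have hs0 : 0 < s := by linarith
    gcongr; linarith
  · have hs1 : 1 ≤ s := by linarith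
    have hs0 : 0 < s := by linarith
    have hη := phiShift_pos (p := p) hp hs0
    have hηs := phiShift_le (p := p) hp hs0
    have hc0 : corrCoeff p 0 = 0 := by
      have := H2 0 (by simp)
      simpa using this
    rw [termR_eq hp hs0, zero_div, hc0, profile_zero, zero_div, zero_add]
    have a2 : |nonlinB p (kappa p) (kappa p / (2 * p * s))| ≤ C4 * kappa p ^ p / s ^ 2 := by
      refine (H4 _ hκ _ ?_).trans ?_
      · rw [abs_of_pos hη, div_le_div_iff₀ (by positivity) (by positivity)]
        have : kappa p * (2 * 1) ≤ kappa p * (2 * (p * s)) := by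
          gcongr; nlinarith
        linarith
      · calc _ ≤ C4 * (kappa p ^ p * (kappa p / s / kappa p) ^ 2) := by gcongr
          _ = _ := by field_simp
    have a3 : |kappa p / (2 * p * s ^ 2)| ≤ kappa p / s ^ 2 := by
      rw [abs_of_pos (by positivity)]
      gcongr
      nlinarith [sq_nonneg s]
    calc _ ≤ C4 * kappa p ^ p / s ^ 2 + kappa p / s ^ 2 :=
          (abs_add_le _ _).trans (add_le_add a2 a3)
      _ = C8 / s ^ 2 := by rw [hC8]; ring
      _ ≤ _ := by gcongr; linarith
  · have hs0 : 0 < s := by linarith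
    have hsq : 0 < √s := Real.sqrt_pos.2 hs0
    have hss := Real.sq_sqrt hs0.le
    have w0 := abs_nonneg y
    -- Interpolating between the powers `0` and `4` of `(1+|y|)/√s` gives the cubic version, which
    -- the negative part needs.
    have := min_one_interp (u := (1 + |y|) / √s) (x := |termR p s y - termR p s 0|) (C := C / s)
      (by positivity) (by positivity) (i := 0) (j := 3) (k := 4) (by norm_num) (by norm_num)
      ((key2 s hs y).trans (by rw [pow_zero, mul_one]; gcongr; linarith))
      ((sub s hs y).trans (le_of_eq (by rw [div_pow, sqrt_pow_four hs0.le]; field_simp)))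
    refine this.trans (le_of_eq ?_)
    rw [show √s ^ 5 = √s ^ 2 * √s ^ 3 by ring, hss]
    field_simp

/-! ### The Duhamel term of the corrective term -/

/-- The explicit formula of `termR_eq` holds for positive times only. Truncation makes joint
measurability visible, and only positive times enter the Duhamel integral. -/
lemma measurable_termR {p : ℝ} (hp : 1 < p) :
    Measurable (Function.uncurry fun σ y : ℝ => if 0 < σ then termR p σ y else 0) := by
  have h0 : Measurable fun q : ℝ × ℝ => q.2 / √q.1 := by fun_prop
  have hf := (measurable_profile p).comp h0
  have hX : Measurable fun q : ℝ × ℝ => profX p (q.2 / √q.1) := by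
    unfold profX; fun_prop
  have hF : Measurable fun q : ℝ × ℝ => corrCoeff p (q.2 / √q.1) / q.1 +
      nonlinB p (profile p (q.2 / √q.1)) (kappa p / (2 * p * q.1)) +
      kappa p / (2 * p * q.1 ^ 2) := by
    unfold corrCoeff profDD profD nonlinB
    simp only [Function.comp_def] at hf
    fun_prop
  have e : (Function.uncurry fun σ y : ℝ => if 0 < σ then termR p σ y else 0) =
      fun q : ℝ × ℝ => if 0 < q.1 then corrCoeff p (q.2 / √q.1) / q.1 +
      nonlinB p (profile p (q.2 / √q.1)) (kappa p / (2 * p * q.1)) +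
      kappa p / (2 * p * q.1 ^ 2) else 0 := by
    ext ⟨σ, y⟩
    by_cases hσ : 0 < σ
    · simp only [Function.uncurry_apply_pair, if_pos hσ, termR_eq hp hσ]
    · simp only [Function.uncurry_apply_pair, if_neg hσ]
  rw [e]
  exact Measurable.ite (measurableSet_lt measurable_const measurable_fst) hF measurable_const

lemma measurable_termR_right {p σ : ℝ} (hp : 1 < p) (hσ : 0 < σ) : Measurable (termR p σ) := by
  have := (measurable_termR hp).comp (measurable_prodMk_left (x := σ))
  simpa only [Function.comp_def, Function.uncurry_apply_pair, if_pos hσ] using this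

section
variable {p Cv ρ : ℝ} {χ₀ : ℝ → ℝ} {c K₀ : ℝ}

/-- Joint measurability of the partial sums passes to the pointwise limit. The truncation in `σ`
restricts to times where the Dyson series converges. -/
lemma measurable_indicator_fundK (hV : PotBounds p Cv) {τ s : ℝ} (hτ : 1 ≤ τ) {G : ℝ → ℝ → ℝ}
    (hG : Measurable (Function.uncurry G)) {M : ℝ} {k : ℕ}
    (h : ∀ σ ∈ Icc τ s, ∀ y, |G σ y| ≤ M * (1 + |y|) ^ k) :
    Measurable fun q : ℝ × ℝ => if q.1 ∈ Icc τ s then fundK p s q.1 (G q.1) q.2 else 0 := by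
  have hm : MeasurableSet {q : ℝ × ℝ | q.1 ∈ Icc τ s} := measurable_fst measurableSet_Icc
  refine measurable_of_tendsto_metrizable (f := fun n (q : ℝ × ℝ) => if q.1 ∈ Icc τ s then
    ∑ i ∈ Finset.range n, dysonTerm p i s q.1 (G q.1) q.2 else 0) (fun n => ?_) ?_
  · refine Measurable.ite hm (Finset.measurable_fun_sum _ fun i _ => ?_) measurable_const
    exact (measurable_dysonTerm p hG i).comp
      (measurable_const.prodMk (measurable_fst.prodMk measurable_snd))
  · rw [tendsto_pi_nhds]
    rintro ⟨σ, y⟩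
    by_cases hσ : σ ∈ Icc τ s
    · simp only [if_pos hσ]
      exact (summable_dysonTerm hV (hτ.trans hσ.1) (hG.comp measurable_prodMk_left)
        (h σ hσ) hσ.2 y).hasSum.tendsto_sum_nat
    · simp only [if_neg hσ]
      exact tendsto_const_nhds

/-- `K(s,σ)R(σ)` is close to the constant function `e^{s-σ} R(σ,0)`. -/
lemma exists_abs_fundK_termR_sub_le (hp : 1 < p) (hV : PotBounds p Cv) {Cr : ℝ}
    (hR : CorrBounds p Cr) (ρ : ℝ) : ∃ C > 0, ∀ σ ≥ max 1 Cr, ∀ s ∈ Icc σ (σ + ρ), ∀ y,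
      |fundK p s σ (termR p σ) y - Real.exp (s - σ) * termR p σ 0| ≤
        C / σ ^ 3 * (1 + |y|) ^ 4 ∧
      |fundK p s σ (termR p σ) y - Real.exp (s - σ) * termR p σ 0| ≤
        C / √σ ^ 5 * (1 + |y|) ^ 3 := by
  have hCr := hR.pos
  have hCv := hV.one_le
  set D : ℕ → ℝ := fun l => Real.exp (dysC Cv ρ (l + 0) * ρ) * (Real.exp ρ * gaussMom (l + 0) *
    (Real.exp ρ * gaussMom 0)) with hD
  have hD0 : ∀ l, 0 ≤ D l := fun l => by
    have := gaussMom_pos (l + 0)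
    have := gaussMom_pos 0
    positivity
  have f3 := fundC_pos Cv ρ 3
  have f4 := fundC_pos Cv ρ 4
  -- No sign is assumed for `ρ`; its absolute value keeps the constant positive, and for negative
  -- `ρ` the time interval is empty.
  obtain ⟨C, hC⟩ : ∃ C, C = (D 1 + D 2) * (Cv * Cr) * |ρ| + (fundC Cv ρ 3 + fundC Cv ρ 4) * Cr :=
    ⟨_, rfl⟩
  have d1 := hD0 1
  have d2 := hD0 2
  have hC0 : 0 < C := by
    rw [hC]
    have : 0 ≤ (D 1 + D 2) * (Cv * Cr) * |ρ| := by positivity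
    have : 0 < (fundC Cv ρ 3 + fundC Cv ρ 4) * Cr := by positivity
    linarith
  refine ⟨C, hC0, fun σ hσ s hs y => ?_⟩
  have hσ1 : 1 ≤ σ := (le_max_left _ _).trans hσ
  have hσC : Cr ≤ σ := (le_max_right _ _).trans hσ
  have hσ0 : 0 < σ := by linarith
  have hsq : 0 < √σ := Real.sqrt_pos.2 hσ0
  have hss := Real.sq_sqrt hσ0.le
  have hw : 1 ≤ 1 + |y| := by linarith [abs_nonneg y]
  have mR := measurable_termR_right hp hσ0
  have pR : PolyBdd fun x => termR p σ x - termR p σ 0 :=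
    PolyBdd.of_bound (mR.sub_const _) (hR.sub σ hσC)
  have hz := hR.zero σ hσC
  -- On the constant `R(σ,0) = O(σ⁻²)`, replacing `K` by the free semigroup costs one factor of `V`,
  -- hence `σ⁻³` with quadratic weight or `σ^{-5/2}` with linear weight; the variable part of `R`
  -- already has these sizes.
  have e1 : fundK p s σ (termR p σ) y = fundK p s σ (fun _ => termR p σ 0) y +
      fundK p s σ (fun x => termR p σ x - termR p σ 0) y := by
    rw [← fundK_add hV hσ1 (PolyBdd.const _) pR hs.1]
    congr 1
    ext x; ring
  have hsemi := semigroupL_const (sub_nonneg.2 hs.1) (termR p σ 0) y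
  have hsρ : s - σ ≤ |ρ| := by linarith [hs.2, le_abs_self ρ]
  have hsσ : 0 ≤ s - σ := sub_nonneg.2 hs.1
  have bound : ∀ (l : ℕ) (v : ℝ), 0 ≤ v →
      (∀ t, σ ≤ t → ∀ x, |potV p t x| ≤ v * (1 + |x|) ^ l) →
      |fundK p s σ (fun _ => termR p σ 0) y - Real.exp (s - σ) * termR p σ 0| ≤
        D l * (v * (Cr / σ ^ 2)) * |ρ| * (1 + |y|) ^ l := by
    intro l v hv hvl
    have := abs_fundK_sub_semigroupL_le (ρ := ρ) (g := fun _ => termR p σ 0) (M := Cr / σ ^ 2)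
      (k := 0) hV hσ1 measurable_const (fun y => by rw [pow_zero, mul_one]; exact hz) hv hvl hs y
    rw [hsemi] at this
    refine this.trans ?_
    have := hD0 l
    show D l * (v * (Cr / σ ^ 2)) * (s - σ) * (1 + |y|) ^ (l + 0) ≤ _
    rw [add_zero]
    gcongr
  have e2 : fundK p s σ (termR p σ) y - Real.exp (s - σ) * termR p σ 0 =
      fundK p s σ (fun _ => termR p σ 0) y - Real.exp (s - σ) * termR p σ 0 +
      fundK p s σ (fun x => termR p σ x - termR p σ 0) y := by rw [e1]; ring
  rw [e2]
  refine ⟨(abs_add_le _ _).trans ?_, (abs_add_le _ _).trans ?_⟩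
  · have b1 := bound 2 (Cv / √σ ^ 2) (by positivity) fun t ht x => abs_potV_le_quad hV hσ1 ht x
    have b2 := abs_fundK_le hV hσ1 pR.1 (hR.sub σ hσC) hs y
    have w : (1 + |y|) ^ 2 ≤ (1 + |y|) ^ 4 := pow_le_pow_right₀ hw (by norm_num)
    calc _ ≤ D 2 * (Cv / √σ ^ 2 * (Cr / σ ^ 2)) * |ρ| * (1 + |y|) ^ 4 +
          fundC Cv ρ 4 * (Cr / σ ^ 3) * (1 + |y|) ^ 4 :=
          add_le_add (b1.trans (by gcongr)) b2
      _ = (D 2 * (Cv * Cr) * |ρ| + fundC Cv ρ 4 * Cr) / σ ^ 3 * (1 + |y|) ^ 4 := by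
          rw [hss]; field_simp
      _ ≤ _ := by
          have t1 : 0 ≤ D 1 * (Cv * Cr) * |ρ| := by positivity
          have t2 : 0 ≤ fundC Cv ρ 3 * Cr := by positivity
          have : D 2 * (Cv * Cr) * |ρ| + fundC Cv ρ 4 * Cr ≤ C := by rw [hC]; linarith
          gcongr
  · have b1 := bound 1 (Cv / √σ) (by positivity) fun t ht x => abs_potV_le_lin hV hσ1 ht x
    have b2 := abs_fundK_le hV hσ1 pR.1 (hR.sub' σ hσC) hs y
    have w : (1 + |y|) ^ 1 ≤ (1 + |y|) ^ 3 := pow_le_pow_right₀ hw (by norm_num)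
    have e5 : √σ ^ 5 = √σ * σ ^ 2 := by
      rw [← sqrt_pow_four hσ0.le]; ring
    calc _ ≤ D 1 * (Cv / √σ * (Cr / σ ^ 2)) * |ρ| * (1 + |y|) ^ 3 +
          fundC Cv ρ 3 * (Cr / √σ ^ 5) * (1 + |y|) ^ 3 :=
          add_le_add (b1.trans (by gcongr)) b2
      _ = (D 1 * (Cv * Cr) * |ρ| + fundC Cv ρ 3 * Cr) / √σ ^ 5 * (1 + |y|) ^ 3 := by
          rw [e5]; field_simp
      _ ≤ _ := by
          have t1 : 0 ≤ D 2 * (Cv * Cr) * |ρ| := by positivity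
          have t2 : 0 ≤ fundC Cv ρ 4 * Cr := by positivity
          have : D 1 * (Cv * Cr) * |ρ| + fundC Cv ρ 3 * Cr ≤ C := by rw [hC]; linarith
          gcongr

/-- The corrective part is a constant plus a small remainder. -/
lemma exists_corrPart_decomposition (hp : 1 < p) (hV : PotBounds p Cv) {Cr : ℝ}
    (hR : CorrBounds p Cr) (ρ : ℝ) : ∃ C > 0, ∀ τ ≥ max 1 Cr, ∀ s ∈ Icc τ (τ + ρ),
      ∃ (I : ℝ) (D : ℝ → ℝ), PolyBdd D ∧ (∀ y, corrPart p τ s y = D y + I * 1) ∧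
        |I| ≤ C / τ ^ 2 * (s - τ) ∧ (∀ y, |D y| ≤ C / τ ^ 3 * (s - τ) * (1 + |y|) ^ 4) ∧
        ∀ y, |D y| ≤ C / √τ ^ 5 * (s - τ) * (1 + |y|) ^ 3 := by
  obtain ⟨C1, hC1, H⟩ := exists_abs_fundK_termR_sub_le hp hV hR ρ
  have hCr := hR.pos
  refine ⟨C1 + Real.exp ρ * Cr, by positivity, fun τ hτ s hs => ?_⟩
  have hτ1 : 1 ≤ τ := (le_max_left _ _).trans hτ
  have hτC : Cr ≤ τ := (le_max_right _ _).trans hτ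
  have hτ0 : 0 < τ := by linarith
  have hsq : 0 < √τ := Real.sqrt_pos.2 hτ0
  set G : ℝ → ℝ → ℝ := fun σ y => if 0 < σ then termR p σ y else 0 with hG
  have hGσ : ∀ σ, 0 < σ → G σ = termR p σ := fun σ hσ => by
    ext y; rw [hG]; simp only [if_pos hσ]
  have mG : Measurable (Function.uncurry G) := measurable_termR hp
  have hGb : ∀ σ ∈ Icc τ s, ∀ y, |G σ y| ≤ Cr / τ * (1 + |y|) ^ 0 := fun σ hσ y => by
    rw [hGσ σ (hτ0.trans_le hσ.1), pow_zero, mul_one]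
    refine (hR.bdd σ (hτC.trans hσ.1) y).trans ?_
    have := hσ.1
    gcongr
  have mF := measurable_indicator_fundK hV hτ1 mG hGb
  have mI : Measurable fun σ : ℝ => Real.exp (s - σ) * G σ 0 :=
    (by fun_prop : Measurable fun σ : ℝ => Real.exp (s - σ)).mul
      (mG.comp (measurable_id.prodMk measurable_const))
  have hIb : ∀ σ ∈ Ioc τ s, |Real.exp (s - σ) * G σ 0| ≤ Real.exp ρ * Cr / τ ^ 2 := by
    intro σ hσ
    have hσ0 : 0 < σ := hτ0.trans hσ.1
    rw [abs_mul, Real.abs_exp, hGσ σ hσ0]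
    have h1 : Real.exp (s - σ) ≤ Real.exp ρ := Real.exp_le_exp.2 (by linarith [hσ.1, hs.2])
    have h2 : |termR p σ 0| ≤ Cr / τ ^ 2 := by
      refine (hR.zero σ (hτC.trans hσ.1.le)).trans ?_
      have := hσ.1
      gcongr
    calc _ ≤ Real.exp ρ * (Cr / τ ^ 2) := by gcongr
      _ = _ := by ring
  have iI := intervalIntegrable_of_bound mI hs.1 hIb
  have hK : ∀ σ ∈ Ioc τ s, ∀ y, fundK p s σ (termR p σ) y =
      if σ ∈ Icc τ s then fundK p s σ (G σ) y else 0 := fun σ hσ y => by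
    rw [if_pos (Ioc_subset_Icc_self hσ), hGσ σ (hτ0.trans hσ.1)]
  have hcorr : ∀ y, corrPart p τ s y =
      ∫ σ in τ..s, if σ ∈ Icc τ s then fundK p s σ (G σ) y else 0 := fun y => by
    rw [corrPart]
    refine intervalIntegral.integral_congr_ae (.of_forall fun σ hσ => ?_)
    rw [uIoc_of_le hs.1] at hσ
    exact hK σ hσ y
  have iF : ∀ y, IntervalIntegrable (fun σ => if σ ∈ Icc τ s then fundK p s σ (G σ) y else 0)
      volume τ s := fun y => by
    refine intervalIntegrable_of_bound (M := fundC Cv ρ 0 * (Cr / τ) * (1 + |y|) ^ 0)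
      (mF.comp (measurable_id.prodMk measurable_const)) hs.1 fun σ hσ => ?_
    have hσ' := Ioc_subset_Icc_self hσ
    change |if σ ∈ Icc τ s then fundK p s σ (G σ) y else 0| ≤ _
    rw [if_pos hσ']
    exact abs_fundK_le hV (hτ1.trans hσ'.1) (mG.comp measurable_prodMk_left)
      (hGb σ hσ') ⟨hσ'.2, by linarith [hσ'.1, hs.2]⟩ y
  have mcorr : Measurable (corrPart p τ s) := by
    have e : corrPart p τ s = fun y =>
      ∫ σ in τ..s, if σ ∈ Icc τ s then fundK p s σ (G σ) y else 0 := funext hcorr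
    rw [e]
    exact measurable_intervalIntegral_param
      (F := fun y σ => if σ ∈ Icc τ s then fundK p s σ (G σ) y else 0)
      (mF.comp measurable_swap) measurable_const measurable_const
  obtain ⟨I, hI⟩ : ∃ I, I = ∫ σ in τ..s, Real.exp (s - σ) * G σ 0 := ⟨_, rfl⟩
  have hD : ∀ y, corrPart p τ s y - I = ∫ σ in τ..s,
      ((if σ ∈ Icc τ s then fundK p s σ (G σ) y else 0) - Real.exp (s - σ) * G σ 0) := fun y => by
    rw [intervalIntegral.integral_sub (iF y) iI, hcorr, hI]
  have hDb : ∀ (B : ℝ → ℝ) (y : ℝ), (∀ σ ∈ Ioc τ s,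
      |fundK p s σ (termR p σ) y - Real.exp (s - σ) * termR p σ 0| ≤ B y) →
      |corrPart p τ s y - I| ≤ B y * (s - τ) := by
    intro B y hB
    rw [hD]
    refine (intervalIntegral.norm_integral_le_of_norm_le_const (C := B y)
      (f := fun σ => (if σ ∈ Icc τ s then fundK p s σ (G σ) y else 0) - Real.exp (s - σ) * G σ 0)
      fun σ hσ => ?_).trans (le_of_eq ?_)
    · rw [uIoc_of_le hs.1] at hσ
      rw [← hK σ hσ y, hGσ σ (hτ0.trans hσ.1)]
      exact hB σ hσ
    · rw [abs_of_nonneg (sub_nonneg.2 hs.1)]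
  have hHσ : ∀ σ ∈ Ioc τ s, ∀ y, _ := fun σ hσ y => H σ (hτ.trans hσ.1.le) s
    ⟨hσ.2, by linarith [hσ.1, hs.2]⟩ y
  have hE : 0 < Real.exp ρ * Cr := by positivity
  have hst : 0 ≤ s - τ := sub_nonneg.2 hs.1
  have b4 : ∀ y, |corrPart p τ s y - I| ≤
      (C1 + Real.exp ρ * Cr) / τ ^ 3 * (s - τ) * (1 + |y|) ^ 4 := by
    intro y
    refine (hDb (fun y => (C1 + Real.exp ρ * Cr) / τ ^ 3 * (1 + |y|) ^ 4) y fun σ hσ =>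
      (hHσ σ hσ y).1.trans ?_).trans (le_of_eq (by ring))
    have := hσ.1
    have : C1 ≤ C1 + Real.exp ρ * Cr := by linarith
    show C1 / σ ^ 3 * (1 + |y|) ^ 4 ≤ (C1 + Real.exp ρ * Cr) / τ ^ 3 * (1 + |y|) ^ 4
    gcongr
  refine ⟨I, fun y => corrPart p τ s y - I, PolyBdd.of_bound (mcorr.sub_const I) b4,
    fun y => by ring, ?_, b4, fun y => ?_⟩
  · rw [hI]
    refine (intervalIntegral.norm_integral_le_of_norm_le_const (C := Real.exp ρ * Cr / τ ^ 2)
      (f := fun σ => Real.exp (s - σ) * G σ 0) fun σ hσ => ?_).trans ?_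
    · rw [uIoc_of_le hs.1] at hσ
      exact hIb σ hσ
    · rw [abs_of_nonneg hst]
      gcongr
      linarith
  · refine (hDb (fun y => (C1 + Real.exp ρ * Cr) / √τ ^ 5 * (1 + |y|) ^ 3) y fun σ hσ =>
      (hHσ σ hσ y).2.trans ?_).trans (le_of_eq (by ring))
    have := hσ.1
    have h1 : √τ ≤ √σ := Real.sqrt_le_sqrt this.le
    have : C1 ≤ C1 + Real.exp ρ * Cr := by linarith
    show C1 / √σ ^ 5 * (1 + |y|) ^ 3 ≤ (C1 + Real.exp ρ * Cr) / √τ ^ 5 * (1 + |y|) ^ 3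
    gcongr

end

/-! ### Final bounds on the Duhamel terms -/

section
variable {p Cv ρ : ℝ} {χ₀ : ℝ → ℝ} {c K₀ : ℝ}

lemma le_two_mul_of_mem_Icc {τ s : ℝ} (hs : s ∈ Icc τ (τ + ρ)) (hτ : ρ ≤ τ) : s ≤ 2 * τ := by
  linarith [hs.2]

lemma inv_cube_le {τ s : ℝ} (hτ : 0 < τ) (hs : τ ≤ s) (h : s ≤ 2 * τ) : 1 / τ ^ 3 ≤ 8 / s ^ 3 := by
  have hs0 : 0 < s := by linarith
  rw [div_le_div_iff₀ (by positivity) (by positivity)]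
  calc 1 * s ^ 3 ≤ 1 * (2 * τ) ^ 3 := by gcongr
    _ = _ := by ring

lemma inv_sq_le {τ s : ℝ} (hτ : 0 < τ) (hs : τ ≤ s) (h : s ≤ 2 * τ) : 1 / τ ^ 2 ≤ 4 / s ^ 2 := by
  have hs0 : 0 < s := by linarith
  rw [div_le_div_iff₀ (by positivity) (by positivity)]
  calc 1 * s ^ 2 ≤ 1 * (2 * τ) ^ 2 := by gcongr
    _ = _ := by ring

lemma inv_sqrt_le {τ s : ℝ} (hτ : 0 < τ) (hs : τ ≤ s) (h : s ≤ 2 * τ) : 1 / √τ ≤ 2 / √s := by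
  have hs0 : 0 < s := by linarith
  have h1 := Real.sqrt_pos.2 hτ
  have h2 := Real.sqrt_pos.2 hs0
  rw [div_le_div_iff₀ h1 h2, one_mul]
  rw [show 2 * √τ = √(4 * τ) by
    rw [Real.sqrt_mul (by norm_num), show (4 : ℝ) = 2 ^ 2 by norm_num,
      Real.sqrt_sq (by norm_num)]]
  exact Real.sqrt_le_sqrt (by linarith)

/-- A plain bound of the source by `τ⁻²` would lose a factor `τ` on the second mode, and the
smallness that frees the negative part from a constant depending on `ρ`. Both are recovered by
treating separately the part constant in `y`, which the projections see only through the cutoff. -/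
lemma CutoffBound.exists_abs_corrPart_le (h : CutoffBound χ₀ c) (hp : 1 < p) (hK : 1 ≤ K₀)
    (hV : PotBounds p Cv) (hρ : 0 < ρ) : ∃ C > 0, ∀ᶠ τ in Filter.atTop, ∀ s ∈ Icc τ (τ + ρ),
      |mode χ₀ K₀ s 2 (corrPart p τ s)| ≤ C * (s - τ) / s ^ 3 ∧
      (∀ y, |negativePart χ₀ K₀ s (corrPart p τ s) y| ≤ (s - τ) * (1 + |y| ^ 3) / s ^ 2) ∧
      ∀ y, |outerPart χ₀ K₀ s (corrPart p τ s) y| ≤ (s - τ) / √s := by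
  obtain ⟨Cr, hR⟩ := exists_corrBounds hp
  obtain ⟨C, hC, H⟩ := exists_corrPart_decomposition hp hV hR ρ
  have hCr := hR.pos
  have hc : 0 < c := one_pos.trans_le h.one_le
  have hK0 : 0 < K₀ := by linarith
  have w6 := wMom_pos (4 + 2)
  have w4 := wMom_pos (0 + 2 + 2)
  have n1 := h.negC_pos
  have n2 := h.negHermC_nonneg
  have f0 := fundC_pos Cv ρ 0
  refine ⟨8 * (c * wMom (4 + 2) * C + C * (2 * c * wMom (0 + 2 + 2))), by positivity, ?_⟩
  filter_upwards [Filter.eventually_ge_atTop (max 1 Cr), Filter.eventually_ge_atTop ρ,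
    eventually_le_sqrt (4 * (negC c * C + C * negHermC c)),
    eventually_le_sqrt (2 * (2 * c * fundC Cv ρ 0 * Cr))] with τ hτ hτρ h4 h5 s hs
  have hτ1 : 1 ≤ τ := (le_max_left _ _).trans hτ
  have hτC : Cr ≤ τ := (le_max_right _ _).trans hτ
  have hτ0 : 0 < τ := by linarith
  have hsτ := hs.1
  have hs1 : 1 ≤ s := hτ1.trans hsτ
  have hs0 : 0 < s := by linarith
  have hst : 0 ≤ s - τ := sub_nonneg.2 hsτ
  have hsq : 0 < √τ := Real.sqrt_pos.2 hτ0
  have hsq1 : 1 ≤ √τ := Real.one_le_sqrt.2 hτ1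
  have hsqs : √τ ≤ √s := Real.sqrt_le_sqrt hsτ
  have h2 := le_two_mul_of_mem_Icc hs hτρ
  obtain ⟨I, D, pD, e, hI, hD4, hD3⟩ := H τ hτ s hs
  have e' : corrPart p τ s = fun y => D y + I * 1 := funext e
  refine ⟨?_, fun y => ?_, fun y => ?_⟩
  · rw [e', h.mode_add hK0.le pD (PolyBdd.const _) (by norm_num), mode_const_mul I (fun _ => 1)]
    have a1 := h.abs_mode_le (K₀ := K₀) (s := s) (m := 2) hK0 hs0 (by norm_num) fun y _ => hD4 y
    have a2 := h.abs_mode_sub_integral_le (K₀ := K₀) (s := s) (g := fun _ => 1) (m := 2) (M := 1)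
      (k := 0) hK hs0 measurable_const (fun y => by simp) (by norm_num) 2
    -- Constants are orthogonal to `h₂`, so their second mode is a pure cutoff error, bounded here
    -- by a multiple of `1/s`; with the factor `τ⁻²` this reaches the order `s⁻³`.
    have a3 : ∫ y, (1 : ℝ) * dualHerm 2 y ∂wGauss = 0 := by
      have := integral_herm_mul_dualHerm (i := 0) (j := 2) (by norm_num) (by norm_num)
      simpa only [herm_zero, if_neg (by norm_num : (0 : ℕ) ≠ 2)] using this
    rw [a3, sub_zero, Real.sq_sqrt hs0.le, mul_one] at a2
    refine (abs_add_le _ _).trans ?_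
    rw [abs_mul]
    calc _ ≤ c * wMom (4 + 2) * (C / τ ^ 3 * (s - τ)) +
          C / τ ^ 2 * (s - τ) * (2 * c * wMom (0 + 2 + 2) / s) := by gcongr
      _ ≤ c * wMom (4 + 2) * (C / τ ^ 3 * (s - τ)) +
          C / τ ^ 2 * (s - τ) * (2 * c * wMom (0 + 2 + 2) / τ) := by gcongr
      _ = (c * wMom (4 + 2) * C + C * (2 * c * wMom (0 + 2 + 2))) * (s - τ) * (1 / τ ^ 3) := by
          field_simp
      _ ≤ (c * wMom (4 + 2) * C + C * (2 * c * wMom (0 + 2 + 2))) * (s - τ) * (8 / s ^ 3) :=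
          mul_le_mul_of_nonneg_left (inv_cube_le hτ0 hsτ h2) (by positivity)
      _ = _ := by ring
  · have e1 : (fun _ : ℝ => (1 : ℝ)) = herm 0 := funext fun y => (herm_zero y).symm
    rw [e', h.negativePart_add hK0.le pD (PolyBdd.const _), negativePart_const_mul I (fun _ => 1), e1]
    have a1 := h.abs_negativePart_le (K₀ := K₀) (s := s) hK0 hs0 (fun y _ => hD3 y) y
    have a2 := h.abs_negativePart_herm_le (K₀ := K₀) (s := s) (m := 0) hK hs1 (by norm_num) y
    rw [Nat.sub_zero] at a2
    refine (abs_add_le _ _).trans ?_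
    rw [abs_mul]
    have hy : 0 ≤ 1 + |y| ^ 3 := by positivity
    have hτ5 : √τ ^ 5 = τ ^ 2 * √τ := by rw [← sqrt_pow_four hτ0.le]; ring
    calc _ ≤ negC c * (C / √τ ^ 5 * (s - τ)) * (1 + |y| ^ 3) +
          C / τ ^ 2 * (s - τ) * (negHermC c / √s ^ 3 * (1 + |y| ^ 3)) := by gcongr
      _ ≤ negC c * (C / √τ ^ 5 * (s - τ)) * (1 + |y| ^ 3) +
          C / τ ^ 2 * (s - τ) * (negHermC c / √τ * (1 + |y| ^ 3)) := by
          have : √τ ≤ √s ^ 3 := hsqs.trans (le_self_pow₀ (hsq1.trans hsqs) (by norm_num))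
          gcongr
      _ = (s - τ) * (1 + |y| ^ 3) * ((negC c * C + C * negHermC c) / √τ * (1 / τ ^ 2)) := by
          rw [hτ5]; field_simp
      _ ≤ (s - τ) * (1 + |y| ^ 3) * (1 / 4 * (4 / s ^ 2)) := by
          have b1 : (negC c * C + C * negHermC c) / √τ ≤ 1 / 4 := by
            rw [div_le_iff₀ hsq]; linarith
          have b2 := inv_sq_le hτ0 hsτ h2
          gcongr
      _ = _ := by ring
  · have a1 := h.abs_outerPart_duhamel_le (K₀ := K₀) (G := termR p) (M := Cr / τ) hK0 hV hτ1 hs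
      (fun σ hσ => measurable_termR_right hp (hτ0.trans_le hσ.1)) (fun σ hσ y => by
        refine (hR.bdd σ (hτC.trans hσ.1) y).trans ?_
        have := hσ.1
        gcongr) y
    refine a1.trans ?_
    have hss := Real.sq_sqrt hτ0.le
    have b1 : 2 * c * fundC Cv ρ 0 * Cr / √τ ≤ 1 / 2 := by
      rw [div_le_iff₀ hsq]; linarith
    calc 2 * c * fundC Cv ρ 0 * (Cr / τ) * (s - τ) =
          (s - τ) * (2 * c * fundC Cv ρ 0 * Cr / √τ * (1 / √τ)) := by
          rw [← hss, show √(√τ ^ 2) = √τ by rw [hss]]; field_simp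
      _ ≤ (s - τ) * (1 / 2 * (2 / √s)) := by
          have := inv_sqrt_le hτ0 hsτ h2
          gcongr
      _ = _ := by ring

/-- The Duhamel term of a source that is small in three ways. -/
lemma CutoffBound.abs_duhamel_le_of_small (h : CutoffBound χ₀ c) (hK : 0 < K₀)
    (hV : PotBounds p Cv) {τ s : ℝ} (hτ : 1 ≤ τ) (hτρ : ρ ≤ τ) (hs : s ∈ Icc τ (τ + ρ))
    {G : ℝ → ℝ → ℝ} (mG : ∀ σ ∈ Icc τ s, Measurable (G σ)) {δ : ℝ} (hδ0 : 0 ≤ δ)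
    (hδ1 : c * wMom (8 + 2) * fundC Cv ρ 8 * δ ≤ 1 / 8)
    (hδ2 : negC c * fundC Cv ρ 3 * δ ≤ 1 / 4) (hδ3 : 2 * c * fundC Cv ρ 0 * δ ≤ 1 / 2)
    (hG : ∀ σ ∈ Icc τ s, ∀ y, |G σ y| ≤ δ / σ ^ 3 * (1 + |y|) ^ 8 ∧
      |G σ y| ≤ δ / σ ^ 2 * (1 + |y|) ^ 3 ∧ |G σ y| ≤ δ / √σ) :
    |mode χ₀ K₀ s 2 fun y => ∫ σ in τ..s, fundK p s σ (G σ) y| ≤ (s - τ) / s ^ 3 ∧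
    (∀ y, |negativePart χ₀ K₀ s (fun y => ∫ σ in τ..s, fundK p s σ (G σ) y) y| ≤
      (s - τ) * (1 + |y| ^ 3) / s ^ 2) ∧
    ∀ y, |outerPart χ₀ K₀ s (fun y => ∫ σ in τ..s, fundK p s σ (G σ) y) y| ≤ (s - τ) / √s := by
  have hτ0 : 0 < τ := by linarith
  have hsq : 0 < √τ := Real.sqrt_pos.2 hτ0
  have hst : 0 ≤ s - τ := sub_nonneg.2 hs.1
  have h2 := le_two_mul_of_mem_Icc hs hτρ
  refine ⟨?_, fun y => ?_, fun y => ?_⟩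
  · refine (h.abs_mode_two_duhamel_le hK hV hτ hs (M := δ / τ ^ 3) (k := 8) mG
      fun σ hσ y => (hG σ hσ y).1.trans ?_).trans ?_
    · have := hσ.1
      gcongr
    · calc _ = c * wMom (8 + 2) * fundC Cv ρ 8 * δ * (1 / τ ^ 3) * (s - τ) := by ring
        _ ≤ 1 / 8 * (8 / s ^ 3) * (s - τ) := by
          have := inv_cube_le hτ0 hs.1 h2
          gcongr
        _ = _ := by ring
  · refine (h.abs_negativePart_duhamel_le hK hV hτ hs (M := δ / τ ^ 2) mG
      (fun σ hσ y => (hG σ hσ y).2.1.trans ?_) y).trans ?_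
    · have := hσ.1
      gcongr
    · calc _ = negC c * fundC Cv ρ 3 * δ * (1 / τ ^ 2) * (s - τ) * (1 + |y| ^ 3) := by ring
        _ ≤ 1 / 4 * (4 / s ^ 2) * (s - τ) * (1 + |y| ^ 3) := by
          have := inv_sq_le hτ0 hs.1 h2
          gcongr
        _ = _ := by ring
  · refine (h.abs_outerPart_duhamel_le hK hV hτ hs (M := δ / √τ) mG
      (fun σ hσ y => (hG σ hσ y).2.2.trans ?_) y).trans ?_
    · have := Real.sqrt_le_sqrt hσ.1
      gcongr
    · calc _ = 2 * c * fundC Cv ρ 0 * δ * (1 / √τ) * (s - τ) := by ring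
        _ ≤ 1 / 2 * (2 / √s) * (s - τ) := by
          have := inv_sqrt_le hτ0 hs.1 h2
          gcongr
        _ = _ := by ring

/-- The Duhamel term of a uniformly small source. -/
lemma CutoffBound.abs_duhamel_le_of_cube (h : CutoffBound χ₀ c) (hK : 0 < K₀)
    (hV : PotBounds p Cv) {τ s : ℝ} (hτ : 1 ≤ τ) (hτρ : ρ ≤ τ) (hs : s ∈ Icc τ (τ + ρ))
    {G : ℝ → ℝ → ℝ} (mG : ∀ σ ∈ Icc τ s, Measurable (G σ)) {δ : ℝ} (hδ0 : 0 ≤ δ)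
    (hδ1 : c * wMom (8 + 2) * fundC Cv ρ 8 * δ ≤ 1 / 8)
    (hδ2 : negC c * fundC Cv ρ 3 * δ ≤ 1 / 8) (hδ3 : 2 * c * fundC Cv ρ 0 * δ ≤ 1 / 8)
    (hG : ∀ σ ∈ Icc τ s, ∀ y, |G σ y| ≤ δ / σ ^ 3) :
    |mode χ₀ K₀ s 2 fun y => ∫ σ in τ..s, fundK p s σ (G σ) y| ≤ (s - τ) / s ^ 3 ∧
    (∀ y, |negativePart χ₀ K₀ s (fun y => ∫ σ in τ..s, fundK p s σ (G σ) y) y| ≤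
      (s - τ) * (1 + |y| ^ 3) / s ^ 3) ∧
    ∀ y, |outerPart χ₀ K₀ s (fun y => ∫ σ in τ..s, fundK p s σ (G σ) y) y| ≤ (s - τ) / s ^ 3 := by
  have hτ0 : 0 < τ := by linarith
  have hst : 0 ≤ s - τ := sub_nonneg.2 hs.1
  have h3 := inv_cube_le hτ0 hs.1 (le_two_mul_of_mem_Icc hs hτρ)
  have hGτ : ∀ σ ∈ Icc τ s, ∀ y, |G σ y| ≤ δ / τ ^ 3 := fun σ hσ y => (hG σ hσ y).trans (by
    have := hσ.1
    gcongr)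
  have hGw : ∀ k : ℕ, ∀ σ ∈ Icc τ s, ∀ y, |G σ y| ≤ δ / τ ^ 3 * (1 + |y|) ^ k :=
    fun k σ hσ y => (hGτ σ hσ y).trans (le_mul_of_one_le_right (by positivity)
      (one_le_pow₀ (by linarith [abs_nonneg y])))
  refine ⟨?_, fun y => ?_, fun y => ?_⟩
  · refine (h.abs_mode_two_duhamel_le hK hV hτ hs mG (hGw 8)).trans ?_
    calc _ = c * wMom (8 + 2) * fundC Cv ρ 8 * δ * (1 / τ ^ 3) * (s - τ) := by ring
      _ ≤ 1 / 8 * (8 / s ^ 3) * (s - τ) := by gcongr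
      _ = _ := by ring
  · refine (h.abs_negativePart_duhamel_le hK hV hτ hs mG (hGw 3) y).trans ?_
    calc _ = negC c * fundC Cv ρ 3 * δ * (1 / τ ^ 3) * (s - τ) * (1 + |y| ^ 3) := by ring
      _ ≤ 1 / 8 * (8 / s ^ 3) * (s - τ) * (1 + |y| ^ 3) := by gcongr
      _ = _ := by ring
  · refine (h.abs_outerPart_duhamel_le hK hV hτ hs mG hGτ y).trans ?_
    calc _ = 2 * c * fundC Cv ρ 0 * δ * (1 / τ ^ 3) * (s - τ) := by ring
      _ ≤ 1 / 8 * (8 / s ^ 3) * (s - τ) := by gcongr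
      _ = _ := by ring

/-- A positive number that is small compared with the constants of the projections. -/
lemma CutoffBound.exists_small (h : CutoffBound χ₀ c) (Cv ρ : ℝ) : ∃ δ > 0,
    c * wMom (8 + 2) * fundC Cv ρ 8 * δ ≤ 1 / 8 ∧ negC c * fundC Cv ρ 3 * δ ≤ 1 / 8 ∧
      2 * c * fundC Cv ρ 0 * δ ≤ 1 / 8 := by
  have hc : 0 < c := one_pos.trans_le h.one_le
  have w := wMom_pos (8 + 2)
  have n := h.negC_pos
  have f0 := fundC_pos Cv ρ 0
  have f3 := fundC_pos Cv ρ 3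
  have f8 := fundC_pos Cv ρ 8
  obtain ⟨a, ha⟩ : ∃ a, a = c * wMom (8 + 2) * fundC Cv ρ 8 := ⟨_, rfl⟩
  obtain ⟨b, hb⟩ : ∃ b, b = negC c * fundC Cv ρ 3 := ⟨_, rfl⟩
  obtain ⟨d, hd⟩ : ∃ d, d = 2 * c * fundC Cv ρ 0 := ⟨_, rfl⟩
  have ha0 : 0 < a := ha ▸ by positivity
  have hb0 : 0 < b := hb ▸ by positivity
  have hd0 : 0 < d := hd ▸ by positivity
  rw [← ha, ← hb, ← hd]
  refine ⟨1 / (8 * (a + b + d)), by positivity, ?_, ?_, ?_⟩ <;>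
    rw [mul_one_div, div_le_div_iff₀ (by positivity) (by norm_num)] <;> linarith

end

lemma IsSolution.continuous {p a abar mu mubar mu0 τ ρ : ℝ} {q : ℝ → ℝ → ℝ}
    (h : IsSolution p a abar mu mubar mu0 τ ρ q) {s : ℝ} (hs : s ∈ Icc τ (τ + ρ)) :
    Continuous (q s) :=
  continuousOn_univ.1 (h.1.comp (f := fun y => (s, y)) (by fun_prop)
    fun _ _ => ⟨hs, mem_univ _⟩)

lemma rpow_three_halves {s : ℝ} (hs : 0 ≤ s) : s ^ (3 / 2 : ℝ) = √s ^ 3 := by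
  rw [Real.sqrt_eq_rpow, ← Real.rpow_natCast, ← Real.rpow_mul hs]
  norm_num

end GradBlowup

/-! ### The lemma itself: choice of constants and of the threshold -/

theorem mainTheorem4 (p a abar mu mubar mu0 : ℝ) (hp : 1 < p)
    (habar0 : 0 ≤ abar) (habar : abar < p) (ha0 : 0 ≤ a) (ha : a < 2 * p / (p + 1)) :
    ∃ Kstar > 0, ∀ K₀ ≥ Kstar, ∀ χ₀ : ℝ → ℝ, IsCutoff χ₀ →
    ∃ A₅ > 0, ∃ C > 0, ∀ ρ > 0, ∃ Cρ > 0, ∀ A ≥ A₅, ∀ C₁ > 0, ∀ T₂ > 0,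
    ∃ T₅ > 0, T₅ ≤ T₂ ∧ ∀ T, 0 < T → T ≤ T₅ → ∀ τ ≥ -Real.log T, ∀ q : ℝ → ℝ → ℝ,
      IsSolution p a abar mu mubar mu0 τ ρ q →
      (∀ s ∈ Icc τ (τ + ρ), InVA χ₀ K₀ A s (q s) ∧ GradBound (C₁ * A ^ 2 / √s) (q s)) →
      ∀ s ∈ Icc τ (τ + ρ),
        -- linear term
        (|mode χ₀ K₀ s 2 (linPart p τ q s)|
            ≤ τ ^ 2 / s ^ 2 * |mode χ₀ K₀ τ 2 (q τ)| + Cρ * A * (s - τ) / s ^ 3 ∧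
          linfW (negativePart χ₀ K₀ s (linPart p τ q s))
            ≤ ENNReal.ofReal
              (Cρ * Real.exp (-(s - τ) / 2) * (linfW (negativePart χ₀ K₀ τ (q τ))).toReal
                + Cρ * Real.exp (-(s - τ) ^ 2) * (linf (outerPart χ₀ K₀ τ (q τ))).toReal
                  / s ^ (3 / 2 : ℝ)) ∧
          linfW (negativePart χ₀ K₀ s (linPart p τ q s))
            ≤ ENNReal.ofReal
              (C * Real.exp (-(s - τ) / 2) * (linfW (negativePart χ₀ K₀ τ (q τ))).toReal
                + C * Real.exp (-(s - τ) ^ 2) * (linf (outerPart χ₀ K₀ τ (q τ))).toReal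
                  / s ^ (3 / 2 : ℝ)
                + (s - τ) / s ^ 2) ∧
          linf (outerPart χ₀ K₀ s (linPart p τ q s))
            ≤ ENNReal.ofReal
              (C * Real.exp (-(s - τ) / p) * (linf (outerPart χ₀ K₀ τ (q τ))).toReal
                + C * Real.exp (s - τ) * (linfW (negativePart χ₀ K₀ τ (q τ))).toReal
                  * s ^ (3 / 2 : ℝ))) ∧
        -- nonlinear term
        (|mode χ₀ K₀ s 2 (nonlinPart p τ q s)| ≤ (s - τ) / s ^ 3 ∧
          (∀ y, |negativePart χ₀ K₀ s (nonlinPart p τ q s) y|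
            ≤ (s - τ) * (1 + |y| ^ 3) / s ^ 2) ∧
          linf (outerPart χ₀ K₀ s (nonlinPart p τ q s)) ≤ ENNReal.ofReal ((s - τ) / √s)) ∧
        -- corrective term
        (|mode χ₀ K₀ s 2 (corrPart p τ s)| ≤ Cρ * (s - τ) / s ^ 3 ∧
          (∀ y, |negativePart χ₀ K₀ s (corrPart p τ s) y|
            ≤ C * (s - τ) * (1 + |y| ^ 3) / s ^ 2) ∧
          linf (outerPart χ₀ K₀ s (corrPart p τ s)) ≤ ENNReal.ofReal ((s - τ) / √s)) ∧
        -- new perturbation term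
        (|mode χ₀ K₀ s 2 (newPart p a abar mu mubar mu0 τ q s)| ≤ C * (s - τ) / s ^ 3 ∧
          (∀ y, |negativePart χ₀ K₀ s (newPart p a abar mu mubar mu0 τ q s) y|
            ≤ C * (s - τ) * (1 + |y| ^ 3) / s ^ 3) ∧
          linf (outerPart χ₀ K₀ s (newPart p a abar mu mubar mu0 τ q s))
            ≤ ENNReal.ofReal (C * (s - τ) / s ^ 3)) := by
  obtain ⟨Cv, hV⟩ := exists_potBounds hp
  obtain ⟨K, hK0, s₀, hs₀, hKout⟩ := exists_potV_outer hp
  -- The factor `4` leaves room for the drift path: when it starts beyond `K₀√τ/2`, it stays where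
  -- `|·| ≥ (K₀/4)√σ ≥ K√σ`.
  refine ⟨max 1 (4 * K), by positivity, fun K₀ hK₀ χ₀ hχ => ?_⟩
  have hK1 : 1 ≤ K₀ := (le_max_left _ _).trans hK₀
  have hKp : 0 < K₀ := by linarith
  have hK4 : 4 * K ≤ K₀ := (le_max_right _ _).trans hK₀
  have hout : ∀ s ≥ s₀, ∀ y, K₀ / 4 * √s ≤ |y| → potV p s y ≤ -(1 + 1 / p) := fun s hs y hy =>
    hKout s hs y ((mul_le_mul_of_nonneg_right (by linarith) (Real.sqrt_nonneg s)).trans hy)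
  obtain ⟨c, hc⟩ := hχ.exists_bound
  obtain ⟨Cn, hCn, Hn⟩ := hc.exists_abs_negativePart_linear_le_uniform hp hK1 hV
  obtain ⟨Ce, hCe, He⟩ := CutoffBound.exists_abs_outerPart_linear_le hp hc hK1 hV hout
  -- `Cn` and `Ce` are fixed before `ρ` is introduced. The summand `1` serves the corrective and new
  -- terms, whose bounds hold with constant `1` once `τ` is large.
  refine ⟨1, one_pos, 1 + Cn + Ce, by positivity, fun ρ hρ => ?_⟩
  obtain ⟨Ca, hCa, Ha⟩ := hc.exists_abs_mode_two_linear_le hK1 hV hρ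
  obtain ⟨Cx, hCx, Hx⟩ := hc.exists_abs_negativePart_linear_le_exp hK1 hV hρ
  obtain ⟨Cr, hCr, Hr⟩ := hc.exists_abs_corrPart_le hp hK1 hV hρ
  obtain ⟨δ, hδ, hδ1, hδ2, hδ3⟩ := hc.exists_small Cv ρ
  refine ⟨Ca + Cx + Cr, by positivity, fun A hA C₁ hC₁ T₂ hT₂ => ?_⟩
  -- All largeness conditions on `τ`, which depend on `ρ`, `A` and `C₁`, are collected into one
  -- threshold. The bounds on the two sources are required at every later time, since they are
  -- integrated over `[τ, s]`.
  have hev := ((Ha A hA).and ((Hn ρ hρ A hA).and ((He ρ hρ A hA).and (Hr.and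
    ((Filter.eventually_forall_ge_atTop.2 (eventually_abs_termB_le hp hχ hK1 hA hδ)).and
    ((Filter.eventually_forall_ge_atTop.2
      (eventually_abs_termN_le hp habar0 habar ha0 ha mu mubar mu0 hδ)).and
    ((Filter.eventually_ge_atTop 1).and ((Filter.eventually_ge_atTop ρ).and
    ((eventually_le_sqrt (100 * K₀ ^ 3 * A ^ 2)).and
    (eventually_le_sqrt (C₁ * A ^ 2)))))))))))
  obtain ⟨t₀, ht₀⟩ := Filter.eventually_atTop.1 hev
  -- With `T ≤ e^{-t₀}`, every `τ ≥ -log T` is at least `t₀`.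
  refine ⟨min T₂ (Real.exp (-t₀)), lt_min hT₂ (Real.exp_pos _), min_le_left _ _,
    fun T hT hTT τ hτT q hsol hq s hs => ?_⟩
  have hτt : t₀ ≤ τ := by
    have := (Real.log_le_iff_le_exp hT).2 (hTT.trans (min_le_right _ _))
    linarith
  obtain ⟨Ha, Hn, He, Hr, HB, HN, hτ1, hτρ, hτq, hτd⟩ := ht₀ τ hτt
  have hτ0 : 0 < τ := by linarith
  have hs0 : 0 < s := hτ0.trans_le hs.1
  have hst : 0 ≤ s - τ := sub_nonneg.2 hs.1
  have hsq : 0 < √s := Real.sqrt_pos.2 hs0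
  have hmem : ∀ σ ∈ Icc τ s, σ ∈ Icc τ (τ + ρ) := fun σ hσ => ⟨hσ.1, hσ.2.trans hs.2⟩
  have hSB : ∀ σ ∈ Icc τ (τ + ρ), ShrinkingBounds χ₀ K₀ A σ _ _ (q σ) := fun σ hσ =>
    (hq σ hσ).1.shrinkingBounds hc hKp.le (by linarith) (hsol.continuous hσ)
  have hτm : τ ∈ Icc τ (τ + ρ) := ⟨le_rfl, by linarith⟩
  have hSτ := hSB τ hτm
  have hN0 := hSτ.neg_nonneg
  have hE0 := hSτ.outer_nonneg
  rw [rpow_three_halves hs0.le]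
  set N := (linfW (negativePart χ₀ K₀ τ (q τ))).toReal with hN
  set E := (linf (outerPart χ₀ K₀ τ (q τ))).toReal with hE
  refine ⟨⟨?_, ?_, ?_, ?_⟩, ?_, ?_, ?_⟩
  · refine (Ha s hs (q τ) N E hSτ).trans ?_
    gcongr
    linarith
  · refine linfW_le_ofReal fun y => (Hx τ hτ1 s hs (q τ) A N E hA hSτ y).trans ?_
    have : Cx ≤ Ca + Cx + Cr := by linarith
    gcongr
  · refine linfW_le_ofReal fun y => (Hn s hs (q τ) N E hSτ y).trans ?_
    have : Cn ≤ 1 + Cn + Ce := by linarith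
    gcongr
  · refine linf_le_ofReal fun y => (He s hs (q τ) N E hSτ y).trans ?_
    have : Ce ≤ 1 + Cn + Ce := by linarith
    have := Real.sqrt_le_sqrt hs.1
    gcongr
  · obtain ⟨h1, h2, h3⟩ := hc.abs_duhamel_le_of_small hKp hV hτ1 hτρ hs
      (G := fun σ => termB p σ (q σ))
      (fun σ hσ => measurable_termB p σ (hsol.continuous (hmem σ hσ)).measurable) hδ.le hδ1
      (hδ2.trans (by norm_num)) (hδ3.trans (by norm_num))
      (fun σ hσ y => HB σ hσ.1 (q σ) _ _ (hSB σ (hmem σ hσ)) y)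
    exact ⟨h1, h2, linf_le_ofReal h3⟩
  · obtain ⟨h1, h2, h3⟩ := Hr s hs
    refine ⟨h1.trans ?_, fun y => (h2 y).trans ?_, linf_le_ofReal h3⟩
    · gcongr
      linarith
    · gcongr
      exact le_mul_of_one_le_left hst (by linarith)
  · obtain ⟨h1, h2, h3⟩ := hc.abs_duhamel_le_of_cube hKp hV hτ1 hτρ hs
      (G := fun σ => termN p a abar mu mubar mu0 σ (q σ))
      (fun σ hσ => measurable_termN p a abar mu mubar mu0 σ
        (hsol.continuous (hmem σ hσ)).measurable) hδ.le hδ1 hδ2 hδ3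
      (fun σ hσ => by
        have hσ0 : 0 < √σ := Real.sqrt_pos.2 (hτ0.trans_le hσ.1)
        have hτσ := Real.sqrt_le_sqrt hσ.1
        refine HN σ hσ.1 (q σ) (fun y => ?_) (fun y => ?_)
        · refine ((hSB σ (hmem σ hσ)).abs_le_sqrt hχ hK1 (hτ1.trans hσ.1) hA y).trans ?_
          rw [div_le_one hσ0]
          exact hτq.trans hτσ
        · refine ((hq σ (hmem σ hσ)).2.abs_deriv_le (by positivity) y).trans ?_
          rw [div_le_one hσ0]
          exact hτd.trans hτσ)
    have h4 : s - τ ≤ (1 + Cn + Ce) * (s - τ) := le_mul_of_one_le_left hst (by linarith)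
    refine ⟨h1.trans ?_, fun y => (h2 y).trans ?_, linf_le_ofReal fun y => (h3 y).trans ?_⟩ <;>
    gcongr
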